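/- **Theorem (universal property of $\mathrm{Rep}(GL_t)$).** Let $t\in\mathbb{C}$. *The category $\mathrm{Rep}(GL_t)$.* Let $\mathrm{Rep}(GL_t)^{(0)}$ be the $\mathbb{C}$-linear category with objects $[l,m]$, $l,m\in\mathbb{Z}_{\ge 0}$ (a row of $l$ black and $m$ white dots), in which $\mathrm{Hom}([l_1,m_1],[l_2,m_2])$ has as a basis the black-white diagrams, i.e. the bijections from the $l_1+m_2$ dots that are black in the top row $[l_1,m_1]$ or white in the bottom row $[l_2,m_2]$ to the $l_2+m_1$ dots that are black in the bottom row or white in the top row. (So it is $0$ if $l_1+m_2\neq l_2+m_1$, and otherwise a copy of $\mathbb{C}S_{l_1+m_2}$.) Composition of diagrams is vertical concatenation, with the middle row removed and every removed closed loop replaced by a factor $t$. The tensor product is $[l_1,m_1]\otimes[l_2,m_2]=[l_1+l_2,m_1+m_2]$ on objects and the union of diagrams on morphisms; the unit is $[0,0]$; and the symmetric braiding is given by the crossing diagrams. $\mathrm{Rep}(GL_t)$ is the Karoubian envelope of the additive completion of $\mathrm{Rep}(GL_t)^{(0)}$, with the induced $\mathbb{C}$-linear symmetric monoidal structure. *The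 target.* Let $\mathcal{T}$ be a $\mathbb{C}$-linear additive Karoubian (all idempotents split) category with a rigid symmetric monoidal structure whose tensor product is $\mathbb{C}$-bilinear on morphisms. The dimension of $X\in\mathcal{T}$ is $$\dim X=\mathrm{ev}_X\circ c_{X,X^*}\circ \mathrm{coev}_X\in\mathrm{End}_{\mathcal{T}}(\mathbf{1}),$$ and $X$ has dimension $t$ if $\dim X=t\cdot\mathrm{id}_{\mathbf{1}}$. *The claim.* For every $\mathbb{C}$-linear (strong) symmetric monoidal functor $F:\mathrm{Rep}(GL_t)\to\mathcal{T}$ the object $F([1,0])$ has dimension $t$; for every monoidal natural transformation $\eta:F\to G$ between such functors, $\eta_{[1,0]}$ is an isomorphism; and the functor $$F\mapsto F([1,0]),\qquad \eta\mapsto\eta_{[1,0]}$$ is an equivalence (that is, it is essentially surjective, full and faithful) from the category of $\mathbb{C}$-linear symmetric monoidal functors $\mathrm{Rep}(GL_t)\to\mathcal{T}$ and monoidal natural transformations to the category whose objects are the objects of $\mathcal{T}$ of dimension $t$ and whose morphisms are the isomorphisms of $\mathcal{T}$ between them. -/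

import Mathlib

set_option linter.unusedVariables false
set_option linter.unusedSectionVars false
set_option linter.unusedSimpArgs false

open CategoryTheory MonoidalCategory Limits

universe v u v₁ u₁ v₂ u₂

noncomputable section

namespace DeligneGL

/-! ### Black-white diagrams -/

/-- Adjoin the last point of `Fin (k + 1)` as `none`. -/
def splitLast (X : Type) (k : ℕ) : X ⊕ Fin (k + 1) ≃ Option (X ⊕ Fin k) :=
  ((Equiv.sumCongr (Equiv.refl X)
      (finSuccEquivLast.trans (Equiv.optionEquivSumPUnit.{0} (Fin k)))).trans
    (Equiv.sumAssoc X (Fin k) PUnit).symm).trans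
    (Equiv.optionEquivSumPUnit.{0} (X ⊕ Fin k)).symm

/-- Let `f` describe strands going from the points `X ⊕ Fin k` to the points `Y ⊕ Fin k`.  Glue the
`i`-th exit in `Fin k` to the `i`-th entrance in `Fin k`, for all `i`, one point at a time.
The result is the induced bijection from `X` to `Y` (follow the strands), together with
the number of closed loops that were formed and removed. -/
def closeUp {X Y : Type} : (k : ℕ) → (X ⊕ Fin k ≃ Y ⊕ Fin k) → (X ≃ Y) × ℕ
  | 0, f => (((Equiv.sumEmpty X (Fin 0)).symm.trans f).trans (Equiv.sumEmpty Y (Fin 0)), 0)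
  | k + 1, f =>
    let g : Option (X ⊕ Fin k) ≃ Option (Y ⊕ Fin k) :=
      ((splitLast X k).symm.trans f).trans (splitLast Y k)
    let r := closeUp k g.removeNone
    (r.1, r.2 + if g none = none then 1 else 0)

/-- Exchange the last two summands. -/
def exch (A B C : Type) : (A ⊕ B) ⊕ C ≃ (A ⊕ C) ⊕ B where
  toFun := Sum.elim (Sum.elim (Sum.inl ∘ Sum.inl) Sum.inr) (Sum.inl ∘ Sum.inr)
  invFun := Sum.elim (Sum.elim (Sum.inl ∘ Sum.inl) Sum.inr) (Sum.inl ∘ Sum.inr)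
  left_inv := by rintro ((_ | _) | _) <;> rfl
  right_inv := by rintro ((_ | _) | _) <;> rfl

/-- A row of dots: `black` black dots followed by `white` white dots. -/
structure Row where
  black : ℕ
  white : ℕ

/-- The black-white diagrams with top row `X = [l₁, m₁]` and bottom row `Y = [l₂, m₂]`: bijections
from the `l₁ + m₂` dots that are top black or bottom white to the `l₂ + m₁` dots that are bottom
black or top white.  There are none unless `l₁ + m₂ = l₂ + m₁`, and then they are a copy of the
symmetric group on `l₁ + m₂` letters. -/
abbrev Diag (X Y : Row) : Type :=
  Fin X.black ⊕ Fin Y.white ≃ Fin Y.black ⊕ Fin X.white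

/-- Put `σ` on top of `τ` and join the strands at the black dots of the middle row. -/
def glue {X Y Z : Row} (σ : Diag X Y) (τ : Diag Y Z) :
    (Fin X.black ⊕ Fin Z.white) ⊕ Fin Y.white ≃ (Fin Z.black ⊕ Fin X.white) ⊕ Fin Y.white :=
  (exch _ _ _).trans <| (Equiv.sumCongr σ (Equiv.refl (Fin Z.white))).trans <|
    (exch _ _ _).trans <| (Equiv.sumCongr τ (Equiv.refl (Fin X.white))).trans <| exch _ _ _

/-- The concatenation of `σ` (on top) and `τ`, with the middle row removed: the strands are joined
at the black dots and then at the white dots of the middle row. The second component is the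
number of removed loops. -/
def concat {X Y Z : Row} (σ : Diag X Y) (τ : Diag Y Z) : Diag X Z × ℕ :=
  closeUp Y.white (glue σ τ)

/-- The diagram made of vertical strands that permutes the black dots by `e` and
the white dots by `g`. -/
def vert {X Y : Row} (e : Fin X.black ≃ Fin Y.black) (g : Fin X.white ≃ Fin Y.white) : Diag X Y :=
  Equiv.sumCongr e g.symm

/-- The tensor product of rows: black dots are put together, and so are white dots. -/
abbrev Row.tensor (X Y : Row) : Row := ⟨X.black + Y.black, X.white + Y.white⟩

/-- The juxtaposition (union) of two diagrams. -/
def union {X Y X' Y' : Row} (σ : Diag X Y) (τ : Diag X' Y') :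
    Diag (X.tensor X') (Y.tensor Y') :=
  (Equiv.sumCongr finSumFinEquiv.symm finSumFinEquiv.symm).trans <|
    (Equiv.sumSumSumComm _ _ _ _).trans <| (Equiv.sumCongr σ τ).trans <|
      (Equiv.sumSumSumComm _ _ _ _).trans (Equiv.sumCongr finSumFinEquiv finSumFinEquiv)

/-! ### Counting colourings

The matrix entries of the tensor attached to a diagram: colour every dot; the entry is `1` if
each strand joins dots of the same colour, and `0` otherwise. -/

section Colourings

variable {N : Type} [Fintype N]

open scoped Classical in
def wt {X Y : Type} (f : X ≃ Y) (u : X → N) (w : Y → N) : ℕ :=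
  if u = w ∘ f then 1 else 0

theorem wt_removeNone {P Q : Type} (g : Option P ≃ Option Q) (p : P → N) (q : Q → N) :
    ∑ n : N, wt g (fun x => x.elim n p) (fun x => x.elim n q) =
      (Fintype.card N) ^ (if g none = none then 1 else 0) * wt g.removeNone p q := by
  classical
  split_ifs with h
  · have key : ∀ n : N, wt g (fun x => x.elim n p) (fun x => x.elim n q) =
        wt g.removeNone p q := by
      intro n
      unfold wt
      congr 1
      rw [eq_iff_iff]
      have hs : ∀ x, g (some x) = some (g.removeNone x) := by
        intro x
        rw [Equiv.removeNone_some]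
        rcases hx : g (some x) with _ | y
        · exact absurd (g.injective (hx.trans h.symm)) (by simp)
        · exact ⟨y, rfl⟩
      constructor
      · intro H
        funext x
        have := congrFun H (some x)
        simpa [hs] using this
      · intro H
        funext x
        cases x with
        | none => simp [h]
        | some x => simpa [hs] using congrFun H x
    rw [Finset.sum_congr rfl (fun n _ => key n)]
    simp
  · obtain ⟨y, hy⟩ := Option.ne_none_iff_exists'.mp h
    rw [pow_zero, one_mul, Finset.sum_eq_single (q y)]
    · unfold wt
      congr 1
      rw [eq_iff_iff]
      constructor
      · intro H
        funext x
        have := congrFun H (some x)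
        rcases hx : g (some x) with _ | z
        · have h2 : some (g.removeNone x) = some y := by
            rw [Equiv.removeNone_none _ hx, hy]
          simp [hx] at this
          simp [this, Option.some.inj h2]
        · have h2 := Equiv.removeNone_some g ⟨z, hx⟩
          rw [hx] at h2
          simp [hx] at this
          simp [this, Option.some.inj h2]
      · intro H
        funext x
        cases x with
        | none => simp [hy]
        | some x =>
          have := congrFun H x
          rcases hx : g (some x) with _ | z
          · have h2 : some (g.removeNone x) = some y := by
              rw [Equiv.removeNone_none _ hx, hy]
            simp [hx, this, Option.some.inj h2]
          · have h2 := Equiv.removeNone_some g ⟨z, hx⟩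
            rw [hx] at h2
            simp [hx, this, Option.some.inj h2]
    · intro n _ hn
      unfold wt
      rw [if_neg]
      intro H
      have := congrFun H none
      simp [hy] at this
      exact hn this
    · simp

theorem wt_conj {X Y X' Y' : Type} (e : X' ≃ X) (f : X ≃ Y) (g : Y ≃ Y') (u : X' → N)
    (w : Y' → N) : wt ((e.trans f).trans g) u w = wt f (u ∘ e.symm) (w ∘ g) := by
  unfold wt
  congr 1
  rw [eq_iff_iff, Equiv.comp_symm_eq]
  rfl

/-- The number of ways to colour the glued points is `|N|` to the number of removed loops if the
outer colouring is compatible with the closed-up diagram, and zero otherwise. -/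
theorem sum_wt_closeUp {X Y : Type} : (k : ℕ) → (f : X ⊕ Fin k ≃ Y ⊕ Fin k) → (x : X → N) →
    (y : Y → N) → ∑ c : Fin k → N, wt f (Sum.elim x c) (Sum.elim y c) =
      (Fintype.card N) ^ (closeUp k f).2 * wt (closeUp k f).1 x y
  | 0, f, x, y => by
    simp only [closeUp, pow_zero, one_mul]
    rw [wt_conj, Fintype.sum_unique]
    congr 1
    · funext z
      rcases z with z | z
      · rfl
      · exact z.elim0
    · funext z
      rcases z with z | z
      · rfl
      · exact z.elim0
  | k + 1, f, x, y => by
    have ih := sum_wt_closeUp k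
      (((splitLast X k).symm.trans f).trans (splitLast Y k)).removeNone x y
    simp only [closeUp]
    rw [pow_add, mul_right_comm, ← ih, mul_comm, Finset.mul_sum]
    simp_rw [← wt_removeNone]
    rw [← (Fin.snocEquiv (fun _ => N)).sum_comp, Fintype.sum_prod_type, Finset.sum_comm]
    refine Finset.sum_congr rfl fun c _ => Finset.sum_congr rfl fun n _ => ?_
    rw [wt_conj]
    congr 1
    · funext z
      rcases z with z | z
      · rfl
      · refine Fin.lastCases ?_ (fun z => ?_) z
        · simp [splitLast, Fin.snocEquiv]
        · simp [splitLast, Fin.snocEquiv]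
    · funext z
      rcases z with z | z
      · rfl
      · refine Fin.lastCases ?_ (fun z => ?_) z
        · simp [splitLast, Fin.snocEquiv]
        · simp [splitLast, Fin.snocEquiv]

/-- The entry of the tensor of a diagram at given colourings of the four kinds of dots: top black,
top white, bottom black, bottom white. -/
def entry {X Y : Row} (σ : Diag X Y) (a : Fin X.black → N) (b : Fin X.white → N)
    (a' : Fin Y.black → N) (b' : Fin Y.white → N) : ℕ :=
  wt σ (Sum.elim a b') (Sum.elim a' b)

theorem wt_glue {X Y Z : Row} (σ : Diag X Y) (τ : Diag Y Z) (a : Fin X.black → N)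
    (b : Fin X.white → N) (b' : Fin Y.white → N) (a'' : Fin Z.black → N) (b'' : Fin Z.white → N) :
    ∑ a' : Fin Y.black → N, entry σ a b a' b' * entry τ a' b' a'' b'' =
      wt (glue σ τ) (Sum.elim (Sum.elim a b'') b') (Sum.elim (Sum.elim a'' b) b') := by
  classical
  set a₀ : Fin Y.black → N := fun i => Sum.elim a b' (σ.symm (Sum.inl i)) with ha₀
  rw [Finset.sum_eq_single a₀]
  · have hg : wt (glue σ τ) (Sum.elim (Sum.elim a b'') b') (Sum.elim (Sum.elim a'' b) b') =
        if (Sum.elim a b' = Sum.elim a₀ b ∘ σ ∧ Sum.elim a₀ b'' = Sum.elim a'' b' ∘ τ)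
        then 1 else 0 := by
      unfold wt
      congr 1
      rw [eq_iff_iff]
      constructor
      · intro H
        constructor
        · funext x
          rcases hx : σ x with j | j
          · have hx' : σ.symm (Sum.inl j) = x := by rw [← hx, Equiv.symm_apply_apply]
            simp [hx, ha₀, hx']
          · have h1 := congrFun H (exch _ _ _ (Sum.inl x))
            rcases x with x | x <;> simpa [glue, exch, hx] using h1
        · funext y
          rcases y with j | k
          · have h1 := congrFun H (exch _ _ _ (Sum.inl (σ.symm (Sum.inl j))))
            rcases hx : σ.symm (Sum.inl j) with x | x <;> rw [hx] at h1 <;>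
              have hx' := (Equiv.symm_apply_eq _).mp hx <;>
              rcases hy : τ (Sum.inl j) with y | y <;>
              simpa [glue, exch, ← hx', hy, ha₀, hx] using h1
          · have h1 := congrFun H (Sum.inl (Sum.inr k))
            rcases hy : τ (Sum.inr k) with y | y <;>
              simpa [glue, exch, hy] using h1
      · rintro ⟨h1, h2⟩
        funext z
        obtain ⟨z, rfl⟩ := (exch _ _ _).surjective z
        rcases z with x | k
        · have h3 := congrFun h1 x
          rcases hx : σ x with j | j
          · have h4 := congrFun h2 (Sum.inl j)
            rcases hy : τ (Sum.inl j) with y | y <;> rcases x with x | x <;>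
              simp_all [glue, exch]
          · rcases x with x | x <;> simp_all [glue, exch]
        · have h4 := congrFun h2 (Sum.inr k)
          rcases hy : τ (Sum.inr k) with y | y <;> simp_all [glue, exch]
    rw [hg]
    unfold entry wt
    split_ifs <;> simp_all
  · intro a' _ h
    unfold entry wt
    rw [if_neg, zero_mul]
    intro H
    apply h
    funext i
    have := congrFun H (σ.symm (Sum.inl i))
    simp at this
    rw [ha₀]
    simp [this]
  · simp

/-- Multiplying the matrices of two diagrams gives `|N|` to the number of removed loops times the
matrix of their concatenation. -/
theorem sum_entry_concat {X Y Z : Row} (σ : Diag X Y) (τ : Diag Y Z) (a : Fin X.black → N)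
    (b : Fin X.white → N) (a'' : Fin Z.black → N) (b'' : Fin Z.white → N) :
    ∑ a' : Fin Y.black → N, ∑ b' : Fin Y.white → N, entry σ a b a' b' * entry τ a' b' a'' b'' =
      (Fintype.card N) ^ (concat σ τ).2 * entry (concat σ τ).1 a b a'' b'' := by
  rw [Finset.sum_comm]
  simp_rw [wt_glue]
  exact sum_wt_closeUp _ _ _ _

theorem entry_vert {X Y : Row} (e : Fin X.black ≃ Fin Y.black) (g : Fin X.white ≃ Fin Y.white)
    (a : Fin X.black → N) (b : Fin X.white → N) (a' : Fin Y.black → N) (b' : Fin Y.white → N)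
    [Decidable (a = a' ∘ e ∧ b = b' ∘ g)] :
    entry (vert e g) a b a' b' = if a = a' ∘ e ∧ b = b' ∘ g then 1 else 0 := by
  unfold entry wt
  congr 1
  rw [eq_iff_iff]
  constructor
  · intro H
    constructor
    · funext i
      simpa [vert] using congrFun H (Sum.inl i)
    · funext i
      simpa [vert] using (congrFun H (Sum.inr (g i))).symm
  · rintro ⟨rfl, rfl⟩
    funext x
    rcases x with x | x <;> simp [vert]

theorem wt_sumCongr {X Y X' Y' : Type} (f : X ≃ Y) (g : X' ≃ Y') (u : X → N) (w : Y → N)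
    (u' : X' → N) (w' : Y' → N) :
    wt (Equiv.sumCongr f g) (Sum.elim u u') (Sum.elim w w') = wt f u w * wt g u' w' := by
  have h : Sum.elim u u' = Sum.elim w w' ∘ Equiv.sumCongr f g ↔ u = w ∘ f ∧ u' = w' ∘ g := by
    constructor
    · intro H
      exact ⟨funext fun x => congrFun H (Sum.inl x), funext fun x => congrFun H (Sum.inr x)⟩
    · rintro ⟨rfl, rfl⟩
      funext x
      rcases x with x | x <;> rfl
  classical
  unfold wt
  rw [if_congr h rfl rfl]
  split_ifs <;> simp_all

theorem entry_union {X Y X' Y' : Row} (σ : Diag X Y) (τ : Diag X' Y')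
    (a : Fin (X.tensor X').black → N) (b : Fin (X.tensor X').white → N)
    (a' : Fin (Y.tensor Y').black → N) (b' : Fin (Y.tensor Y').white → N) :
    entry (union σ τ) a b a' b' =
      entry σ (a ∘ Fin.castAdd _) (b ∘ Fin.castAdd _) (a' ∘ Fin.castAdd _) (b' ∘ Fin.castAdd _) *
      entry τ (a ∘ Fin.natAdd _) (b ∘ Fin.natAdd _) (a' ∘ Fin.natAdd _) (b' ∘ Fin.natAdd _) := by
  unfold entry
  rw [← wt_sumCongr]
  have := wt_conj ((Equiv.sumCongr finSumFinEquiv.symm finSumFinEquiv.symm).trans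
    (Equiv.sumSumSumComm _ _ _ _)) (Equiv.sumCongr σ τ) ((Equiv.sumSumSumComm _ _ _ _).trans
      (Equiv.sumCongr finSumFinEquiv finSumFinEquiv)) (Sum.elim a b') (Sum.elim a' b)
  refine Eq.trans this ?_
  congr 1
  · funext x
    rcases x with (x | x) | (x | x) <;> simp
  · funext x
    rcases x with (x | x) | (x | x) <;> simp

end Colourings

/-- A diagram with a number of loops is determined by its matrices for two colours. -/
theorem entry_ext {X Y : Row} {P Q : Diag X Y × ℕ}
    (h : ∀ (a : Fin X.black → Bool) (b : Fin X.white → Bool) (a' : Fin Y.black → Bool)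
      (b' : Fin Y.white → Bool),
      Fintype.card Bool ^ P.2 * entry P.1 a b a' b' =
        Fintype.card Bool ^ Q.2 * entry Q.1 a b a' b') : P = Q := by
  obtain ⟨f, m⟩ := P
  obtain ⟨g, n⟩ := Q
  have h0 : m = n := by
    have := h (fun _ => true) (fun _ => true) (fun _ => true) (fun _ => true)
    have hc : ∀ (k : Diag X Y), entry k (fun _ => true) (fun _ => true) (fun _ => true)
        (fun _ => true) = 1 := by
      intro k
      unfold entry wt
      rw [if_pos]
      funext x
      have : ∀ y : Fin Y.black ⊕ Fin X.white,
          Sum.elim (fun _ => true) (fun _ => true) y = true := by rintro (y | y) <;> rfl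
      rcases x with x | x <;> simp
    simp only [hc, mul_one, Fintype.card_bool] at this
    exact Nat.pow_right_injective le_rfl this
  subst h0
  have h1 : f = g := by
    refine Equiv.ext fun x => ?_
    classical
    set w : Fin Y.black ⊕ Fin X.white → Bool := fun y => decide (f x = y) with hw
    have := h ((w ∘ f) ∘ Sum.inl) (w ∘ Sum.inr) (w ∘ Sum.inl) ((w ∘ f) ∘ Sum.inr)
    rw [Nat.mul_right_inj (by positivity)] at this
    unfold entry at this
    rw [Sum.elim_comp_inl_inr, Sum.elim_comp_inl_inr] at this
    unfold wt at this
    rw [if_pos rfl] at this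
    have h2 := congrFun (of_not_not fun hn => by rw [if_neg hn] at this; simp at this) x
    simpa [hw] using h2
  rw [h1]

theorem sum_entry (N : Type) [Fintype N] {X Y Z : Row} (σ : Diag X Y) (τ : Diag Y Z)
    (a : Fin X.black → N) (b : Fin X.white → N) (a'' : Fin Z.black → N) (b'' : Fin Z.white → N) :
      (Fintype.card N) ^ (concat σ τ).2 * entry (concat σ τ).1 a b a'' b'' =
        ∑ p : (Fin Y.black → N) × (Fin Y.white → N),
          entry σ a b p.1 p.2 * entry τ p.1 p.2 a'' b'' := by
  rw [← sum_entry_concat, Fintype.sum_prod_type]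

theorem concat_assoc {W X Y Z : Row} (σ : Diag W X) (τ : Diag X Y) (ρ : Diag Y Z) :
    ((concat (concat σ τ).1 ρ).1, (concat σ τ).2 + (concat (concat σ τ).1 ρ).2) =
      ((concat σ (concat τ ρ).1).1, (concat τ ρ).2 + (concat σ (concat τ ρ).1).2) := by
  apply entry_ext
  intro a b a' b'
  simp only [pow_add, mul_assoc]
  rw [sum_entry, sum_entry, Finset.mul_sum, Finset.mul_sum]
  have hL : ∀ p : (Fin Y.black → Bool) × (Fin Y.white → Bool),
      Fintype.card Bool ^ (concat σ τ).2 *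
        (entry (concat σ τ).1 a b p.1 p.2 * entry ρ p.1 p.2 a' b') =
      ∑ q : (Fin X.black → Bool) × (Fin X.white → Bool),
        entry σ a b q.1 q.2 * (entry τ q.1 q.2 p.1 p.2 * entry ρ p.1 p.2 a' b') := by
    intro p
    rw [← mul_assoc, sum_entry, Finset.sum_mul]
    simp only [mul_assoc]
  have hR : ∀ q : (Fin X.black → Bool) × (Fin X.white → Bool),
      Fintype.card Bool ^ (concat τ ρ).2 *
        (entry σ a b q.1 q.2 * entry (concat τ ρ).1 q.1 q.2 a' b') =
      ∑ p : (Fin Y.black → Bool) × (Fin Y.white → Bool),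
        entry σ a b q.1 q.2 * (entry τ q.1 q.2 p.1 p.2 * entry ρ p.1 p.2 a' b') := by
    intro q
    rw [mul_left_comm, sum_entry, Finset.mul_sum]
  simp only [hL, hR]
  exact Finset.sum_comm

theorem concat_vert {X Y Z : Row} (σ : Diag X Y) (e : Fin Y.black ≃ Fin Z.black)
    (g : Fin Y.white ≃ Fin Z.white) (N : Type) [Fintype N] (a : Fin X.black → N)
    (b : Fin X.white → N) (a'' : Fin Z.black → N) (b'' : Fin Z.white → N) :
    (Fintype.card N) ^ (concat σ (vert e g)).2 * entry (concat σ (vert e g)).1 a b a'' b'' =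
      entry σ a b (a'' ∘ e) (b'' ∘ g) := by
  classical
  rw [sum_entry, Finset.sum_eq_single (a'' ∘ e, b'' ∘ g)]
  · rw [entry_vert, if_pos ⟨rfl, rfl⟩, mul_one]
  · intro p _ hp
    rw [entry_vert, if_neg, mul_zero]
    rintro ⟨h1, h2⟩
    exact hp (Prod.ext h1 h2)
  · simp

theorem vert_concat {X Y Z : Row} (e : Fin X.black ≃ Fin Y.black)
    (g : Fin X.white ≃ Fin Y.white) (τ : Diag Y Z) (N : Type) [Fintype N] (a : Fin X.black → N)
    (b : Fin X.white → N) (a'' : Fin Z.black → N) (b'' : Fin Z.white → N) :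
    (Fintype.card N) ^ (concat (vert e g) τ).2 * entry (concat (vert e g) τ).1 a b a'' b'' =
      entry τ (a ∘ e.symm) (b ∘ g.symm) a'' b'' := by
  classical
  rw [sum_entry, Finset.sum_eq_single (a ∘ e.symm, b ∘ g.symm)]
  · rw [entry_vert, if_pos, one_mul]
    simp [Function.comp_assoc]
  · intro p _ hp
    rw [entry_vert, if_neg, zero_mul]
    rintro ⟨h1, h2⟩
    exact hp (Prod.ext ((Equiv.eq_comp_symm _ _ _).mpr h1.symm)
      ((Equiv.eq_comp_symm _ _ _).mpr h2.symm))
  · simp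

theorem concat_vert_vert {X Y Z : Row} (e : Fin X.black ≃ Fin Y.black)
    (g : Fin X.white ≃ Fin Y.white) (e' : Fin Y.black ≃ Fin Z.black)
    (g' : Fin Y.white ≃ Fin Z.white) :
    concat (vert e g) (vert e' g') = (vert (e.trans e') (g.trans g'), 0) := by
  classical
  apply entry_ext
  intro a b a' b'
  rw [concat_vert, entry_vert, entry_vert, pow_zero, one_mul]
  congr 1

theorem vert_refl_concat {X Y : Row} (τ : Diag X Y) :
    concat (vert (Equiv.refl _) (Equiv.refl _)) τ = (τ, 0) := by
  apply entry_ext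
  intro a b a' b'
  rw [vert_concat]
  simp

theorem concat_vert_refl {X Y : Row} (σ : Diag X Y) :
    concat σ (vert (Equiv.refl _) (Equiv.refl _)) = (σ, 0) := by
  apply entry_ext
  intro a b a' b'
  rw [concat_vert]
  simp

theorem concat_union {X Y Z X' Y' Z' : Row} (σ : Diag X Y) (τ : Diag Y Z) (σ' : Diag X' Y')
    (τ' : Diag Y' Z') :
    concat (union σ σ') (union τ τ') =
      (union (concat σ τ).1 (concat σ' τ').1, (concat σ τ).2 + (concat σ' τ').2) := by
  apply entry_ext
  intro a b a' b'
  rw [pow_add]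
  dsimp only
  rw [entry_union, mul_mul_mul_comm, sum_entry, sum_entry, sum_entry]
  simp_rw [Fintype.sum_prod_type, entry_union]
  rw [← (Fin.appendEquiv Y.black Y'.black).sum_comp, Fintype.sum_prod_type]
  simp_rw [← (Fin.appendEquiv Y.white Y'.white).sum_comp, Fintype.sum_prod_type]
  simp only [Finset.sum_mul_sum]
  refine Finset.sum_congr rfl fun x _ => Finset.sum_congr rfl fun x' _ =>
    Finset.sum_congr rfl fun y _ => Finset.sum_congr rfl fun y' _ => ?_
  have h1 : ∀ {m n : ℕ} (f : Fin m → Bool) (g : Fin n → Bool),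
      Fin.appendEquiv m n (f, g) ∘ Fin.castAdd n = f := fun f g => by
    funext i
    simp
  have h2 : ∀ {m n : ℕ} (f : Fin m → Bool) (g : Fin n → Bool),
      Fin.appendEquiv m n (f, g) ∘ Fin.natAdd m = g := fun f g => by
    funext i
    simp
  rw [h1, h1, h2, h2, mul_mul_mul_comm]

theorem union_vert {X Y X' Y' : Row} (e : Fin X.black ≃ Fin Y.black)
    (g : Fin X.white ≃ Fin Y.white) (e' : Fin X'.black ≃ Fin Y'.black)
    (g' : Fin X'.white ≃ Fin Y'.white) :
    union (vert e g) (vert e' g') =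
      vert (X := X.tensor X') (Y := Y.tensor Y')
      ((finSumFinEquiv.symm.trans (Equiv.sumCongr e e')).trans finSumFinEquiv)
      ((finSumFinEquiv.symm.trans (Equiv.sumCongr g g')).trans finSumFinEquiv) := by
  refine Equiv.ext fun x => ?_
  rcases x with x | x
  · obtain ⟨x, rfl⟩ := finSumFinEquiv.surjective x
    rcases x with x | x <;> simp [union, vert]
  · obtain ⟨x, rfl⟩ := finSumFinEquiv.surjective x
    rcases x with x | x <;> simp [union, vert]

/-! ### The structural diagrams -/

abbrev Row.unit : Row := ⟨0, 0⟩

def assocDiag (X Y Z : Row) : Diag ((X.tensor Y).tensor Z) (X.tensor (Y.tensor Z)) :=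
  vert (finCongr (Nat.add_assoc _ _ _)) (finCongr (Nat.add_assoc _ _ _))

def assocDiagInv (X Y Z : Row) : Diag (X.tensor (Y.tensor Z)) ((X.tensor Y).tensor Z) :=
  vert (finCongr (Nat.add_assoc _ _ _).symm) (finCongr (Nat.add_assoc _ _ _).symm)

def leftDiag (X : Row) : Diag (Row.unit.tensor X) X :=
  vert (finCongr (Nat.zero_add _)) (finCongr (Nat.zero_add _))

def leftDiagInv (X : Row) : Diag X (Row.unit.tensor X) :=
  vert (finCongr (Nat.zero_add _).symm) (finCongr (Nat.zero_add _).symm)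

def rightDiag (X : Row) : Diag (X.tensor Row.unit) X :=
  vert (finCongr (Nat.add_zero _)) (finCongr (Nat.add_zero _))

def rightDiagInv (X : Row) : Diag X (X.tensor Row.unit) :=
  vert (finCongr (Nat.add_zero _).symm) (finCongr (Nat.add_zero _).symm)

/-- The crossing: the first block of black dots is moved past the second block, and so are the
white dots. -/
def crossDiag (X Y : Row) : Diag (X.tensor Y) (Y.tensor X) :=
  vert finAddFlip finAddFlip

def idDiag (X : Row) : Diag X X := vert (Equiv.refl _) (Equiv.refl _)

theorem vert_congr {X Y : Row} {e e' : Fin X.black ≃ Fin Y.black}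
    {g g' : Fin X.white ≃ Fin Y.white} (h : ∀ i, e i = e' i) (h' : ∀ i, g i = g' i) :
    vert e g = vert e' g' := by
  rw [Equiv.ext h, Equiv.ext h']

theorem union_id (X Y : Row) : union (idDiag X) (idDiag Y) = idDiag (X.tensor Y) := by
  unfold idDiag
  rw [union_vert]
  apply vert_congr <;> intro i <;> simp

theorem col_eq {N : Type} {m n : ℕ} (a : Fin n → N) {f g : Fin m → Fin n}
    (h : ∀ i, (f i : ℕ) = g i) : a ∘ f = a ∘ g := by
  funext i
  exact congrArg a (Fin.ext (h i))

theorem assoc_natural {X₁ X₂ X₃ Y₁ Y₂ Y₃ : Row} (σ₁ : Diag X₁ Y₁) (σ₂ : Diag X₂ Y₂)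
    (σ₃ : Diag X₃ Y₃) :
    concat (union (union σ₁ σ₂) σ₃) (assocDiag Y₁ Y₂ Y₃) =
      concat (assocDiag X₁ X₂ X₃) (union σ₁ (union σ₂ σ₃)) := by
  apply entry_ext
  intro a b a' b'
  unfold assocDiag
  rw [concat_vert, vert_concat]
  simp only [entry_union, mul_assoc, Function.comp_assoc]
  congr 2
  congr 1 <;> apply col_eq <;> intro i <;> simp [Nat.add_assoc]

theorem left_natural {X Y : Row} (σ : Diag X Y) :
    concat (union (idDiag Row.unit) σ) (leftDiag Y) = concat (leftDiag X) σ := by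
  apply entry_ext
  intro a b a' b'
  unfold leftDiag
  rw [concat_vert, vert_concat, entry_union, idDiag, entry_vert, if_pos, one_mul]
  · simp only [Function.comp_assoc]
    nth_rw 2 [← Function.comp_id a', ← Function.comp_id b']
    congr 1 <;> apply col_eq <;> intro i <;> simp
  · constructor <;> funext i <;> exact i.elim0

theorem right_natural {X Y : Row} (σ : Diag X Y) :
    concat (union σ (idDiag Row.unit)) (rightDiag Y) = concat (rightDiag X) σ := by
  apply entry_ext
  intro a b a' b'
  unfold rightDiag
  rw [concat_vert, vert_concat, entry_union, idDiag, entry_vert, if_pos, mul_one]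
  · simp only [Function.comp_assoc]
    nth_rw 2 [← Function.comp_id a', ← Function.comp_id b']
    congr 1
  · constructor <;> funext i <;> exact i.elim0

theorem cross_natural {X₁ X₂ Y₁ Y₂ : Row} (σ₁ : Diag X₁ Y₁) (σ₂ : Diag X₂ Y₂) :
    concat (union σ₁ σ₂) (crossDiag Y₁ Y₂) = concat (crossDiag X₁ X₂) (union σ₂ σ₁) := by
  apply entry_ext
  intro a b a' b'
  unfold crossDiag
  rw [concat_vert, vert_concat]
  simp only [entry_union, Function.comp_assoc]
  rw [mul_comm]
  have hs : ∀ m n : ℕ, (finAddFlip (m := m) (n := n)).symm = finAddFlip := fun _ _ => rfl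
  congr 2 <;> apply col_eq <;> intro i <;> simp [hs]

theorem vert_concat_vert_eq {X Y Z : Row} {e : Fin X.black ≃ Fin Y.black}
    {g : Fin X.white ≃ Fin Y.white} {e' : Fin Y.black ≃ Fin Z.black}
    {g' : Fin Y.white ≃ Fin Z.white} {e'' : Fin X.black ≃ Fin Z.black}
    {g'' : Fin X.white ≃ Fin Z.white} (h : ∀ i, e' (e i) = e'' i) (h' : ∀ i, g' (g i) = g'' i) :
    concat (vert e g) (vert e' g') = (vert e'' g'', 0) := by
  rw [concat_vert_vert, vert_congr h h']


/-! ### The category with objects `[l, m]` -/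

/-- The objects `[l, m]` of the diagram category with loop parameter `t`. -/
structure RepGLZero (t : ℂ) where
  row : Row

namespace RepGLZero

variable {t : ℂ}

/-- Morphisms are formal complex linear combinations of diagrams. -/
abbrev Mor (X Y : RepGLZero t) : Type := Diag X.row Y.row →₀ ℂ

/-- The basis morphism of a diagram. -/
abbrev basis {X Y : RepGLZero t} (σ : Diag X.row Y.row) : Mor X Y := Finsupp.single σ 1

/-- A diagram from which loops have been removed: each removed loop gives a factor `t`. -/
abbrev scaled {X Y : RepGLZero t} (P : Diag X.row Y.row × ℕ) : Mor X Y := t ^ P.2 • basis P.1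

/-- The bilinear composition with `e_σ`, then `e_τ`, composing to `t ^ (number of removed loops)`
times the basis element of the concatenation. -/
def compMor (X Y Z : RepGLZero t) : Mor X Y →ₗ[ℂ] Mor Y Z →ₗ[ℂ] Mor X Z :=
  Finsupp.linearCombination ℂ fun σ =>
    Finsupp.linearCombination ℂ fun τ => scaled (concat σ τ)

/-- The bilinear tensor product, which is the union of diagrams on basis elements. -/
def tensorMor (X Y X' Y' : RepGLZero t) :
    Mor X Y →ₗ[ℂ] Mor X' Y' →ₗ[ℂ] Mor (t := t) ⟨X.row.tensor X'.row⟩ ⟨Y.row.tensor Y'.row⟩ :=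
  Finsupp.linearCombination ℂ fun σ =>
    Finsupp.linearCombination ℂ fun τ => basis (union σ τ)

theorem compMor_basis {X Y Z : RepGLZero t} (σ : Diag X.row Y.row) (τ : Diag Y.row Z.row) :
    compMor X Y Z (basis σ) (basis τ) = scaled (concat σ τ) := by
  simp [compMor]

theorem tensorMor_basis {X Y X' Y' : RepGLZero t} (σ : Diag X.row Y.row)
    (τ : Diag X'.row Y'.row) :
    tensorMor X Y X' Y' (basis σ) (basis τ) = basis (union σ τ) := by
  simp [tensorMor]

@[elab_as_elim]
theorem mor_induction {X Y : RepGLZero t} {p : Mor X Y → Prop} (f : Mor X Y) (zero : p 0)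
    (add : ∀ f g, p f → p g → p (f + g)) (smul : ∀ (c : ℂ) f, p f → p (c • f))
    (hb : ∀ σ, p (basis σ)) : p f := by
  refine Finsupp.induction_linear f zero add fun σ c => ?_
  have := smul c _ (hb σ)
  rwa [Finsupp.smul_single_one] at this

theorem id_compMor {X Y : RepGLZero t} (f : Mor X Y) :
    compMor X X Y (basis (idDiag X.row)) f = f := by
  refine mor_induction f ?_ ?_ ?_ ?_
  · simp
  · intro f g hf hg
    rw [map_add, hf, hg]
  · intro c f hf
    rw [map_smul, hf]
  · intro σ
    rw [compMor_basis, idDiag, vert_refl_concat]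
    simp

theorem compMor_id {X Y : RepGLZero t} (f : Mor X Y) :
    compMor X Y Y f (basis (idDiag Y.row)) = f := by
  refine mor_induction f ?_ ?_ ?_ ?_
  · simp
  · intro f g hf hg
    rw [LinearMap.map_add₂, hf, hg]
  · intro c f hf
    rw [LinearMap.map_smul₂, hf]
  · intro σ
    rw [compMor_basis, idDiag, concat_vert_refl]
    simp

theorem compMor_assoc {W X Y Z : RepGLZero t} (f : Mor W X) (g : Mor X Y) (h : Mor Y Z) :
    compMor W Y Z (compMor W X Y f g) h = compMor W X Z f (compMor X Y Z g h) := by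
  refine mor_induction f ?_ ?_ ?_ fun σ => mor_induction g ?_ ?_ ?_ fun τ =>
    mor_induction h ?_ ?_ ?_ fun ρ => ?_
  · simp
  · intro f f' hf hf'
    simp only [map_add, LinearMap.add_apply, hf, hf']
  · intro c f hf
    simp only [map_smul, LinearMap.smul_apply, hf]
  · simp
  · intro f f' hf hf'
    simp only [map_add, LinearMap.add_apply, hf, hf']
  · intro c f hf
    simp only [map_smul, LinearMap.smul_apply, hf]
  · simp
  · intro f f' hf hf'
    simp only [map_add, hf, hf']
  · intro c f hf
    simp only [map_smul, hf]
  · rw [compMor_basis, compMor_basis, map_smul, LinearMap.smul_apply, map_smul, compMor_basis,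
      compMor_basis, smul_smul, smul_smul, ← pow_add, ← pow_add]
    exact congrArg scaled (concat_assoc σ τ ρ)

instance : Category (RepGLZero t) where
  Hom X Y := Mor X Y
  id X := basis (idDiag X.row)
  comp f g := compMor _ _ _ f g
  id_comp f := id_compMor f
  comp_id f := compMor_id f
  assoc f g h := compMor_assoc f g h

instance : Preadditive (RepGLZero t) where
  homGroup X Y := inferInstanceAs (AddCommGroup (Mor X Y))
  add_comp X Y Z f f' g := LinearMap.map_add₂ (compMor X Y Z) f f' g
  comp_add X Y Z f g g' := LinearMap.map_add (compMor X Y Z f) g g'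

instance : Linear ℂ (RepGLZero t) where
  homModule X Y := inferInstanceAs (Module ℂ (Mor X Y))
  smul_comp X Y Z r f g := LinearMap.map_smul₂ (compMor X Y Z) r f g
  comp_smul X Y Z f r g := LinearMap.map_smul (compMor X Y Z f) r g

theorem tensorMor_id (X Y : RepGLZero t) :
    tensorMor X X Y Y (basis (idDiag X.row)) (basis (idDiag Y.row)) =
      basis (idDiag (X.row.tensor Y.row)) := by
  rw [tensorMor_basis, union_id]

theorem tensorMor_compMor {X Y Z X' Y' Z' : RepGLZero t} (f : Mor X Y) (f' : Mor X' Y')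
    (g : Mor Y Z) (g' : Mor Y' Z') :
    compMor ⟨X.row.tensor X'.row⟩ ⟨Y.row.tensor Y'.row⟩ ⟨Z.row.tensor Z'.row⟩
      (tensorMor X Y X' Y' f f') (tensorMor Y Z Y' Z' g g') =
      tensorMor X Z X' Z' (compMor X Y Z f g) (compMor X' Y' Z' f' g') := by
  refine mor_induction f ?_ ?_ ?_ fun σ => mor_induction g ?_ ?_ ?_ fun τ =>
    mor_induction f' ?_ ?_ ?_ fun σ' => mor_induction g' ?_ ?_ ?_ fun τ' => ?_
  · simp
  · intro f f' hf hf'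
    simp only [map_add, LinearMap.add_apply, hf, hf']
  · intro c f hf
    simp only [map_smul, LinearMap.smul_apply, hf]
  · simp
  · intro f f' hf hf'
    simp only [map_add, LinearMap.add_apply, hf, hf']
  · intro c f hf
    simp only [map_smul, LinearMap.smul_apply, hf]
  · simp
  · intro f f' hf hf'
    simp only [map_add, LinearMap.add_apply, hf, hf']
  · intro c f hf
    simp only [map_smul, LinearMap.smul_apply, hf]
  · simp
  · intro f f' hf hf'
    simp only [map_add, hf, hf']
  · intro c f hf
    simp only [map_smul, hf]
  · rw [tensorMor_basis, tensorMor_basis]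
    rw [compMor_basis, compMor_basis, compMor_basis, map_smul, map_smul, LinearMap.smul_apply,
      tensorMor_basis, smul_smul, ← pow_add, Nat.add_comm]
    exact congrArg scaled (concat_union σ τ σ' τ')

theorem comp_basis {X Y Z : RepGLZero t} (σ : Diag X.row Y.row) (τ : Diag Y.row Z.row) :
    (show X ⟶ Y from basis σ) ≫ (show Y ⟶ Z from basis τ) = scaled (concat σ τ) :=
  compMor_basis σ τ

/-- Vertical diagrams compose without loops. -/
theorem comp_vert {X Y Z : RepGLZero t} {e : Fin X.row.black ≃ Fin Y.row.black}
    {g : Fin X.row.white ≃ Fin Y.row.white} {e' : Fin Y.row.black ≃ Fin Z.row.black}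
    {g' : Fin Y.row.white ≃ Fin Z.row.white} {e'' : Fin X.row.black ≃ Fin Z.row.black}
    {g'' : Fin X.row.white ≃ Fin Z.row.white} (h : ∀ i, e' (e i) = e'' i)
    (h' : ∀ i, g' (g i) = g'' i) :
    (show X ⟶ Y from basis (vert e g)) ≫ (show Y ⟶ Z from basis (vert e' g')) =
      basis (vert e'' g'') := by
  rw [comp_basis, vert_concat_vert_eq h h']
  exact one_smul ℂ _

instance : MonoidalCategoryStruct (RepGLZero t) where
  tensorObj X Y := ⟨X.row.tensor Y.row⟩
  tensorUnit := ⟨Row.unit⟩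
  tensorHom {X Y X' Y'} f g := tensorMor X Y X' Y' f g
  whiskerLeft X Y Y' f := tensorMor X X Y Y' (𝟙 X) f
  whiskerRight {X X'} f Y := tensorMor X X' Y Y f (𝟙 Y)
  associator X Y Z :=
    { hom := basis (assocDiag X.row Y.row Z.row)
      inv := basis (assocDiagInv X.row Y.row Z.row)
      hom_inv_id := comp_vert (fun _ => rfl) (fun _ => rfl)
      inv_hom_id := comp_vert (fun _ => rfl) (fun _ => rfl) }
  leftUnitor X :=
    { hom := basis (leftDiag X.row)
      inv := basis (leftDiagInv X.row)
      hom_inv_id := comp_vert (fun _ => rfl) (fun _ => rfl)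
      inv_hom_id := comp_vert (fun _ => rfl) (fun _ => rfl) }
  rightUnitor X :=
    { hom := basis (rightDiag X.row)
      inv := basis (rightDiagInv X.row)
      hom_inv_id := comp_vert (fun _ => rfl) (fun _ => rfl)
      inv_hom_id := comp_vert (fun _ => rfl) (fun _ => rfl) }

theorem assoc_naturality_mor {X₁ X₂ X₃ Y₁ Y₂ Y₃ : RepGLZero t} (f₁ : X₁ ⟶ Y₁) (f₂ : X₂ ⟶ Y₂)
    (f₃ : X₃ ⟶ Y₃) :
    ((f₁ ⊗ₘ f₂) ⊗ₘ f₃) ≫ (α_ Y₁ Y₂ Y₃).hom = (α_ X₁ X₂ X₃).hom ≫ (f₁ ⊗ₘ (f₂ ⊗ₘ f₃)) := by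
  change compMor _ _ _ (tensorMor _ _ _ _ (tensorMor _ _ _ _ f₁ f₂) f₃) _ =
    compMor _ _ _ _ (tensorMor _ _ _ _ f₁ (tensorMor _ _ _ _ f₂ f₃))
  refine mor_induction f₁ ?_ ?_ ?_ fun σ => mor_induction f₂ ?_ ?_ ?_ fun τ =>
    mor_induction f₃ ?_ ?_ ?_ fun ρ => ?_
  · simp
  · intro f f' hf hf'
    simp only [map_add, LinearMap.add_apply, hf, hf']
  · intro c f hf
    simp only [map_smul, LinearMap.smul_apply, hf]
  · simp
  · intro f f' hf hf'
    simp only [map_add, LinearMap.add_apply, hf, hf']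
  · intro c f hf
    simp only [map_smul, LinearMap.smul_apply, hf]
  · simp
  · intro f f' hf hf'
    simp only [map_add, LinearMap.add_apply, hf, hf']
  · intro c f hf
    simp only [map_smul, LinearMap.smul_apply, hf]
  · rw [tensorMor_basis, tensorMor_basis, tensorMor_basis, tensorMor_basis]
    exact (compMor_basis _ _).trans
      ((congrArg scaled (assoc_natural σ τ ρ)).trans (compMor_basis _ _).symm)

theorem left_naturality_mor {X Y : RepGLZero t} (f : X ⟶ Y) :
    (𝟙 (𝟙_ (RepGLZero t)) ⊗ₘ f) ≫ (λ_ Y).hom = (λ_ X).hom ≫ f := by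
  change compMor _ _ _ (tensorMor _ _ _ _ _ f) _ = compMor _ _ _ _ f
  refine mor_induction f ?_ ?_ ?_ fun σ => ?_
  · simp
  · intro f f' hf hf'
    simp only [map_add, LinearMap.add_apply, hf, hf']
  · intro c f hf
    simp only [map_smul, LinearMap.smul_apply, hf]
  · refine (congrArg (fun z => compMor _ _ _ z _) (tensorMor_basis _ _)).trans ?_
    exact (compMor_basis _ _).trans
      ((congrArg scaled (left_natural σ)).trans (compMor_basis _ _).symm)

theorem right_naturality_mor {X Y : RepGLZero t} (f : X ⟶ Y) :
    (f ⊗ₘ 𝟙 (𝟙_ (RepGLZero t))) ≫ (ρ_ Y).hom = (ρ_ X).hom ≫ f := by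
  change compMor _ _ _ (tensorMor _ _ _ _ f _) _ = compMor _ _ _ _ f
  refine mor_induction f ?_ ?_ ?_ fun σ => ?_
  · simp
  · intro f f' hf hf'
    simp only [map_add, LinearMap.add_apply, hf, hf']
  · intro c f hf
    simp only [map_smul, LinearMap.smul_apply, hf]
  · refine (congrArg (fun z => compMor _ _ _ z _) (tensorMor_basis _ _)).trans ?_
    exact (compMor_basis _ _).trans
      ((congrArg scaled (right_natural σ)).trans (compMor_basis _ _).symm)

theorem cross_naturality_mor {X₁ X₂ Y₁ Y₂ : RepGLZero t} (f₁ : X₁ ⟶ Y₁) (f₂ : X₂ ⟶ Y₂) :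
    compMor _ _ _ (tensorMor X₁ Y₁ X₂ Y₂ f₁ f₂) (basis (crossDiag Y₁.row Y₂.row)) =
      compMor ⟨X₁.row.tensor X₂.row⟩ _ _ (basis (crossDiag X₁.row X₂.row))
        (tensorMor X₂ Y₂ X₁ Y₁ f₂ f₁) := by
  refine mor_induction f₁ ?_ ?_ ?_ fun σ => mor_induction f₂ ?_ ?_ ?_ fun τ => ?_
  · simp
  · intro f f' hf hf'
    simp only [map_add, LinearMap.add_apply, hf, hf']
  · intro c f hf
    simp only [map_smul, LinearMap.smul_apply, hf]
  · simp
  · intro f f' hf hf'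
    simp only [map_add, LinearMap.add_apply, hf, hf']
  · intro c f hf
    simp only [map_smul, LinearMap.smul_apply, hf]
  · rw [tensorMor_basis, tensorMor_basis]
    exact (compMor_basis _ _).trans
      ((congrArg scaled (cross_natural σ τ)).trans (compMor_basis _ _).symm)

end RepGLZero

/-- The bijection of `Fin (a + b)` with `Fin (c + d)` given by `e` on the first block and by `e'`
on the second. -/
def blockSum {a b c d : ℕ} (e : Fin a ≃ Fin c) (e' : Fin b ≃ Fin d) : Fin (a + b) ≃ Fin (c + d) :=
  (finSumFinEquiv.symm.trans (Equiv.sumCongr e e')).trans finSumFinEquiv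

theorem blockSum_castAdd {a b c d : ℕ} (e : Fin a ≃ Fin c) (e' : Fin b ≃ Fin d) (i : Fin a) :
    blockSum e e' (Fin.castAdd b i) = Fin.castAdd d (e i) := by
  simp [blockSum]

theorem blockSum_natAdd {a b c d : ℕ} (e : Fin a ≃ Fin c) (e' : Fin b ≃ Fin d) (i : Fin b) :
    blockSum e e' (Fin.natAdd a i) = Fin.natAdd c (e' i) := by
  simp [blockSum]

theorem blockSum_val {a b c d : ℕ} {e : Fin a ≃ Fin c} {e' : Fin b ≃ Fin d}
    (h : ∀ i, (e i : ℕ) = i) (h' : ∀ i, (e' i : ℕ) = i) (i : Fin (a + b)) :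
    (blockSum e e' i : ℕ) = i := by
  have hac : a = c := by simpa using Fintype.card_congr e
  subst hac
  refine Fin.addCases (fun i => ?_) (fun i => ?_) i
  · rw [blockSum_castAdd]
    simp [h]
  · rw [blockSum_natAdd]
    simp [h']

theorem pentagon_fin (w x y z : ℕ) (i : Fin (w + x + y + z)) :
    blockSum (Equiv.refl (Fin w)) (finCongr (Nat.add_assoc x y z))
      (finCongr (Nat.add_assoc w (x + y) z)
        (blockSum (finCongr (Nat.add_assoc w x y)) (Equiv.refl (Fin z)) i)) =
    finCongr (Nat.add_assoc w x (y + z)) (finCongr (Nat.add_assoc (w + x) y z) i) := by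
  apply Fin.ext
  rw [blockSum_val (fun _ => rfl) (fun _ => rfl)]
  exact blockSum_val (e := finCongr (Nat.add_assoc w x y)) (e' := Equiv.refl (Fin z))
    (fun _ => rfl) (fun _ => rfl) i

theorem triangle_fin (x y : ℕ) (i : Fin (x + 0 + y)) :
    blockSum (Equiv.refl (Fin x)) (finCongr (Nat.zero_add y)) (finCongr (Nat.add_assoc x 0 y) i) =
      blockSum (finCongr (Nat.add_zero x)) (Equiv.refl (Fin y)) i := by
  apply Fin.ext
  rw [blockSum_val (fun _ => rfl) (fun _ => rfl), blockSum_val (fun _ => rfl) (fun _ => rfl)]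
  rfl

theorem hexagon_fin (a b c : ℕ) (i : Fin (a + b + c)) :
    finCongr (Nat.add_assoc b c a) (finAddFlip (m := a) (n := b + c)
      (finCongr (Nat.add_assoc a b c) i)) =
    blockSum (Equiv.refl (Fin b)) (finAddFlip (m := a) (n := c))
      (finCongr (Nat.add_assoc b a c) (blockSum finAddFlip (Equiv.refl (Fin c)) i)) := by
  refine Fin.addCases (fun i => ?_) (fun i => ?_) i
  · refine Fin.addCases (fun i => ?_) (fun i => ?_) i
    · have h1 : finCongr (Nat.add_assoc a b c) (Fin.castAdd c (Fin.castAdd b i)) =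
          Fin.castAdd (b + c) i := Fin.ext rfl
      have h2 : finCongr (Nat.add_assoc b a c) (Fin.castAdd c (Fin.natAdd b i)) =
          Fin.natAdd b (Fin.castAdd c i) := Fin.ext rfl
      rw [h1, blockSum_castAdd, finAddFlip_apply_castAdd, finAddFlip_apply_castAdd, h2,
        blockSum_natAdd, finAddFlip_apply_castAdd]
      apply Fin.ext
      simp [Nat.add_assoc]
    · have h1 : finCongr (Nat.add_assoc a b c) (Fin.castAdd c (Fin.natAdd a i)) =
          Fin.natAdd a (Fin.castAdd c i) := Fin.ext rfl
      have h2 : finCongr (Nat.add_assoc b a c) (Fin.castAdd c (Fin.castAdd a i)) =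
          Fin.castAdd (a + c) i := Fin.ext rfl
      rw [h1, blockSum_castAdd, finAddFlip_apply_natAdd, finAddFlip_apply_natAdd, h2,
        blockSum_castAdd]
      rfl
  · have h1 : finCongr (Nat.add_assoc a b c) (Fin.natAdd (a + b) i) =
        Fin.natAdd a (Fin.natAdd b i) := Fin.ext (by simp [Nat.add_assoc])
    have h2 : finCongr (Nat.add_assoc b a c) (Fin.natAdd (b + a) i) =
        Fin.natAdd b (Fin.natAdd a i) := Fin.ext (by simp [Nat.add_assoc])
    rw [h1, blockSum_natAdd, finAddFlip_apply_natAdd, Equiv.refl_apply, h2, blockSum_natAdd,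
      finAddFlip_apply_natAdd]
    rfl

theorem hexagon_fin' (a b c : ℕ) (i : Fin (a + (b + c))) :
    finCongr (Nat.add_assoc c a b).symm (finAddFlip (m := a + b) (n := c)
      (finCongr (Nat.add_assoc a b c).symm i)) =
    blockSum (finAddFlip (m := a) (n := c)) (Equiv.refl (Fin b))
      (finCongr (Nat.add_assoc a c b).symm (blockSum (Equiv.refl (Fin a)) finAddFlip i)) := by
  refine Fin.addCases (fun i => ?_) (fun i => ?_) i
  · have h1 : finCongr (Nat.add_assoc a b c).symm (Fin.castAdd (b + c) i) =
        Fin.castAdd c (Fin.castAdd b i) := Fin.ext rfl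
    have h2 : finCongr (Nat.add_assoc a c b).symm (Fin.castAdd (c + b) i) =
        Fin.castAdd b (Fin.castAdd c i) := Fin.ext rfl
    rw [h1, blockSum_castAdd, finAddFlip_apply_castAdd, Equiv.refl_apply, h2, blockSum_castAdd,
      finAddFlip_apply_castAdd]
    rfl
  · refine Fin.addCases (fun i => ?_) (fun i => ?_) i
    · have h1 : finCongr (Nat.add_assoc a b c).symm (Fin.natAdd a (Fin.castAdd c i)) =
          Fin.castAdd c (Fin.natAdd a i) := Fin.ext rfl
      have h2 : finCongr (Nat.add_assoc a c b).symm (Fin.natAdd a (Fin.natAdd c i)) =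
          Fin.natAdd (a + c) i := Fin.ext (by simp [Nat.add_assoc])
      rw [h1, blockSum_natAdd, finAddFlip_apply_castAdd, finAddFlip_apply_castAdd, h2,
        blockSum_natAdd]
      apply Fin.ext
      simp [Nat.add_assoc]
      try omega
    · have h1 : finCongr (Nat.add_assoc a b c).symm (Fin.natAdd a (Fin.natAdd b i)) =
          Fin.natAdd (a + b) i := Fin.ext (by simp [Nat.add_assoc])
      have h2 : finCongr (Nat.add_assoc a c b).symm (Fin.natAdd a (Fin.castAdd b i)) =
          Fin.castAdd b (Fin.natAdd a i) := Fin.ext rfl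
      rw [h1, blockSum_natAdd, finAddFlip_apply_natAdd, finAddFlip_apply_natAdd, h2,
        blockSum_castAdd, finAddFlip_apply_natAdd]
      rfl

namespace RepGLZero

variable {t : ℂ}

theorem tensor_vert {X Y X' Y' : RepGLZero t} {e : Fin X.row.black ≃ Fin Y.row.black}
    {g : Fin X.row.white ≃ Fin Y.row.white} {e' : Fin X'.row.black ≃ Fin Y'.row.black}
    {g' : Fin X'.row.white ≃ Fin Y'.row.white} :
    (show X ⟶ Y from basis (vert e g)) ⊗ₘ (show X' ⟶ Y' from basis (vert e' g')) =
      basis (vert (X := X.row.tensor X'.row) (Y := Y.row.tensor Y'.row)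
        (blockSum e e') (blockSum g g')) :=
  (tensorMor_basis _ _).trans (congrArg basis (union_vert e g e' g'))

theorem basis_vert_congr {X Y : RepGLZero t} {e e' : Fin X.row.black ≃ Fin Y.row.black}
    {g g' : Fin X.row.white ≃ Fin Y.row.white} (h : ∀ i, e i = e' i) (h' : ∀ i, g i = g' i) :
    (show X ⟶ Y from basis (vert e g)) = basis (vert e' g') :=
  congrArg basis (vert_congr h h')

theorem comp_vert' {X Y Z : RepGLZero t} {e : Fin X.row.black ≃ Fin Y.row.black}
    {g : Fin X.row.white ≃ Fin Y.row.white} {e' : Fin Y.row.black ≃ Fin Z.row.black}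
    {g' : Fin Y.row.white ≃ Fin Z.row.white} :
    (show X ⟶ Y from basis (vert e g)) ≫ (show Y ⟶ Z from basis (vert e' g')) =
      basis (vert (e.trans e') (g.trans g')) :=
  comp_vert (fun _ => rfl) (fun _ => rfl)

theorem pentagon_mor (W X Y Z : RepGLZero t) :
    ((α_ W X Y).hom ⊗ₘ 𝟙 Z) ≫ (α_ W (X ⊗ Y) Z).hom ≫ (𝟙 W ⊗ₘ (α_ X Y Z).hom) =
      (α_ (W ⊗ X) Y Z).hom ≫ (α_ W X (Y ⊗ Z)).hom := by
  refine (congrArg₂ (fun x y => x ≫ _ ≫ y) tensor_vert tensor_vert).trans ?_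
  refine (congrArg (fun x => _ ≫ x) comp_vert').trans ?_
  refine comp_vert'.trans ?_
  refine Eq.trans ?_ comp_vert'.symm
  refine basis_vert_congr ?_ ?_
  · exact pentagon_fin _ _ _ _
  · exact pentagon_fin _ _ _ _

theorem triangle_mor (X Y : RepGLZero t) :
    (α_ X (𝟙_ (RepGLZero t)) Y).hom ≫ (𝟙 X ⊗ₘ (λ_ Y).hom) = (ρ_ X).hom ⊗ₘ 𝟙 Y := by
  refine (congrArg (fun x => _ ≫ x) tensor_vert).trans ?_
  refine comp_vert'.trans ?_
  refine Eq.trans ?_ tensor_vert.symm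
  refine basis_vert_congr ?_ ?_
  · exact triangle_fin _ _
  · exact triangle_fin _ _

instance : MonoidalCategory (RepGLZero t) := MonoidalCategory.ofTensorHom
  (id_tensorHom_id := tensorMor_id)
  (id_tensorHom := fun _ _ _ _ => rfl)
  (tensorHom_id := fun _ _ => rfl)
  (tensorHom_comp_tensorHom := fun f₁ f₂ g₁ g₂ => tensorMor_compMor f₁ f₂ g₁ g₂)
  (associator_naturality := assoc_naturality_mor)
  (leftUnitor_naturality := left_naturality_mor)
  (rightUnitor_naturality := right_naturality_mor)
  (pentagon := pentagon_mor)
  (triangle := triangle_mor)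

instance : SymmetricCategory (RepGLZero t) where
  braiding X Y :=
    { hom := basis (crossDiag X.row Y.row)
      inv := basis (crossDiag Y.row X.row)
      hom_inv_id := comp_vert (fun i => finAddFlip.symm_apply_apply i)
        (fun i => finAddFlip.symm_apply_apply i)
      inv_hom_id := comp_vert (fun i => finAddFlip.symm_apply_apply i)
        (fun i => finAddFlip.symm_apply_apply i) }
  braiding_naturality_right X _ _ f := cross_naturality_mor (𝟙 X) f
  braiding_naturality_left f Z := cross_naturality_mor f (𝟙 Z)
  hexagon_forward X Y Z := by
    refine (congrArg (fun x => _ ≫ x) comp_vert').trans ?_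
    refine comp_vert'.trans ?_
    refine Eq.trans ?_ (congrArg₂ (fun x y => x ≫ _ ≫ y)
      (show basis (crossDiag X.row Y.row) ⊗ₘ 𝟙 Z = _ from tensor_vert)
      (show 𝟙 Y ⊗ₘ basis (crossDiag X.row Z.row) = _ from tensor_vert)).symm
    refine Eq.trans ?_ (congrArg (fun x => _ ≫ x) comp_vert').symm
    refine Eq.trans ?_ comp_vert'.symm
    exact basis_vert_congr (hexagon_fin _ _ _) (hexagon_fin _ _ _)
  hexagon_reverse X Y Z := by
    refine (congrArg (fun x => _ ≫ x) comp_vert').trans ?_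
    refine comp_vert'.trans ?_
    refine Eq.trans ?_ (congrArg₂ (fun x y => x ≫ _ ≫ y)
      (show 𝟙 X ⊗ₘ basis (crossDiag Y.row Z.row) = _ from tensor_vert)
      (show basis (crossDiag X.row Z.row) ⊗ₘ 𝟙 Y = _ from tensor_vert)).symm
    refine Eq.trans ?_ (congrArg (fun x => _ ≫ x) comp_vert').symm
    refine Eq.trans ?_ comp_vert'.symm
    exact basis_vert_congr (hexagon_fin' _ _ _) (hexagon_fin' _ _ _)
  symmetry X Y := comp_vert (fun i => finAddFlip.symm_apply_apply i)
        (fun i => finAddFlip.symm_apply_apply i)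

instance : MonoidalPreadditive (RepGLZero t) where
  whiskerLeft_zero {X Y Z} := LinearMap.map_zero (tensorMor X X Y Z (𝟙 X))
  zero_whiskerRight {X Y Z} := LinearMap.map_zero₂ (tensorMor Y Z X X) (𝟙 X)
  whiskerLeft_add {X Y Z} f g := LinearMap.map_add (tensorMor X X Y Z (𝟙 X)) f g
  add_whiskerRight {X Y Z} f g := LinearMap.map_add₂ (tensorMor Y Z X X) f g (𝟙 X)

instance : MonoidalLinear ℂ (RepGLZero t) where
  whiskerLeft_smul X Y Z r f := LinearMap.map_smul (tensorMor X X Y Z (𝟙 X)) r f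
  smul_whiskerRight r Y Z f X := LinearMap.map_smul₂ (tensorMor Y Z X X) r f (𝟙 X)

end RepGLZero

/-! ### The additive completion as a symmetric monoidal category -/

section AdditiveCompletion

variable {C : Type u} [Category.{v} C] [Preadditive C]

/-- The matrix whose only possibly nonzero entries are the `φ i`, at the places `(i, e i)`. -/
def monomialMat {M N : Mat_ C} (e : M.ι → N.ι) (φ : ∀ i, M.X i ⟶ N.X (e i)) : M ⟶ N := by
  classical
  exact fun i k => if h : e i = k then φ i ≫ eqToHom (congrArg N.X h) else 0

theorem monomialMat_self {M N : Mat_ C} (e : M.ι → N.ι) (φ : ∀ i, M.X i ⟶ N.X (e i)) (i : M.ι) :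
    monomialMat e φ i (e i) = φ i := by
  simp [monomialMat]

theorem monomialMat_ne {M N : Mat_ C} (e : M.ι → N.ι) (φ : ∀ i, M.X i ⟶ N.X (e i)) {i : M.ι}
    {k : N.ι} (h : e i ≠ k) : monomialMat e φ i k = 0 := by
  simp [monomialMat, h]

theorem monomialMat_comp_apply {M N K : Mat_ C} (e : M.ι → N.ι) (φ : ∀ i, M.X i ⟶ N.X (e i))
    (g : N ⟶ K) (i : M.ι) (k : K.ι) : (monomialMat e φ ≫ g) i k = φ i ≫ g (e i) k := by
  rw [Mat_.comp_apply, Finset.sum_eq_single (e i), monomialMat_self]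
  · intro j _ hj
    rw [monomialMat_ne _ _ hj.symm, zero_comp]
  · simp

theorem comp_monomialMat_apply {M N K : Mat_ C} (f : M ⟶ N) (e : N.ι → K.ι)
    (he : Function.Injective e) (φ : ∀ i, N.X i ⟶ K.X (e i)) (i : M.ι) (k : N.ι) :
    (f ≫ monomialMat e φ) i (e k) = f i k ≫ φ k := by
  rw [Mat_.comp_apply, Finset.sum_eq_single k, monomialMat_self]
  · intro j _ hj
    rw [monomialMat_ne _ _ (fun h => hj (he h)), comp_zero]
  · simp

theorem monomialMat_comp {M N K : Mat_ C} (e : M.ι → N.ι) (φ : ∀ i, M.X i ⟶ N.X (e i))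
    (e' : N.ι → K.ι) (φ' : ∀ i, N.X i ⟶ K.X (e' i)) :
    monomialMat e φ ≫ monomialMat e' φ' =
      monomialMat (M := M) (N := K) (fun i => e' (e i)) (fun i => φ i ≫ φ' (e i)) := by
  ext i k
  rw [monomialMat_comp_apply]
  unfold monomialMat
  split_ifs <;> simp

theorem monomialMat_id (M : Mat_ C) : monomialMat (M := M) (N := M) (fun i => i) (fun _ => 𝟙 _) =
    𝟙 M := by
  ext i k
  unfold monomialMat
  rw [Mat_.id_apply]
  split_ifs <;> simp

theorem monomialMat_congr {M N : Mat_ C} {e : M.ι → N.ι} {φ φ' : ∀ i, M.X i ⟶ N.X (e i)}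
    (h : ∀ i, φ i = φ' i) : monomialMat e φ = monomialMat e φ' := by
  rw [funext h]

section Linear

variable {R : Type*} [Semiring R] [Linear R C]

instance : Linear R (Mat_ C) where
  homModule M N := inferInstanceAs (Module R (∀ (i : M.ι) (j : N.ι), M.X i ⟶ N.X j))
  smul_comp M N K r f g := by
    ext i k
    change ∑ j, (r • f i j) ≫ g j k = r • ∑ j, f i j ≫ g j k
    simp [Finset.smul_sum]
  comp_smul M N K f r g := by
    ext i k
    change ∑ j, f i j ≫ (r • g j k) = r • ∑ j, f i j ≫ g j k
    simp [Finset.smul_sum]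

end Linear

variable [MonoidalCategory C]

instance : MonoidalCategoryStruct (Mat_ C) where
  tensorObj M N := ⟨M.ι × N.ι, fun p => M.X p.1 ⊗ N.X p.2⟩
  tensorUnit := ⟨PUnit, fun _ => 𝟙_ C⟩
  tensorHom f g := fun p q => f p.1 q.1 ⊗ₘ g p.2 q.2
  whiskerLeft M _ _ g := fun p q => (𝟙 M : M ⟶ M) p.1 q.1 ⊗ₘ g p.2 q.2
  whiskerRight f N := fun p q => f p.1 q.1 ⊗ₘ (𝟙 N : N ⟶ N) p.2 q.2
  associator M N K :=
    { hom := monomialMat (fun p => (p.1.1, (p.1.2, p.2))) fun p => (α_ _ _ _).hom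
      inv := monomialMat (fun p => ((p.1, p.2.1), p.2.2)) fun p => (α_ _ _ _).inv
      hom_inv_id := by
        rw [monomialMat_comp, ← monomialMat_id]
        exact monomialMat_congr fun p => Iso.hom_inv_id _
      inv_hom_id := by
        rw [monomialMat_comp, ← monomialMat_id]
        exact monomialMat_congr fun p => Iso.inv_hom_id _ }
  leftUnitor M :=
    { hom := monomialMat (fun p => p.2) fun p => (λ_ _).hom
      inv := monomialMat (fun i => (PUnit.unit, i)) fun p => (λ_ _).inv
      hom_inv_id := by
        rw [monomialMat_comp, ← monomialMat_id]
        exact monomialMat_congr fun p => Iso.hom_inv_id _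
      inv_hom_id := by
        rw [monomialMat_comp, ← monomialMat_id]
        exact monomialMat_congr fun p => Iso.inv_hom_id _ }
  rightUnitor M :=
    { hom := monomialMat (fun p => p.1) fun p => (ρ_ _).hom
      inv := monomialMat (fun i => (i, PUnit.unit)) fun p => (ρ_ _).inv
      hom_inv_id := by
        rw [monomialMat_comp, ← monomialMat_id]
        exact monomialMat_congr fun p => Iso.hom_inv_id _
      inv_hom_id := by
        rw [monomialMat_comp, ← monomialMat_id]
        exact monomialMat_congr fun p => Iso.inv_hom_id _ }

variable [MonoidalPreadditive C]

theorem tensor_monomialMat {M N M' N' : Mat_ C} (e : M.ι → N.ι) (φ : ∀ i, M.X i ⟶ N.X (e i))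
    (e' : M'.ι → N'.ι) (φ' : ∀ i, M'.X i ⟶ N'.X (e' i)) :
    monomialMat e φ ⊗ₘ monomialMat e' φ' =
      monomialMat (M := M ⊗ M') (N := N ⊗ N') (fun p => (e p.1, e' p.2))
        (fun p => φ p.1 ⊗ₘ φ' p.2) := by
  ext ⟨i, i'⟩ ⟨k, k'⟩
  change monomialMat e φ i k ⊗ₘ monomialMat e' φ' i' k' = _
  by_cases h : e i = k
  · by_cases h' : e' i' = k'
    · subst h h'
      rw [monomialMat_self, monomialMat_self]
      exact (monomialMat_self (M := M ⊗ M') (N := N ⊗ N') (fun p => (e p.1, e' p.2))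
        (fun p => φ p.1 ⊗ₘ φ' p.2) (i, i')).symm
    · rw [monomialMat_ne e' φ' h', MonoidalPreadditive.tensor_zero, monomialMat_ne]
      intro H
      exact h' (congrArg Prod.snd H)
  · rw [monomialMat_ne e φ h, MonoidalPreadditive.zero_tensor, monomialMat_ne]
    intro H
    exact h (congrArg Prod.fst H)

theorem id_tensor_monomialMat {M N M' : Mat_ C} (e : M.ι → N.ι) (φ : ∀ i, M.X i ⟶ N.X (e i)) :
    𝟙 M' ⊗ₘ monomialMat e φ =
      monomialMat (M := M' ⊗ M) (N := M' ⊗ N) (fun p => (p.1, e p.2))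
        (fun p => 𝟙 _ ⊗ₘ φ p.2) := by
  rw [← monomialMat_id, tensor_monomialMat]

theorem monomialMat_tensor_id {M N M' : Mat_ C} (e : M.ι → N.ι) (φ : ∀ i, M.X i ⟶ N.X (e i)) :
    monomialMat e φ ⊗ₘ 𝟙 M' =
      monomialMat (M := M ⊗ M') (N := N ⊗ M') (fun p => (e p.1, p.2))
        (fun p => φ p.1 ⊗ₘ 𝟙 _) := by
  rw [← monomialMat_id, tensor_monomialMat]

theorem mat_id_tensor_id (M N : Mat_ C) : 𝟙 M ⊗ₘ 𝟙 N = 𝟙 (M ⊗ N) := by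
  rw [← monomialMat_id N, id_tensor_monomialMat, ← monomialMat_id]
  exact monomialMat_congr fun p => MonoidalCategory.id_tensorHom_id _ _

theorem mat_tensor_comp {M₁ M₂ N₁ N₂ K₁ K₂ : Mat_ C} (f₁ : M₁ ⟶ N₁) (f₂ : M₂ ⟶ N₂)
    (g₁ : N₁ ⟶ K₁) (g₂ : N₂ ⟶ K₂) :
    (f₁ ⊗ₘ f₂) ≫ (g₁ ⊗ₘ g₂) = (f₁ ≫ g₁) ⊗ₘ (f₂ ≫ g₂) := by
  ext p q
  change ∑ r : N₁.ι × N₂.ι, (f₁ p.1 r.1 ⊗ₘ f₂ p.2 r.2) ≫ (g₁ r.1 q.1 ⊗ₘ g₂ r.2 q.2) =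
    (∑ j, f₁ p.1 j ≫ g₁ j q.1) ⊗ₘ ∑ j, f₂ p.2 j ≫ g₂ j q.2
  rw [sum_tensor]
  simp_rw [tensor_sum]
  refine (Fintype.sum_prod_type _).trans ?_
  refine Finset.sum_congr rfl fun j _ => Finset.sum_congr rfl fun j' _ => ?_
  exact MonoidalCategory.tensorHom_comp_tensorHom _ _ _ _

theorem mat_associator_naturality {M₁ M₂ M₃ N₁ N₂ N₃ : Mat_ C} (f₁ : M₁ ⟶ N₁) (f₂ : M₂ ⟶ N₂)
    (f₃ : M₃ ⟶ N₃) :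
    ((f₁ ⊗ₘ f₂) ⊗ₘ f₃) ≫ (α_ N₁ N₂ N₃).hom = (α_ M₁ M₂ M₃).hom ≫ (f₁ ⊗ₘ (f₂ ⊗ₘ f₃)) := by
  ext ⟨⟨i₁, i₂⟩, i₃⟩ ⟨k₁, k₂, k₃⟩
  refine (comp_monomialMat_apply (N := (N₁ ⊗ N₂) ⊗ N₃) _ _ ?_ _ _ ((k₁, k₂), k₃)).trans
    (Eq.trans ?_ (monomialMat_comp_apply _ _ _ _ _).symm)
  · rintro ⟨⟨_, _⟩, _⟩ ⟨⟨_, _⟩, _⟩ h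
    obtain ⟨h1, h2⟩ := Prod.mk.inj h
    obtain ⟨h2, h3⟩ := Prod.mk.inj h2
    exact Prod.ext (Prod.ext h1 h2) h3
  · exact MonoidalCategory.associator_naturality _ _ _

theorem mat_left_naturality {M N : Mat_ C} (f : M ⟶ N) :
    (𝟙 (𝟙_ (Mat_ C)) ⊗ₘ f) ≫ (λ_ N).hom = (λ_ M).hom ≫ f := by
  ext ⟨⟨⟩, i⟩ k
  refine (comp_monomialMat_apply (N := 𝟙_ (Mat_ C) ⊗ N) _ _ ?_ _ _ (PUnit.unit, k)).trans
    (Eq.trans ?_ (monomialMat_comp_apply _ _ _ _ _).symm)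
  · rintro ⟨⟨⟩, _⟩ ⟨⟨⟩, _⟩ h
    exact congrArg _ h
  · change ((𝟙 (𝟙_ (Mat_ C)) : 𝟙_ (Mat_ C) ⟶ 𝟙_ (Mat_ C)) PUnit.unit PUnit.unit ⊗ₘ f i k) ≫ _ = _
    rw [Mat_.id_apply_self]
    exact (congrArg (fun x => x ≫ (λ_ (N.X k)).hom) (MonoidalCategory.id_tensorHom _ _)).trans
      (MonoidalCategory.leftUnitor_naturality _)

theorem mat_right_naturality {M N : Mat_ C} (f : M ⟶ N) :
    (f ⊗ₘ 𝟙 (𝟙_ (Mat_ C))) ≫ (ρ_ N).hom = (ρ_ M).hom ≫ f := by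
  ext ⟨i, ⟨⟩⟩ k
  refine (comp_monomialMat_apply (N := N ⊗ 𝟙_ (Mat_ C)) _ _ ?_ _ _ (k, PUnit.unit)).trans
    (Eq.trans ?_ (monomialMat_comp_apply _ _ _ _ _).symm)
  · rintro ⟨_, ⟨⟩⟩ ⟨_, ⟨⟩⟩ h
    exact congrArg (fun x => (x, PUnit.unit)) h
  · change (f i k ⊗ₘ (𝟙 (𝟙_ (Mat_ C)) : 𝟙_ (Mat_ C) ⟶ 𝟙_ (Mat_ C)) PUnit.unit PUnit.unit) ≫ _ = _
    rw [Mat_.id_apply_self]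
    exact (congrArg (fun x => x ≫ (ρ_ (N.X k)).hom) (MonoidalCategory.tensorHom_id _ _)).trans
      (MonoidalCategory.rightUnitor_naturality _)

theorem mat_pentagon (W X Y Z : Mat_ C) :
    ((α_ W X Y).hom ⊗ₘ 𝟙 Z) ≫ (α_ W (X ⊗ Y) Z).hom ≫ (𝟙 W ⊗ₘ (α_ X Y Z).hom) =
      (α_ (W ⊗ X) Y Z).hom ≫ (α_ W X (Y ⊗ Z)).hom := by
  refine (congrArg₂ (fun x y => x ≫ _ ≫ y) (monomialMat_tensor_id _ _)
    (id_tensor_monomialMat _ _)).trans ?_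
  refine (congrArg (fun x => _ ≫ x) (monomialMat_comp _ _ _ _)).trans ?_
  refine (monomialMat_comp _ _ _ _).trans (Eq.trans ?_ (monomialMat_comp _ _ _ _).symm)
  refine monomialMat_congr fun p => ?_
  have h := MonoidalCategory.pentagon (W.X p.1.1.1) (X.X p.1.1.2) (Y.X p.1.2) (Z.X p.2)
  rw [← MonoidalCategory.tensorHom_id, ← MonoidalCategory.id_tensorHom] at h
  exact h

theorem mat_triangle (X Y : Mat_ C) :
    (α_ X (𝟙_ (Mat_ C)) Y).hom ≫ (𝟙 X ⊗ₘ (λ_ Y).hom) = (ρ_ X).hom ⊗ₘ 𝟙 Y := by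
  refine (congrArg (fun x => _ ≫ x) (id_tensor_monomialMat _ _)).trans ?_
  refine (monomialMat_comp _ _ _ _).trans (Eq.trans ?_ (monomialMat_tensor_id _ _).symm)
  refine monomialMat_congr fun p => ?_
  have h := MonoidalCategory.triangle (X.X p.1.1) (Y.X p.2)
  rw [← MonoidalCategory.tensorHom_id, ← MonoidalCategory.id_tensorHom] at h
  exact h

instance : MonoidalCategory (Mat_ C) := MonoidalCategory.ofTensorHom
  (id_tensorHom_id := mat_id_tensor_id)
  (id_tensorHom := fun _ _ _ _ => rfl)
  (tensorHom_id := fun _ _ => rfl)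
  (tensorHom_comp_tensorHom := mat_tensor_comp)
  (associator_naturality := mat_associator_naturality)
  (leftUnitor_naturality := mat_left_naturality)
  (rightUnitor_naturality := mat_right_naturality)
  (pentagon := mat_pentagon)
  (triangle := mat_triangle)

instance : MonoidalPreadditive (Mat_ C) where
  whiskerLeft_zero {X Y Z} := by
    ext p q
    exact MonoidalPreadditive.tensor_zero _
  zero_whiskerRight {X Y Z} := by
    ext p q
    exact MonoidalPreadditive.zero_tensor _
  whiskerLeft_add f g := by
    ext p q
    exact MonoidalPreadditive.tensor_add _ _ _
  add_whiskerRight f g := by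
    ext p q
    exact MonoidalPreadditive.add_tensor _ _ _

instance {R : Type*} [Semiring R] [Linear R C] [MonoidalLinear R C] : MonoidalLinear R (Mat_ C) where
  whiskerLeft_smul X Y Z r f := by
    ext p q
    change (𝟙 X : X ⟶ X) p.1 q.1 ⊗ₘ (r • f p.2 q.2) = r • ((𝟙 X : X ⟶ X) p.1 q.1 ⊗ₘ f p.2 q.2)
    simp [MonoidalCategory.tensorHom_def]
  smul_whiskerRight r Y Z f X := by
    ext p q
    change (r • f p.1 q.1) ⊗ₘ (𝟙 X : X ⟶ X) p.2 q.2 = r • (f p.1 q.1 ⊗ₘ (𝟙 X : X ⟶ X) p.2 q.2)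
    simp [MonoidalCategory.tensorHom_def]

theorem mat_braiding_naturality [BraidedCategory C] {M M' N N' : Mat_ C} (f : M ⟶ N)
    (g : M' ⟶ N') :
    (f ⊗ₘ g) ≫ monomialMat (M := N ⊗ N') (N := N' ⊗ N) (fun p => (p.2, p.1))
        (fun p => (β_ _ _).hom) =
      monomialMat (M := M ⊗ M') (N := M' ⊗ M) (fun p => (p.2, p.1)) (fun p => (β_ _ _).hom) ≫
        (g ⊗ₘ f) := by
  ext ⟨i, i'⟩ ⟨k', k⟩
  refine (comp_monomialMat_apply (N := N ⊗ N') _ _ ?_ _ _ (k, k')).trans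
    (Eq.trans ?_ (monomialMat_comp_apply _ _ _ _ _).symm)
  · rintro ⟨_, _⟩ ⟨_, _⟩ h
    obtain ⟨h1, h2⟩ := Prod.mk.inj h
    exact Prod.ext h2 h1
  · exact BraidedCategory.braiding_naturality _ _

instance [SymmetricCategory C] : SymmetricCategory (Mat_ C) where
  braiding M N :=
    { hom := monomialMat (fun p => (p.2, p.1)) fun p => (β_ _ _).hom
      inv := monomialMat (fun p => (p.2, p.1)) fun p => (β_ _ _).hom
      hom_inv_id := by
        rw [monomialMat_comp, ← monomialMat_id]
        exact monomialMat_congr fun p => SymmetricCategory.symmetry _ _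
      inv_hom_id := by
        rw [monomialMat_comp, ← monomialMat_id]
        exact monomialMat_congr fun p => SymmetricCategory.symmetry _ _ }
  braiding_naturality_right X _ _ f := mat_braiding_naturality (𝟙 X) f
  braiding_naturality_left f Z := mat_braiding_naturality f (𝟙 Z)
  hexagon_forward X Y Z := by
    rw [← MonoidalCategory.tensorHom_id, ← MonoidalCategory.id_tensorHom]
    refine (congrArg (fun x => _ ≫ x) (monomialMat_comp _ _ _ _)).trans ?_
    refine (monomialMat_comp _ _ _ _).trans ?_
    refine Eq.trans ?_ (congrArg₂ (fun x y => x ≫ _ ≫ y) (monomialMat_tensor_id _ _)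
      (id_tensor_monomialMat _ _)).symm
    refine Eq.trans ?_ (congrArg (fun x => _ ≫ x) (monomialMat_comp _ _ _ _)).symm
    refine Eq.trans ?_ (monomialMat_comp _ _ _ _).symm
    refine monomialMat_congr fun p => ?_
    have h := BraidedCategory.hexagon_forward (X.X p.1.1) (Y.X p.1.2) (Z.X p.2)
    rw [← MonoidalCategory.tensorHom_id, ← MonoidalCategory.id_tensorHom] at h
    exact h
  hexagon_reverse X Y Z := by
    rw [← MonoidalCategory.tensorHom_id, ← MonoidalCategory.id_tensorHom]
    refine (congrArg (fun x => _ ≫ x) (monomialMat_comp _ _ _ _)).trans ?_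
    refine (monomialMat_comp _ _ _ _).trans ?_
    refine Eq.trans ?_ (congrArg₂ (fun x y => x ≫ _ ≫ y) (id_tensor_monomialMat _ _)
      (monomialMat_tensor_id _ _)).symm
    refine Eq.trans ?_ (congrArg (fun x => _ ≫ x) (monomialMat_comp _ _ _ _)).symm
    refine Eq.trans ?_ (monomialMat_comp _ _ _ _).symm
    refine monomialMat_congr fun p => ?_
    have h := BraidedCategory.hexagon_reverse (X.X p.1) (Y.X p.2.1) (Z.X p.2.2)
    rw [← MonoidalCategory.tensorHom_id, ← MonoidalCategory.id_tensorHom] at h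
    exact h
  symmetry X Y := by
    refine (monomialMat_comp _ _ _ _).trans (Eq.trans ?_ (monomialMat_id _))
    exact monomialMat_congr fun p => SymmetricCategory.symmetry _ _

end AdditiveCompletion

/-! ### The Karoubian envelope as a symmetric monoidal category -/

section KaroubianEnvelope

open Idempotents

variable {C : Type u} [Category.{v} C]

section Linear

variable [Preadditive C] {R : Type*} [Semiring R] [Linear R C]

instance (P Q : Karoubi C) : SMul R (P ⟶ Q) where
  smul r f := ⟨r • f.f, by rw [Linear.smul_comp, Linear.comp_smul, f.comm]⟩

theorem karoubi_smul_f {P Q : Karoubi C} (r : R) (f : P ⟶ Q) : (r • f).f = r • f.f := rfl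

instance : Linear R (Karoubi C) where
  homModule P Q :=
    { one_smul := fun f => by ext; simp [karoubi_smul_f]
      mul_smul := fun r s f => by ext; simp [karoubi_smul_f, mul_smul]
      smul_zero := fun r => by ext; simp [karoubi_smul_f]
      smul_add := fun r f g => by ext; simp [karoubi_smul_f]
      add_smul := fun r s f => by ext; simp [karoubi_smul_f, add_smul]
      zero_smul := fun f => by ext; simp [karoubi_smul_f] }
  smul_comp P Q S r f g := by ext; simp [karoubi_smul_f]
  comp_smul P Q S f r g := by ext; simp [karoubi_smul_f]

end Linear

/-- An isomorphism `φ : X ≅ Y` with `p ≫ φ = φ ≫ q` gives an isomorphism `(X, p) ≅ (Y, q)`. -/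
def karoubiIso (P Q : Karoubi C) (φ : P.X ≅ Q.X) (h : P.p ≫ φ.hom = φ.hom ≫ Q.p) : P ≅ Q where
  hom := ⟨P.p ≫ φ.hom, by rw [Category.assoc, ← h, P.idem_assoc, P.idem_assoc]⟩
  inv := ⟨Q.p ≫ φ.inv, by
    have h' : Q.p ≫ φ.inv = φ.inv ≫ P.p := by
      rw [Iso.comp_inv_eq, Category.assoc, h, Iso.inv_hom_id_assoc]
    rw [Category.assoc, ← h', Q.idem_assoc, Q.idem_assoc]⟩
  hom_inv_id := by
    ext
    change (P.p ≫ φ.hom) ≫ Q.p ≫ φ.inv = P.p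
    rw [h, Category.assoc, Q.idem_assoc, ← reassoc_of% h, Iso.hom_inv_id, Category.comp_id]
  inv_hom_id := by
    ext
    change (Q.p ≫ φ.inv) ≫ P.p ≫ φ.hom = Q.p
    rw [h, Category.assoc, Iso.inv_hom_id_assoc, Q.idem]

/-- The morphism `f` of the envelope is induced by the morphism `φ` of `C`, which commutes with
the idempotents. -/
def IsInduced {P Q : Karoubi C} (f : P ⟶ Q) (φ : P.X ⟶ Q.X) : Prop :=
  f.f = P.p ≫ φ ∧ P.p ≫ φ = φ ≫ Q.p

namespace IsInduced

theorem ext {P Q : Karoubi C} {f g : P ⟶ Q} {φ ψ : P.X ⟶ Q.X} (hf : IsInduced f φ)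
    (hg : IsInduced g ψ) (h : φ = ψ) : f = g := by
  ext
  rw [hf.1, hg.1, h]

theorem self {P Q : Karoubi C} (f : P ⟶ Q) : IsInduced f f.f :=
  ⟨(Karoubi.p_comp f).symm, by rw [Karoubi.p_comp, Karoubi.comp_p]⟩

theorem id (P : Karoubi C) : IsInduced (𝟙 P) (𝟙 P.X) :=
  ⟨(Category.comp_id _).symm, by rw [Category.comp_id, Category.id_comp]⟩

theorem comp {P Q S : Karoubi C} {f : P ⟶ Q} {g : Q ⟶ S} {φ : P.X ⟶ Q.X} {ψ : Q.X ⟶ S.X}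
    (hf : IsInduced f φ) (hg : IsInduced g ψ) : IsInduced (f ≫ g) (φ ≫ ψ) :=
  ⟨by rw [Karoubi.comp_f, hf.1, hg.1, hf.2, Category.assoc, Q.idem_assoc, ← reassoc_of% hf.2],
    by rw [reassoc_of% hf.2, hg.2, Category.assoc]⟩

theorem iso {P Q : Karoubi C} (φ : P.X ≅ Q.X) (h : P.p ≫ φ.hom = φ.hom ≫ Q.p) :
    IsInduced (karoubiIso P Q φ h).hom φ.hom :=
  ⟨rfl, h⟩

theorem iso_inv {P Q : Karoubi C} (φ : P.X ≅ Q.X) (h : P.p ≫ φ.hom = φ.hom ≫ Q.p) :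
    IsInduced (karoubiIso P Q φ h).inv φ.inv :=
  ⟨rfl, by rw [Iso.comp_inv_eq, Category.assoc, h, Iso.inv_hom_id_assoc]⟩

end IsInduced

variable [MonoidalCategory C]

/-- The tensor product `(X, p) ⊗ (Y, q) = (X ⊗ Y, p ⊗ q)`. -/
def karoubiTensor (P Q : Karoubi C) : Karoubi C :=
  ⟨P.X ⊗ Q.X, P.p ⊗ₘ Q.p, by rw [MonoidalCategory.tensorHom_comp_tensorHom, P.idem, Q.idem]⟩

/-- The tensor product of morphisms is that of `C`. -/
def karoubiTensorHom {P Q P' Q' : Karoubi C} (f : P ⟶ Q) (g : P' ⟶ Q') :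
    karoubiTensor P P' ⟶ karoubiTensor Q Q' :=
  ⟨f.f ⊗ₘ g.f, by
    simp only [karoubiTensor, MonoidalCategory.tensorHom_comp_tensorHom, f.comm, g.comm]⟩

instance : MonoidalCategoryStruct (Karoubi C) where
  tensorObj := karoubiTensor
  tensorUnit := ⟨𝟙_ C, 𝟙 _, Category.comp_id _⟩
  tensorHom := karoubiTensorHom
  whiskerLeft P _ _ g := karoubiTensorHom (𝟙 P) g
  whiskerRight f Q := karoubiTensorHom f (𝟙 Q)
  associator P Q S := karoubiIso _ _ (α_ P.X Q.X S.X) (MonoidalCategory.associator_naturality _ _ _)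
  leftUnitor P := karoubiIso _ _ (λ_ P.X) (by
    change (𝟙 (𝟙_ C) ⊗ₘ P.p) ≫ _ = _
    rw [MonoidalCategory.id_tensorHom, MonoidalCategory.leftUnitor_naturality]
    rfl)
  rightUnitor P := karoubiIso _ _ (ρ_ P.X) (by
    change (P.p ⊗ₘ 𝟙 (𝟙_ C)) ≫ _ = _
    rw [MonoidalCategory.tensorHom_id, MonoidalCategory.rightUnitor_naturality]
    rfl)

namespace IsInduced

theorem tensor {P Q P' Q' : Karoubi C} {f : P ⟶ Q} {g : P' ⟶ Q'} {φ : P.X ⟶ Q.X}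
    {ψ : P'.X ⟶ Q'.X} (hf : IsInduced f φ) (hg : IsInduced g ψ) :
    IsInduced (f ⊗ₘ g) (show (P ⊗ P').X ⟶ (Q ⊗ Q').X from φ ⊗ₘ ψ) := by
  constructor
  · change f.f ⊗ₘ g.f = (P.p ⊗ₘ P'.p) ≫ (φ ⊗ₘ ψ)
    rw [MonoidalCategory.tensorHom_comp_tensorHom, hf.1, hg.1]
  · change (P.p ⊗ₘ P'.p) ≫ (φ ⊗ₘ ψ) = (φ ⊗ₘ ψ) ≫ (Q.p ⊗ₘ Q'.p)
    rw [MonoidalCategory.tensorHom_comp_tensorHom, MonoidalCategory.tensorHom_comp_tensorHom,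
      hf.2, hg.2]

end IsInduced

instance : MonoidalCategory (Karoubi C) := MonoidalCategory.ofTensorHom
  (id_tensorHom_id := fun _ _ => rfl)
  (id_tensorHom := fun _ _ _ _ => rfl)
  (tensorHom_id := fun _ _ => rfl)
  (tensorHom_comp_tensorHom := fun _ _ _ _ => by
    ext
    exact MonoidalCategory.tensorHom_comp_tensorHom _ _ _ _)
  (associator_naturality := fun f₁ f₂ f₃ =>
    IsInduced.ext
      ((((IsInduced.self f₁).tensor (.self f₂)).tensor (.self f₃)).comp (.iso _ _))
      (.comp (.iso _ _) ((IsInduced.self f₁).tensor ((IsInduced.self f₂).tensor (.self f₃))))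
      (MonoidalCategory.associator_naturality _ _ _))
  (leftUnitor_naturality := fun {X Y} f =>
    IsInduced.ext
      (((IsInduced.id (𝟙_ (Karoubi C))).tensor (.self f)).comp (.iso _ _))
      (.comp (.iso _ _) (.self f))
      (by
        change (𝟙 (𝟙_ C) ⊗ₘ f.f) ≫ (λ_ Y.X).hom = (λ_ X.X).hom ≫ f.f
        rw [MonoidalCategory.id_tensorHom, MonoidalCategory.leftUnitor_naturality]))
  (rightUnitor_naturality := fun {X Y} f =>
    IsInduced.ext
      (((IsInduced.self f).tensor (.id (𝟙_ (Karoubi C)))).comp (.iso _ _))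
      (.comp (.iso _ _) (.self f))
      (by
        change (f.f ⊗ₘ 𝟙 (𝟙_ C)) ≫ (ρ_ Y.X).hom = (ρ_ X.X).hom ≫ f.f
        rw [MonoidalCategory.tensorHom_id, MonoidalCategory.rightUnitor_naturality]))
  (pentagon := fun W X Y Z =>
    IsInduced.ext
      (.comp (.tensor (.iso _ _) (.id Z)) (.comp (.iso _ _) (.tensor (.id W) (.iso _ _))))
      (.comp (.iso _ _) (.iso _ _))
      (by
        change ((α_ W.X X.X Y.X).hom ⊗ₘ 𝟙 Z.X) ≫ (α_ W.X (X.X ⊗ Y.X) Z.X).hom ≫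
          (𝟙 W.X ⊗ₘ (α_ X.X Y.X Z.X).hom) =
            (α_ (W.X ⊗ X.X) Y.X Z.X).hom ≫ (α_ W.X X.X (Y.X ⊗ Z.X)).hom
        simp))
  (triangle := fun X Y =>
    IsInduced.ext
      (.comp (.iso _ _) (.tensor (.id X) (.iso _ _)))
      (.tensor (.iso _ _) (.id Y))
      (by
        change (α_ X.X (𝟙_ C) Y.X).hom ≫ (𝟙 X.X ⊗ₘ (λ_ Y.X).hom) = (ρ_ X.X).hom ⊗ₘ 𝟙 Y.X
        simp))

namespace IsInduced

theorem whiskerLeft (S : Karoubi C) {P Q : Karoubi C} {f : P ⟶ Q} {φ : P.X ⟶ Q.X}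
    (hf : IsInduced f φ) : IsInduced (S ◁ f) (show (S ⊗ P).X ⟶ (S ⊗ Q).X from S.X ◁ φ) := by
  have h := tensor (IsInduced.id S) hf
  rw [MonoidalCategory.id_tensorHom, MonoidalCategory.id_tensorHom] at h
  exact h

theorem whiskerRight (S : Karoubi C) {P Q : Karoubi C} {f : P ⟶ Q} {φ : P.X ⟶ Q.X}
    (hf : IsInduced f φ) : IsInduced (f ▷ S) (show (P ⊗ S).X ⟶ (Q ⊗ S).X from φ ▷ S.X) := by
  have h := tensor hf (IsInduced.id S)
  rw [MonoidalCategory.tensorHom_id, MonoidalCategory.tensorHom_id] at h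
  exact h

end IsInduced

instance [Preadditive C] [MonoidalPreadditive C] : MonoidalPreadditive (Karoubi C) where
  whiskerLeft_zero := by
    intros
    ext
    exact MonoidalPreadditive.tensor_zero _
  zero_whiskerRight := by
    intros
    ext
    exact MonoidalPreadditive.zero_tensor _
  whiskerLeft_add f g := by
    ext
    exact MonoidalPreadditive.tensor_add _ _ _
  add_whiskerRight f g := by
    ext
    exact MonoidalPreadditive.add_tensor _ _ _

instance [Preadditive C] [MonoidalPreadditive C] {R : Type*} [Semiring R] [Linear R C]
    [MonoidalLinear R C] : MonoidalLinear R (Karoubi C) where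
  whiskerLeft_smul X Y Z r f := by
    ext
    change X.p ⊗ₘ (r • f.f) = r • (X.p ⊗ₘ f.f)
    simp [MonoidalCategory.tensorHom_def]
  smul_whiskerRight r Y Z f X := by
    ext
    change (r • f.f) ⊗ₘ X.p = r • (f.f ⊗ₘ X.p)
    simp [MonoidalCategory.tensorHom_def]

instance [SymmetricCategory C] : SymmetricCategory (Karoubi C) where
  braiding P Q := karoubiIso _ _ (β_ P.X Q.X) (BraidedCategory.braiding_naturality _ _)
  braiding_naturality_right X Y Z f :=
    IsInduced.ext (.comp (.whiskerLeft X (.self f)) (.iso _ _))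
      (.comp (.iso _ _) (.whiskerRight X (.self f)))
      (BraidedCategory.braiding_naturality_right _ _)
  braiding_naturality_left f Z :=
    IsInduced.ext (.comp (.whiskerRight Z (.self f)) (.iso _ _))
      (.comp (.iso _ _) (.whiskerLeft Z (.self f)))
      (BraidedCategory.braiding_naturality_left _ _)
  hexagon_forward X Y Z :=
    IsInduced.ext (.comp (.iso _ _) (.comp (.iso _ _) (.iso _ _)))
      (.comp (.whiskerRight Z (.iso _ _)) (.comp (.iso _ _) (.whiskerLeft Y (.iso _ _))))
      (BraidedCategory.hexagon_forward _ _ _)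
  hexagon_reverse X Y Z :=
    IsInduced.ext (.comp (.iso_inv _ _) (.comp (.iso _ _) (.iso_inv _ _)))
      (.comp (.whiskerLeft X (.iso _ _)) (.comp (.iso_inv _ _) (.whiskerRight Y (.iso _ _))))
      (BraidedCategory.hexagon_reverse _ _ _)
  symmetry _ _ :=
    IsInduced.ext (.comp (.iso _ _) (.iso _ _)) (.id _) (SymmetricCategory.symmetry _ _)

end KaroubianEnvelope

/-! ### The category `Rep(GL_t)` -/

/-- `Rep(GL_t)`: the Karoubian envelope of the additive completion (finite formal direct sums,
matrices of morphisms) of the category of walled Brauer diagrams with parameter `t`. -/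
abbrev RepGL (t : ℂ) := Idempotents.Karoubi (Mat_ (RepGLZero t))

/-- The object `[1,0]` of `Rep(GL_t)`. -/
def std (t : ℂ) : RepGL t :=
  (Idempotents.toKaroubi (Mat_ (RepGLZero t))).obj ((Mat_.embedding (RepGLZero t)).obj ⟨⟨1, 0⟩⟩)

/-! ### Traces and dimensions -/

/-- The trace of an endomorphism: `𝟙 ⟶ X ⊗ Xᘁ ⟶ X ⊗ Xᘁ ⟶ Xᘁ ⊗ X ⟶ 𝟙`. -/
def trace {T : Type u} [Category.{v} T] [MonoidalCategory T] [SymmetricCategory T] {X : T}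
    [HasRightDual X] (f : X ⟶ X) : 𝟙_ T ⟶ 𝟙_ T :=
  η_ X Xᘁ ≫ f ▷ Xᘁ ≫ (β_ X Xᘁ).hom ≫ ε_ X Xᘁ

/-- The dimension of a dualizable object, an endomorphism of the unit object. -/
def dim {T : Type u} [Category.{v} T] [MonoidalCategory T] [SymmetricCategory T] (X : T)
    [HasRightDual X] : 𝟙_ T ⟶ 𝟙_ T :=
  trace (𝟙 X)

/-! ### Linear symmetric monoidal functors -/

section Functors

variable (C : Type u₁) [Category.{v₁} C] [Preadditive C] [Linear ℂ C] [MonoidalCategory C]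
  [SymmetricCategory C]
variable (D : Type u₂) [Category.{v₂} D] [Preadditive D] [Linear ℂ D] [MonoidalCategory D]
  [SymmetricCategory D]

/-- Additive `ℂ`-linear (strong) symmetric monoidal functors. -/
structure LinSymFunctor where
  /-- The underlying functor. -/
  toFunctor : C ⥤ D
  [additive : toFunctor.Additive]
  [linear : toFunctor.Linear ℂ]
  [braided : toFunctor.Braided]

attribute [instance] LinSymFunctor.additive LinSymFunctor.linear LinSymFunctor.braided

variable {C D}

/-- Monoidal natural transformations. -/
structure LinSymFunctor.Hom (F G : LinSymFunctor C D) where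
  /-- The underlying natural transformation. -/
  toNatTrans : F.toFunctor ⟶ G.toFunctor
  [isMonoidal : toNatTrans.IsMonoidal]

attribute [instance] LinSymFunctor.Hom.isMonoidal

instance : Category (LinSymFunctor C D) where
  Hom F G := LinSymFunctor.Hom F G
  id F := ⟨𝟙 F.toFunctor⟩
  comp η θ := ⟨η.toNatTrans ≫ θ.toNatTrans⟩

end Functors

/-! ### Evaluation at `[1,0]` -/

section Evaluation

variable (t : ℂ) (T : Type u) [Category.{v} T] [Preadditive T] [Linear ℂ T] [MonoidalCategory T]
  [SymmetricCategory T] [RigidCategory T]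

/-- Objects of `T` of dimension `t`. -/
structure DimObj where
  /-- The underlying object. -/
  obj : T
  dim_eq : dim obj = t • 𝟙 (𝟙_ T)

/-- The morphisms between objects of dimension `t` are the isomorphisms of `T`. -/
instance : Category (DimObj t T) where
  Hom X Y := X.obj ≅ Y.obj
  id X := Iso.refl X.obj
  comp f g := f ≪≫ g

/-- The functor `F ↦ F([1,0])`, `η ↦ η_{[1,0]}`. -/
def evalStd (hdim : ∀ F : LinSymFunctor (RepGL t) T, dim (F.toFunctor.obj (std t)) = t • 𝟙 (𝟙_ T))
    (hiso : ∀ {F G : LinSymFunctor (RepGL t) T} (η : F ⟶ G), IsIso (η.toNatTrans.app (std t))) :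
    LinSymFunctor (RepGL t) T ⥤ DimObj t T where
  obj F := ⟨F.toFunctor.obj (std t), hdim F⟩
  map {F G} η := @asIso T _ (F.toFunctor.obj (std t)) (G.toFunctor.obj (std t))
    (η.toNatTrans.app (std t)) (hiso η)
  map_id _ := Iso.ext rfl
  map_comp _ _ := Iso.ext rfl

end Evaluation

end DeligneGL

end

open DeligneGL

/-!
A symmetric monoidal functor out of `Rep(GL_t)` is determined by the image of `[1, 0]`, because
`[0, 1]` is dual to it, every `[l, m]` is a tensor product of copies of the two, and every object
of `Rep(GL_t)` is a direct summand of a sum of such products.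

*Functors.* Let `X` be an object of dimension `t`, with dual `X*`. To construct a functor, every
diagram has to be interpreted as a morphism of `T`, independently of how it is drawn. The needed
coherence is obtained in two steps. Morphisms composed of structural isomorphisms are determined
by the permutation of the tensor factors (`Struct.unique`), and every permutation that respects
the factors occurs (`Struct.exists_of_lbl_eq`); the proof pulls one factor after the other to the
front. A `Net` creates dual pairs `X ⊗ X*`, permutes all factors and annihilates dual pairs; by the
coherence theorem it depends only on the permutation (`Net.unique`), and nets can be composed and
tensored. Drawing all strands of a black-white diagram downwards turns it into a net
(`downward`, `diagMor`). The composite of the nets of two diagrams has more created and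
annihilated pairs than the net of the concatenation; `Net.close` removes them one at a time,
which is the same recursion as `closeUp` in the composition of diagrams, and each removed loop
gives the factor `dim X = t`. This proves functoriality (`diagMor_comp`), and `Struct.unique`
provides the coherence of the monoidal structure (`rowFunctor`).

*Transformations.* The component at `[0, 1]` of a monoidal transformation is the mate of the
component at `[1, 0]`, which is therefore invertible (`IsMate.isIso`), and determines the component
at every `[l, m]` (`natTrans_ext_of_std`). Conversely an isomorphism and its mate commute with
creation and annihilation, hence with all nets (`WordNat.of_net`). That this amounts to naturality
on the diagram category is due to `diagMor_rowIso`: in the diagram category itself the net of a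
diagram is this diagram. The identity is checked on matrices of diagrams, that is, by counting
colourings with two colours (`WMat`); these determine a diagram with its number of loops.

*The envelope.* The passage from the diagram category to the Karoubian envelope of its additive
completion uses that every object `P` of the envelope is a summand of a finite sum of objects of
the diagram category (`inclCover`), so that `𝟙 P` is a sum of endomorphisms that factor through
such objects. Hence transformations and monoidal structures extend uniquely (`extTrans`,
`extBraided`), and functors extend since `T` has biproducts and split idempotents
(`exists_extension`).
-/

noncomputable section

namespace DeligneGL

/-! ### Coherence for symmetric monoidal categories -/

/-- Bracketed words in the letters `K`, with units. -/
inductive Word (K : Type) : Type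
  | unit : Word K
  | of (k : K) : Word K
  | tensor (A B : Word K) : Word K

namespace Word

variable {K : Type}

/-- The positions of the letters of a word. -/
@[reducible] def pts : Word K → Type
  | unit => Empty
  | of _ => Unit
  | tensor A B => A.pts ⊕ B.pts

/-- The letter at a position. -/
def lbl : (A : Word K) → A.pts → K
  | of k, _ => k
  | tensor A _, Sum.inl p => A.lbl p
  | tensor _ B, Sum.inr p => B.lbl p

/-- The word in which the letter at a position is replaced by the unit. -/
def del : (A : Word K) → A.pts → Word K
  | of _, _ => unit
  | tensor A B, Sum.inl p => tensor (A.del p) B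
  | tensor A B, Sum.inr p => tensor A (B.del p)

/-- The number of letters. -/
def len : Word K → ℕ
  | unit => 0
  | of _ => 1
  | tensor A B => A.len + B.len

theorem len_del : (A : Word K) → (p : A.pts) → (A.del p).len + 1 = A.len
  | of _, _ => rfl
  | tensor A B, Sum.inl p => by
    have := len_del A p
    simp only [del, len]
    omega
  | tensor A B, Sum.inr p => by
    have := len_del B p
    simp only [del, len]
    omega

instance instFintypePts : (A : Word K) → Fintype A.pts
  | unit => inferInstanceAs (Fintype Empty)
  | of _ => inferInstanceAs (Fintype Unit)
  | tensor A B =>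
    have := instFintypePts A
    have := instFintypePts B
    inferInstanceAs (Fintype (A.pts ⊕ B.pts))

/-- The positions of a word are a given position and those of the word with that letter deleted.
The bijection is composed of the same steps as the isomorphism `Word.pull`. -/
def pullEquiv : (A : Word K) → (p : A.pts) → A.pts ≃ Unit ⊕ (A.del p).pts
  | of _, _ => (Equiv.sumEmpty Unit Empty).symm
  | tensor A B, Sum.inl p =>
    (Equiv.sumCongr (A.pullEquiv p) (Equiv.refl B.pts)).trans (Equiv.sumAssoc _ _ _)
  | tensor A B, Sum.inr p =>
    (Equiv.sumCongr (Equiv.refl A.pts) (B.pullEquiv p)).trans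
      ((Equiv.sumAssoc _ _ _).symm.trans
        ((Equiv.sumCongr (Equiv.sumComm _ _) (Equiv.refl _)).trans (Equiv.sumAssoc _ _ _)))

theorem pullEquiv_symm_inl : (A : Word K) → (p : A.pts) →
    (A.pullEquiv p).symm (Sum.inl ()) = p
  | of _, _ => rfl
  | tensor A _, Sum.inl p => congrArg Sum.inl (pullEquiv_symm_inl A p)
  | tensor _ B, Sum.inr p => congrArg Sum.inr (pullEquiv_symm_inl B p)

/-- The inclusion of the positions of the word with a letter deleted. -/
def emb (A : Word K) (p : A.pts) (x : (A.del p).pts) : A.pts :=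
  (A.pullEquiv p).symm (Sum.inr x)

theorem emb_injective (A : Word K) (p : A.pts) : Function.Injective (A.emb p) :=
  (A.pullEquiv p).symm.injective.comp Sum.inr_injective

theorem emb_ne (A : Word K) (p : A.pts) (x : (A.del p).pts) : A.emb p x ≠ p := fun h => by
  have h' := h.trans (A.pullEquiv_symm_inl p).symm
  simp [emb] at h'

theorem exists_emb (A : Word K) (p : A.pts) {q : A.pts} (h : q ≠ p) : ∃ x, A.emb p x = q := by
  obtain ⟨y, rfl⟩ := (A.pullEquiv p).symm.surjective q
  rcases y with ⟨⟩ | y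
  · exact absurd (A.pullEquiv_symm_inl p) h
  · exact ⟨y, rfl⟩

/-- The positions of the word with a letter deleted are the other positions. -/
def embEquiv (A : Word K) (p : A.pts) : (A.del p).pts ≃ {q : A.pts // q ≠ p} :=
  Equiv.ofBijective (fun x => ⟨A.emb p x, A.emb_ne p x⟩)
    ⟨fun _ _ h => A.emb_injective p (congrArg Subtype.val h), fun ⟨_, hq⟩ =>
      (A.exists_emb p hq).imp fun _ h => Subtype.ext h⟩

theorem lbl_emb : (A : Word K) → (p : A.pts) → (x : (A.del p).pts) →
    A.lbl (A.emb p x) = (A.del p).lbl x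
  | of _, _, x => x.elim
  | tensor A _, Sum.inl p, Sum.inl x => lbl_emb A p x
  | tensor _ _, Sum.inl _, Sum.inr _ => rfl
  | tensor _ _, Sum.inr _, Sum.inl _ => rfl
  | tensor _ B, Sum.inr p, Sum.inr x => lbl_emb B p x

section Obj

variable {T : Type u} [Category.{v} T] [MonoidalCategory T]

/-- The tensor product of the objects attached to the letters. -/
@[reducible] def obj (c : K → T) : Word K → T
  | unit => 𝟙_ T
  | of k => c k
  | tensor A B => obj c A ⊗ obj c B

/-- A word without letters gives the unit object. -/
def unitIso (c : K → T) : (A : Word K) → (A.pts → False) → (A.obj c ≅ 𝟙_ T)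
  | unit, _ => Iso.refl _
  | of _, h => (h ()).elim
  | tensor A B, h =>
    (unitIso c A (fun p => h (Sum.inl p)) ⊗ᵢ unitIso c B (fun p => h (Sum.inr p))) ≪≫ λ_ (𝟙_ T)

/-- Pull the letter at a given position to the front. -/
def pull [SymmetricCategory T] (c : K → T) :
    (A : Word K) → (p : A.pts) → (A.obj c ≅ c (A.lbl p) ⊗ (A.del p).obj c)
  | of _, _ => (ρ_ _).symm
  | tensor A B, Sum.inl p => whiskerRightIso (A.pull c p) (B.obj c) ≪≫ α_ _ _ _
  | tensor A B, Sum.inr p =>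
    whiskerLeftIso (A.obj c) (B.pull c p) ≪≫ (α_ _ _ _).symm ≪≫
      whiskerRightIso (β_ _ _) _ ≪≫ α_ _ _ _

end Obj

end Word

open Word

variable {K : Type} {T : Type u} [Category.{v} T] [MonoidalCategory T] [SymmetricCategory T]

/-- `Struct c f φ`: the morphism `φ` is composed of structural isomorphisms of the symmetric
monoidal category, which permute the tensor factors by `f`. -/
inductive Struct (c : K → T) : {A B : Word K} → (A.pts ≃ B.pts) → (A.obj c ⟶ B.obj c) → Prop
  | id (A : Word K) : Struct c (Equiv.refl A.pts) (𝟙 (A.obj c))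
  | comp {A B C : Word K} {f : A.pts ≃ B.pts} {g : B.pts ≃ C.pts} {φ : A.obj c ⟶ B.obj c}
      {ψ : B.obj c ⟶ C.obj c} : Struct c f φ → Struct c g ψ → Struct c (f.trans g) (φ ≫ ψ)
  | left (C : Word K) {A B : Word K} {f : A.pts ≃ B.pts} {φ : A.obj c ⟶ B.obj c} :
      Struct c f φ →
      Struct c (A := tensor C A) (B := tensor C B) (Equiv.sumCongr (Equiv.refl C.pts) f)
        (C.obj c ◁ φ)
  | right {A B : Word K} {f : A.pts ≃ B.pts} {φ : A.obj c ⟶ B.obj c} (C : Word K) :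
      Struct c f φ →
      Struct c (A := tensor A C) (B := tensor B C) (Equiv.sumCongr f (Equiv.refl C.pts))
        (φ ▷ C.obj c)
  | assoc (A B C : Word K) :
      Struct c (A := tensor (tensor A B) C) (B := tensor A (tensor B C)) (Equiv.sumAssoc _ _ _)
        (α_ (A.obj c) (B.obj c) (C.obj c)).hom
  | assoc_inv (A B C : Word K) :
      Struct c (A := tensor A (tensor B C)) (B := tensor (tensor A B) C)
        (Equiv.sumAssoc _ _ _).symm (α_ (A.obj c) (B.obj c) (C.obj c)).inv
  | leftU (A : Word K) :
      Struct c (A := tensor unit A) (B := A) (Equiv.emptySum Empty A.pts) (λ_ (A.obj c)).hom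
  | leftU_inv (A : Word K) :
      Struct c (A := A) (B := tensor unit A) (Equiv.emptySum Empty A.pts).symm (λ_ (A.obj c)).inv
  | rightU (A : Word K) :
      Struct c (A := tensor A unit) (B := A) (Equiv.sumEmpty A.pts Empty) (ρ_ (A.obj c)).hom
  | rightU_inv (A : Word K) :
      Struct c (A := A) (B := tensor A unit) (Equiv.sumEmpty A.pts Empty).symm (ρ_ (A.obj c)).inv
  | braid (A B : Word K) :
      Struct c (A := tensor A B) (B := tensor B A) (Equiv.sumComm _ _) (β_ (A.obj c) (B.obj c)).hom

namespace Struct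

variable {c : K → T}

theorem of_eq {A B : Word K} {f g : A.pts ≃ B.pts} {φ : A.obj c ⟶ B.obj c} (h : Struct c f φ)
    (hfg : ∀ x, f x = g x) : Struct c g φ := by
  rwa [← Equiv.ext hfg]

theorem tensor {A B A' B' : Word K} {f : A.pts ≃ B.pts} {φ : A.obj c ⟶ B.obj c}
    {f' : A'.pts ≃ B'.pts} {φ' : A'.obj c ⟶ B'.obj c} (h : Struct c f φ) (h' : Struct c f' φ') :
    Struct c (A := .tensor A A') (B := .tensor B B') (Equiv.sumCongr f f') (φ ⊗ₘ φ') := by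
  rw [MonoidalCategory.tensorHom_def]
  refine ((h.right A').comp (h'.left B)).of_eq ?_
  rintro (x | x) <;> rfl

/-- The inverse of a structural morphism is structural, with the inverse permutation. -/
theorem inv_comp {A B : Word K} {f : A.pts ≃ B.pts} {φ : A.obj c ⟶ B.obj c} (h : Struct c f φ) :
    ∃ ψ, Struct c f.symm ψ ∧ φ ≫ ψ = 𝟙 _ ∧ ψ ≫ φ = 𝟙 _ := by
  induction h with
  | id A => exact ⟨_, .id A, by simp, by simp⟩
  | comp _ _ ih ih' =>
    obtain ⟨ψ, h1, h2, h3⟩ := ih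
    obtain ⟨ψ', h1', h2', h3'⟩ := ih'
    exact ⟨_, h1'.comp h1, by simp [reassoc_of% h2', h2], by simp [reassoc_of% h3, h3']⟩
  | left C _ ih =>
    obtain ⟨ψ, h1, h2, h3⟩ := ih
    exact ⟨_, h1.left C, by simp [← MonoidalCategory.whiskerLeft_comp, h2],
      by simp [← MonoidalCategory.whiskerLeft_comp, h3]⟩
  | right C _ ih =>
    obtain ⟨ψ, h1, h2, h3⟩ := ih
    exact ⟨_, h1.right C, by simp [← MonoidalCategory.comp_whiskerRight, h2],
      by simp [← MonoidalCategory.comp_whiskerRight, h3]⟩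
  | assoc A B C => exact ⟨_, .assoc_inv A B C, by simp, by simp⟩
  | assoc_inv A B C => exact ⟨_, .assoc A B C, by simp, by simp⟩
  | leftU A => exact ⟨_, .leftU_inv A, by simp, by simp⟩
  | leftU_inv A => exact ⟨_, .leftU A, by simp, by simp⟩
  | rightU A => exact ⟨_, .rightU_inv A, by simp, by simp⟩
  | rightU_inv A => exact ⟨_, .rightU A, by simp, by simp⟩
  | braid A B => exact ⟨_, .braid B A, by simp, by simp⟩

theorem eqToHom {k k' : K} (h : k = k') :
    Struct c (A := .of k) (B := .of k') (Equiv.refl Unit) (eqToHom (congrArg c h)) := by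
  subst h
  exact .id (.of k)

theorem pull : (A : Word K) → (p : A.pts) →
    Struct c (B := .tensor (.of (A.lbl p)) (A.del p)) (A.pullEquiv p) (A.pull c p).hom
  | .of _, _ => .rightU_inv _
  | .tensor A B, Sum.inl p => ((pull A p).right B).comp (.assoc (.of _) _ _)
  | .tensor A B, Sum.inr p =>
    ((pull B p).left A).comp ((Struct.assoc_inv A (.of _) _).comp
      (((Struct.braid A (.of _)).right _).comp (.assoc (.of _) A _)))

theorem pull_inv (A : Word K) (p : A.pts) :
    Struct c (A := .tensor (.of (A.lbl p)) (A.del p)) (A.pullEquiv p).symm (A.pull c p).inv := by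
  obtain ⟨ψ, h, h', -⟩ := (pull (c := c) A p).inv_comp
  rw [← Iso.eq_inv_comp, Category.comp_id] at h'
  exact h' ▸ h

theorem unit_assoc {X Y Z : T} (a : X ⟶ 𝟙_ T) (b : Y ⟶ 𝟙_ T) (d : Z ⟶ 𝟙_ T) :
    (α_ X Y Z).hom ≫ (a ⊗ₘ ((b ⊗ₘ d) ≫ (λ_ (𝟙_ T)).hom)) ≫ (λ_ (𝟙_ T)).hom =
      (((a ⊗ₘ b) ≫ (λ_ (𝟙_ T)).hom) ⊗ₘ d) ≫ (λ_ (𝟙_ T)).hom := by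
  have h1 : (a ⊗ₘ ((b ⊗ₘ d) ≫ (λ_ (𝟙_ T)).hom)) = (a ⊗ₘ (b ⊗ₘ d)) ≫ (_ ◁ (λ_ (𝟙_ T)).hom) := by
    simp [MonoidalCategory.tensorHom_def]
  have h2 : (((a ⊗ₘ b) ≫ (λ_ (𝟙_ T)).hom) ⊗ₘ d) = ((a ⊗ₘ b) ⊗ₘ d) ≫ ((λ_ (𝟙_ T)).hom ▷ _) := by
    rw [← MonoidalCategory.tensorHom_id, MonoidalCategory.tensorHom_comp_tensorHom,
      Category.comp_id]
  rw [h1, h2, Category.assoc, Category.assoc, ← MonoidalCategory.associator_naturality_assoc]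
  congr 1
  monoidal

/-- A structural morphism between words without letters is the canonical one. -/
theorem comp_unitIso {A B : Word K} {f : A.pts ≃ B.pts} {φ : A.obj c ⟶ B.obj c}
    (h : Struct c f φ) (hA : A.pts → False) (hB : B.pts → False) :
    φ ≫ (B.unitIso c hB).hom = (A.unitIso c hA).hom := by
  induction h with
  | id A => simp
  | @comp A B C f g φ ψ _ _ ih ih' =>
    rw [Category.assoc, ih' (fun x => hA (f.symm x)) hB, ih]
  | left C _ ih =>
    have := ih (fun x => hA (Sum.inr x)) (fun x => hB (Sum.inr x))
    simp only [unitIso, ← this, Iso.trans_hom, MonoidalCategory.tensorIso_hom]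
    rw [← MonoidalCategory.id_tensorHom, MonoidalCategory.tensorHom_comp_tensorHom_assoc,
      Category.id_comp]
  | right C _ ih =>
    have := ih (fun x => hA (Sum.inl x)) (fun x => hB (Sum.inl x))
    simp only [unitIso, ← this, Iso.trans_hom, MonoidalCategory.tensorIso_hom]
    rw [← MonoidalCategory.tensorHom_id, MonoidalCategory.tensorHom_comp_tensorHom_assoc,
      Category.id_comp]
  | assoc A B C => exact unit_assoc _ _ _
  | assoc_inv A B C =>
    rw [Iso.inv_comp_eq]
    exact (unit_assoc _ _ _).symm
  | leftU A => simp [unitIso, MonoidalCategory.tensorHom_def]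
  | leftU_inv A => simp [unitIso, MonoidalCategory.tensorHom_def]
  | rightU A => simp [unitIso, MonoidalCategory.tensorHom_def, MonoidalCategory.unitors_equal]
  | rightU_inv A => simp [unitIso, MonoidalCategory.tensorHom_def, MonoidalCategory.unitors_equal]
  | braid A B =>
    simp only [unitIso, Iso.trans_hom, MonoidalCategory.tensorIso_hom]
    rw [← BraidedCategory.braiding_naturality_assoc, braiding_leftUnitor,
      MonoidalCategory.unitors_equal]

/-- Pull a factor out of the left factor of a tensor product. -/
abbrev pullL {X X' k : T} (a : X ⟶ k ⊗ X') (Y : T) : X ⊗ Y ⟶ k ⊗ (X' ⊗ Y) :=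
  a ▷ Y ≫ (α_ _ _ _).hom

/-- Pull a factor out of the right factor of a tensor product. -/
abbrev pullR (X : T) {Y Y' k : T} (b : Y ⟶ k ⊗ Y') : X ⊗ Y ⟶ k ⊗ (X ⊗ Y') :=
  X ◁ b ≫ (α_ _ _ _).inv ≫ (β_ _ _).hom ▷ _ ≫ (α_ _ _ _).hom

theorem left_pullL {X Y Z Z' k : T} (φ : X ⟶ Y) (a : Z ⟶ k ⊗ Z') :
    Z ◁ φ ≫ pullL a Y = pullL a X ≫ (𝟙 k ⊗ₘ (Z' ◁ φ)) := by
  simp [MonoidalCategory.whisker_exchange_assoc]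

theorem left_pullR {X X' Y Y' k k' : T} (Z : T) {φ : X ⟶ Y} {b : X ⟶ k ⊗ X'} {b' : Y ⟶ k' ⊗ Y'}
    {e : k ⟶ k'} {ψ : X' ⟶ Y'} (h : φ ≫ b' = b ≫ (e ⊗ₘ ψ)) :
    Z ◁ φ ≫ pullR Z b' = pullR Z b ≫ (e ⊗ₘ (Z ◁ ψ)) := by
  have h1 : Z ◁ φ ≫ Z ◁ b' = Z ◁ b ≫ Z ◁ (e ⊗ₘ ψ) := by
    rw [← MonoidalCategory.whiskerLeft_comp, h, MonoidalCategory.whiskerLeft_comp]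
  simp only [pullR, reassoc_of% h1, Category.assoc]
  have h2 : Z ◁ (e ⊗ₘ ψ) ≫ (α_ Z k' Y').inv ≫ (β_ Z k').hom ▷ Y' =
      (α_ Z k X').inv ≫ (β_ Z k).hom ▷ X' ≫ ((e ⊗ₘ 𝟙 Z) ⊗ₘ ψ) := by
    rw [← MonoidalCategory.id_tensorHom, MonoidalCategory.associator_inv_naturality_assoc,
      ← MonoidalCategory.tensorHom_id, ← MonoidalCategory.tensorHom_id,
      MonoidalCategory.tensorHom_comp_tensorHom, MonoidalCategory.tensorHom_comp_tensorHom,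
      BraidedCategory.braiding_naturality, Category.comp_id, Category.id_comp]
  rw [reassoc_of% h2, MonoidalCategory.associator_naturality, MonoidalCategory.id_tensorHom]

theorem right_pullL {X X' Y Y' k k' : T} (Z : T) {φ : X ⟶ Y} {b : X ⟶ k ⊗ X'} {b' : Y ⟶ k' ⊗ Y'}
    {e : k ⟶ k'} {ψ : X' ⟶ Y'} (h : φ ≫ b' = b ≫ (e ⊗ₘ ψ)) :
    φ ▷ Z ≫ pullL b' Z = pullL b Z ≫ (e ⊗ₘ (ψ ▷ Z)) := by
  have h1 : φ ▷ Z ≫ b' ▷ Z = b ▷ Z ≫ (e ⊗ₘ ψ) ▷ Z := by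
    rw [← MonoidalCategory.comp_whiskerRight, h, MonoidalCategory.comp_whiskerRight]
  simp only [pullL, reassoc_of% h1, Category.assoc]
  rw [← MonoidalCategory.tensorHom_id, ← MonoidalCategory.tensorHom_id,
    MonoidalCategory.associator_naturality, MonoidalCategory.tensorHom_id,
    MonoidalCategory.tensorHom_id]

theorem right_pullR {X Y Z Z' k : T} (φ : X ⟶ Y) (a : Z ⟶ k ⊗ Z') :
    φ ▷ Z ≫ pullR Y a = pullR X a ≫ (𝟙 k ⊗ₘ (φ ▷ Z')) := by
  simp only [pullR]
  have h : φ ▷ k ▷ Z' ≫ (β_ Y k).hom ▷ Z' = (β_ X k).hom ▷ Z' ≫ (k ◁ φ) ▷ Z' := by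
    rw [← MonoidalCategory.comp_whiskerRight, ← MonoidalCategory.comp_whiskerRight,
      BraidedCategory.braiding_naturality_left]
  rw [← MonoidalCategory.whisker_exchange_assoc]
  simp [reassoc_of% h]

theorem assoc_pull₁ {X X' k : T} (a : X ⟶ k ⊗ X') (Y Z : T) :
    (α_ X Y Z).hom ≫ pullL a (Y ⊗ Z) = pullL (pullL a Y) Z ≫ (𝟙 k ⊗ₘ (α_ X' Y Z).hom) := by
  simp

theorem assoc_pull₂ (X : T) {Y Y' k : T} (a : Y ⟶ k ⊗ Y') (Z : T) :
    (α_ X Y Z).hom ≫ pullR X (pullL a Z) =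
      pullL (pullR X a) Z ≫ (𝟙 k ⊗ₘ (α_ X Y' Z).hom) := by
  simp only [pullR, pullL, MonoidalCategory.whiskerLeft_comp, MonoidalCategory.comp_whiskerRight,
    Category.assoc, MonoidalCategory.id_tensorHom]
  rw [← MonoidalCategory.associator_naturality_middle_assoc]
  monoidal

theorem assoc_pull₃ (X Y : T) {Z Z' k : T} (a : Z ⟶ k ⊗ Z') :
    (α_ X Y Z).hom ≫ pullR X (pullR Y a) =
      pullR (X ⊗ Y) a ≫ (𝟙 k ⊗ₘ (α_ X Y Z').hom) := by
  simp only [pullR, MonoidalCategory.whiskerLeft_comp,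
    Category.assoc, MonoidalCategory.id_tensorHom, BraidedCategory.braiding_tensor_left_hom]
  monoidal

theorem leftU_pull {Y Y' k : T} (a : Y ⟶ k ⊗ Y') :
    (λ_ Y).hom ≫ a = pullR (𝟙_ T) a ≫ (𝟙 k ⊗ₘ (λ_ Y').hom) := by
  simp only [pullR, Category.assoc, MonoidalCategory.id_tensorHom,
    braiding_tensorUnit_left]
  monoidal

theorem rightU_pull {X X' k : T} (a : X ⟶ k ⊗ X') :
    (ρ_ X).hom ≫ a = pullL a (𝟙_ T) ≫ (𝟙 k ⊗ₘ (ρ_ X').hom) := by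
  simp

theorem braid_pull₁ {X X' k : T} (a : X ⟶ k ⊗ X') (Y : T) :
    (β_ X Y).hom ≫ pullR Y a = pullL a Y ≫ (𝟙 k ⊗ₘ (β_ X' Y).hom) := by
  simp only [pullR, pullL, Category.assoc, MonoidalCategory.id_tensorHom]
  rw [← BraidedCategory.braiding_naturality_left_assoc, BraidedCategory.braiding_tensor_left_hom]
  simp only [Category.assoc, Iso.hom_inv_id_assoc]
  rw [← MonoidalCategory.comp_whiskerRight_assoc, SymmetricCategory.symmetry]
  simp

theorem braid_pull₂ (X : T) {Y Y' k : T} (a : Y ⟶ k ⊗ Y') :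
    (β_ X Y).hom ≫ pullL a X = pullR X a ≫ (𝟙 k ⊗ₘ (β_ X Y').hom) := by
  simp only [pullR, pullL, Category.assoc, MonoidalCategory.id_tensorHom]
  rw [← BraidedCategory.braiding_naturality_right_assoc, BraidedCategory.braiding_tensor_right_hom]
  simp

/-- Turn a statement about an isomorphism into one about its inverse. -/
theorem inv_pull {X Y X' Y' k : T} (i : X ≅ Y) (i' : X' ≅ Y') {a : X ⟶ k ⊗ X'} {b : Y ⟶ k ⊗ Y'}
    (h : i.hom ≫ b = a ≫ (𝟙 k ⊗ₘ i'.hom)) : i.inv ≫ a = b ≫ (𝟙 k ⊗ₘ i'.inv) := by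
  rw [Iso.inv_comp_eq, reassoc_of% h, MonoidalCategory.tensorHom_comp_tensorHom]
  simp

/-- The effect of a structural morphism on a letter pulled to the front. -/
theorem pull_comp {A B : Word K} {f : A.pts ≃ B.pts} {φ : A.obj c ⟶ B.obj c}
    (h : Struct c f φ) (p : A.pts) :
    ∃ (hl : A.lbl p = B.lbl (f p)) (f' : (A.del p).pts ≃ (B.del (f p)).pts)
      (ψ : (A.del p).obj c ⟶ (B.del (f p)).obj c), Struct c f' ψ ∧
      (∀ x, f (A.emb p x) = B.emb (f p) (f' x)) ∧
      φ ≫ (B.pull c (f p)).hom =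
        (A.pull c p).hom ≫ (CategoryTheory.eqToHom (congrArg c hl) ⊗ₘ ψ) := by
  induction h with
  | id A => exact ⟨rfl, _, _, .id _, fun _ => rfl, (Category.id_comp _).trans (by
      refine Eq.trans ?_ (congrArg _ (MonoidalCategory.id_tensorHom_id _ _).symm)
      exact (Category.comp_id _).symm)⟩
  | @comp A B C f g φ ψ _ _ ih ih' =>
    obtain ⟨hl, f₁, ψ₁, h1, h2, h3⟩ := ih p
    obtain ⟨hl', f₂, ψ₂, h1', h2', h3'⟩ := ih' (f p)
    refine ⟨hl.trans hl', _, _, h1.comp h1', fun x => ?_, ?_⟩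
    · exact (congrArg g (h2 x)).trans (h2' _)
    · change (φ ≫ ψ) ≫ (C.pull c (g (f p))).hom = _
      rw [Category.assoc, h3', reassoc_of% h3, MonoidalCategory.tensorHom_comp_tensorHom,
        eqToHom_trans]
      rfl
  | @left C A B f φ h ih =>
    rcases p with p | p
    · refine ⟨rfl, _, _, h.left (C.del p), ?_, left_pullL φ (C.pull c p).hom⟩
      rintro (x | x) <;> rfl
    · obtain ⟨hl, f₁, ψ₁, h1, h2, h3⟩ := ih p
      refine ⟨hl, _, _, h1.left C, ?_, left_pullR _ h3⟩
      rintro (x | x)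
      · rfl
      · exact congrArg Sum.inr (h2 x)
  | @right A B f φ C h ih =>
    rcases p with p | p
    · obtain ⟨hl, f₁, ψ₁, h1, h2, h3⟩ := ih p
      refine ⟨hl, _, _, h1.right C, ?_, right_pullL _ h3⟩
      rintro (x | x)
      · exact congrArg Sum.inl (h2 x)
      · rfl
    · refine ⟨rfl, _, _, h.right (C.del p), ?_, right_pullR φ (C.pull c p).hom⟩
      rintro (x | x) <;> rfl
  | assoc A B C =>
    rcases p with (p | p) | p
    · refine ⟨rfl, _, _, .assoc (A.del p) B C, ?_, assoc_pull₁ _ _ _⟩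
      rintro ((x | x) | x) <;> rfl
    · refine ⟨rfl, _, _, .assoc A (B.del p) C, ?_, assoc_pull₂ _ _ _⟩
      rintro ((x | x) | x) <;> rfl
    · refine ⟨rfl, _, _, .assoc A B (C.del p), ?_, assoc_pull₃ _ _ _⟩
      rintro ((x | x) | x) <;> rfl
  | assoc_inv A B C =>
    rcases p with p | p | p
    · refine ⟨rfl, _, _, .assoc_inv (A.del p) B C, ?_, inv_pull _ (α_ _ _ _) (assoc_pull₁ _ _ _)⟩
      rintro (x | x | x) <;> rfl
    · refine ⟨rfl, _, _, .assoc_inv A (B.del p) C, ?_, inv_pull _ (α_ _ _ _) (assoc_pull₂ _ _ _)⟩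
      rintro (x | x | x) <;> rfl
    · refine ⟨rfl, _, _, .assoc_inv A B (C.del p), ?_, inv_pull _ (α_ _ _ _) (assoc_pull₃ _ _ _)⟩
      rintro (x | x | x) <;> rfl
  | leftU A =>
    rcases p with p | p
    · exact p.elim
    · refine ⟨rfl, _, _, .leftU (A.del p), ?_, leftU_pull _⟩
      rintro (x | x)
      · exact x.elim
      · rfl
  | leftU_inv A =>
    exact ⟨rfl, _, _, .leftU_inv (A.del p), fun _ => rfl, inv_pull _ (λ_ _) (leftU_pull _)⟩
  | rightU A =>
    rcases p with p | p
    · refine ⟨rfl, _, _, .rightU (A.del p), ?_, rightU_pull _⟩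
      rintro (x | x)
      · rfl
      · exact x.elim
    · exact p.elim
  | rightU_inv A =>
    exact ⟨rfl, _, _, .rightU_inv (A.del p), fun _ => rfl, inv_pull _ (ρ_ _) (rightU_pull _)⟩
  | braid A B =>
    rcases p with p | p
    · refine ⟨rfl, _, _, .braid (A.del p) B, ?_, braid_pull₁ _ _⟩
      rintro (x | x) <;> rfl
    · refine ⟨rfl, _, _, .braid A (B.del p), ?_, braid_pull₂ _ _⟩
      rintro (x | x) <;> rfl

theorem lbl_eq {A B : Word K} {f : A.pts ≃ B.pts} {φ : A.obj c ⟶ B.obj c}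
    (h : Struct c f φ) (p : A.pts) : B.lbl (f p) = A.lbl p :=
  (h.pull_comp p).1.symm

theorem isEmpty_pts_of_len_eq_zero : (A : Word K) → A.len = 0 → A.pts → False
  | .unit, _, p => p.elim
  | .of _, h, _ => by simp [len] at h
  | .tensor A B, h, p => by
    simp only [len, Nat.add_eq_zero_iff] at h
    exact p.elim (isEmpty_pts_of_len_eq_zero A h.1) (isEmpty_pts_of_len_eq_zero B h.2)

theorem exists_pt_of_len_ne_zero (A : Word K) (h : A.len ≠ 0) : Nonempty A.pts := by
  induction A with
  | unit => exact absurd rfl h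
  | of k => exact ⟨()⟩
  | tensor A B ihA ihB =>
    by_cases hA : A.len = 0
    · obtain ⟨p⟩ := ihB (fun hB => h (by simp [len, hA, hB]))
      exact ⟨Sum.inr p⟩
    · obtain ⟨p⟩ := ihA hA
      exact ⟨Sum.inl p⟩

/-- Coherence: a structural morphism is determined by the permutation of the factors. -/
theorem unique {A B : Word K} {f : A.pts ≃ B.pts} {φ φ' : A.obj c ⟶ B.obj c}
    (h : Struct c f φ) (h' : Struct c f φ') : φ = φ' := by
  -- Induction on the number of letters: both morphisms, composed with pulling a letter to the
  -- front, are pulling a letter to the front followed by a structural morphism on the rest.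
  obtain ⟨n, hn⟩ : ∃ n, A.len = n := ⟨_, rfl⟩
  induction n generalizing A B with
  | zero =>
    have hA := isEmpty_pts_of_len_eq_zero A hn
    have hB : B.pts → False := fun p => hA (f.symm p)
    rw [← cancel_mono (B.unitIso c hB).hom, h.comp_unitIso hA hB, h'.comp_unitIso hA hB]
  | succ n ih =>
    obtain ⟨p⟩ := exists_pt_of_len_ne_zero A (by omega)
    obtain ⟨hl, f₁, ψ, h1, h2, h3⟩ := h.pull_comp p
    obtain ⟨_, f₂, ψ', h1', h2', h3'⟩ := h'.pull_comp p
    have hf : f₁ = f₂ := Equiv.ext fun x => B.emb_injective (f p) ((h2 x).symm.trans (h2' x))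
    subst hf
    have hn' := A.len_del p
    rw [← cancel_mono (B.pull c (f p)).hom, h3, h3', ih h1 h1' (by omega)]

theorem exists_unitIso : (A : Word K) → (h : A.pts → False) →
    ∃ g : A.pts ≃ Empty, Struct c (B := unit) g (A.unitIso c h).hom
  | .unit, _ => ⟨_, .id unit⟩
  | .of _, h => (h ()).elim
  | .tensor A B, h => by
    obtain ⟨_, hA⟩ := exists_unitIso A fun p => h (Sum.inl p)
    obtain ⟨_, hB⟩ := exists_unitIso B fun p => h (Sum.inr p)
    exact ⟨_, (hA.tensor hB).comp (.leftU unit)⟩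

/-- Every letter-preserving bijection of positions is realized by a structural morphism. -/
theorem exists_of_lbl_eq {A B : Word K} (f : A.pts ≃ B.pts) (hf : ∀ p, B.lbl (f p) = A.lbl p) :
    ∃ φ, Struct c f φ := by
  obtain ⟨n, hn⟩ : ∃ n, A.len = n := ⟨_, rfl⟩
  induction n generalizing A B with
  | zero =>
    have hA := isEmpty_pts_of_len_eq_zero A hn
    obtain ⟨g, hg⟩ := exists_unitIso (c := c) A hA
    obtain ⟨g', hg'⟩ := exists_unitIso (c := c) B fun p => hA (f.symm p)
    obtain ⟨ψ, hψ, -⟩ := hg'.inv_comp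
    exact ⟨_, (hg.comp hψ).of_eq fun x => (hA x).elim⟩
  | succ n ih =>
    obtain ⟨p⟩ := exists_pt_of_len_ne_zero A (by omega)
    -- Pull `p` and `f p` to the front; the remaining letters are permuted by `g`.
    let g : (A.del p).pts ≃ (B.del (f p)).pts :=
      (A.embEquiv p).trans ((f.subtypeEquiv fun q => by simp).trans (B.embEquiv (f p)).symm)
    have hg : ∀ x, f (A.emb p x) = B.emb (f p) (g x) := fun x =>
      (congrArg Subtype.val ((B.embEquiv (f p)).apply_symm_apply
        ((f.subtypeEquiv fun q => by simp) (A.embEquiv p x)))).symm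
    obtain ⟨ψ, hψ⟩ := ih g (fun x => by
      rw [← lbl_emb, ← hg, hf, lbl_emb]) (by have := A.len_del p; omega)
    refine ⟨_, ((Struct.pull A p).comp (((Struct.eqToHom (hf p).symm).tensor hψ).comp
      (Struct.pull_inv B (f p)))).of_eq fun x => ?_⟩
    obtain ⟨y, rfl⟩ := (A.pullEquiv p).symm.surjective x
    simp only [Equiv.trans_apply, Equiv.apply_symm_apply]
    rcases y with ⟨⟩ | y
    · rw [A.pullEquiv_symm_inl]
      exact B.pullEquiv_symm_inl (f p)
    · exact (hg y).symm

end Struct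

/-! ### Partial traces -/

section Frames

variable {T : Type u} [Category.{v} T] [MonoidalCategory T] [SymmetricCategory T]

/-- Create `P`, apply `ψ`, annihilate `P'`. -/
def frame {A B P P' : T} (p : 𝟙_ T ⟶ P) (p' : P' ⟶ 𝟙_ T) (ψ : A ⊗ P ⟶ B ⊗ P') : A ⟶ B :=
  (ρ_ A).inv ≫ A ◁ p ≫ ψ ≫ B ◁ p' ≫ (ρ_ B).hom

theorem comp_frame {A A' B P P' : T} (p : 𝟙_ T ⟶ P) (p' : P' ⟶ 𝟙_ T) (a : A' ⟶ A)
    (ψ : A ⊗ P ⟶ B ⊗ P') : a ≫ frame p p' ψ = frame p p' (a ▷ P ≫ ψ) := by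
  simp only [frame, Category.assoc]
  rw [MonoidalCategory.whisker_exchange_assoc]
  simp

theorem frame_comp {A B B' P P' : T} (p : 𝟙_ T ⟶ P) (p' : P' ⟶ 𝟙_ T) (ψ : A ⊗ P ⟶ B ⊗ P')
    (b : B ⟶ B') : frame p p' ψ ≫ b = frame p p' (ψ ≫ b ▷ P') := by
  simp only [frame, Category.assoc]
  rw [← MonoidalCategory.whisker_exchange_assoc]
  simp

theorem frame_left {A B P P' : T} (p : 𝟙_ T ⟶ P) (p' : P' ⟶ 𝟙_ T) (Z : T)
    (ψ : A ⊗ P ⟶ B ⊗ P') :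
    Z ◁ frame p p' ψ = frame p p' ((α_ Z A P).hom ≫ Z ◁ ψ ≫ (α_ Z B P').inv) := by
  simp [frame]

/-- Creating `Q ⊗ P` and exchanging the factors is creating `P` and then `Q`. -/
theorem create_create {A P Q : T} (p : 𝟙_ T ⟶ P) (q : 𝟙_ T ⟶ Q) :
    (ρ_ A).inv ≫ A ◁ ((λ_ (𝟙_ T)).inv ≫ (q ⊗ₘ p)) ≫ A ◁ (β_ Q P).hom ≫ (α_ A P Q).inv =
      (ρ_ A).inv ≫ A ◁ p ≫ (ρ_ _).inv ≫ (A ⊗ P) ◁ q := by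
  have h : (λ_ (𝟙_ T)).inv ≫ (q ⊗ₘ p) ≫ (β_ Q P).hom = p ≫ (ρ_ P).inv ≫ P ◁ q := by
    rw [BraidedCategory.braiding_naturality, MonoidalCategory.tensorHom_def,
      braiding_tensorUnit_left]
    simp
  rw [← MonoidalCategory.whiskerLeft_comp_assoc, Category.assoc, h]
  simp

/-- Exchanging the factors and annihilating `P ⊗ Q` is annihilating `P` and then `Q`. -/
theorem annihilate_annihilate {A P Q : T} (p : P ⟶ 𝟙_ T) (q : Q ⟶ 𝟙_ T) :
    (α_ A Q P).hom ≫ A ◁ (β_ Q P).hom ≫ A ◁ ((p ⊗ₘ q) ≫ (λ_ (𝟙_ T)).hom) ≫ (ρ_ A).hom =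
      (A ⊗ Q) ◁ p ≫ (ρ_ _).hom ≫ A ◁ q ≫ (ρ_ A).hom := by
  have h : (β_ Q P).hom ≫ (p ⊗ₘ q) ≫ (λ_ (𝟙_ T)).hom = Q ◁ p ≫ (ρ_ Q).hom ≫ q := by
    rw [← BraidedCategory.braiding_naturality_assoc, braiding_leftUnitor,
      MonoidalCategory.tensorHom_def']
    simp
  rw [← MonoidalCategory.whiskerLeft_comp_assoc, h]
  simp

/-- Creations commute with annihilations. -/
theorem annihilate_create {A P Q : T} (p : P ⟶ 𝟙_ T) (q : 𝟙_ T ⟶ Q) :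
    (ρ_ _).inv ≫ (A ⊗ P) ◁ q ≫ (α_ A P Q).hom ≫ A ◁ (β_ P Q).hom ≫ (α_ A Q P).inv ≫
      (A ⊗ Q) ◁ p ≫ (ρ_ _).hom = A ◁ p ≫ A ◁ q := by
  have h : (ρ_ P).inv ≫ P ◁ q ≫ (β_ P Q).hom ≫ Q ◁ p ≫ (ρ_ Q).hom = p ≫ q := by
    rw [BraidedCategory.braiding_naturality_right_assoc, ← MonoidalCategory.whisker_exchange_assoc,
      braiding_tensorUnit_right]
    simp [← MonoidalCategory.unitors_equal]
  rw [← MonoidalCategory.whiskerLeft_comp, ← h]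
  simp only [MonoidalCategory.whiskerLeft_comp]
  monoidal

/-- Two frames in a row form a single frame. -/
theorem frame_comp_frame {A B E P P' Q Q' : T} (p : 𝟙_ T ⟶ P) (p' : P' ⟶ 𝟙_ T)
    (q : 𝟙_ T ⟶ Q) (q' : Q' ⟶ 𝟙_ T) (ψ : A ⊗ P ⟶ B ⊗ P') (ψ' : B ⊗ Q ⟶ E ⊗ Q') :
    frame p p' ψ ≫ frame q q' ψ' =
      frame ((λ_ (𝟙_ T)).inv ≫ (q ⊗ₘ p)) ((p' ⊗ₘ q') ≫ (λ_ (𝟙_ T)).hom)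
        (A ◁ (β_ Q P).hom ≫ (α_ A P Q).inv ≫ ψ ▷ Q ≫ (α_ B P' Q).hom ≫ B ◁ (β_ P' Q).hom ≫
          (α_ B Q P').inv ≫ ψ' ▷ P' ≫ (α_ E Q' P').hom ≫ E ◁ (β_ Q' P').hom) := by
  symm
  unfold frame
  simp only [Category.assoc]
  rw [annihilate_annihilate]
  rw [reassoc_of% create_create (A := A) p q, MonoidalCategory.whisker_exchange_assoc,
    ← MonoidalCategory.rightUnitor_inv_naturality_assoc,
    ← MonoidalCategory.whisker_exchange_assoc, MonoidalCategory.rightUnitor_naturality_assoc,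
    reassoc_of% annihilate_create (A := B) p' q]
  simp

/-- A duality between `y` and `y'`, expressed with the braiding. -/
structure Pairing (y y' : T) where
  /-- the coevaluation -/
  coev : 𝟙_ T ⟶ y ⊗ y'
  /-- the evaluation -/
  ev : y ⊗ y' ⟶ 𝟙_ T
  yank : frame coev ev ((α_ y y y').inv ≫ (β_ y y).hom ▷ y' ≫ (α_ y y y').hom) = 𝟙 y

/-- The braided form of a duality. -/
def Pairing.ofExact (X Y : T) [ExactPairing X Y] : Pairing X Y where
  coev := η_ X Y
  ev := (β_ X Y).hom ≫ ε_ X Y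
  yank := by
    have h1 : X ◁ η_ X Y ≫ (α_ X X Y).inv ≫ (β_ X X).hom ▷ Y ≫ (α_ X X Y).hom ≫
        X ◁ (β_ X Y).hom = (β_ X (𝟙_ T)).hom ≫ η_ X Y ▷ X ≫ (α_ X Y X).hom := by
      rw [← BraidedCategory.braiding_naturality_right_assoc,
        BraidedCategory.braiding_tensor_right_hom]
      simp
    have h2 := ExactPairing.evaluation_coevaluation X Y
    simp only [frame, MonoidalCategory.whiskerLeft_comp, Category.assoc]
    rw [reassoc_of% h1, reassoc_of% h2]
    simp

/-- The partial trace over `y`. -/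
def Pairing.tr {y y' : T} (d : Pairing y y') {U V : T} (h : U ⊗ y ⟶ V ⊗ y) : U ⟶ V :=
  frame d.coev d.ev ((α_ U y y').inv ≫ h ▷ y' ≫ (α_ V y y').hom)

variable {y y' : T} (d : Pairing y y')

theorem Pairing.tr_comp_left {U U' V : T} (a : U' ⟶ U) (h : U ⊗ y ⟶ V ⊗ y) :
    d.tr (a ▷ y ≫ h) = a ≫ d.tr h := by
  rw [tr, tr, comp_frame]
  simp

theorem Pairing.tr_comp_right {U V V' : T} (h : U ⊗ y ⟶ V ⊗ y) (b : V ⟶ V') :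
    d.tr (h ≫ b ▷ y) = d.tr h ≫ b := by
  rw [tr, tr, frame_comp]
  simp

theorem Pairing.tr_id (U : T) :
    d.tr (𝟙 (U ⊗ y)) = (ρ_ U).inv ≫ U ◁ (d.coev ≫ d.ev) ≫ (ρ_ U).hom := by
  simp [tr, frame]

theorem Pairing.tr_swap (U : T) :
    d.tr ((α_ U y y).hom ≫ U ◁ (β_ y y).hom ≫ (α_ U y y).inv) = 𝟙 (U ⊗ y) := by
  rw [← MonoidalCategory.whiskerLeft_id, ← d.yank, frame_left, tr]
  congr 1
  simp

/-- Create a further dual pair and trace it out. -/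
theorem frame_frame {y y' : T} (d : Pairing y y') {A B P P' R : T} (p : 𝟙_ T ⟶ P)
    (p' : P' ⟶ 𝟙_ T) (tw : R ≅ y ⊗ y')
    (h : (A ⊗ P) ⊗ y ⟶ (B ⊗ P') ⊗ y) :
    frame ((λ_ (𝟙_ T)).inv ≫ (p ⊗ₘ (d.coev ≫ tw.inv))) ((p' ⊗ₘ (tw.hom ≫ d.ev)) ≫ (λ_ (𝟙_ T)).hom)
      ((α_ A P R).inv ≫ (A ⊗ P) ◁ tw.hom ≫ (α_ _ y y').inv ≫ h ▷ y' ≫ (α_ _ y y').hom ≫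
        (B ⊗ P') ◁ tw.inv ≫ (α_ B P' R).hom) = frame p p' (d.tr h) := by
  have h1 : (ρ_ A).inv ≫ A ◁ ((λ_ (𝟙_ T)).inv ≫ (p ⊗ₘ (d.coev ≫ tw.inv))) ≫ (α_ A P R).inv ≫
      (A ⊗ P) ◁ tw.hom = (ρ_ A).inv ≫ A ◁ p ≫ (ρ_ _).inv ≫ (A ⊗ P) ◁ d.coev := by
    simp [MonoidalCategory.tensorHom_def]
  have h2 : (B ⊗ P') ◁ tw.inv ≫ (α_ B P' R).hom ≫
      B ◁ ((p' ⊗ₘ (tw.hom ≫ d.ev)) ≫ (λ_ (𝟙_ T)).hom) ≫ (ρ_ B).hom =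
      (B ⊗ P') ◁ d.ev ≫ (ρ_ _).hom ≫ B ◁ p' ≫ (ρ_ B).hom := by
    simp [MonoidalCategory.tensorHom_def']
  simp only [frame, Pairing.tr, Category.assoc]
  rw [reassoc_of% h1, h2]

/-- The same duality, read from the other side. -/
def Pairing.swapOfExact (X Y : T) [ExactPairing X Y] : Pairing Y X where
  coev := η_ X Y ≫ (β_ X Y).hom
  ev := (β_ Y X).hom ≫ (β_ X Y).hom ≫ ε_ X Y
  yank := by
    let _ : ExactPairing Y X := BraidedCategory.exactPairing_swap X Y
    have h := (Pairing.ofExact Y X).yank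
    have h1 : η_ Y X = η_ X Y ≫ (β_ X Y).hom := by
      change η_ X Y ≫ (β_ Y X).inv = _
      congr 1
      rw [← cancel_mono (β_ Y X).hom]
      simp
    rw [← h1]
    exact h

end Frames

/-! ### Permutations, creations and annihilations -/

section Nets

variable {T : Type u} [Category.{v} T] [MonoidalCategory T] [SymmetricCategory T]

/-- Replace each letter of a word by the word `X ⊗ Y`, where `true` stands for `X` and `false`
for its dual `Y`. -/
@[reducible] def cups : Word Unit → Word Bool
  | .unit => .unit
  | .of _ => .tensor (.of true) (.of false)
  | .tensor s s' => .tensor (cups s) (cups s')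

/-- The positions of `cups s` are two for each letter of `s`. -/
def cupsEquiv : (s : Word Unit) → (cups s).pts ≃ s.pts × Bool
  | .unit => (Equiv.equivOfIsEmpty Empty (Empty × Bool))
  | .of _ =>
    { toFun := Sum.elim (fun _ => ((), true)) (fun _ => ((), false))
      invFun := fun p => if p.2 then Sum.inl () else Sum.inr ()
      left_inv := by rintro (_ | _) <;> rfl
      right_inv := by rintro ⟨_, _ | _⟩ <;> rfl }
  | .tensor s s' =>
    (Equiv.sumCongr (cupsEquiv s) (cupsEquiv s')).trans (Equiv.sumProdDistrib _ _ _).symm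

theorem lbl_cups : (s : Word Unit) → (x : (cups s).pts) → (cups s).lbl x = (cupsEquiv s x).2
  | .unit, x => x.elim
  | .of _, Sum.inl _ => rfl
  | .of _, Sum.inr _ => rfl
  | .tensor s _, Sum.inl x => lbl_cups s x
  | .tensor _ s', Sum.inr x => lbl_cups s' x

variable (c : Bool → T) [ExactPairing (c true) (c false)]

/-- The tensor product of coevaluations. -/
def coevS : (s : Word Unit) → (𝟙_ T ⟶ (cups s).obj c)
  | .unit => 𝟙 _
  | .of _ => η_ (c true) (c false)
  | .tensor s s' => (λ_ (𝟙_ T)).inv ≫ (coevS s ⊗ₘ coevS s')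

/-- The tensor product of (braided) evaluations. -/
def evS : (s : Word Unit) → ((cups s).obj c ⟶ 𝟙_ T)
  | .unit => 𝟙 _
  | .of _ => (β_ (c true) (c false)).hom ≫ ε_ (c true) (c false)
  | .tensor s s' => (evS s ⊗ₘ evS s') ≫ (λ_ (𝟙_ T)).hom

variable {c}

theorem coev_assoc {X Y Z : T} (a : 𝟙_ T ⟶ X) (b : 𝟙_ T ⟶ Y) (d : 𝟙_ T ⟶ Z) :
    ((λ_ (𝟙_ T)).inv ≫ (((λ_ (𝟙_ T)).inv ≫ (a ⊗ₘ b)) ⊗ₘ d)) ≫ (α_ X Y Z).hom =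
      (λ_ (𝟙_ T)).inv ≫ (a ⊗ₘ ((λ_ (𝟙_ T)).inv ≫ (b ⊗ₘ d))) := by
  have h1 : (a ⊗ₘ ((λ_ (𝟙_ T)).inv ≫ (b ⊗ₘ d))) = (_ ◁ (λ_ (𝟙_ T)).inv) ≫ (a ⊗ₘ (b ⊗ₘ d)) := by
    rw [← MonoidalCategory.id_tensorHom, MonoidalCategory.tensorHom_comp_tensorHom,
      Category.id_comp]
  have h2 : (((λ_ (𝟙_ T)).inv ≫ (a ⊗ₘ b)) ⊗ₘ d) = ((λ_ (𝟙_ T)).inv ▷ _) ≫ ((a ⊗ₘ b) ⊗ₘ d) := by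
    rw [← MonoidalCategory.tensorHom_id, MonoidalCategory.tensorHom_comp_tensorHom,
      Category.id_comp]
  rw [h1, h2, Category.assoc, Category.assoc, MonoidalCategory.associator_naturality,
    ← Category.assoc, ← Category.assoc, ← Category.assoc]
  congr 1
  monoidal

/-- Permuting the created pairs has no effect. -/
theorem exists_permute_cups {s s' : Word Unit} (e : s.pts ≃ s'.pts) :
    ∃ (f : (cups s).pts ≃ (cups s').pts) (ψ : (cups s).obj c ⟶ (cups s').obj c),
      Struct c f ψ ∧ (∀ x, cupsEquiv s' (f x) = Prod.map e id (cupsEquiv s x)) ∧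
      coevS c s ≫ ψ = coevS c s' ∧ ψ ≫ evS c s' = evS c s := by
  -- A decomposition of `e` into structural permutations, with any object in place of the pairs,
  -- shows how to permute the pairs.
  obtain ⟨θ, hθ⟩ := Struct.exists_of_lbl_eq (c := fun _ : Unit => 𝟙_ T) e (fun _ => rfl)
  induction hθ with
  | id A => exact ⟨_, _, .id _, fun x => rfl, by simp, by simp⟩
  | comp _ _ ih ih' =>
    obtain ⟨f, ψ, h1, h2, h3, h4⟩ := ih
    obtain ⟨f', ψ', h1', h2', h3', h4'⟩ := ih'
    refine ⟨_, _, h1.comp h1', fun x => ?_, ?_, ?_⟩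
    · exact (h2' _).trans (congrArg _ (h2 x))
    · rw [reassoc_of% h3, h3']
    · rw [Category.assoc, h4', h4]
  | left C _ ih =>
    obtain ⟨f, ψ, h1, h2, h3, h4⟩ := ih
    refine ⟨_, _, h1.left (cups C), ?_, ?_, ?_⟩
    · rintro (x | x)
      · rfl
      · have := h2 x
        simp only [cupsEquiv] at this ⊢
        simp [this]
    · simp only [coevS, Category.assoc]
      rw [← MonoidalCategory.id_tensorHom, MonoidalCategory.tensorHom_comp_tensorHom, h3,
        Category.comp_id]
    · simp only [evS]
      rw [← MonoidalCategory.id_tensorHom, MonoidalCategory.tensorHom_comp_tensorHom_assoc, h4,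
        Category.id_comp]
  | right C _ ih =>
    obtain ⟨f, ψ, h1, h2, h3, h4⟩ := ih
    refine ⟨_, _, h1.right (cups C), ?_, ?_, ?_⟩
    · rintro (x | x)
      · have := h2 x
        simp only [cupsEquiv] at this ⊢
        simp [this]
      · rfl
    · simp only [coevS, Category.assoc]
      rw [← MonoidalCategory.tensorHom_id, MonoidalCategory.tensorHom_comp_tensorHom, h3,
        Category.comp_id]
    · simp only [evS]
      rw [← MonoidalCategory.tensorHom_id, MonoidalCategory.tensorHom_comp_tensorHom_assoc, h4,
        Category.id_comp]
  | assoc A B C =>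
    refine ⟨_, _, .assoc _ _ _, ?_, ?_, ?_⟩
    · rintro ((x | x) | x) <;> rfl
    · exact coev_assoc _ _ _
    · exact Struct.unit_assoc _ _ _
  | assoc_inv A B C =>
    refine ⟨_, _, .assoc_inv _ _ _, ?_, ?_, ?_⟩
    · rintro (x | x | x) <;> rfl
    · rw [Iso.comp_inv_eq]
      exact (coev_assoc _ _ _).symm
    · rw [Iso.inv_comp_eq]
      exact (Struct.unit_assoc _ _ _).symm
  | leftU A =>
    refine ⟨_, _, .leftU _, ?_, ?_, ?_⟩
    · rintro (x | x)
      · exact x.elim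
      · rfl
    · simp [coevS]
    · simp [evS]
  | leftU_inv A =>
    refine ⟨_, _, .leftU_inv _, fun x => rfl, ?_, ?_⟩
    · simp [coevS]
    · simp [evS]
  | rightU A =>
    refine ⟨_, _, .rightU _, ?_, ?_, ?_⟩
    · rintro (x | x)
      · rfl
      · exact x.elim
    · simp [coevS, ← MonoidalCategory.unitors_equal]
    · simp [evS, MonoidalCategory.unitors_equal]
  | rightU_inv A =>
    refine ⟨_, _, .rightU_inv _, fun x => rfl, ?_, ?_⟩
    · simp [coevS, ← MonoidalCategory.unitors_equal]
    · simp [evS, MonoidalCategory.unitors_equal]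
  | braid A B =>
    refine ⟨_, _, .braid _ _, ?_, ?_, ?_⟩
    · rintro (x | x) <;> rfl
    · simp only [coevS, Category.assoc]
      rw [BraidedCategory.braiding_naturality, braiding_tensorUnit_left]
      simp [MonoidalCategory.unitors_equal]
    · simp only [evS]
      rw [← BraidedCategory.braiding_naturality_assoc, braiding_leftUnitor,
        MonoidalCategory.unitors_equal]

end Nets

section Nets

variable {T : Type u} [Category.{v} T] [MonoidalCategory T] [SymmetricCategory T]

/-- The positions of `cups s`, for a word `s` with letters numbered by `C`. -/
def dots {s : Word Unit} {C : Type} (e : s.pts ≃ C) : (cups s).pts ≃ C × Bool :=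
  (cupsEquiv s).trans (e.prodCongr (Equiv.refl Bool))

/-- `Net c f φ`: the morphism `φ` creates pairs of dual factors numbered by `C`, permutes all
factors by `f`, and annihilates pairs of dual factors numbered by `D`. -/
def Net (c : Bool → T) [ExactPairing (c true) (c false)] {A B : Word Bool} {C D : Type}
    (f : A.pts ⊕ C × Bool ≃ B.pts ⊕ D × Bool) (φ : A.obj c ⟶ B.obj c) : Prop :=
  ∃ (s s' : Word Unit) (e : s.pts ≃ C) (e' : s'.pts ≃ D)
    (g : (A.tensor (cups s)).pts ≃ (B.tensor (cups s')).pts)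
    (ψ : (A.tensor (cups s)).obj c ⟶ (B.tensor (cups s')).obj c), Struct c g ψ ∧
    (∀ x, Sum.map id (dots e') (g x) = f (Sum.map id (dots e) x)) ∧
    φ = frame (coevS c s) (evS c s') ψ

/-- Every finite type numbers the letters of a word. -/
theorem exists_word {C : Type} [Finite C] : ∃ s : Word Unit, Nonempty (s.pts ≃ C) := by
  obtain ⟨n, ⟨e⟩⟩ := Finite.exists_equiv_fin C
  have : ∀ n : ℕ, ∃ s : Word Unit, Nonempty (s.pts ≃ Fin n) := by
    intro n
    induction n with
    | zero => exact ⟨.unit, ⟨Equiv.equivOfIsEmpty Empty (Fin 0)⟩⟩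
    | succ n ih =>
      obtain ⟨s, ⟨e⟩⟩ := ih
      exact ⟨.tensor s (.of ()), ⟨(Equiv.sumCongr e (Equiv.ofUnique Unit (Fin 1))).trans
        finSumFinEquiv⟩⟩
  obtain ⟨s, ⟨e'⟩⟩ := this n
  exact ⟨s, ⟨e'.trans e.symm⟩⟩

variable {c : Bool → T} [ExactPairing (c true) (c false)]

namespace Net

variable {A B E : Word Bool} {C D C' D' : Type}

/-- The words in which the pairs are arranged can be chosen at will. -/
theorem choose_words {f : A.pts ⊕ C × Bool ≃ B.pts ⊕ D × Bool} {φ : A.obj c ⟶ B.obj c}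
    (h : Net c f φ) (s s' : Word Unit) (e : s.pts ≃ C) (e' : s'.pts ≃ D) :
    ∃ (g : (A.tensor (cups s)).pts ≃ (B.tensor (cups s')).pts)
    (ψ : (A.tensor (cups s)).obj c ⟶ (B.tensor (cups s')).obj c), Struct c g ψ ∧
    (∀ x, Sum.map id (dots e') (g x) = f (Sum.map id (dots e) x)) ∧
    φ = frame (coevS c s) (evS c s') ψ := by
  obtain ⟨s₁, s₁', e₁, e₁', g, ψ, h1, h2, rfl⟩ := h
  obtain ⟨a, α, ha, ha', hα, -⟩ := exists_permute_cups (c := c) (e.trans e₁.symm)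
  obtain ⟨b, β, hb, hb', -, hβ⟩ := exists_permute_cups (c := c) (e₁'.trans e'.symm)
  refine ⟨_, _, (ha.left A).comp (h1.comp (hb.left B)), fun x => ?_, ?_⟩
  · have hD : ∀ y, dots e' (b y) = dots e₁' y := fun y => by
      simp [dots, hb', Prod.map]
    have hC : ∀ y, dots e₁ (a y) = dots e y := fun y => by
      simp [dots, ha', Prod.map]
    have h3 : Sum.map id (dots e₁) (Sum.map id a x) = Sum.map id (dots e) x := by
      rcases x with x | x
      · rfl
      · exact congrArg Sum.inr (hC x)
    have h4 := h2 (Sum.map id a x)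
    rw [h3] at h4
    rw [← h4]
    change Sum.map id (dots e') (Sum.map id b (g (Sum.map id a x))) = _
    rcases g (Sum.map id a x) with y | y
    · rfl
    · exact congrArg Sum.inr (hD y)
  · simp only [frame, Category.assoc]
    rw [← MonoidalCategory.whiskerLeft_comp_assoc, hα, ← MonoidalCategory.whiskerLeft_comp_assoc,
      hβ]

/-- A net is determined by its diagram. -/
theorem unique [Finite C] [Finite D] {f : A.pts ⊕ C × Bool ≃ B.pts ⊕ D × Bool}
    {φ φ' : A.obj c ⟶ B.obj c}
    (h : Net c f φ) (h' : Net c f φ') : φ = φ' := by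
  obtain ⟨s, ⟨e⟩⟩ := exists_word (C := C)
  obtain ⟨s', ⟨e'⟩⟩ := exists_word (C := D)
  obtain ⟨g, ψ, h1, h2, rfl⟩ := h.choose_words s s' e e'
  obtain ⟨g', ψ', h1', h2', rfl⟩ := h'.choose_words s s' e e'
  have hg : g = g' := Equiv.ext fun x =>
    (Function.injective_id.sumMap (dots e').injective) ((h2 x).trans (h2' x).symm)
  subst hg
  rw [h1.unique h1']

theorem of_eq {f f' : A.pts ⊕ C × Bool ≃ B.pts ⊕ D × Bool}
    {φ : A.obj c ⟶ B.obj c} (h : Net c f φ) (hf : ∀ x, f x = f' x) : Net c f' φ := by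
  rwa [← Equiv.ext hf]

/-- Renumbering the pairs. -/
theorem reindex {f : A.pts ⊕ C × Bool ≃ B.pts ⊕ D × Bool} {φ : A.obj c ⟶ B.obj c}
    (h : Net c f φ) (a : C ≃ C') (b : D ≃ D') {f' : A.pts ⊕ C' × Bool ≃ B.pts ⊕ D' × Bool}
    (hf : ∀ x, f' (Sum.map id (Prod.map a id) x) = Sum.map id (Prod.map b id) (f x)) :
    Net c f' φ := by
  obtain ⟨s, s', e, e', g, ψ, h1, h2, rfl⟩ := h
  refine ⟨s, s', e.trans a, e'.trans b, g, ψ, h1, fun x => ?_, rfl⟩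
  have h3 : Sum.map id (dots (e.trans a)) x =
      Sum.map id (Prod.map a id) (Sum.map id (dots e) x) := by
    rcases x with x | x <;> rfl
  rw [h3, hf, ← h2]
  rcases g x with y | y <;> rfl

/-- Every bijection that respects the labels is the diagram of a net. -/
theorem exists_of_lbl_eq [Finite C] [Finite D] (f : A.pts ⊕ C × Bool ≃ B.pts ⊕ D × Bool)
    (hf : ∀ x, Sum.elim B.lbl Prod.snd (f x) = Sum.elim A.lbl Prod.snd x) :
    ∃ φ, Net c f φ := by
  obtain ⟨s, ⟨e⟩⟩ := exists_word (C := C)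
  obtain ⟨s', ⟨e'⟩⟩ := exists_word (C := D)
  have hl : ∀ (A : Word Bool) (C : Type) (s : Word Unit) (e : s.pts ≃ C)
      (x : (A.tensor (cups s)).pts), (A.tensor (cups s)).lbl x =
        Sum.elim A.lbl Prod.snd (Sum.map id (dots e) x) := by
    intro A C s e x
    rcases x with x | x
    · rfl
    · exact lbl_cups s x
  let g : (A.tensor (cups s)).pts ≃ (B.tensor (cups s')).pts :=
    (Equiv.sumCongr (Equiv.refl _) (dots e)).trans
      (f.trans (Equiv.sumCongr (Equiv.refl _) (dots e')).symm)
  have hg : ∀ x, Sum.map id (dots e') (g x) = f (Sum.map id (dots e) x) := fun x =>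
    (Equiv.sumCongr (Equiv.refl B.pts) (dots e')).apply_symm_apply _
  obtain ⟨ψ, hψ⟩ := Struct.exists_of_lbl_eq (c := c) g fun x => by
    rw [hl B D s' e', hg, hf, ← hl]
  exact ⟨_, s, s', e, e', g, ψ, hψ, hg, rfl⟩

end Net

/-- Split the numbered pairs into two groups. -/
def packL (P C C' : Type) : P ⊕ (C' ⊕ C) × Bool ≃ (P ⊕ C × Bool) ⊕ C' × Bool where
  toFun
    | Sum.inl a => Sum.inl (Sum.inl a)
    | Sum.inr (Sum.inl x, b) => Sum.inr (x, b)
    | Sum.inr (Sum.inr x, b) => Sum.inl (Sum.inr (x, b))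
  invFun
    | Sum.inl (Sum.inl a) => Sum.inl a
    | Sum.inl (Sum.inr (x, b)) => Sum.inr (Sum.inr x, b)
    | Sum.inr (x, b) => Sum.inr (Sum.inl x, b)
  left_inv := by rintro (_ | ⟨_ | _, _⟩) <;> rfl
  right_inv := by rintro ((_ | ⟨_, _⟩) | ⟨_, _⟩) <;> rfl

/-- The diagram of a composite. -/
def netComp {P Q R C D C' D' : Type} (f : P ⊕ C × Bool ≃ Q ⊕ D × Bool)
    (g : Q ⊕ C' × Bool ≃ R ⊕ D' × Bool) : P ⊕ (C' ⊕ C) × Bool ≃ R ⊕ (D ⊕ D') × Bool :=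
  (packL P C C').trans <| (Equiv.sumCongr f (Equiv.refl _)).trans <| (exch _ _ _).trans <|
    (Equiv.sumCongr g (Equiv.refl _)).trans (packL R D' D).symm

namespace Net

variable {A B E A' B' : Word Bool} {C D C' D' : Type}

theorem comp {f : A.pts ⊕ C × Bool ≃ B.pts ⊕ D × Bool} {g : B.pts ⊕ C' × Bool ≃ E.pts ⊕ D' × Bool}
    {φ : A.obj c ⟶ B.obj c} {ψ : B.obj c ⟶ E.obj c} (h : Net c f φ) (h' : Net c g ψ) :
    Net c (netComp f g) (φ ≫ ψ) := by
  obtain ⟨s, s', e, e', f₁, φ₁, h1, h2, rfl⟩ := h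
  obtain ⟨r, r', d, d', g₁, ψ₁, h1', h2', rfl⟩ := h'
  refine ⟨.tensor r s, .tensor s' r', Equiv.sumCongr d e, Equiv.sumCongr e' d', _, _,
    ((Struct.braid (cups r) (cups s)).left A).comp <| (Struct.assoc_inv A (cups s) (cups r)).comp <|
    (h1.right (cups r)).comp <| (Struct.assoc B (cups s') (cups r)).comp <|
    ((Struct.braid (cups s') (cups r)).left B).comp <|
    (Struct.assoc_inv B (cups r) (cups s')).comp <|
    (h1'.right (cups s')).comp <| (Struct.assoc E (cups r') (cups s')).comp <|
    (Struct.braid (cups r') (cups s')).left E, ?_, frame_comp_frame _ _ _ _ _ _⟩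
  -- the second half of the composite
  have key : ∀ z : (B.pts ⊕ (cups s').pts) ⊕ (cups r).pts,
      Sum.map id (dots (s := .tensor s' r') (Equiv.sumCongr e' d'))
        (Sum.map id Sum.swap (Equiv.sumAssoc E.pts (cups r').pts (cups s').pts
          (Sum.map g₁ id ((Equiv.sumAssoc B.pts (cups r).pts (cups s').pts).symm
            (Sum.map id Sum.swap (Equiv.sumAssoc B.pts (cups s').pts (cups r).pts z)))))) =
        (packL _ _ _).symm (Sum.map g id (exch _ _ _
          (Sum.map (Sum.map id (dots e')) (dots d) z))) := by
    have hl : ∀ w : E.pts ⊕ (cups r').pts,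
        Sum.map id (dots (s := .tensor s' r') (Equiv.sumCongr e' d'))
          (Sum.map id Sum.swap (Equiv.sumAssoc E.pts (cups r').pts (cups s').pts (Sum.inl w))) =
        (packL _ _ _).symm (Sum.inl (Sum.map id (dots d') w)) := by
      rintro (w | w) <;> rfl
    rintro ((z | z) | z)
    · exact (hl (g₁ (Sum.inl z))).trans (congrArg (fun y => (packL _ _ _).symm (Sum.inl y))
        (h2' (Sum.inl z)))
    · rfl
    · exact (hl (g₁ (Sum.inr z))).trans (congrArg (fun y => (packL _ _ _).symm (Sum.inl y))
        (h2' (Sum.inr z)))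
  rintro (x | x | x)
  · exact (key (Sum.inl (f₁ (Sum.inl x)))).trans (congrArg (fun y => (packL _ _ _).symm
      (Sum.map g id (exch _ _ _ (Sum.inl y)))) (h2 (Sum.inl x)))
  · exact key (Sum.inr x)
  · exact (key (Sum.inl (f₁ (Sum.inr x)))).trans (congrArg (fun y => (packL _ _ _).symm
      (Sum.map g id (exch _ _ _ (Sum.inl y)))) (h2 (Sum.inr x)))

theorem of_struct {f : A.pts ≃ B.pts} {φ : A.obj c ⟶ B.obj c} (h : Struct c f φ) :
    Net c (Equiv.sumCongr f (Equiv.refl (Empty × Bool))) φ := by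
  refine ⟨.unit, .unit, Equiv.refl Empty, Equiv.refl Empty, _, _, h.right .unit, ?_, ?_⟩
  · rintro (x | x)
    · rfl
    · exact x.elim
  · simp [frame, coevS, evS]

theorem struct_comp {f : A.pts ≃ B.pts} {φ : A.obj c ⟶ B.obj c}
    {g : B.pts ⊕ C × Bool ≃ E.pts ⊕ D × Bool} {ψ : B.obj c ⟶ E.obj c}
    (h : Struct c f φ) (h' : Net c g ψ) :
    Net c ((Equiv.sumCongr f (Equiv.refl _)).trans g) (φ ≫ ψ) := by
  obtain ⟨s, s', e, e', g₁, ψ₁, h1, h2, rfl⟩ := h'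
  refine ⟨s, s', e, e', _, _, (h.right (cups s)).comp h1, ?_, comp_frame _ _ _ _⟩
  rintro (x | x)
  · exact h2 (Sum.inl (f x))
  · exact h2 (Sum.inr x)

theorem comp_struct {f : A.pts ⊕ C × Bool ≃ B.pts ⊕ D × Bool} {φ : A.obj c ⟶ B.obj c}
    {g : B.pts ≃ E.pts} {ψ : B.obj c ⟶ E.obj c} (h : Net c f φ) (h' : Struct c g ψ) :
    Net c (f.trans (Equiv.sumCongr g (Equiv.refl _))) (φ ≫ ψ) := by
  obtain ⟨s, s', e, e', f₁, φ₁, h1, h2, rfl⟩ := h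
  refine ⟨s, s', e, e', _, _, h1.comp (h'.right (cups s')), fun x => ?_, frame_comp _ _ _ _⟩
  have := h2 x
  simp only [Equiv.trans_apply, ← this]
  rcases f₁ x with y | y <;> rfl

theorem left {f : A.pts ⊕ C × Bool ≃ B.pts ⊕ D × Bool} {φ : A.obj c ⟶ B.obj c} (E : Word Bool)
    (h : Net c f φ) :
    Net c (A := .tensor E A) (B := .tensor E B)
      ((Equiv.sumAssoc E.pts A.pts (C × Bool)).trans
        ((Equiv.sumCongr (Equiv.refl _) f).trans (Equiv.sumAssoc E.pts B.pts (D × Bool)).symm))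
      (E.obj c ◁ φ) := by
  obtain ⟨s, s', e, e', f₁, φ₁, h1, h2, rfl⟩ := h
  refine ⟨s, s', e, e', _, _, (Struct.assoc E A (cups s)).comp ((h1.left E).comp
    (.assoc_inv E B (cups s'))), ?_, frame_left _ _ _ _⟩
  have key : ∀ y : B.pts ⊕ (cups s').pts, Sum.map id (dots e')
      ((Equiv.sumAssoc E.pts B.pts (cups s').pts).symm (Sum.inr y)) =
      (Equiv.sumAssoc E.pts B.pts (D × Bool)).symm (Sum.inr (Sum.map id (dots e') y)) := by
    rintro (y | y) <;> rfl
  rintro ((x | x) | x)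
  · rfl
  · exact (key (f₁ (Sum.inl x))).trans (congrArg (fun y =>
      (Equiv.sumAssoc E.pts B.pts (D × Bool)).symm (Sum.inr y)) (h2 (Sum.inl x)))
  · exact (key (f₁ (Sum.inr x))).trans (congrArg (fun y =>
      (Equiv.sumAssoc E.pts B.pts (D × Bool)).symm (Sum.inr y)) (h2 (Sum.inr x)))

/-- The diagram of a tensor product. -/
theorem tensor {f : A.pts ⊕ C × Bool ≃ B.pts ⊕ D × Bool} {φ : A.obj c ⟶ B.obj c}
    {f' : A'.pts ⊕ C' × Bool ≃ B'.pts ⊕ D' × Bool} {φ' : A'.obj c ⟶ B'.obj c}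
    (h : Net c f φ) (h' : Net c f' φ') :
    Net c (A := .tensor A A') (B := .tensor B B') (C := C ⊕ C') (D := D ⊕ D')
      ((Equiv.sumCongr (Equiv.refl _) (Equiv.sumProdDistrib _ _ _)).trans <|
        (Equiv.sumSumSumComm _ _ _ _).trans <| (Equiv.sumCongr f f').trans <|
        (Equiv.sumSumSumComm _ _ _ _).trans <|
        Equiv.sumCongr (Equiv.refl _) (Equiv.sumProdDistrib _ _ _).symm) (φ ⊗ₘ φ') := by
  have h1 : φ ⊗ₘ φ' = ((β_ (A.obj c) (A'.obj c)).hom ≫ (A'.obj c ◁ φ)) ≫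
      (β_ (A'.obj c) (B.obj c)).hom ≫ (B.obj c ◁ φ') := by
    rw [Category.assoc, ← BraidedCategory.braiding_naturality_left_assoc,
      SymmetricCategory.symmetry_assoc, MonoidalCategory.tensorHom_def]
  rw [h1]
  refine ((Net.struct_comp (.braid A A') (h.left A')).comp
    (Net.struct_comp (.braid A' B) (h'.left B))).reindex (Equiv.sumComm _ _) (Equiv.refl _) ?_
  rintro ((x | x) | ⟨x | x, b⟩)
  · rcases hf : f (Sum.inl x) with y | y <;> simp [netComp, packL, exch, hf]
  · rcases hf : f' (Sum.inl x) with y | y <;> simp [netComp, packL, exch, hf]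
  · rcases hf : f' (Sum.inr (x, b)) with y | y <;> simp [netComp, packL, exch, hf]
  · rcases hf : f (Sum.inr (x, b)) with y | y <;> simp [netComp, packL, exch, hf]

end Net

/-! ### The trace of a permutation -/

section Trace

variable {K : Type} [Preadditive T] [Linear ℂ T] [MonoidalPreadditive T] [MonoidalLinear ℂ T]

open scoped Classical in
/-- The partial trace of a permutation of tensor factors over one factor: the strand through the
traced factor is shortened, or it is a loop and gives the factor `t`. -/
theorem exists_tr_struct {c : K → T} {A B : Word K} {k : K} {y' : T} (d : Pairing (c k) y') {t : ℂ}
    (hd : d.coev ≫ d.ev = t • 𝟙 (𝟙_ T)) {g : A.pts ⊕ Unit ≃ B.pts ⊕ Unit}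
    {h : A.obj c ⊗ c k ⟶ B.obj c ⊗ c k}
    (hs : Struct c (A := .tensor A (.of k)) (B := .tensor B (.of k)) g h) (r : A.pts ≃ B.pts)
    (h1 : ∀ x y, g (Sum.inl x) = Sum.inl y → r x = y)
    (h2 : ∀ x y, g (Sum.inl x) = Sum.inr () → g (Sum.inr ()) = Sum.inl y → r x = y) :
    ∃ ψ, Struct c r ψ ∧ (g (Sum.inr ()) = Sum.inr () → d.tr h = t • ψ) ∧
      (g (Sum.inr ()) ≠ Sum.inr () → d.tr h = ψ) := by
  have hl : ∀ x, B.lbl (r x) = A.lbl x := by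
    intro x
    have hx := hs.lbl_eq (Sum.inl x)
    rcases hgx : g (Sum.inl x) with y | ⟨⟩
    · rw [hgx] at hx
      rw [h1 x y hgx]
      exact hx
    · have hu := hs.lbl_eq (Sum.inr ())
      rcases hgu : g (Sum.inr ()) with y | ⟨⟩
      · rw [hgx] at hx
        rw [hgu] at hu
        rw [h2 x y hgx hgu]
        exact hu.trans hx
      · simpa using g.injective (hgx.trans hgu.symm)
  obtain ⟨ψ, hψ⟩ := Struct.exists_of_lbl_eq (c := c) r hl
  refine ⟨ψ, hψ, fun hg => ?_, fun hg => ?_⟩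
  -- The traced factor is fixed, so that `h` is `ψ` next to it, and a loop splits off.
  · have hh : h = ψ ▷ c k := by
      refine hs.unique ((hψ.right (.of k)).of_eq ?_)
      rintro (x | ⟨⟩)
      · rcases hgx : g (Sum.inl x) with y | ⟨⟩
        · exact congrArg Sum.inl (h1 x y hgx)
        · simpa using g.injective (hgx.trans hg.symm)
      · exact hg.symm
    rw [hh, ← Category.comp_id (ψ ▷ c k), d.tr_comp_left, d.tr_id, hd]
    simp
  -- Otherwise the traced strand enters at `x₀` and leaves at `y₀`. Up to `π`, which brings the
  -- factor `y₀` to the last place, `h` is `ψ` followed by the exchange of the last two factors,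
  -- and the trace of the exchange is the identity.
  · obtain ⟨y₀, hy₀⟩ : ∃ y, g (Sum.inr ()) = Sum.inl y := by
      rcases hgu : g (Sum.inr ()) with y | ⟨⟩
      · exact ⟨y, rfl⟩
      · exact absurd hgu hg
    obtain ⟨x₀, hx₀⟩ : ∃ x, g (Sum.inl x) = Sum.inr () := by
      obtain ⟨z, hz⟩ := g.surjective (Sum.inr ())
      rcases z with x | ⟨⟩
      · exact ⟨x, hz⟩
      · exact absurd hz hg
    have hk : B.lbl y₀ = k := by
      have hu := hs.lbl_eq (Sum.inr ())
      rw [hy₀] at hu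
      exact hu
    have hr := h2 x₀ y₀ hx₀ hy₀
    let p : B.pts ≃ (B.del y₀).pts ⊕ Unit := (B.pullEquiv y₀).trans (Equiv.sumComm _ _)
    have hp₀ : p.symm (Sum.inr ()) = y₀ := B.pullEquiv_symm_inl y₀
    obtain ⟨π, hπ⟩ : ∃ π, Struct c (A := B) (B := .tensor (B.del y₀) (.of k)) p π :=
      ⟨_, ((Struct.pull B y₀).comp ((Struct.braid (.of _) _).comp
        ((Struct.eqToHom hk).left (B.del y₀)))).of_eq fun x => by
          change Sum.map id id (p x) = p x
          simp⟩
    obtain ⟨π', hπ', hππ, -⟩ := hπ.inv_comp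
    have hh : h = (ψ ≫ π) ▷ c k ≫ ((α_ _ _ _).hom ≫ _ ◁ (β_ (c k) (c k)).hom ≫ (α_ _ _ _).inv) ≫
        π' ▷ c k := by
      refine hs.unique ((((hψ.comp hπ).right (.of k)).comp
        (((Struct.assoc _ (.of k) (.of k)).comp (((Struct.braid (.of k) (.of k)).left _).comp
          (.assoc_inv _ (.of k) (.of k)))).comp (hπ'.right (.of k)))).of_eq ?_)
      have key : ∀ w, (Equiv.sumCongr p.symm (Equiv.refl Unit)) ((Equiv.sumAssoc _ _ _).symm
          (Sum.map id Sum.swap (Equiv.sumAssoc (B.del y₀).pts Unit Unit (Sum.inl w)))) =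
          if w = Sum.inr () then Sum.inr () else Sum.inl (p.symm w) := by
        rintro (w | ⟨⟩)
        · simp
        · simp
      rintro (x | ⟨⟩)
      · refine (key (p (r x))).trans ?_
        rw [Equiv.symm_apply_apply]
        by_cases hx : x = x₀
        · rw [if_pos, hx, hx₀]
          rw [← Equiv.eq_symm_apply, hp₀, hx, hr]
        · rw [if_neg]
          · rcases hgx : g (Sum.inl x) with y | ⟨⟩
            · rw [h1 x y hgx]
            · exact absurd (Sum.inl_injective (g.injective (hgx.trans hx₀.symm))) hx
          · rw [← Equiv.eq_symm_apply, hp₀, ← hr]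
            exact fun H => hx (r.injective H)
      · rw [hy₀]
        exact congrArg Sum.inl hp₀
    rw [hh, d.tr_comp_left, d.tr_comp_right, d.tr_swap, Category.id_comp, Category.assoc, hππ,
      Category.comp_id]

/-- The two given dual objects, with the object of label `k` in the first place. -/
def pairK (c : Bool → T) [ExactPairing (c true) (c false)] : (k : Bool) → Pairing (c k) (c !k)
  | true => .ofExact (c true) (c false)
  | false => .swapOfExact (c true) (c false)

/-- The symmetry that brings the factor of label `k` to the first place. -/
def twist (c : Bool → T) : (k : Bool) → (c true ⊗ c false ≅ c k ⊗ c !k)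
  | true => Iso.refl _
  | false => β_ _ _

end Trace

end Nets

/-! ### Removing pairs and closing loops -/

section Loops

variable {T : Type u} [Category.{v} T] [MonoidalCategory T] [SymmetricCategory T]
  [Preadditive T] [Linear ℂ T] [MonoidalPreadditive T] [MonoidalLinear ℂ T]
variable {c : Bool → T} [ExactPairing (c true) (c false)]

/-- The value of a loop. -/
def loop (c : Bool → T) [ExactPairing (c true) (c false)] : 𝟙_ T ⟶ 𝟙_ T :=
  η_ (c true) (c false) ≫ (β_ (c true) (c false)).hom ≫ ε_ (c true) (c false)

theorem pairK_loop : (k : Bool) → (pairK c k).coev ≫ (pairK c k).ev = loop c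
  | true => rfl
  | false => by
    change (η_ (c true) (c false) ≫ (β_ _ _).hom) ≫ (β_ _ _).hom ≫ (β_ _ _).hom ≫
      ε_ (c true) (c false) = _
    simp [loop]

theorem pairK_coev : (k : Bool) → (pairK c k).coev ≫ (twist c k).inv = η_ (c true) (c false)
  | true => Category.comp_id _
  | false => by
    change (η_ (c true) (c false) ≫ (β_ _ _).hom) ≫ (β_ (c true) (c false)).inv = _
    simp

theorem pairK_ev : (k : Bool) → (twist c k).hom ≫ (pairK c k).ev =
    (β_ (c true) (c false)).hom ≫ ε_ (c true) (c false)
  | true => Category.id_comp _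
  | false => by
    change (β_ (c true) (c false)).hom ≫ (β_ _ _).hom ≫ (β_ _ _).hom ≫
      ε_ (c true) (c false) = _
    simp

/-- The permutation belonging to `twist`. -/
def twistEquiv : Bool → (Unit ⊕ Unit ≃ Unit ⊕ Unit)
  | true => Equiv.refl _
  | false => Equiv.sumComm _ _

theorem struct_twist : (k : Bool) → Struct c (A := .tensor (.of true) (.of false))
    (B := .tensor (.of k) (.of (!k))) (twistEquiv k) (twist c k).hom
  | true => .id _
  | false => .braid (.of true) (.of false)

theorem struct_twist_inv : (k : Bool) → Struct c (A := .tensor (.of k) (.of (!k)))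
    (B := .tensor (.of true) (.of false)) (twistEquiv k).symm (twist c k).inv
  | true => .id _
  | false => (Struct.braid (.of false) (.of true)).of_eq (fun _ => rfl) |> (by
      have : (twist c false).inv = (β_ (c false) (c true)).hom := by
        rw [← cancel_epi (twist c false).hom, Iso.hom_inv_id]
        exact (SymmetricCategory.symmetry (c true) (c false)).symm
      rw [this]
      exact ·)

/-- The points on all strands, except for one end of label `!k` of the last pair. -/
def offStrand {P C : Type} (k : Bool) : (P ⊕ C × Bool) ⊕ Unit → P ⊕ (C ⊕ Unit) × Bool
  | Sum.inl (Sum.inl a) => Sum.inl a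
  | Sum.inl (Sum.inr (x, b)) => Sum.inr (Sum.inl x, b)
  | Sum.inr _ => Sum.inr (Sum.inr (), k)

/-- If a net connects the ends of label `!k` of a created pair and of an annihilated pair
directly, then both pairs may be removed, at the cost of a factor `t` if there was a loop. -/
theorem Net.remove_pair {A B : Word Bool} {C D : Type} [Finite C] [Finite D] {t : ℂ}
    (ht : loop c = t • 𝟙 (𝟙_ T)) (k : Bool)
    {f : A.pts ⊕ (C ⊕ Unit) × Bool ≃ B.pts ⊕ (D ⊕ Unit) × Bool} {φ : A.obj c ⟶ B.obj c}
    (h : Net c f φ) (hf : f (Sum.inr (Sum.inr (), !k)) = Sum.inr (Sum.inr (), !k))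
    (g : (A.pts ⊕ C × Bool) ⊕ Unit ≃ (B.pts ⊕ D × Bool) ⊕ Unit)
    (hg : ∀ z, f (offStrand k z) = offStrand k (g z)) (r : A.pts ⊕ C × Bool ≃ B.pts ⊕ D × Bool)
    (h1 : ∀ x y, g (Sum.inl x) = Sum.inl y → r x = y)
    (h2 : ∀ x y, g (Sum.inl x) = Sum.inr () → g (Sum.inr ()) = Sum.inl y → r x = y) :
    ∃ ψ, Net c r ψ ∧ (g (Sum.inr ()) = Sum.inr () → φ = t • ψ) ∧
      (g (Sum.inr ()) ≠ Sum.inr () → φ = ψ) := by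
  obtain ⟨s, ⟨e⟩⟩ := exists_word (C := C)
  obtain ⟨s', ⟨e'⟩⟩ := exists_word (C := D)
  obtain ⟨F, Ψ, hΨ, hF, rfl⟩ := h.choose_words (.tensor s (.of ())) (.tensor s' (.of ()))
    (Equiv.sumCongr e (Equiv.refl Unit)) (Equiv.sumCongr e' (Equiv.refl Unit))
  -- the positions on all strands in the words, except for the end of label `!k` of the last pair
  let off : ∀ (A : Word Bool) (s : Word Unit), (A.pts ⊕ (cups s).pts) ⊕ Unit →
      (A.tensor (cups (.tensor s (.of ())))).pts := fun A s =>
    Sum.elim (Sum.elim Sum.inl (Sum.inr ∘ Sum.inl))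
      (fun _ => Sum.inr (Sum.inr ((twistEquiv k).symm (Sum.inl ()))))
  have hoff : ∀ (A : Word Bool) (s : Word Unit) {C : Type} (e : s.pts ≃ C)
      (z : (A.pts ⊕ (cups s).pts) ⊕ Unit),
      Sum.map id (dots (s := .tensor s (.of ())) (Equiv.sumCongr e (Equiv.refl Unit)))
        (off A s z) = offStrand k (Sum.map (Sum.map id (dots e)) id z) := by
    intro A s C e z
    rcases z with (z | z) | z
    · rfl
    · rfl
    · cases k <;> rfl
  have hlbl : ∀ (A : Word Bool) (s : Word Unit) (z : (A.pts ⊕ (cups s).pts) ⊕ Unit),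
      (A.tensor (cups (.tensor s (.of ())))).lbl (off A s z) =
        ((A.tensor (cups s)).tensor (.of k)).lbl z := by
    intro A s z
    rcases z with (z | z) | z
    · rfl
    · rfl
    · cases k <;> rfl
  have hinj : ∀ (A : Word Bool) (s : Word Unit), Function.Injective (off A s) := by
    intro A s
    rintro ((x | x) | x) ((y | y) | y) hxy <;> simp [off] at hxy ⊢ <;> exact hxy
  let κ := fun (A : Word Bool) {s : Word Unit} {C : Type} (e : s.pts ≃ C) =>
    Equiv.sumCongr (Equiv.refl A.pts) (dots e)
  let g' : (A.pts ⊕ (cups s).pts) ⊕ Unit ≃ (B.pts ⊕ (cups s').pts) ⊕ Unit :=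
    (Equiv.sumCongr (κ A e) (Equiv.refl _)).trans
      (g.trans (Equiv.sumCongr (κ B e') (Equiv.refl _)).symm)
  have hg' : ∀ z, F (off A s z) = off B s' (g' z) := by
    intro z
    have hi : Function.Injective (Sum.map (id : B.pts → B.pts)
        (dots (s := .tensor s' (.of ())) (Equiv.sumCongr e' (Equiv.refl Unit)))) :=
      Function.injective_id.sumMap (Equiv.injective _)
    apply hi
    rw [hF, hoff, hoff, hg]
    congr 1
    exact ((Equiv.sumCongr (κ B e') (Equiv.refl Unit)).apply_symm_apply _).symm
  obtain ⟨h₀, hh₀⟩ := Struct.exists_of_lbl_eq (c := c) (A := .tensor (.tensor A (cups s)) (.of k))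
    (B := .tensor (.tensor B (cups s')) (.of k)) g' fun z => by
      rw [← hlbl, ← hg', hΨ.lbl_eq, hlbl]
  -- The direct strand between the ends of label `!k` splits off, so that the pairs give a trace.
  have hΨ' := hΨ.unique (((((Struct.assoc_inv A (cups s) (.tensor (.of true) (.of false))).comp <|
    ((struct_twist k).left (.tensor A (cups s))).comp <|
    (Struct.assoc_inv _ (.of k) (.of (!k))).comp <|
    (hh₀.right (.of (!k))).comp <|
    (Struct.assoc _ (.of k) (.of (!k))).comp <|
    ((struct_twist_inv k).left (.tensor B (cups s'))).comp <|
    (Struct.assoc B (cups s') (.tensor (.of true) (.of false)))))).of_eq ?_)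
  · obtain ⟨ψ, hψ, hψ1, hψ2⟩ := exists_tr_struct (A := .tensor A (cups s))
      (B := .tensor B (cups s')) (pairK c k) (t := t) ((pairK_loop k).trans ht) hh₀
      ((κ A e).trans (r.trans (κ B e').symm)) (fun x y hxy => by
        have hxy' : g (Sum.inl (κ A e x)) = Sum.inl (κ B e' y) :=
          ((Equiv.sumCongr (κ B e') (Equiv.refl Unit)).symm_apply_eq).mp hxy
        exact (Equiv.symm_apply_eq _).mpr (h1 _ _ hxy')) (fun x y hx hy => by
        have hx' : g (Sum.inl (κ A e x)) = Sum.inr () :=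
          ((Equiv.sumCongr (κ B e') (Equiv.refl Unit)).symm_apply_eq).mp hx
        have hy' : g (Sum.inr ()) = Sum.inl (κ B e' y) :=
          ((Equiv.sumCongr (κ B e') (Equiv.refl Unit)).symm_apply_eq).mp hy
        exact (Equiv.symm_apply_eq _).mpr (h2 _ _ hx' hy'))
    have hcoev : coevS c (.tensor s (.of ())) =
        (λ_ (𝟙_ T)).inv ≫ (coevS c s ⊗ₘ ((pairK c k).coev ≫ (twist c k).inv)) := by
      rw [pairK_coev]
      rfl
    have hev : evS c (.tensor s' (.of ())) =
        (evS c s' ⊗ₘ ((twist c k).hom ≫ (pairK c k).ev)) ≫ (λ_ (𝟙_ T)).hom := by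
      rw [pairK_ev]
      rfl
    have hfr : frame (coevS c (.tensor s (.of ()))) (evS c (.tensor s' (.of ()))) Ψ =
        frame (coevS c s) (evS c s') ((pairK c k).tr h₀) := by
      rw [hcoev, hev, hΨ']
      exact frame_frame _ _ _ _ _
    refine ⟨_, ⟨s, s', e, e', _, ψ, hψ, fun x => ?_, rfl⟩, fun hl => ?_, fun hl => ?_⟩
    · exact (κ B e').apply_symm_apply _
    · rw [hfr, hψ1 ?_]
      · simp [frame]
      · change (Equiv.sumCongr (κ B e') (Equiv.refl Unit)).symm (g (Sum.inr ())) = _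
        rw [hl]
        rfl
    · rw [hfr, hψ2 ?_]
      change (Equiv.sumCongr (κ B e') (Equiv.refl Unit)).symm (g (Sum.inr ())) ≠ _
      intro hn
      rw [Equiv.symm_apply_eq] at hn
      exact hl hn
  · have hF₀ : F (Sum.inr (Sum.inr ((twistEquiv k).symm (Sum.inr ())))) =
        Sum.inr (Sum.inr ((twistEquiv k).symm (Sum.inr ()))) := by
      have hi : Function.Injective (Sum.map (id : B.pts → B.pts)
          (dots (s := .tensor s' (.of ())) (Equiv.sumCongr e' (Equiv.refl Unit)))) :=
        Function.injective_id.sumMap (Equiv.injective _)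
      have hd : ∀ (s : Word Unit) {C : Type} (e : s.pts ≃ C),
          dots (s := .tensor s (.of ())) (Equiv.sumCongr e (Equiv.refl Unit))
            (Sum.inr ((twistEquiv k).symm (Sum.inr ()))) = (Sum.inr (), !k) := by
        intro s C e
        cases k <;> rfl
      apply hi
      rw [hF, Sum.map_inr, hd, hf, Sum.map_inr, hd]
    have hback : ∀ z : ((B.pts ⊕ (cups s').pts) ⊕ Unit),
        Equiv.sumAssoc B.pts (cups s').pts (Unit ⊕ Unit) (Sum.map id (twistEquiv k).symm
          (Equiv.sumAssoc (B.pts ⊕ (cups s').pts) Unit Unit (Sum.inl z))) = off B s' z := by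
      rintro ((z | z) | z) <;> rfl
    rintro (x | x | x)
    · exact (hback (g' (Sum.inl (Sum.inl x)))).trans (hg' (Sum.inl (Sum.inl x))).symm
    · exact (hback (g' (Sum.inl (Sum.inr x)))).trans (hg' (Sum.inl (Sum.inr x))).symm
    · obtain ⟨x, rfl⟩ := (twistEquiv k).symm.surjective x
      rcases x with x | x
      · have hu := (hback (g' (Sum.inr ()))).trans (hg' (Sum.inr ())).symm
        cases k <;> exact hu
      · refine Eq.trans ?_ hF₀.symm
        cases k <;> rfl

/-- Name the two ends of each pair, the end of label `k` first. -/
def ends (N : Type) (k : Bool) : N × Bool ≃ N ⊕ N where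
  toFun p := if p.2 = k then Sum.inl p.1 else Sum.inr p.1
  invFun := Sum.elim (fun x => (x, k)) (fun x => (x, !k))
  left_inv := by
    rintro ⟨x, b⟩
    cases b <;> cases k <;> rfl
  right_inv := by
    rintro (x | x) <;> cases k <;> rfl

/-- Add further pairs to points in two groups, with the ends of label `k` in the first group. -/
def addEnds {P C X Z : Type} (k : Bool) (i : P ⊕ C × Bool ≃ X ⊕ Z) (N : Type) :
    P ⊕ (C ⊕ N) × Bool ≃ (X ⊕ N) ⊕ (Z ⊕ N) :=
  (packL P N C).trans <| (exch _ _ _).trans <| (Equiv.sumCongr i (ends N k)).trans <|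
    Equiv.sumSumSumComm _ _ _ _

/-- Split off one end of a further pair. -/
def addEnd {Q V W : Type} (m : Q ≃ V ⊕ W) : Option V ⊕ W ≃ Q ⊕ Unit where
  toFun
    | Sum.inl none => Sum.inr ()
    | Sum.inl (some v) => Sum.inl (m.symm (Sum.inl v))
    | Sum.inr w => Sum.inl (m.symm (Sum.inr w))
  invFun
    | Sum.inl q => Sum.map some id (m q)
    | Sum.inr _ => Sum.inl none
  left_inv := by rintro ((_ | v) | w) <;> simp
  right_inv := by
    rintro (q | _)
    · obtain ⟨q, rfl⟩ := m.symm.surjective q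
      rcases q with v | w <;> simp
    · rfl

section AddEnds

variable {P C X Z : Type} (k : Bool) (i : P ⊕ C × Bool ≃ X ⊕ Z) (n : ℕ)

/-- Separate the last one of the further pairs. -/
def lastPair (C : Type) (n : ℕ) : C ⊕ Fin (n + 1) ≃ (C ⊕ Fin n) ⊕ Unit :=
  (splitLast C n).trans (Equiv.optionEquivSumPUnit _)

theorem lastPair_inl (x : C) : lastPair C n (Sum.inl x) = Sum.inl (Sum.inl x) := by
  simp [lastPair, splitLast]

theorem lastPair_castSucc (x : Fin n) :
    lastPair C n (Sum.inr x.castSucc) = Sum.inl (Sum.inr x) := by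
  simp [lastPair, splitLast]

theorem lastPair_last : lastPair C n (Sum.inr (Fin.last n)) = Sum.inr () := by
  simp [lastPair, splitLast]

theorem addEnds_symm_left (N : Type) (v : X) :
    (addEnds k i N).symm (Sum.inl (Sum.inl v)) =
      Sum.map _root_.id (Prod.map Sum.inl _root_.id) (i.symm (Sum.inl v)) := by
  rcases h : i.symm (Sum.inl v) with x | x <;> simp [addEnds, packL, exch, h]; rfl

theorem addEnds_symm_right (N : Type) (v : Z) :
    (addEnds k i N).symm (Sum.inr (Sum.inl v)) =
      Sum.map _root_.id (Prod.map Sum.inl _root_.id) (i.symm (Sum.inr v)) := by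
  rcases h : i.symm (Sum.inr v) with x | x <;> simp [addEnds, packL, exch, h]; rfl

theorem addEnds_symm_end (N : Type) (x : N) :
    (addEnds k i N).symm (Sum.inl (Sum.inr x)) = Sum.inr (Sum.inr x, k) := by
  simp [addEnds, packL, exch, ends]

theorem addEnds_symm_other (N : Type) (x : N) :
    (addEnds k i N).symm (Sum.inr (Sum.inr x)) = Sum.inr (Sum.inr x, !k) := by
  simp [addEnds, packL, exch, ends]

theorem map_lastPair (x : P ⊕ C × Bool) :
    Sum.map (_root_.id : P → P) (Prod.map (lastPair C n) (_root_.id : Bool → Bool))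
        (Sum.map _root_.id (Prod.map Sum.inl _root_.id) x) =
      offStrand k (Sum.inl (Sum.map _root_.id (Prod.map Sum.inl _root_.id) x)) := by
  rcases x with x | ⟨x, b⟩
  · rfl
  · simp [lastPair_inl, offStrand]

theorem addEnds_splitLast (o : Option (X ⊕ Fin n)) :
    Sum.map (_root_.id : P → P) (Prod.map (lastPair C n) (_root_.id : Bool → Bool))
        ((addEnds k i (Fin (n + 1))).symm (Sum.inl ((splitLast X n).symm o))) =
      offStrand k (addEnd (addEnds k i (Fin n)) (Sum.inl o)) := by
  rcases o with _ | v | m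
  · have h : (splitLast X n).symm none = Sum.inr (Fin.last n) := by simp [splitLast]
    rw [h, addEnds_symm_end]
    simp [lastPair_last, offStrand, addEnd]
  · have h : (splitLast X n).symm (some (Sum.inl v)) = Sum.inl v := by simp [splitLast]
    rw [h, addEnds_symm_left, map_lastPair k]
    exact congrArg (fun x => offStrand k (Sum.inl x)) (addEnds_symm_left k i (Fin n) v).symm
  · have h : (splitLast X n).symm (some (Sum.inr m)) = Sum.inr m.castSucc := by simp [splitLast]
    rw [h, addEnds_symm_end]
    refine Eq.trans ?_ (congrArg (fun x => offStrand k (Sum.inl x))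
      (addEnds_symm_end k i (Fin n) m).symm)
    simp [lastPair_castSucc, offStrand]

theorem addEnds_castSucc (w : Z ⊕ Fin n) :
    Sum.map (_root_.id : P → P) (Prod.map (lastPair C n) (_root_.id : Bool → Bool))
        ((addEnds k i (Fin (n + 1))).symm (Sum.inr (Sum.map _root_.id Fin.castSucc w))) =
      offStrand k (addEnd (addEnds k i (Fin n)) (Sum.inr w)) := by
  rcases w with v | m
  · rw [Sum.map_inl, _root_.id, addEnds_symm_right, map_lastPair k]
    exact congrArg (fun x => offStrand k (Sum.inl x)) (addEnds_symm_right k i (Fin n) v).symm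
  · rw [Sum.map_inr, addEnds_symm_other]
    refine Eq.trans ?_ (congrArg (fun x => offStrand k (Sum.inl x))
      (addEnds_symm_other k i (Fin n) m).symm)
    simp [lastPair_castSucc, offStrand]

theorem addEnds_last :
    Sum.map (_root_.id : P → P) (Prod.map (lastPair C n) (_root_.id : Bool → Bool))
        ((addEnds k i (Fin (n + 1))).symm (Sum.inr (Sum.inr (Fin.last n)))) =
      Sum.inr (Sum.inr (), !k) := by
  rw [addEnds_symm_other]
  simp [lastPair_last]

end AddEnds

/-- If a net connects the ends of label `!k` of `n` created and `n` annihilated pairs directly,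
then the pairs may be removed by closing up the strands. -/
theorem Net.close {A B : Word Bool} {C D : Type} [Finite C] [Finite D] {t : ℂ}
    (ht : loop c = t • 𝟙 (𝟙_ T)) (k : Bool) {X Y Z : Type} (i : A.pts ⊕ C × Bool ≃ X ⊕ Z)
    (j : B.pts ⊕ D × Bool ≃ Y ⊕ Z) (n : ℕ) (g : X ⊕ Fin n ≃ Y ⊕ Fin n) {φ : A.obj c ⟶ B.obj c}
    (h : Net c ((addEnds k i (Fin n)).trans
      ((Equiv.sumCongr g (Equiv.refl _)).trans (addEnds k j (Fin n)).symm)) φ) :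
    ∃ ψ, Net c (i.trans ((Equiv.sumCongr (closeUp n g).1 (Equiv.refl _)).trans j.symm)) ψ ∧
      φ = t ^ (closeUp n g).2 • ψ := by
  induction n generalizing φ with
  | zero =>
    refine ⟨φ, h.reindex (Equiv.sumEmpty C (Fin 0)) (Equiv.sumEmpty D (Fin 0)) fun x => ?_, ?_⟩
    · obtain ⟨x, rfl⟩ := (addEnds k i (Fin 0)).symm.surjective x
      have hm : ∀ {P C : Type} (x : P ⊕ C × Bool), Sum.map (_root_.id : P → P)
          (Prod.map (Equiv.sumEmpty C (Fin 0)) (_root_.id : Bool → Bool))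
          (Sum.map _root_.id (Prod.map Sum.inl _root_.id) x) = x := by
        rintro P C (x | ⟨x, b⟩) <;> rfl
      rw [Equiv.trans_apply (addEnds k i (Fin 0)), Equiv.apply_symm_apply]
      rcases x with (x | x) | (x | x)
      · rw [addEnds_symm_left, hm]
        rcases hx : g (Sum.inl x) with y | y
        · simp [hx, addEnds_symm_left, hm, closeUp]
        · exact y.elim0
      · exact x.elim0
      · rw [addEnds_symm_right, hm]
        simp [addEnds_symm_right, hm]
      · exact x.elim0
    · simp [closeUp]
  | succ n ih =>
    let g' : Option (X ⊕ Fin n) ≃ Option (Y ⊕ Fin n) :=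
      ((splitLast X n).symm.trans g).trans (splitLast Y n)
    let m := addEnds k i (Fin n)
    let m' := addEnds k j (Fin n)
    -- `F` is the diagram with its last pair separated, and `G` is the part of `F` outside the
    -- direct strand between the ends of label `!k` of that pair.
    let G := (addEnd m).symm.trans ((Equiv.sumCongr g' (Equiv.refl (Z ⊕ Fin n))).trans (addEnd m'))
    let F : A.pts ⊕ ((C ⊕ Fin n) ⊕ Unit) × Bool ≃ B.pts ⊕ ((D ⊕ Fin n) ⊕ Unit) × Bool :=
      (Equiv.sumCongr (Equiv.refl _) ((lastPair C n).prodCongr (Equiv.refl _))).symm.trans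
        (((addEnds k i (Fin (n + 1))).trans ((Equiv.sumCongr g (Equiv.refl _)).trans
          (addEnds k j (Fin (n + 1))).symm)).trans
        (Equiv.sumCongr (Equiv.refl _) ((lastPair D n).prodCongr (Equiv.refl _))))
    have hF : ∀ y, F (Sum.map _root_.id (Prod.map (lastPair C n) _root_.id)
        ((addEnds k i (Fin (n + 1))).symm y)) =
        Sum.map _root_.id (Prod.map (lastPair D n) _root_.id)
          ((addEnds k j (Fin (n + 1))).symm (Sum.map g _root_.id y)) := by
      intro y
      have h1 : Sum.map (_root_.id : A.pts → A.pts)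
          (Prod.map (lastPair C n) (_root_.id : Bool → Bool))
          ((addEnds k i (Fin (n + 1))).symm y) =
          Equiv.sumCongr (Equiv.refl _) ((lastPair C n).prodCongr (Equiv.refl _))
            ((addEnds k i (Fin (n + 1))).symm y) := rfl
      rw [h1]
      simp only [F, Equiv.trans_apply, Equiv.symm_apply_apply, Equiv.apply_symm_apply]
      rfl
    have h' := h.reindex (lastPair C n) (lastPair D n) (f' := F) (fun x => by
      obtain ⟨x, rfl⟩ := (addEnds k i (Fin (n + 1))).symm.surjective x
      rw [hF]
      simp only [Equiv.trans_apply, Equiv.apply_symm_apply]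
      rfl)
    have hG : ∀ z, G (addEnd m z) = addEnd m' (Sum.map g' _root_.id z) := by
      intro z
      simp only [G, Equiv.trans_apply, Equiv.symm_apply_apply]
      rfl
    have hGs : ∀ v, G (Sum.inl (m.symm (Sum.inl v))) = addEnd m' (Sum.inl (g' (some v))) :=
      fun v => hG (Sum.inl (some v))
    have hGr : ∀ w, G (Sum.inl (m.symm (Sum.inr w))) = Sum.inl (m'.symm (Sum.inr w)) :=
      fun w => hG (Sum.inr w)
    have hGn : G (Sum.inr ()) = addEnd m' (Sum.inl (g' none)) := hG (Sum.inl none)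
    have hnone : ∀ o : Option (Y ⊕ Fin n), addEnd m' (Sum.inl o) = Sum.inr () ↔ o = none := by
      rintro (_ | o) <;> simp [addEnd]
    have hsome : ∀ (o : Option (Y ⊕ Fin n)) y, addEnd m' (Sum.inl o) = Sum.inl y →
        ∃ v, o = some v ∧ m'.symm (Sum.inl v) = y := by
      rintro (_ | o) y <;> simp [addEnd]
    obtain ⟨ψ, hψ, hψ1, hψ2⟩ := h'.remove_pair ht k
      (by
        rw [← addEnds_last k i n, hF, Sum.map_inr]
        exact addEnds_last k j n)
      G
      (fun z => by
        obtain ⟨z, rfl⟩ := (addEnd m).surjective z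
        rw [hG]
        rcases z with o | w
        · rw [← addEnds_splitLast k i n, hF, Sum.map_inl, Sum.map_inl, ← addEnds_splitLast k j n]
          simp [g']
        · rw [← addEnds_castSucc k i n, hF, Sum.map_inr, Sum.map_inr]
          exact addEnds_castSucc k j n w)
      (m.trans ((Equiv.sumCongr g'.removeNone (Equiv.refl _)).trans m'.symm))
      (fun x y hxy => by
        obtain ⟨x, rfl⟩ := m.symm.surjective x
        rcases x with v | w
        · rw [hGs] at hxy
          obtain ⟨v', h1, rfl⟩ := hsome _ _ hxy
          have h2 := Equiv.removeNone_some g' ⟨v', h1⟩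
          rw [h1] at h2
          simp [Option.some.inj h2]
        · rw [hGr] at hxy
          simpa using Sum.inl.inj hxy)
      (fun x y hx hy => by
        obtain ⟨x, rfl⟩ := m.symm.surjective x
        rcases x with v | w
        · rw [hGs, hnone] at hx
          rw [hGn] at hy
          obtain ⟨v', h1, rfl⟩ := hsome _ _ hy
          have h2 := Equiv.removeNone_none g' hx
          rw [h1] at h2
          simp [Option.some.inj h2]
        · rw [hGr] at hx
          exact absurd hx (by simp))
    obtain ⟨ψ', hψ', rfl⟩ := ih _ hψ
    refine ⟨ψ', hψ', ?_⟩
    rw [hGn, hnone] at hψ1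
    rw [hGn, Ne, hnone] at hψ2
    change φ = t ^ ((closeUp n g'.removeNone).2 + if g' none = none then 1 else 0) • ψ'
    split_ifs with h0
    · rw [hψ1 h0, smul_smul, pow_succ']
    · rw [hψ2 h0, add_zero]

end Loops

/-! ### The morphism of a diagram -/

section RowWords

/-- The word `unit ⊗ k ⊗ ⋯ ⊗ k` with `n` letters `k`. -/
def pw (k : Bool) : ℕ → Word Bool
  | 0 => .unit
  | n + 1 => .tensor (pw k n) (.of k)

/-- The letters of `pw k n` are numbered from the left. -/
def pwEquiv (k : Bool) : (n : ℕ) → (pw k n).pts ≃ Fin n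
  | 0 => Equiv.equivOfIsEmpty Empty (Fin 0)
  | n + 1 => (Equiv.sumCongr (pwEquiv k n) (Equiv.ofUnique Unit (Fin 1))).trans finSumFinEquiv

theorem lbl_pw (k : Bool) : (n : ℕ) → (p : (pw k n).pts) → (pw k n).lbl p = k
  | 0, p => p.elim
  | n + 1, Sum.inl p => lbl_pw k n p
  | n + 1, Sum.inr _ => rfl

/-- The word of a row of dots. -/
def rowWord (R : Row) : Word Bool := .tensor (pw true R.black) (pw false R.white)

/-- The letters of the word of a row are its dots. -/
def rowEquiv (R : Row) : (rowWord R).pts ≃ Fin R.black ⊕ Fin R.white :=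
  Equiv.sumCongr (pwEquiv true R.black) (pwEquiv false R.white)

theorem lbl_rowWord (R : Row) (p : (rowWord R).pts) :
    (rowWord R).lbl p = Sum.elim (fun _ => true) (fun _ => false) (rowEquiv R p) := by
  rcases p with p | p
  · exact lbl_pw true _ p
  · exact lbl_pw false _ p

/-- Divide the dots of a row and of `n` further pairs into black and white ones. -/
def side (R : Row) (n : ℕ) :
    (rowWord R).pts ⊕ Fin n × Bool ≃ (Fin R.black ⊕ Fin n) ⊕ (Fin R.white ⊕ Fin n) :=
  (Equiv.sumCongr (rowEquiv R) (ends (Fin n) true)).trans (Equiv.sumSumSumComm _ _ _ _)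

/-- A black-white diagram drawn with all strands running downwards: every white dot of the top row
is joined to the white end of a cap and every white dot of the bottom row to the white end of a
cup. -/
def downward {R S : Row} (σ : Diag R S) :
    (rowWord R).pts ⊕ Fin S.white × Bool ≃ (rowWord S).pts ⊕ Fin R.white × Bool :=
  (side R S.white).trans
    ((Equiv.sumCongr σ (Equiv.sumComm _ _)).trans (side S R.white).symm)

section Points

variable {R S : Row} (n : ℕ) (σ : Diag R S)

theorem side_symm_black (b : Fin R.black) :
    (side R n).symm (Sum.inl (Sum.inl b)) = Sum.inl ((rowEquiv R).symm (Sum.inl b)) := by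
  simp [side]

theorem side_symm_white (w : Fin R.white) :
    (side R n).symm (Sum.inr (Sum.inl w)) = Sum.inl ((rowEquiv R).symm (Sum.inr w)) := by
  simp [side]

theorem side_symm_true (m : Fin n) :
    (side R n).symm (Sum.inl (Sum.inr m)) = Sum.inr (m, true) := by
  simp [side, ends]

theorem side_symm_false (m : Fin n) :
    (side R n).symm (Sum.inr (Sum.inr m)) = Sum.inr (m, false) := by
  simp [side, ends]

theorem downward_side (x : (Fin R.black ⊕ Fin S.white) ⊕ (Fin R.white ⊕ Fin S.white)) :
    downward σ ((side R S.white).symm x) =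
      (side S R.white).symm (Sum.map σ Sum.swap x) := by
  unfold downward
  simp only [Equiv.trans_apply, Equiv.apply_symm_apply]
  rfl

theorem downward_black (b : Fin R.black) :
    downward σ (Sum.inl ((rowEquiv R).symm (Sum.inl b))) =
      (side S R.white).symm (Sum.inl (σ (Sum.inl b))) := by
  rw [← side_symm_black, downward_side, Sum.map_inl]

theorem downward_true (m : Fin S.white) :
    downward σ (Sum.inr (m, true)) = (side S R.white).symm (Sum.inl (σ (Sum.inr m))) := by
  rw [← side_symm_true, downward_side, Sum.map_inl]

theorem downward_white (w : Fin R.white) :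
    downward σ (Sum.inl ((rowEquiv R).symm (Sum.inr w))) = Sum.inr (w, false) := by
  rw [← side_symm_white, downward_side, Sum.map_inr, Sum.swap_inl, side_symm_false]

theorem downward_false (m : Fin S.white) :
    downward σ (Sum.inr (m, false)) = Sum.inl ((rowEquiv S).symm (Sum.inr m)) := by
  rw [← side_symm_false, downward_side, Sum.map_inr, Sum.swap_inr, side_symm_white]

end Points

theorem lbl_side (R : Row) (n : ℕ) (x : (rowWord R).pts ⊕ Fin n × Bool) :
    Sum.elim (rowWord R).lbl Prod.snd x =
      Sum.elim (fun _ => true) (fun _ => false) (side R n x) := by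
  rcases x with x | ⟨x, b⟩
  · rw [Sum.elim_inl, lbl_rowWord]
    rcases h : rowEquiv R x with y | y <;> simp [side, h]
  · cases b <;> simp [side, ends]

theorem lbl_downward {R S : Row} (σ : Diag R S) (x : (rowWord R).pts ⊕ Fin S.white × Bool) :
    Sum.elim (rowWord S).lbl Prod.snd (downward σ x) = Sum.elim (rowWord R).lbl Prod.snd x := by
  rw [lbl_side, lbl_side]
  unfold downward
  simp only [Equiv.trans_apply, Equiv.apply_symm_apply]
  rcases side R S.white x with y | y
  · rfl
  · rfl

/-- Closing up the exchange of two bundles of strands straightens the strands. As there is only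
one colouring of the closed strands for given ends, this follows by counting colourings. -/
theorem closeUp_sumComm (n : ℕ) :
    closeUp n (Equiv.sumComm (Fin n) (Fin n)) = (Equiv.refl (Fin n), 0) := by
  classical
  have key : ∀ x y : Fin n → Bool,
      2 ^ (closeUp n (Equiv.sumComm (Fin n) (Fin n))).2 *
        wt (closeUp n (Equiv.sumComm (Fin n) (Fin n))).1 x y = if x = y then 1 else 0 := by
    intro x y
    have h := sum_wt_closeUp n (Equiv.sumComm (Fin n) (Fin n)) x y
    rw [Fintype.card_bool] at h
    rw [← h, Finset.sum_eq_single x]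
    · unfold wt
      congr 1
      rw [eq_iff_iff]
      constructor
      · intro H
        funext i
        simpa using congrFun H (Sum.inr i)
      · rintro rfl
        funext i
        rcases i with i | i <;> rfl
    · intro c _ hc
      unfold wt
      rw [if_neg]
      intro H
      apply hc
      funext i
      simpa using (congrFun H (Sum.inl i)).symm
    · simp
  have h0 : (closeUp n (Equiv.sumComm (Fin n) (Fin n))).2 = 0 := by
    have h := key (fun _ => true) (fun _ => true)
    rw [if_pos rfl] at h
    have h1 := Nat.eq_one_of_mul_eq_one_right h
    by_contra h2
    exact absurd h1 (Nat.one_lt_two_pow h2).ne'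
  refine Prod.ext (Equiv.ext fun i => ?_) h0
  have h := key (fun j => decide ((closeUp n (Equiv.sumComm (Fin n) (Fin n))).1 j =
    (closeUp n (Equiv.sumComm (Fin n) (Fin n))).1 i))
    (fun j => decide (j = (closeUp n (Equiv.sumComm (Fin n) (Fin n))).1 i))
  have h1 : ∀ (f : Fin n ≃ Fin n),
      wt f (fun j => decide (f j = f i)) (fun j => decide (j = f i)) = 1 := fun f => if_pos (funext fun _ => rfl)
  rw [h0, pow_zero, one_mul, h1] at h
  split_ifs at h with h2
  exact (of_decide_eq_true ((congrFun h2 i).symm.trans (decide_eq_true rfl))).symm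

end RowWords

/-- Composing downward diagrams amounts to glueing, with the white dots of the middle row replaced
by a pair. -/
theorem netComp_downward {Q R S : Row} (σ : Diag Q R) (τ : Diag R S)
    (x : ((Fin Q.black ⊕ Fin S.white) ⊕ Fin R.white) ⊕
      ((Fin Q.white ⊕ Fin S.white) ⊕ Fin R.white)) :
    netComp (downward σ) (downward τ) ((addEnds true (side Q S.white) (Fin R.white)).symm x) =
      (addEnds true ((side S Q.white).trans (Equiv.sumCongr (Equiv.refl _) (Equiv.sumComm _ _)))
        (Fin R.white)).symm (Sum.map (glue σ τ) _root_.id x) := by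
  rcases x with ((x | x) | x) | ((x | x) | x)
  · rcases h : σ (Sum.inl x) with b | w
    · rcases h' : τ (Sum.inl b) with b' | w' <;>
        simp [netComp, packL, exch, glue, side_symm_black, side_symm_white, side_symm_true,
          side_symm_false, downward_black, downward_white, downward_true, downward_false,
          addEnds_symm_left, addEnds_symm_right, addEnds_symm_end, addEnds_symm_other, h, h']
    · simp [netComp, packL, exch, glue, side_symm_black, side_symm_white, side_symm_true,
        side_symm_false, downward_black, downward_white, downward_true, downward_false,
        addEnds_symm_left, addEnds_symm_right, addEnds_symm_end, addEnds_symm_other, h]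
  · rcases h : τ (Sum.inr x) with b | w <;>
        simp [netComp, packL, exch, glue, side_symm_black, side_symm_white, side_symm_true,
          side_symm_false, downward_black, downward_white, downward_true, downward_false,
          addEnds_symm_left, addEnds_symm_right, addEnds_symm_end, addEnds_symm_other, h]
  · rcases h : σ (Sum.inr x) with b | w
    · rcases h' : τ (Sum.inl b) with b' | w' <;>
        simp [netComp, packL, exch, glue, side_symm_black, side_symm_white, side_symm_true,
          side_symm_false, downward_black, downward_white, downward_true, downward_false,
          addEnds_symm_left, addEnds_symm_right, addEnds_symm_end, addEnds_symm_other, h, h']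
    · simp [netComp, packL, exch, glue, side_symm_black, side_symm_white, side_symm_true,
        side_symm_false, downward_black, downward_white, downward_true, downward_false,
        addEnds_symm_left, addEnds_symm_right, addEnds_symm_end, addEnds_symm_other, h]
  · simp [netComp, packL, exch, glue, side_symm_black, side_symm_white, side_symm_true,
      side_symm_false, downward_black, downward_white, downward_true, downward_false,
      addEnds_symm_left, addEnds_symm_right, addEnds_symm_end, addEnds_symm_other]
  · simp [netComp, packL, exch, glue, side_symm_black, side_symm_white, side_symm_true,
      side_symm_false, downward_black, downward_white, downward_true, downward_false,
      addEnds_symm_left, addEnds_symm_right, addEnds_symm_end, addEnds_symm_other]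
  · simp [netComp, packL, exch, glue, side_symm_black, side_symm_white, side_symm_true,
      side_symm_false, downward_black, downward_white, downward_true, downward_false,
      addEnds_symm_left, addEnds_symm_right, addEnds_symm_end, addEnds_symm_other]

section RowFunctor

variable {T : Type u} [Category.{v} T] [MonoidalCategory T] [SymmetricCategory T]
  [Preadditive T] [Linear ℂ T] [MonoidalPreadditive T] [MonoidalLinear ℂ T]
variable {c : Bool → T} [ExactPairing (c true) (c false)]

/-- The morphism of `T` represented by a black-white diagram. -/
def diagMor (c : Bool → T) [ExactPairing (c true) (c false)] {R S : Row} (σ : Diag R S) :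
    (rowWord R).obj c ⟶ (rowWord S).obj c :=
  (Net.exists_of_lbl_eq (downward σ) (lbl_downward σ)).choose

theorem net_diagMor {R S : Row} (σ : Diag R S) : Net c (downward σ) (diagMor c σ) :=
  (Net.exists_of_lbl_eq (downward σ) (lbl_downward σ)).choose_spec

/-- Concatenation of diagrams becomes composition, and a removed loop the factor `t`. -/
theorem diagMor_comp {t : ℂ} (ht : loop c = t • 𝟙 (𝟙_ T)) {Q R S : Row} (σ : Diag Q R)
    (τ : Diag R S) :
    diagMor c σ ≫ diagMor c τ = t ^ (concat σ τ).2 • diagMor c (concat σ τ).1 := by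
  obtain ⟨ψ, hψ, h⟩ := Net.close ht true (side Q S.white)
    ((side S Q.white).trans (Equiv.sumCongr (Equiv.refl _) (Equiv.sumComm _ _))) R.white
    (glue σ τ) (((net_diagMor σ).comp (net_diagMor τ)).of_eq fun x => by
      obtain ⟨x, rfl⟩ := (addEnds true (side Q S.white) (Fin R.white)).symm.surjective x
      rw [Equiv.trans_apply (addEnds true (side Q S.white) (Fin R.white)),
        Equiv.apply_symm_apply]
      exact netComp_downward σ τ x)
  rw [h]
  congr 1
  refine hψ.unique ((net_diagMor (concat σ τ).1).of_eq fun x => ?_)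
  obtain ⟨x, rfl⟩ := (side Q S.white).symm.surjective x
  rcases x with x | x | x <;> simp [downward, concat]

/-- The net of the identity diagram creates and annihilates a pair for each white dot;
straightening the strands removes these pairs. -/
theorem diagMor_id {t : ℂ} (ht : loop c = t • 𝟙 (𝟙_ T)) (R : Row) :
    diagMor c (idDiag R) = 𝟙 ((rowWord R).obj c) := by
  let i : (rowWord R).pts ⊕ Empty × Bool ≃ Fin R.white ⊕ Fin R.black :=
    (Equiv.sumEmpty _ _).trans ((rowEquiv R).trans (Equiv.sumComm _ _))
  have hi1 : ∀ w, i.symm (Sum.inl w) = Sum.inl ((rowEquiv R).symm (Sum.inr w)) := fun _ => rfl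
  have hi2 : ∀ b, i.symm (Sum.inr b) = Sum.inl ((rowEquiv R).symm (Sum.inl b)) := fun _ => rfl
  -- In the identity diagram the black ends of the pairs are joined directly.
  obtain ⟨ψ, hψ, h⟩ := Net.close ht false i i R.white (Equiv.sumComm _ _)
    ((net_diagMor (idDiag R)).reindex (Equiv.emptySum Empty _).symm
      (Equiv.emptySum Empty _).symm fun x => by
      obtain ⟨x, rfl⟩ := (side R R.white).symm.surjective x
      have key : ∀ y, Sum.map (_root_.id : (rowWord R).pts → (rowWord R).pts) (Prod.map
          (Equiv.emptySum Empty (Fin R.white)).symm (_root_.id : Bool → Bool))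
          ((side R R.white).symm y) = (addEnds false i (Fin R.white)).symm
            (Sum.elim (Sum.elim (Sum.inr ∘ Sum.inl) (Sum.inr ∘ Sum.inr))
              (Sum.elim (Sum.inl ∘ Sum.inl) (Sum.inl ∘ Sum.inr)) y) := by
        rintro ((y | y) | (y | y)) <;>
          simp [side_symm_black, side_symm_white, side_symm_true, side_symm_false,
            addEnds_symm_left, addEnds_symm_right, addEnds_symm_end, addEnds_symm_other, hi1, hi2]
      rw [downward_side, key, key, Equiv.trans_apply (addEnds false i (Fin R.white)),
        Equiv.apply_symm_apply, Equiv.trans_apply]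
      congr 1
      rcases x with (x | x) | (x | x) <;> rfl)
  rw [h]
  rw [closeUp_sumComm] at hψ ⊢
  rw [pow_zero, one_smul]
  refine hψ.unique ((Net.of_struct (.id _)).of_eq fun x => ?_)
  simp

/-- A diagram of vertical strands represents the permutation of the factors. -/
theorem diagMor_vert {t : ℂ} (ht : loop c = t • 𝟙 (𝟙_ T)) {R S : Row}
    (e : Fin R.black ≃ Fin S.black) (g : Fin R.white ≃ Fin S.white)
    {φ : (rowWord R).obj c ⟶ (rowWord S).obj c}
    (h : Struct c ((rowEquiv R).trans ((Equiv.sumCongr e g).trans (rowEquiv S).symm)) φ) :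
    diagMor c (vert e g) = φ := by
  have h1 := (net_diagMor (idDiag R)).comp_struct h
  rw [diagMor_id ht, Category.id_comp] at h1
  refine (net_diagMor (vert e g)).unique (h1.reindex g (Equiv.refl _) fun x => ?_)
  obtain ⟨x, rfl⟩ := (side R R.white).symm.surjective x
  have key : ∀ y, Sum.map (_root_.id : (rowWord R).pts → (rowWord R).pts) (Prod.map
      g (_root_.id : Bool → Bool)) ((side R R.white).symm y) = (side R S.white).symm
        (Sum.map (Sum.map _root_.id g) (Sum.map _root_.id g) y) := by
    rintro ((y | y) | (y | y)) <;>
      simp [side_symm_black, side_symm_white, side_symm_true, side_symm_false]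
  rw [key, downward_side, Equiv.trans_apply, downward_side]
  rcases x with (x | x) | (x | x) <;>
    simp [side_symm_black, side_symm_white, side_symm_true, side_symm_false, idDiag, vert]

/-- Juxtaposed words of rows, as compared with the word of the tensor product. -/
def rowTensorEquiv (R S : Row) : ((rowWord R).tensor (rowWord S)).pts ≃
    (rowWord (R.tensor S)).pts :=
  (Equiv.sumCongr (rowEquiv R) (rowEquiv S)).trans ((Equiv.sumSumSumComm _ _ _ _).trans
    ((Equiv.sumCongr finSumFinEquiv finSumFinEquiv).trans (rowEquiv (R.tensor S)).symm))

theorem lbl_rowTensorEquiv (R S : Row) (p : ((rowWord R).tensor (rowWord S)).pts) :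
    (rowWord (R.tensor S)).lbl (rowTensorEquiv R S p) =
      ((rowWord R).tensor (rowWord S)).lbl p := by
  rcases p with p | p
  · refine (lbl_rowWord _ _).trans (Eq.trans ?_ (lbl_rowWord R p).symm)
    rcases h : rowEquiv R p with y | y <;> simp [rowTensorEquiv, h]
  · refine (lbl_rowWord _ _).trans (Eq.trans ?_ (lbl_rowWord S p).symm)
    rcases h : rowEquiv S p with y | y <;> simp [rowTensorEquiv, h]

/-- The diagram of a juxtaposition. -/
theorem diagMor_union {R S R' S' : Row} (σ : Diag R S) (τ : Diag R' S')
    {φ : ((rowWord R).tensor (rowWord R')).obj c ⟶ (rowWord (R.tensor R')).obj c}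
    {ψ : ((rowWord S).tensor (rowWord S')).obj c ⟶ (rowWord (S.tensor S')).obj c}
    (hφ : Struct c (rowTensorEquiv R R') φ) (hψ : Struct c (rowTensorEquiv S S') ψ) :
    (diagMor c σ ⊗ₘ diagMor c τ) ≫ ψ = φ ≫ diagMor c (union σ τ) := by
  have h1 := ((net_diagMor σ).tensor (net_diagMor τ)).comp_struct hψ
  have h2 := Net.struct_comp hφ (net_diagMor (union σ τ))
  refine (h1.reindex finSumFinEquiv finSumFinEquiv fun x => ?_).unique h2
  have hr : ∀ x, rowTensorEquiv R R' x = (rowEquiv (R.tensor R')).symm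
    (Sum.map finSumFinEquiv finSumFinEquiv (Equiv.sumSumSumComm _ _ _ _
      (Sum.map (rowEquiv R) (rowEquiv R') x))) := fun _ => rfl
  have hs : ∀ x, rowTensorEquiv S S' x = (rowEquiv (S.tensor S')).symm
    (Sum.map finSumFinEquiv finSumFinEquiv (Equiv.sumSumSumComm _ _ _ _
      (Sum.map (rowEquiv S) (rowEquiv S') x))) := fun _ => rfl
  have u1 : ∀ x, union σ τ (Sum.inl (Fin.castAdd _ x)) =
      Sum.map (Fin.castAdd _) (Fin.castAdd _) (σ (Sum.inl x)) := fun x => by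
    rcases h : σ (Sum.inl x) with y | y <;> simp [union, h]
  have u2 : ∀ x, union σ τ (Sum.inl (Fin.natAdd _ x)) =
      Sum.map (Fin.natAdd _) (Fin.natAdd _) (τ (Sum.inl x)) := fun x => by
    rcases h : τ (Sum.inl x) with y | y <;> simp [union, h]
  have u3 : ∀ x, union σ τ (Sum.inr (Fin.castAdd _ x)) =
      Sum.map (Fin.castAdd _) (Fin.castAdd _) (σ (Sum.inr x)) := fun x => by
    rcases h : σ (Sum.inr x) with y | y <;> simp [union, h]
  have u4 : ∀ x, union σ τ (Sum.inr (Fin.natAdd _ x)) =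
      Sum.map (Fin.natAdd _) (Fin.natAdd _) (τ (Sum.inr x)) := fun x => by
    rcases h : τ (Sum.inr x) with y | y <;> simp [union, h]
  have hb : ∀ b : Fin (R.black + R'.black), downward (union σ τ)
      (Sum.inl ((rowEquiv (R.tensor R')).symm (Sum.inl b))) =
      (side _ _).symm (Sum.inl (union σ τ (Sum.inl b))) :=
    downward_black (R := R.tensor R') (S := S.tensor S') (union σ τ)
  have hw : ∀ b : Fin (R.white + R'.white), downward (union σ τ)
      (Sum.inl ((rowEquiv (R.tensor R')).symm (Sum.inr b))) = Sum.inr (b, false) :=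
    downward_white (R := R.tensor R') (S := S.tensor S') (union σ τ)
  have ht : ∀ m : Fin (S.white + S'.white), downward (union σ τ) (Sum.inr (m, true)) =
      (side _ _).symm (Sum.inl (union σ τ (Sum.inr m))) :=
    downward_true (R := R.tensor R') (S := S.tensor S') (union σ τ)
  have hf : ∀ m : Fin (S.white + S'.white), downward (union σ τ) (Sum.inr (m, false)) =
      Sum.inl ((rowEquiv (S.tensor S')).symm (Sum.inr m)) :=
    downward_false (R := R.tensor R') (S := S.tensor S') (union σ τ)
  have kb : ∀ b : Fin (S.black + S'.black), (side (S.tensor S') (R.tensor R').white).symm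
      (Sum.inl (Sum.inl b)) = Sum.inl ((rowEquiv (S.tensor S')).symm (Sum.inl b)) :=
    side_symm_black (R := S.tensor S') _
  have kt : ∀ b : Fin (R.white + R'.white), (side (S.tensor S') (R.tensor R').white).symm
      (Sum.inl (Sum.inr b)) = Sum.inr (b, true) :=
    side_symm_true (R := S.tensor S') (R.tensor R').white
  rcases x with (x | x) | ⟨x | x, b⟩
  · obtain ⟨x, rfl⟩ := (rowEquiv R).symm.surjective x
    rcases x with x | x
    · rcases h : σ (Sum.inl x) with y | y <;>
        simp [hr, hs, downward_black, side_symm_black, side_symm_true, downward_white, downward_true,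
          downward_false, hb, hw, ht, hf, kb, kt, u1, h]
    · simp [hr, hs, downward_black, side_symm_black, side_symm_true, downward_white, downward_true,
        downward_false, hb, hw, ht, hf, kb, kt]
  · obtain ⟨x, rfl⟩ := (rowEquiv R').symm.surjective x
    rcases x with x | x
    · rcases h : τ (Sum.inl x) with y | y <;>
        simp [hr, hs, downward_black, side_symm_black, side_symm_true, downward_white, downward_true,
          downward_false, hb, hw, ht, hf, kb, kt, u2, h]
    · simp [hr, hs, downward_black, side_symm_black, side_symm_true, downward_white, downward_true,
        downward_false, hb, hw, ht, hf, kb, kt]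
  · cases b
    · simp [hr, hs, downward_black, side_symm_black, side_symm_true, downward_white, downward_true,
        downward_false, hb, hw, ht, hf, kb, kt]
    · rcases h : σ (Sum.inr x) with y | y <;>
        simp [hr, hs, downward_black, side_symm_black, side_symm_true, downward_white, downward_true,
          downward_false, hb, hw, ht, hf, kb, kt, u3, h]
  · cases b
    · simp [hr, hs, downward_black, side_symm_black, side_symm_true, downward_white, downward_true,
        downward_false, hb, hw, ht, hf, kb, kt]
    · rcases h : τ (Sum.inr x) with y | y <;>
        simp [hr, hs, downward_black, side_symm_black, side_symm_true, downward_white, downward_true,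
          downward_false, hb, hw, ht, hf, kb, kt, u4, h]

end RowFunctor

/-! ### The functor attached to an object of dimension `t` -/

section PermIso

variable {K : Type} {T : Type u} [Category.{v} T] [MonoidalCategory T] [SymmetricCategory T]

theorem exists_permIso (c : K → T) {A B : Word K} (f : A.pts ≃ B.pts)
    (hf : ∀ p, B.lbl (f p) = A.lbl p) :
    ∃ φ : A.obj c ≅ B.obj c, Struct c f φ.hom ∧ Struct c f.symm φ.inv := by
  obtain ⟨φ, h⟩ := Struct.exists_of_lbl_eq (c := c) f hf
  obtain ⟨ψ, h', h1, h2⟩ := h.inv_comp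
  exact ⟨⟨φ, ψ, h1, h2⟩, h, h'⟩

/-- The isomorphism that permutes the factors by a bijection respecting the labels. -/
def permIso (c : K → T) {A B : Word K} (f : A.pts ≃ B.pts) (hf : ∀ p, B.lbl (f p) = A.lbl p) :
    A.obj c ≅ B.obj c :=
  (exists_permIso c f hf).choose

theorem struct_permIso (c : K → T) {A B : Word K} (f : A.pts ≃ B.pts)
    (hf : ∀ p, B.lbl (f p) = A.lbl p) : Struct c f (permIso c f hf).hom :=
  (exists_permIso c f hf).choose_spec.1

end PermIso

section RowPoints

/-- The permutation of the letters of a word of a row by a vertical diagram. -/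
def vertEquiv {R S : Row} (e : Fin R.black ≃ Fin S.black) (g : Fin R.white ≃ Fin S.white) :
    (rowWord R).pts ≃ (rowWord S).pts :=
  (rowEquiv R).trans ((Equiv.sumCongr e g).trans (rowEquiv S).symm)

variable {R S : Row}

theorem lbl_vertEquiv (e : Fin R.black ≃ Fin S.black) (g : Fin R.white ≃ Fin S.white)
    (p : (rowWord R).pts) : (rowWord S).lbl (vertEquiv e g p) = (rowWord R).lbl p := by
  rw [lbl_rowWord, lbl_rowWord]
  rcases h : rowEquiv R p with y | y <;> simp [vertEquiv, h]

/-- The letter of a black dot. -/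
def bpt (R : Row) (i : Fin R.black) : (rowWord R).pts := (rowEquiv R).symm (Sum.inl i)

/-- The letter of a white dot. -/
def wpt (R : Row) (i : Fin R.white) : (rowWord R).pts := (rowEquiv R).symm (Sum.inr i)

theorem row_cases (x : (rowWord R).pts) : (∃ i, bpt R i = x) ∨ ∃ i, wpt R i = x := by
  obtain ⟨x, rfl⟩ := (rowEquiv R).symm.surjective x
  rcases x with x | x
  · exact .inl ⟨x, rfl⟩
  · exact .inr ⟨x, rfl⟩

theorem vertEquiv_bpt (e : Fin R.black ≃ Fin S.black) (g : Fin R.white ≃ Fin S.white)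
    (i : Fin R.black) : vertEquiv e g (bpt R i) = bpt S (e i) := by
  simp [vertEquiv, bpt]

theorem vertEquiv_wpt (e : Fin R.black ≃ Fin S.black) (g : Fin R.white ≃ Fin S.white)
    (i : Fin R.white) : vertEquiv e g (wpt R i) = wpt S (g i) := by
  simp [vertEquiv, wpt]

theorem rowTensorEquiv_inl_bpt (i : Fin R.black) :
    rowTensorEquiv R S (Sum.inl (bpt R i)) = bpt (R.tensor S) (Fin.castAdd S.black i) := by
  simp [rowTensorEquiv, bpt]

theorem rowTensorEquiv_inl_wpt (i : Fin R.white) :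
    rowTensorEquiv R S (Sum.inl (wpt R i)) = wpt (R.tensor S) (Fin.castAdd S.white i) := by
  simp [rowTensorEquiv, wpt]

theorem rowTensorEquiv_inr_bpt (i : Fin S.black) :
    rowTensorEquiv R S (Sum.inr (bpt S i)) = bpt (R.tensor S) (Fin.natAdd R.black i) := by
  simp [rowTensorEquiv, bpt]

theorem rowTensorEquiv_inr_wpt (i : Fin S.white) :
    rowTensorEquiv R S (Sum.inr (wpt S i)) = wpt (R.tensor S) (Fin.natAdd R.white i) := by
  simp [rowTensorEquiv, wpt]

/-- The empty word, as compared with the word of the empty row. -/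
def rowUnitEquiv : (Word.unit : Word Bool).pts ≃ (rowWord Row.unit).pts :=
  (Equiv.equivOfIsEmpty Empty (Fin 0 ⊕ Fin 0)).trans (rowEquiv Row.unit).symm

theorem assoc_points (Q R S : Row) (x : (((rowWord Q).tensor (rowWord R)).tensor (rowWord S)).pts) :
    vertEquiv (R := (Q.tensor R).tensor S) (S := Q.tensor (R.tensor S))
      (finCongr (Nat.add_assoc _ _ _)) (finCongr (Nat.add_assoc _ _ _))
      (rowTensorEquiv (Q.tensor R) S (Sum.map (rowTensorEquiv Q R) id x)) =
    rowTensorEquiv Q (R.tensor S) (Sum.map id (rowTensorEquiv R S) (Equiv.sumAssoc _ _ _ x)) := by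
  rcases x with (x | x) | x
  · obtain ⟨i, rfl⟩ | ⟨i, rfl⟩ := row_cases x
    · refine (Equiv.congr_arg (Equiv.congr_arg
        (congrArg Sum.inl (rowTensorEquiv_inl_bpt i)))).trans ?_
      refine (Equiv.congr_arg (rowTensorEquiv_inl_bpt _)).trans ?_
      refine (vertEquiv_bpt _ _ _).trans ?_
      refine Eq.trans ?_ (rowTensorEquiv_inl_bpt i).symm
      rfl
    · refine (Equiv.congr_arg (Equiv.congr_arg
        (congrArg Sum.inl (rowTensorEquiv_inl_wpt i)))).trans ?_
      refine (Equiv.congr_arg (rowTensorEquiv_inl_wpt _)).trans ?_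
      refine (vertEquiv_wpt _ _ _).trans ?_
      refine Eq.trans ?_ (rowTensorEquiv_inl_wpt i).symm
      rfl
  · obtain ⟨i, rfl⟩ | ⟨i, rfl⟩ := row_cases x
    · refine (Equiv.congr_arg (Equiv.congr_arg
        (congrArg Sum.inl (rowTensorEquiv_inr_bpt i)))).trans ?_
      refine (Equiv.congr_arg (rowTensorEquiv_inl_bpt _)).trans ?_
      refine (vertEquiv_bpt _ _ _).trans ?_
      refine Eq.trans ?_ (Equiv.congr_arg (congrArg Sum.inr (rowTensorEquiv_inl_bpt i))).symm
      refine Eq.trans ?_ (rowTensorEquiv_inr_bpt _).symm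
      rfl
    · refine (Equiv.congr_arg (Equiv.congr_arg
        (congrArg Sum.inl (rowTensorEquiv_inr_wpt i)))).trans ?_
      refine (Equiv.congr_arg (rowTensorEquiv_inl_wpt _)).trans ?_
      refine (vertEquiv_wpt _ _ _).trans ?_
      refine Eq.trans ?_ (Equiv.congr_arg (congrArg Sum.inr (rowTensorEquiv_inl_wpt i))).symm
      refine Eq.trans ?_ (rowTensorEquiv_inr_wpt _).symm
      rfl
  · obtain ⟨i, rfl⟩ | ⟨i, rfl⟩ := row_cases x
    · refine (Equiv.congr_arg (rowTensorEquiv_inr_bpt _)).trans ?_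
      refine (vertEquiv_bpt _ _ _).trans ?_
      refine Eq.trans ?_ (Equiv.congr_arg (congrArg Sum.inr (rowTensorEquiv_inr_bpt i))).symm
      refine Eq.trans ?_ (rowTensorEquiv_inr_bpt _).symm
      exact congrArg (bpt _) (Fin.ext (Nat.add_assoc _ _ _))
    · refine (Equiv.congr_arg (rowTensorEquiv_inr_wpt _)).trans ?_
      refine (vertEquiv_wpt _ _ _).trans ?_
      refine Eq.trans ?_ (Equiv.congr_arg (congrArg Sum.inr (rowTensorEquiv_inr_wpt i))).symm
      refine Eq.trans ?_ (rowTensorEquiv_inr_wpt _).symm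
      exact congrArg (wpt _) (Fin.ext (Nat.add_assoc _ _ _))

theorem left_points (R : Row) (x : (rowWord R).pts) :
    vertEquiv (R := Row.unit.tensor R) (S := R)
      (finCongr (Nat.zero_add _)) (finCongr (Nat.zero_add _))
      (rowTensorEquiv Row.unit R (Sum.inr x)) = x := by
  obtain ⟨i, rfl⟩ | ⟨i, rfl⟩ := row_cases x
  · refine (Equiv.congr_arg (rowTensorEquiv_inr_bpt _)).trans ?_
    refine (vertEquiv_bpt _ _ _).trans ?_
    exact congrArg (bpt _) (Fin.ext (Nat.zero_add _))
  · refine (Equiv.congr_arg (rowTensorEquiv_inr_wpt _)).trans ?_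
    refine (vertEquiv_wpt _ _ _).trans ?_
    exact congrArg (wpt _) (Fin.ext (Nat.zero_add _))

theorem right_points (R : Row) (x : (rowWord R).pts) :
    vertEquiv (R := R.tensor Row.unit) (S := R)
      (finCongr (Nat.add_zero _)) (finCongr (Nat.add_zero _))
      (rowTensorEquiv R Row.unit (Sum.inl x)) = x := by
  obtain ⟨i, rfl⟩ | ⟨i, rfl⟩ := row_cases x
  · refine (Equiv.congr_arg (rowTensorEquiv_inl_bpt _)).trans ?_
    exact vertEquiv_bpt _ _ _
  · refine (Equiv.congr_arg (rowTensorEquiv_inl_wpt _)).trans ?_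
    exact vertEquiv_wpt _ _ _

theorem cross_points (R S : Row) (x : ((rowWord R).tensor (rowWord S)).pts) :
    vertEquiv (R := R.tensor S) (S := S.tensor R) finAddFlip finAddFlip (rowTensorEquiv R S x) =
      rowTensorEquiv S R (Sum.swap x) := by
  rcases x with x | x
  · obtain ⟨i, rfl⟩ | ⟨i, rfl⟩ := row_cases x
    · refine (Equiv.congr_arg (rowTensorEquiv_inl_bpt _)).trans ?_
      refine (vertEquiv_bpt _ _ _).trans (Eq.trans ?_ (rowTensorEquiv_inr_bpt _).symm)
      exact congrArg (bpt _) (finAddFlip_apply_castAdd _ _)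
    · refine (Equiv.congr_arg (rowTensorEquiv_inl_wpt _)).trans ?_
      refine (vertEquiv_wpt _ _ _).trans (Eq.trans ?_ (rowTensorEquiv_inr_wpt _).symm)
      exact congrArg (wpt _) (finAddFlip_apply_castAdd _ _)
  · obtain ⟨i, rfl⟩ | ⟨i, rfl⟩ := row_cases x
    · refine (Equiv.congr_arg (rowTensorEquiv_inr_bpt _)).trans ?_
      refine (vertEquiv_bpt _ _ _).trans (Eq.trans ?_ (rowTensorEquiv_inl_bpt _).symm)
      exact congrArg (bpt _) (finAddFlip_apply_natAdd _ _)
    · refine (Equiv.congr_arg (rowTensorEquiv_inr_wpt _)).trans ?_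
      refine (vertEquiv_wpt _ _ _).trans (Eq.trans ?_ (rowTensorEquiv_inl_wpt _).symm)
      exact congrArg (wpt _) (finAddFlip_apply_natAdd _ _)

end RowPoints

section RowFunctor

variable {T : Type u} [Category.{v} T] [MonoidalCategory T] [SymmetricCategory T]
  [Preadditive T] [Linear ℂ T] [MonoidalPreadditive T] [MonoidalLinear ℂ T]
variable (c : Bool → T) [ExactPairing (c true) (c false)]

/-- The linear extension of `diagMor`. -/
def rowMap {t : ℂ} (X Y : RepGLZero t) :
    RepGLZero.Mor X Y →ₗ[ℂ] ((rowWord X.row).obj c ⟶ (rowWord Y.row).obj c) :=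
  Finsupp.linearCombination ℂ fun σ => diagMor c σ

theorem rowMap_basis {t : ℂ} {X Y : RepGLZero t} (σ : Diag X.row Y.row) :
    rowMap c X Y (RepGLZero.basis σ) = diagMor c σ := by
  simp [rowMap]

theorem rowMap_compMor {t : ℂ} (ht : loop c = t • 𝟙 (𝟙_ T)) {X Y Z : RepGLZero t}
    (f : RepGLZero.Mor X Y) (g : RepGLZero.Mor Y Z) :
    rowMap c X Z (RepGLZero.compMor X Y Z f g) = rowMap c X Y f ≫ rowMap c Y Z g := by
  refine RepGLZero.mor_induction f ?_ ?_ ?_ fun σ => RepGLZero.mor_induction g ?_ ?_ ?_ fun τ => ?_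
  · simp
  · intro f f' hf hf'
    simp only [map_add, LinearMap.add_apply, hf, hf', Preadditive.add_comp]
  · intro r f hf
    simp only [map_smul, LinearMap.smul_apply, hf, Linear.smul_comp]
  · simp
  · intro f f' hf hf'
    simp only [map_add, hf, hf', Preadditive.comp_add]
  · intro r f hf
    simp only [map_smul, hf, Linear.comp_smul]
  · rw [RepGLZero.compMor_basis, rowMap_basis, rowMap_basis, diagMor_comp ht, map_smul,
      rowMap_basis]

variable {t : ℂ} (ht : loop c = t • 𝟙 (𝟙_ T))

/-- The functor `[l, m] ↦ X ⊗ ⋯ ⊗ X ⊗ X* ⊗ ⋯ ⊗ X*`, where `c` stands for the pair of `X`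
and `X*`. -/
def rowFunctor : RepGLZero t ⥤ T where
  obj R := (rowWord R.row).obj c
  map {X Y} f := rowMap c X Y f
  map_id X := (rowMap_basis c _).trans (diagMor_id ht X.row)
  map_comp f g := rowMap_compMor c ht f g

instance : (rowFunctor c ht).Additive where
  map_add {X Y f g} := map_add (rowMap c X Y) f g

instance : (rowFunctor c ht).Linear ℂ where
  map_smul {X Y} f r := map_smul (rowMap c X Y) r f

theorem struct_rowFunctor_map {X Y : RepGLZero t} (e : Fin X.row.black ≃ Fin Y.row.black)
    (g : Fin X.row.white ≃ Fin Y.row.white) :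
    Struct c (vertEquiv e g)
      ((rowFunctor c ht).map (show X ⟶ Y from RepGLZero.basis (vert e g))) := by
  have h := struct_permIso c (vertEquiv e g) (lbl_vertEquiv e g)
  have h2 : (rowFunctor c ht).map (show X ⟶ Y from RepGLZero.basis (vert e g)) = _ :=
    (rowMap_basis c _).trans (diagMor_vert ht e g h)
  rw [h2]
  exact h

/-- The tensorator of `rowFunctor`. -/
def rowTensorIso (X Y : RepGLZero t) :
    (rowWord X.row).obj c ⊗ (rowWord Y.row).obj c ≅ (rowWord (X.row.tensor Y.row)).obj c :=
  permIso c (rowTensorEquiv X.row Y.row) (lbl_rowTensorEquiv X.row Y.row)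

theorem struct_rowTensorIso (X Y : RepGLZero t) :
    Struct c (rowTensorEquiv X.row Y.row) (rowTensorIso c X Y).hom :=
  struct_permIso c _ _

theorem rowMap_tensorMor {X Y X' Y' : RepGLZero t} (f : RepGLZero.Mor X Y)
    (g : RepGLZero.Mor X' Y') :
    (rowMap c X Y f ⊗ₘ rowMap c X' Y' g) ≫ (rowTensorIso c Y Y').hom =
      (rowTensorIso c X X').hom ≫ rowMap c ⟨X.row.tensor X'.row⟩ ⟨Y.row.tensor Y'.row⟩
        (RepGLZero.tensorMor X Y X' Y' f g) := by
  refine RepGLZero.mor_induction f ?_ ?_ ?_ fun σ => RepGLZero.mor_induction g ?_ ?_ ?_ fun τ => ?_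
  · simp
  · intro f f' hf hf'
    simp only [map_add, LinearMap.add_apply, MonoidalPreadditive.add_tensor, hf, hf',
      Preadditive.add_comp, Preadditive.comp_add]
  · intro r f hf
    simp only [map_smul, LinearMap.smul_apply, MonoidalCategory.tensorHom_def,
      MonoidalLinear.smul_whiskerRight, Linear.smul_comp, Linear.comp_smul] at hf ⊢
    rw [hf]
  · simp
  · intro f f' hf hf'
    simp only [map_add, MonoidalPreadditive.tensor_add, hf, hf',
      Preadditive.add_comp, Preadditive.comp_add]
  · intro r f hf
    simp only [map_smul, MonoidalCategory.tensorHom_def,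
      MonoidalLinear.whiskerLeft_smul, Linear.smul_comp, Linear.comp_smul] at hf ⊢
    rw [hf]
  · rw [RepGLZero.tensorMor_basis, rowMap_basis, rowMap_basis, rowMap_basis]
    exact diagMor_union σ τ (struct_rowTensorIso c X X') (struct_rowTensorIso c Y Y')

theorem lbl_rowUnitEquiv (p : (Word.unit : Word Bool).pts) :
    (rowWord Row.unit).lbl (rowUnitEquiv p) = (Word.unit : Word Bool).lbl p :=
  p.elim

/-- The symmetric monoidal structure of `rowFunctor`. -/
def rowCore : (rowFunctor c ht).CoreMonoidal where
  εIso := permIso c rowUnitEquiv lbl_rowUnitEquiv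
  μIso X Y := rowTensorIso c X Y
  μIso_hom_natural_left {X Y} f X' := by
    have h := rowMap_tensorMor c f (𝟙 X')
    rw [← MonoidalCategory.tensorHom_id, ← (rowFunctor c ht).map_id]
    exact h
  μIso_hom_natural_right {X Y} X' f := by
    have h := rowMap_tensorMor c (𝟙 X') f
    rw [← MonoidalCategory.id_tensorHom, ← (rowFunctor c ht).map_id]
    exact h
  associativity X Y Z :=
    (((struct_rowTensorIso c X Y).right _).comp ((struct_rowTensorIso c (X ⊗ Y) Z).comp
      (struct_rowFunctor_map c ht _ _))).unique
    (((Struct.assoc _ _ _).comp (((struct_rowTensorIso c Y Z).left _).comp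
      (struct_rowTensorIso c X (Y ⊗ Z)))).of_eq fun x =>
        (assoc_points X.row Y.row Z.row x).symm)
  left_unitality X :=
    (Struct.leftU _).unique ((((struct_permIso c rowUnitEquiv lbl_rowUnitEquiv).right _).comp
      ((struct_rowTensorIso c (𝟙_ _) X).comp (struct_rowFunctor_map c ht _ _))).of_eq fun x => by
        rcases x with x | x
        · exact x.elim
        · exact left_points X.row x)
  right_unitality X :=
    (Struct.rightU _).unique ((((struct_permIso c rowUnitEquiv lbl_rowUnitEquiv).left _).comp
      ((struct_rowTensorIso c X (𝟙_ _)).comp (struct_rowFunctor_map c ht _ _))).of_eq fun x => by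
        rcases x with x | x
        · exact right_points X.row x
        · exact x.elim)

instance : (rowFunctor c ht).Braided where
  toMonoidal := (rowCore c ht).toMonoidal
  braided X Y :=
    ((struct_rowTensorIso c X Y).comp (struct_rowFunctor_map c ht _ _)).unique
      (((Struct.braid _ _).comp (struct_rowTensorIso c Y X)).of_eq fun x =>
        (cross_points X.row Y.row x).symm)

/-- The object `[1, 0]` goes to `X`. -/
def rowFunctorStd : (rowFunctor c ht).obj ⟨⟨1, 0⟩⟩ ≅ c true :=
  permIso c (A := rowWord ⟨1, 0⟩) (B := .of true)
    ((rowEquiv ⟨1, 0⟩).trans ((Equiv.sumEmpty (Fin 1) (Fin 0)).trans (Equiv.ofUnique (Fin 1) Unit)))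
    (fun p => by
      rw [lbl_rowWord]
      rcases h : rowEquiv ⟨1, 0⟩ p with y | y
      · rfl
      · exact y.elim0)

end RowFunctor

/-! ### The duality between `[1, 0]` and `[0, 1]` -/

section Duality

/-- The one-dot rows: a black dot for `true`, a white dot for `false`. -/
def dotRow : Bool → Row
  | true => ⟨1, 0⟩
  | false => ⟨0, 1⟩

/-- The cup from the empty row to `[1, 1]`. -/
def cupDiag : Diag Row.unit ((dotRow true).tensor (dotRow false)) where
  toFun := Sum.elim (fun i => i.elim0) Sum.inl
  invFun := Sum.elim Sum.inr (fun i => i.elim0)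
  left_inv := by
    rintro (i | i)
    · exact i.elim0
    · rfl
  right_inv := by
    rintro (i | i)
    · rfl
    · exact i.elim0

/-- The cap from `[1, 1]` to the empty row. -/
def capDiag : Diag ((dotRow false).tensor (dotRow true)) Row.unit where
  toFun := Sum.elim Sum.inr (fun i => i.elim0)
  invFun := Sum.elim (fun i => i.elim0) Sum.inl
  left_inv := by
    rintro (i | i)
    · rfl
    · exact i.elim0
  right_inv := by
    rintro (i | i)
    · exact i.elim0
    · rfl

/-- The two one-dot objects. -/
def dotObj (t : ℂ) (k : Bool) : RepGLZero t := ⟨dotRow k⟩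

theorem diag_eq_of_le_one {R S : Row} (h : R.black + S.white ≤ 1) (σ τ : Diag R S) : σ = τ := by
  have hc := Fintype.card_congr σ
  simp only [Fintype.card_sum, Fintype.card_fin] at hc
  have : Subsingleton (Fin S.black ⊕ Fin R.white) := by
    rw [← Fintype.card_le_one_iff_subsingleton]
    simp only [Fintype.card_sum, Fintype.card_fin]
    omega
  exact Equiv.ext fun x => Subsingleton.elim _ _

namespace RepGLZero

variable {t : ℂ}

/-- A composite of two diagrams without closed loops. -/
theorem comp_basis_of_eq {X Y Z : RepGLZero t} (σ : Diag X.row Y.row) (τ : Diag Y.row Z.row)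
    (ρ : Diag X.row Z.row) (h : concat σ τ = (ρ, 0)) :
    (show X ⟶ Y from basis σ) ≫ (show Y ⟶ Z from basis τ) = basis ρ := by
  rw [comp_basis, h]
  exact one_smul ℂ _

theorem comp_basis_of_le_one {X Y Z : RepGLZero t} {σ : Diag X.row Y.row} {τ : Diag Y.row Z.row}
    {ρ : Diag X.row Z.row} (h : X.row.black + Z.row.white ≤ 1) (h0 : (concat σ τ).2 = 0) :
    (show X ⟶ Y from basis σ) ≫ (show Y ⟶ Z from basis τ) = basis ρ :=
  comp_basis_of_eq σ τ ρ (Prod.ext (diag_eq_of_le_one h _ _) h0)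

instance : ExactPairing (dotObj t true) (dotObj t false) where
  coevaluation' := basis cupDiag
  evaluation' := basis capDiag
  coevaluation_evaluation' := by
    have h1 : (show _ ⟶ _ from (α_ (dotObj t false) (dotObj t true) (dotObj t false)).inv) ≫
        (show dotObj t false ⊗ dotObj t true ⟶ 𝟙_ _ from basis capDiag) ▷ dotObj t false =
        basis (concat (assocDiagInv _ _ _) (union capDiag (idDiag (dotRow false)))).1 := by
      refine (congrArg (fun x => _ ≫ x) (tensorMor_basis capDiag (idDiag (dotRow false)))).trans ?_
      exact comp_basis_of_eq _ _ _ (Prod.ext rfl rfl)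
    rw [h1]
    refine (congrArg (fun x => x ≫ _) (tensorMor_basis (idDiag (dotRow false)) cupDiag)).trans ?_
    refine (comp_basis_of_le_one (ρ := vert (Equiv.refl _) (Equiv.refl _)) le_rfl rfl).trans ?_
    exact (comp_basis_of_le_one le_rfl rfl).symm
  evaluation_coevaluation' := by
    have h1 : (show _ ⟶ _ from (α_ (dotObj t true) (dotObj t false) (dotObj t true)).hom) ≫
        dotObj t true ◁ (show dotObj t false ⊗ dotObj t true ⟶ 𝟙_ _ from basis capDiag)  =
        basis (concat (assocDiag _ _ _) (union (idDiag (dotRow true)) capDiag)).1 := by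
      refine (congrArg (fun x => _ ≫ x) (tensorMor_basis (idDiag (dotRow true)) capDiag)).trans ?_
      exact comp_basis_of_eq _ _ _ (Prod.ext rfl rfl)
    rw [h1]
    refine (congrArg (fun x => x ≫ _) (tensorMor_basis cupDiag (idDiag (dotRow true)))).trans ?_
    refine (comp_basis_of_le_one (ρ := vert (Equiv.refl _) (Equiv.refl _)) le_rfl rfl).trans ?_
    exact (comp_basis_of_le_one le_rfl rfl).symm

/-- The loop of the diagram category has the value `t`. -/
theorem loop_dotObj : loop (dotObj t) = t • 𝟙 (𝟙_ (RepGLZero t)) := by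
  have h1 : (β_ (dotObj t true) (dotObj t false)).hom ≫
      (show dotObj t false ⊗ dotObj t true ⟶ 𝟙_ _ from basis capDiag) =
      basis (concat (crossDiag _ _) capDiag).1 :=
    comp_basis_of_eq _ _ _ (Prod.ext rfl rfl)
  refine (congrArg (fun x => _ ≫ x) h1).trans ?_
  refine (comp_basis cupDiag _).trans ?_
  have h2 : concat cupDiag (concat (crossDiag (dotRow true) (dotRow false)) capDiag).1 =
      (idDiag _, 1) := by decide
  refine (congrArg scaled h2).trans ?_
  change t ^ 1 • _ = _
  rw [pow_one]
  rfl

end RepGLZero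

end Duality

/-! ### Matrices of diagrams -/

section Matrices

open RepGLZero

variable {t : ℂ}

/-- The dots of an object `[l, m]`. -/
abbrev Dots (X : RepGLZero t) : Type := Fin X.row.black ⊕ Fin X.row.white

open scoped Classical in
/-- The number `1` if a proposition holds, and `0` otherwise. -/
def ind (p : Prop) : ℕ := if p then 1 else 0

theorem ind_mul (p q : Prop) : ind p * ind q = ind (p ∧ q) := by
  unfold ind
  split_ifs <;> simp_all

theorem ind_congr {p q : Prop} (h : p ↔ q) : ind p = ind q := by
  rw [propext h]

theorem sum_ind_mul {α : Type} [Fintype α] (a : α) {p : α → Prop} (hp : ∀ b, p b ↔ b = a)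
    (f : α → ℕ) : ∑ b, ind (p b) * f b = f a := by
  classical
  rw [Finset.sum_eq_single a]
  · simp [ind, hp]
  · intro b _ hb
    simp [ind, hp, hb]
  · simp

/-- The morphism is a power of `t` times a diagram, and `m` is the matrix of this diagram for two
colours, a loop counting as the number of colours.  This makes sense for every `t`, and determines
the morphism. -/
def HasMat {X Y : RepGLZero t} (φ : X ⟶ Y) (m : (Dots X → Bool) → (Dots Y → Bool) → ℕ) : Prop :=
  ∃ P : Diag X.row Y.row × ℕ, φ = scaled P ∧ ∀ u w, Fintype.card Bool ^ P.2 *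
    entry P.1 (u ∘ Sum.inl) (u ∘ Sum.inr) (w ∘ Sum.inl) (w ∘ Sum.inr) = m u w

namespace HasMat

variable {X Y Z X' Y' : RepGLZero t}

theorem unique {φ φ' : X ⟶ Y} {m : (Dots X → Bool) → (Dots Y → Bool) → ℕ} (h : HasMat φ m)
    (h' : HasMat φ' m) : φ = φ' := by
  obtain ⟨P, rfl, h⟩ := h
  obtain ⟨Q, rfl, h'⟩ := h'
  have : P = Q := entry_ext fun a b a' b' =>
    (h (Sum.elim a b) (Sum.elim a' b')).trans (h' (Sum.elim a b) (Sum.elim a' b')).symm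
  rw [this]

theorem congr {φ : X ⟶ Y} {m m' : (Dots X → Bool) → (Dots Y → Bool) → ℕ} (h : HasMat φ m)
    (h' : ∀ u w, m u w = m' u w) : HasMat φ m' := by
  obtain ⟨P, rfl, h⟩ := h
  exact ⟨P, rfl, fun u w => (h u w).trans (h' u w)⟩

theorem basis (σ : Diag X.row Y.row) : HasMat (show X ⟶ Y from RepGLZero.basis σ)
    fun u w => entry σ (u ∘ Sum.inl) (u ∘ Sum.inr) (w ∘ Sum.inl) (w ∘ Sum.inr) :=
  ⟨(σ, 0), (one_smul ℂ _).symm, fun u w => by simp⟩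

theorem comp {φ : X ⟶ Y} {ψ : Y ⟶ Z} {m : (Dots X → Bool) → (Dots Y → Bool) → ℕ}
    {m' : (Dots Y → Bool) → (Dots Z → Bool) → ℕ} (h : HasMat φ m) (h' : HasMat ψ m') :
    HasMat (φ ≫ ψ) fun u w => ∑ v, m u v * m' v w := by
  obtain ⟨P, rfl, h⟩ := h
  obtain ⟨Q, rfl, h'⟩ := h'
  refine ⟨((concat P.1 Q.1).1, P.2 + Q.2 + (concat P.1 Q.1).2), ?_, fun u w => ?_⟩
  · refine (Linear.smul_comp _ _ _ _ _ _).trans ?_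
    refine (congrArg (fun x => t ^ P.2 • x) ((Linear.comp_smul _ _ _ _ _ _).trans
      (congrArg (fun x => t ^ Q.2 • x) (comp_basis P.1 Q.1)))).trans ?_
    change t ^ P.2 • t ^ Q.2 • t ^ _ • RepGLZero.basis _ = t ^ _ • RepGLZero.basis _
    rw [smul_smul, smul_smul, ← pow_add, ← pow_add, add_assoc]
  · dsimp only
    rw [pow_add, mul_assoc, sum_entry, Finset.mul_sum,
      ← (Equiv.sumArrowEquivProdArrow (Fin Y.row.black) (Fin Y.row.white) Bool).sum_comp]
    refine Finset.sum_congr rfl fun v _ => ?_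
    rw [← h, ← h', pow_add]
    change _ * (entry _ _ _ (v ∘ Sum.inl) (v ∘ Sum.inr) * entry _ (v ∘ Sum.inl) (v ∘ Sum.inr) _ _)
      = _
    ring

theorem tensor {φ : X ⟶ Y} {ψ : X' ⟶ Y'} {m : (Dots X → Bool) → (Dots Y → Bool) → ℕ}
    {m' : (Dots X' → Bool) → (Dots Y' → Bool) → ℕ} (h : HasMat φ m) (h' : HasMat ψ m') :
    HasMat (φ ⊗ₘ ψ) fun u w =>
      m (u ∘ Sum.map (Fin.castAdd _) (Fin.castAdd _)) (w ∘ Sum.map (Fin.castAdd _) (Fin.castAdd _))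
      * m' (u ∘ Sum.map (Fin.natAdd _) (Fin.natAdd _))
        (w ∘ Sum.map (Fin.natAdd _) (Fin.natAdd _)) := by
  obtain ⟨P, rfl, h⟩ := h
  obtain ⟨Q, rfl, h'⟩ := h'
  refine ⟨(union P.1 Q.1, P.2 + Q.2), ?_, fun u w => ?_⟩
  · change tensorMor _ _ _ _ (t ^ P.2 • RepGLZero.basis P.1) (t ^ Q.2 • RepGLZero.basis Q.1) = _
    rw [map_smul, map_smul, LinearMap.smul_apply, tensorMor_basis, smul_smul, mul_comm, ← pow_add]
  · dsimp only
    rw [pow_add, entry_union, mul_mul_mul_comm, ← h, ← h']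
    rfl

theorem vert (e : Fin X.row.black ≃ Fin Y.row.black) (g : Fin X.row.white ≃ Fin Y.row.white) :
    HasMat (show X ⟶ Y from RepGLZero.basis (vert e g)) fun u w =>
      ind (u = w ∘ Sum.map e g) := by
  classical
  refine (basis _).congr fun u w => ?_
  rw [entry_vert]
  unfold ind
  congr 1
  rw [eq_iff_iff]
  constructor
  · rintro ⟨h1, h2⟩
    funext x
    rcases x with x | x
    · exact congrFun h1 x
    · exact congrFun h2 x
  · rintro rfl
    exact ⟨rfl, rfl⟩

end HasMat

/-! ### The dots of a word -/

/-- The letters of a word are the dots of its object. -/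
def wordEquiv (t : ℂ) : (A : Word Bool) → A.pts ≃ Dots (A.obj (dotObj t))
  | .unit => Equiv.equivOfIsEmpty Empty (Fin 0 ⊕ Fin 0)
  | .of true => (Equiv.ofUnique Unit (Fin 1)).trans (Equiv.sumEmpty (Fin 1) (Fin 0)).symm
  | .of false => (Equiv.ofUnique Unit (Fin 1)).trans (Equiv.emptySum (Fin 0) (Fin 1)).symm
  | .tensor A B => (Equiv.sumCongr (wordEquiv t A) (wordEquiv t B)).trans
      ((Equiv.sumSumSumComm _ _ _ _).trans (Equiv.sumCongr finSumFinEquiv finSumFinEquiv))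

theorem wordEquiv_inl (A B : Word Bool) (x : A.pts) :
    wordEquiv t (.tensor A B) (Sum.inl x) =
      Sum.map (Fin.castAdd _) (Fin.castAdd _) (wordEquiv t A x) := by
  rcases h : wordEquiv t A x with y | y <;> simp [wordEquiv, h] <;>
    exact finSumFinEquiv_apply_left _

theorem wordEquiv_inr (A B : Word Bool) (x : B.pts) :
    wordEquiv t (.tensor A B) (Sum.inr x) =
      Sum.map (Fin.natAdd _) (Fin.natAdd _) (wordEquiv t B x) := by
  rcases h : wordEquiv t B x with y | y <;> simp [wordEquiv, h] <;>
    exact finSumFinEquiv_apply_right _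

theorem lbl_wordEquiv : (A : Word Bool) → (x : A.pts) →
    Sum.elim (fun _ => true) (fun _ => false) (wordEquiv t A x) = A.lbl x
  | .of true, _ => rfl
  | .of false, _ => rfl
  | .tensor A B, Sum.inl x => by
    rw [wordEquiv_inl, Sum.elim_map]
    exact lbl_wordEquiv A x
  | .tensor A B, Sum.inr x => by
    rw [wordEquiv_inr, Sum.elim_map]
    exact lbl_wordEquiv B x

theorem map_blockSum_castAdd {a b a' b' p q p' q' : ℕ} (e : Fin a ≃ Fin a') (e' : Fin b ≃ Fin b')
    (g : Fin p ≃ Fin p') (g' : Fin q ≃ Fin q') (y : Fin a ⊕ Fin p) :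
    Sum.map (blockSum e e') (blockSum g g') (Sum.map (Fin.castAdd b) (Fin.castAdd q) y) =
      Sum.map (Fin.castAdd b') (Fin.castAdd q') (Sum.map e g y) := by
  rcases y with y | y <;> simp [blockSum_castAdd]

theorem map_blockSum_natAdd {a b a' b' p q p' q' : ℕ} (e : Fin a ≃ Fin a') (e' : Fin b ≃ Fin b')
    (g : Fin p ≃ Fin p') (g' : Fin q ≃ Fin q') (y : Fin b ⊕ Fin q) :
    Sum.map (blockSum e e') (blockSum g g') (Sum.map (Fin.natAdd a) (Fin.natAdd p) y) =
      Sum.map (Fin.natAdd a') (Fin.natAdd p') (Sum.map e' g' y) := by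
  rcases y with y | y <;> simp [blockSum_natAdd]

/-- The vertical diagram with strands `e` and `g` permutes the letters of the words by `f`. -/
def Permutes (t : ℂ) {A B : Word Bool} (f : A.pts ≃ B.pts)
    (e : Fin (A.obj (dotObj t)).row.black ≃ Fin (B.obj (dotObj t)).row.black)
    (g : Fin (A.obj (dotObj t)).row.white ≃ Fin (B.obj (dotObj t)).row.white) : Prop :=
  ∀ x, wordEquiv t B (f x) = Sum.map e g (wordEquiv t A x)

namespace Permutes

theorem symm {A B : Word Bool} {f : A.pts ≃ B.pts}
    {e : Fin (A.obj (dotObj t)).row.black ≃ Fin (B.obj (dotObj t)).row.black}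
    {g : Fin (A.obj (dotObj t)).row.white ≃ Fin (B.obj (dotObj t)).row.white}
    (h : Permutes t f e g) : Permutes t f.symm e.symm g.symm := by
  intro x
  obtain ⟨x, rfl⟩ := f.surjective x
  rw [h, Equiv.symm_apply_apply]
  rcases wordEquiv t A x with y | y <;> simp

theorem tensor {A B A' B' : Word Bool} {f : A.pts ≃ B.pts} {f' : A'.pts ≃ B'.pts}
    {e : Fin (A.obj (dotObj t)).row.black ≃ Fin (B.obj (dotObj t)).row.black}
    {g : Fin (A.obj (dotObj t)).row.white ≃ Fin (B.obj (dotObj t)).row.white}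
    {e' : Fin (A'.obj (dotObj t)).row.black ≃ Fin (B'.obj (dotObj t)).row.black}
    {g' : Fin (A'.obj (dotObj t)).row.white ≃ Fin (B'.obj (dotObj t)).row.white}
    (h : Permutes t f e g) (h' : Permutes t f' e' g') :
    Permutes t (A := .tensor A A') (B := .tensor B B') (Equiv.sumCongr f f')
      (blockSum e e') (blockSum g g') := by
  rintro (x | x)
  · refine (wordEquiv_inl _ _ _).trans ((congrArg _ (wordEquiv_inl _ _ _)).trans ?_).symm
    rw [h]
    exact map_blockSum_castAdd _ _ _ _ _
  · refine (wordEquiv_inr _ _ _).trans ((congrArg _ (wordEquiv_inr _ _ _)).trans ?_).symm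
    rw [h']
    exact map_blockSum_natAdd _ _ _ _ _

theorem assoc (A B C : Word Bool) :
    Permutes t (A := .tensor (.tensor A B) C) (B := .tensor A (.tensor B C)) (Equiv.sumAssoc _ _ _)
      (finCongr (Nat.add_assoc _ _ _)) (finCongr (Nat.add_assoc _ _ _)) := by
  rintro ((x | x) | x)
  · refine (wordEquiv_inl _ _ _).trans ((congrArg _ ((wordEquiv_inl _ _ _).trans
      (congrArg _ (wordEquiv_inl _ _ _)))).trans ?_).symm
    rcases wordEquiv t A x with y | y <;> rfl
  · refine (wordEquiv_inr _ _ _).trans (Eq.trans (congrArg _ (wordEquiv_inl _ _ _))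
      ((congrArg _ ((wordEquiv_inl _ _ _).trans (congrArg _ (wordEquiv_inr _ _ _)))).trans ?_).symm)
    rcases wordEquiv t B x with y | y <;> rfl
  · refine (wordEquiv_inr _ _ _).trans (Eq.trans (congrArg _ (wordEquiv_inr _ _ _))
      ((congrArg _ (wordEquiv_inr _ _ _)).trans ?_).symm)
    rcases wordEquiv t C x with y | y
    · exact congrArg Sum.inl (Fin.ext (Nat.add_assoc _ _ _))
    · exact congrArg Sum.inr (Fin.ext (Nat.add_assoc _ _ _))

theorem leftU (A : Word Bool) :
    Permutes t (A := .tensor .unit A) (B := A) (Equiv.emptySum Empty A.pts)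
      (finCongr (Nat.zero_add _)) (finCongr (Nat.zero_add _)) := by
  rintro (x | x)
  · exact x.elim
  · refine Eq.trans ?_ (congrArg _ (wordEquiv_inr _ _ _)).symm
    change wordEquiv t A x = _
    rcases wordEquiv t A x with y | y
    · exact congrArg Sum.inl (Fin.ext (Nat.zero_add _).symm)
    · exact congrArg Sum.inr (Fin.ext (Nat.zero_add _).symm)

theorem rightU (A : Word Bool) :
    Permutes t (A := .tensor A .unit) (B := A) (Equiv.sumEmpty A.pts Empty)
      (finCongr (Nat.add_zero _)) (finCongr (Nat.add_zero _)) := by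
  rintro (x | x)
  · refine Eq.trans ?_ (congrArg _ (wordEquiv_inl _ _ _)).symm
    change wordEquiv t A x = _
    rcases wordEquiv t A x with y | y <;> rfl
  · exact x.elim

theorem braid (A B : Word Bool) :
    Permutes t (A := .tensor A B) (B := .tensor B A) (Equiv.sumComm _ _)
      finAddFlip finAddFlip := by
  rintro (x | x)
  · refine (wordEquiv_inr _ _ _).trans ((congrArg _ (wordEquiv_inl _ _ _)).trans ?_).symm
    rcases wordEquiv t A x with y | y
    · exact congrArg Sum.inl (finAddFlip_apply_castAdd _ _)
    · exact congrArg Sum.inr (finAddFlip_apply_castAdd _ _)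
  · refine (wordEquiv_inl _ _ _).trans ((congrArg _ (wordEquiv_inr _ _ _)).trans ?_).symm
    rcases wordEquiv t B x with y | y
    · exact congrArg Sum.inl (finAddFlip_apply_natAdd _ _)
    · exact congrArg Sum.inr (finAddFlip_apply_natAdd _ _)

end Permutes

/-- In the diagram category, a symmetric structure morphism is a vertical diagram. -/
theorem Struct.exists_vert {A B : Word Bool} {f : A.pts ≃ B.pts}
    {φ : A.obj (dotObj t) ⟶ B.obj (dotObj t)} (h : Struct (dotObj t) f φ) :
    ∃ e g, φ = RepGLZero.basis (vert e g) ∧ Permutes t f e g := by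
  have hid : ∀ A : Word Bool, Permutes t (Equiv.refl A.pts) (Equiv.refl _) (Equiv.refl _) :=
    fun A x => by simp
  induction h with
  | id A => exact ⟨Equiv.refl _, Equiv.refl _, rfl, hid A⟩
  | comp _ _ ih ih' =>
    obtain ⟨e, g, rfl, h⟩ := ih
    obtain ⟨e', g', rfl, h'⟩ := ih'
    refine ⟨e.trans e', g.trans g', comp_vert', fun x => ?_⟩
    rw [Equiv.trans_apply, h', h, Sum.map_map]
    rfl
  | left C _ ih =>
    obtain ⟨e, g, rfl, h⟩ := ih
    exact ⟨_, _, (MonoidalCategory.id_tensorHom _ _).symm.trans tensor_vert, (hid C).tensor h⟩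
  | right C _ ih =>
    obtain ⟨e, g, rfl, h⟩ := ih
    exact ⟨_, _, (MonoidalCategory.tensorHom_id _ _).symm.trans tensor_vert, h.tensor (hid C)⟩
  | assoc A B C => exact ⟨_, _, rfl, .assoc A B C⟩
  | assoc_inv A B C => exact ⟨_, _, rfl, (Permutes.assoc A B C).symm⟩
  | leftU A => exact ⟨_, _, rfl, .leftU A⟩
  | leftU_inv A => exact ⟨_, _, rfl, (Permutes.leftU A).symm⟩
  | rightU A => exact ⟨_, _, rfl, .rightU A⟩
  | rightU_inv A => exact ⟨_, _, rfl, (Permutes.rightU A).symm⟩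
  | braid A B => exact ⟨_, _, rfl, .braid A B⟩

end Matrices

/-! ### Matrices of words and nets -/

section WordMatrices

open RepGLZero

/-- The sum over a finite type; no enumeration of the type is part of the data. -/
def tot {α : Type} [Finite α] (f : α → ℕ) : ℕ := (Fintype.ofFinite α).elems.sum f

section Tot

variable {α β : Type} [Finite α] [Finite β]

theorem tot_eq_sum [h : Fintype α] (f : α → ℕ) : tot f = ∑ x, f x := by
  have : Fintype.ofFinite α = h := Subsingleton.elim _ _
  unfold tot
  rw [this]
  rfl

theorem tot_equiv (e : α ≃ β) (f : α → ℕ) : tot f = tot fun y => f (e.symm y) := by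
  have := Fintype.ofFinite α
  have := Fintype.ofFinite β
  rw [tot_eq_sum, tot_eq_sum]
  exact Fintype.sum_equiv e _ _ fun x => by rw [e.symm_apply_apply]

theorem tot_mul_tot (f : α → ℕ) (g : β → ℕ) :
    tot f * tot g = tot fun p : α × β => f p.1 * g p.2 := by
  have := Fintype.ofFinite α
  have := Fintype.ofFinite β
  rw [tot_eq_sum, tot_eq_sum, tot_eq_sum, Finset.sum_mul_sum, ← Fintype.sum_prod_type']

theorem mul_tot (f : α → ℕ) (a : ℕ) : a * tot f = tot fun x => a * f x := by
  have := Fintype.ofFinite α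
  rw [tot_eq_sum, tot_eq_sum, Finset.mul_sum]

theorem tot_comm (f : α → β → ℕ) :
    tot (fun x => tot fun y => f x y) = tot fun y => tot fun x => f x y := by
  have := Fintype.ofFinite α
  have := Fintype.ofFinite β
  simp only [tot_eq_sum]
  exact Finset.sum_comm

theorem tot_ind_mul (a : α) {p : α → Prop} (hp : ∀ b, p b ↔ b = a) (f : α → ℕ) :
    tot (fun b => ind (p b) * f b) = f a := by
  classical
  have := Fintype.ofFinite α
  rw [tot_eq_sum, Finset.sum_eq_single a]
  · simp [ind, hp]
  · intro b _ hb
    simp [ind, hp, hb]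
  · simp

/-- A sum over `v` in which the factor depending on `x` determines `v`. -/
theorem tot_tot_mul_tot {V : Type} [Finite V] {p r : V → Prop} {q : V → α → Prop}
    {r' : V → β → Prop} (k : α → V) (hk : ∀ v x, p v ∧ q v x ↔ v = k x) :
    (tot fun v => (ind (p v) * tot fun x => ind (q v x)) *
      (ind (r v) * tot fun y => ind (r' v y))) =
        tot fun x => tot fun y => ind (r (k x) ∧ r' (k x) y) := by
  have h : ∀ v, (ind (p v) * tot fun x => ind (q v x)) * (ind (r v) * tot fun y => ind (r' v y)) =
      tot fun x => ind (v = k x) * tot fun y => ind (r v ∧ r' v y) := fun v => by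
    simp_rw [← hk, ← ind_mul, ← mul_tot]
    rw [mul_tot, mul_comm, mul_tot]
    congr 1
    funext x
    rw [mul_comm]
  simp_rw [h]
  rw [tot_comm]
  congr 1
  funext x
  exact tot_ind_mul (k x) (fun v => Iff.rfl) _

end Tot

variable {t : ℂ}

/-- Matrices of morphisms between words, with colourings of the letters as indices. -/
def WMat {A B : Word Bool} (φ : A.obj (dotObj t) ⟶ B.obj (dotObj t))
    (m : (A.pts → Bool) → (B.pts → Bool) → ℕ) : Prop :=
  HasMat φ fun u w => m (u ∘ wordEquiv t A) (w ∘ wordEquiv t B)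

namespace WMat

variable {A B C A' B' : Word Bool}

theorem congr {φ : A.obj (dotObj t) ⟶ B.obj (dotObj t)} {m m' : (A.pts → Bool) → (B.pts → Bool) → ℕ}
    (h : WMat φ m) (h' : ∀ u w, m u w = m' u w) : WMat φ m' :=
  HasMat.congr h fun _ _ => h' _ _

theorem comp {φ : A.obj (dotObj t) ⟶ B.obj (dotObj t)} {ψ : B.obj (dotObj t) ⟶ C.obj (dotObj t)}
    {m : (A.pts → Bool) → (B.pts → Bool) → ℕ} {m' : (B.pts → Bool) → (C.pts → Bool) → ℕ}
    (h : WMat φ m) (h' : WMat ψ m') : WMat (φ ≫ ψ) fun u w =>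
      tot fun v : B.pts → Bool => m u v * m' v w := by
  refine (HasMat.comp h h').congr fun u w => ?_
  rw [← tot_eq_sum]
  exact (tot_equiv ((wordEquiv t B).arrowCongr (Equiv.refl Bool))
    fun v => m (u ∘ wordEquiv t A) v * m' v (w ∘ wordEquiv t C)).symm

theorem tensor {φ : A.obj (dotObj t) ⟶ B.obj (dotObj t)} {ψ : A'.obj (dotObj t) ⟶ B'.obj (dotObj t)}
    {m : (A.pts → Bool) → (B.pts → Bool) → ℕ} {m' : (A'.pts → Bool) → (B'.pts → Bool) → ℕ}
    (h : WMat φ m) (h' : WMat ψ m') :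
    WMat (A := .tensor A A') (B := .tensor B B') (φ ⊗ₘ ψ) fun u w =>
      m (u ∘ Sum.inl) (w ∘ Sum.inl) * m' (u ∘ Sum.inr) (w ∘ Sum.inr) := by
  refine (HasMat.tensor h h').congr fun u w => ?_
  have h1 : ∀ (A A' : Word Bool) (u : Dots ((Word.tensor A A').obj (dotObj t)) → Bool),
      (u ∘ wordEquiv t (.tensor A A')) ∘ Sum.inl =
        (u ∘ Sum.map (Fin.castAdd _) (Fin.castAdd _)) ∘ wordEquiv t A := fun A A' u =>
    funext fun x => congrArg u (wordEquiv_inl A A' x)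
  have h2 : ∀ (A A' : Word Bool) (u : Dots ((Word.tensor A A').obj (dotObj t)) → Bool),
      (u ∘ wordEquiv t (.tensor A A')) ∘ Sum.inr =
        (u ∘ Sum.map (Fin.natAdd _) (Fin.natAdd _)) ∘ wordEquiv t A' := fun A A' u =>
    funext fun x => congrArg u (wordEquiv_inr A A' x)
  change _ = m ((u ∘ wordEquiv t (.tensor A A')) ∘ Sum.inl)
    ((w ∘ wordEquiv t (.tensor B B')) ∘ Sum.inl) * m' ((u ∘ wordEquiv t (.tensor A A')) ∘ Sum.inr)
    ((w ∘ wordEquiv t (.tensor B B')) ∘ Sum.inr)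
  rw [h1, h1, h2, h2]

theorem of_struct {f : A.pts ≃ B.pts} {φ : A.obj (dotObj t) ⟶ B.obj (dotObj t)}
    (h : Struct (dotObj t) f φ) : WMat φ fun u w => ind (u = w ∘ f) := by
  obtain ⟨e, g, rfl, hp⟩ := h.exists_vert
  refine (HasMat.vert e g).congr fun u w => ?_
  refine ind_congr ?_
  have hf : (w ∘ wordEquiv t B) ∘ f = (w ∘ Sum.map e g) ∘ wordEquiv t A := funext fun x =>
    congrArg w (hp x)
  rw [hf]
  exact ((wordEquiv t A).surjective.injective_comp_right.eq_iff).symm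

theorem id_tensor {ψ : A'.obj (dotObj t) ⟶ B'.obj (dotObj t)}
    {m' : (A'.pts → Bool) → (B'.pts → Bool) → ℕ}
    (h' : WMat ψ m') :
    WMat (A := .tensor A A') (B := .tensor A B') (A.obj (dotObj t) ◁ ψ) fun u w =>
      ind (u ∘ Sum.inl = w ∘ Sum.inl) * m' (u ∘ Sum.inr) (w ∘ Sum.inr) := by
  rw [← MonoidalCategory.id_tensorHom]
  exact (of_struct (.id A)).tensor h'

theorem struct_comp {f : A.pts ≃ B.pts} {φ : A.obj (dotObj t) ⟶ B.obj (dotObj t)}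
    {ψ : B.obj (dotObj t) ⟶ C.obj (dotObj t)} {m : (B.pts → Bool) → (C.pts → Bool) → ℕ}
    (h : Struct (dotObj t) f φ) (h' : WMat ψ m) : WMat (φ ≫ ψ) fun u w => m (u ∘ f.symm) w :=
  ((of_struct h).comp h').congr fun u w =>
    tot_ind_mul (u ∘ f.symm) (fun v => by rw [Equiv.eq_comp_symm, eq_comm]) _

theorem comp_struct {f : B.pts ≃ C.pts} {φ : A.obj (dotObj t) ⟶ B.obj (dotObj t)}
    {ψ : B.obj (dotObj t) ⟶ C.obj (dotObj t)} {m : (A.pts → Bool) → (B.pts → Bool) → ℕ}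
    (h : WMat φ m) (h' : Struct (dotObj t) f ψ) : WMat (φ ≫ ψ) fun u w => m u (w ∘ f) :=
  (h.comp (of_struct h')).congr fun u w => by
    simp_rw [mul_comm (m _ _)]
    exact tot_ind_mul (w ∘ f) (fun v => Iff.rfl) _

theorem sum_ind_pair (w : (cups (.of ())).pts → Bool) :
    (tot fun x : (Word.of ()).pts → Bool => ind (w = fun p => x (cupsEquiv (.of ()) p).1)) =
      ind (w (Sum.inl ()) = w (Sum.inr ())) := by
  rw [tot_equiv (Equiv.funUnique Unit Bool), tot_eq_sum, Fintype.sum_bool]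
  have h : ∀ b : Bool, ind (w = fun p => (Equiv.funUnique Unit Bool).symm b
      (cupsEquiv (.of ()) p).1) = ind (w (Sum.inl ()) = b ∧ w (Sum.inr ()) = b) := fun b => by
    refine ind_congr ⟨fun h => ?_, fun h => ?_⟩
    · exact ⟨congrFun h _, congrFun h _⟩
    · funext p
      rcases p with p | p
      · exact h.1
      · exact h.2
  rw [h, h]
  generalize w (Sum.inl ()) = a
  generalize w (Sum.inr ()) = b
  cases a <;> cases b <;> simp [ind]

theorem cup : WMat (t := t) (A := .unit) (B := .tensor (.of true) (.of false))
    (show 𝟙_ (RepGLZero t) ⟶ dotObj t true ⊗ dotObj t false from RepGLZero.basis cupDiag)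
    fun _ w => ind (w (Sum.inl ()) = w (Sum.inr ())) :=
  (HasMat.basis (X := 𝟙_ _) (Y := dotObj t true ⊗ dotObj t false) cupDiag).congr fun u w => by
    change ind _ = ind _
    refine ind_congr ⟨fun h => ?_, fun h => ?_⟩
    · exact (congrFun h (Sum.inr (0 : Fin 1))).symm
    · funext p
      rcases p with p | p
      · exact p.elim0
      · have hp : p = (0 : Fin 1) := Subsingleton.elim (α := Fin 1) _ _
        subst hp
        exact h.symm

theorem cap : WMat (t := t) (B := .unit) (A := .tensor (.of false) (.of true))
    (show dotObj t false ⊗ dotObj t true ⟶ 𝟙_ (RepGLZero t) from RepGLZero.basis capDiag)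
    fun w _ => ind (w (Sum.inl ()) = w (Sum.inr ())) :=
  (HasMat.basis (X := dotObj t false ⊗ dotObj t true) (Y := 𝟙_ _) capDiag).congr fun u w => by
    change ind _ = ind _
    refine ind_congr ⟨fun h => ?_, fun h => ?_⟩
    · exact (congrFun h (Sum.inl (0 : Fin 1))).symm
    · funext p
      rcases p with p | p
      · have hp : p = (0 : Fin 1) := Subsingleton.elim (α := Fin 1) _ _
        subst hp
        exact h.symm
      · exact p.elim0

/-- Created pairs have equal colours. -/
theorem coevS : (s : Word Unit) → WMat (A := .unit) (coevS (dotObj t) s) fun _ w =>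
    tot fun x : s.pts → Bool => ind (w = fun p => x (cupsEquiv s p).1)
  | .unit => (of_struct (.id .unit)).congr fun u w => by
    rw [tot_eq_sum, Fintype.sum_unique]
    exact ind_congr ⟨fun _ => Subsingleton.elim _ _, fun _ => Subsingleton.elim _ _⟩
  | .of () => cup.congr fun u w => (sum_ind_pair w).symm
  | .tensor s s' =>
    (struct_comp (.leftU_inv .unit) ((coevS s).tensor (coevS s'))).congr fun u w => by
    rw [tot_mul_tot, tot_equiv (Equiv.sumArrowEquivProdArrow s.pts s'.pts Bool).symm]
    congr 1
    funext x
    rw [ind_mul]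
    refine ind_congr ⟨fun h => ?_, fun h => ?_⟩
    · funext p
      rcases p with p | p
      · exact congrFun h.1 p
      · exact congrFun h.2 p
    · exact ⟨funext fun p => congrFun h (Sum.inl p), funext fun p => congrFun h (Sum.inr p)⟩

/-- Annihilated pairs have equal colours. -/
theorem evS : (s : Word Unit) → WMat (B := .unit) (evS (dotObj t) s) fun u _ =>
    tot fun x : s.pts → Bool => ind (u = fun p => x (cupsEquiv s p).1)
  | .unit => (of_struct (.id .unit)).congr fun u w => by
    rw [tot_eq_sum, Fintype.sum_unique]
    exact ind_congr ⟨fun _ => Subsingleton.elim _ _, fun _ => Subsingleton.elim _ _⟩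
  | .of () => (struct_comp (.braid (.of true) (.of false)) cap).congr fun u w =>
      Eq.trans (ind_congr eq_comm) (sum_ind_pair u).symm
  | .tensor s s' => (comp_struct ((evS s).tensor (evS s')) (.leftU .unit)).congr fun u w => by
    rw [tot_mul_tot, tot_equiv (Equiv.sumArrowEquivProdArrow s.pts s'.pts Bool).symm]
    congr 1
    funext x
    rw [ind_mul]
    refine ind_congr ⟨fun h => ?_, fun h => ?_⟩
    · funext p
      rcases p with p | p
      · exact congrFun h.1 p
      · exact congrFun h.2 p
    · exact ⟨funext fun p => congrFun h (Sum.inl p), funext fun p => congrFun h (Sum.inr p)⟩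

/-- The matrix of a net: the colourings of the created and of the annihilated pairs that fit are
counted. -/
theorem net {A B : Word Bool} {s s' : Word Unit}
    {f : (A.tensor (cups s)).pts ≃ (B.tensor (cups s')).pts}
    {ψ : (A.tensor (cups s)).obj (dotObj t) ⟶ (B.tensor (cups s')).obj (dotObj t)}
    (h : Struct (dotObj t) f ψ) :
    WMat (frame (DeligneGL.coevS (dotObj t) s) (DeligneGL.evS (dotObj t) s') ψ) fun u w =>
      tot fun x : s.pts → Bool => tot fun y : s'.pts → Bool =>
        ind (Sum.elim u (fun p => x (cupsEquiv s p).1) =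
          Sum.elim w (fun p => y (cupsEquiv s' p).1) ∘ f) := by
  refine (struct_comp (.rightU_inv A) ((id_tensor (coevS s)).comp (struct_comp h
    (comp_struct (id_tensor (evS s')) (.rightU B))))).congr fun u w => ?_
  refine (tot_tot_mul_tot (fun x => Sum.elim u fun p => x (cupsEquiv s p).1)
    fun v x => ⟨fun h => ?_, ?_⟩).trans ?_
  · funext p
    rcases p with p | p
    · exact (congrFun h.1 p).symm
    · exact congrFun h.2 p
  · rintro rfl
    exact ⟨rfl, rfl⟩
  · congr 1
    funext x
    congr 1
    funext y
    refine ind_congr ⟨fun h => ?_, fun h => ?_⟩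
    · rw [← Equiv.comp_symm_eq]
      funext p
      rcases p with p | p
      · exact congrFun h.1 p
      · exact congrFun h.2 p
    · rw [← Equiv.comp_symm_eq] at h
      exact ⟨funext fun p => congrFun h (Sum.inl p), funext fun p => congrFun h (Sum.inr p)⟩

end WMat

end WordMatrices

/-! ### Words of rows in the diagram category -/

section RowDots

open RepGLZero

/-- A bijection that respects the two summands is a sum of bijections. -/
theorem exists_sumCongr {A B A' B' : Type} (f : A ⊕ B ≃ A' ⊕ B')
    (h : ∀ x, (f x).isLeft = x.isLeft) : ∃ (e : A ≃ A') (g : B ≃ B'), Equiv.sumCongr e g = f := by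
  have h' : ∀ y, (f.symm y).isLeft = y.isLeft := fun y => by
    rw [← h, f.apply_symm_apply]
  have hl : ∀ a, (f (Sum.inl a)).isLeft := fun a => h (Sum.inl a)
  have hl' : ∀ a, (f.symm (Sum.inl a)).isLeft := fun a => h' (Sum.inl a)
  have hr : ∀ b, (f (Sum.inr b)).isRight := fun b => by
    have := h (Sum.inr b)
    rcases hb : f (Sum.inr b) with y | y <;> simp_all
  have hr' : ∀ b, (f.symm (Sum.inr b)).isRight := fun b => by
    have := h' (Sum.inr b)
    rcases hb : f.symm (Sum.inr b) with y | y <;> simp_all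
  refine ⟨⟨fun a => (f (Sum.inl a)).getLeft (hl a), fun a => (f.symm (Sum.inl a)).getLeft (hl' a),
    fun a => Sum.inl_injective (β := B) (by simp), fun a => Sum.inl_injective (β := B') (by simp)⟩,
    ⟨fun b => (f (Sum.inr b)).getRight (hr b), fun b => (f.symm (Sum.inr b)).getRight (hr' b),
    fun a => Sum.inr_injective (α := A) (by simp), fun a => Sum.inr_injective (α := A') (by simp)⟩,
    Equiv.ext ?_⟩
  rintro (x | x) <;> simp

variable (t : ℂ)

/-- The letters of the word of a row are its dots, of the same colours as in the object of the
diagram category that the word defines. -/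
theorem exists_rowDots (R : Row) : ∃ (e : Fin ((rowWord R).obj (dotObj t)).row.black ≃ Fin R.black)
    (g : Fin ((rowWord R).obj (dotObj t)).row.white ≃ Fin R.white),
    ∀ x, Sum.map e g (wordEquiv t (rowWord R) x) = rowEquiv R x := by
  obtain ⟨e, g, h⟩ := exists_sumCongr ((wordEquiv t (rowWord R)).symm.trans (rowEquiv R))
    fun x => by
      obtain ⟨x, rfl⟩ := (wordEquiv t (rowWord R)).surjective x
      have h1 := (lbl_wordEquiv (t := t) (rowWord R) x).trans (lbl_rowWord R x)
      rw [Equiv.trans_apply, Equiv.symm_apply_apply]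
      rcases hy : rowEquiv R x with y | y <;> rcases hz : wordEquiv t (rowWord R) x with z | z <;>
        simp [hy, hz] at h1 ⊢
  refine ⟨e, g, fun x => ?_⟩
  have := Equiv.congr_fun h (wordEquiv t (rowWord R) x)
  rw [Equiv.trans_apply, Equiv.symm_apply_apply] at this
  exact this

/-- The black dots of the word of a row. -/
def rowBlack (R : Row) : Fin ((rowWord R).obj (dotObj t)).row.black ≃ Fin R.black :=
  (exists_rowDots t R).choose

/-- The white dots of the word of a row. -/
def rowWhite (R : Row) : Fin ((rowWord R).obj (dotObj t)).row.white ≃ Fin R.white :=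
  (exists_rowDots t R).choose_spec.choose

theorem rowBlack_rowWhite (R : Row) (x : (rowWord R).pts) :
    Sum.map (rowBlack t R) (rowWhite t R) (wordEquiv t (rowWord R) x) = rowEquiv R x :=
  (exists_rowDots t R).choose_spec.choose_spec x

/-- In the diagram category, the word of a row `[l, m]` is isomorphic to `[l, m]`. -/
def rowIso (X : RepGLZero t) : (rowWord X.row).obj (dotObj t) ≅ X where
  hom := basis (vert (rowBlack t X.row) (rowWhite t X.row))
  inv := basis (vert (rowBlack t X.row).symm (rowWhite t X.row).symm)
  hom_inv_id := comp_vert'.trans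
    (basis_vert_congr (by simp) (by simp))
  inv_hom_id := comp_vert'.trans
    (basis_vert_congr (by simp) (by simp))

variable {t}

theorem WMat.comp_rowIso {A : Word Bool} {Y : RepGLZero t}
    {φ : A.obj (dotObj t) ⟶ (rowWord Y.row).obj (dotObj t)}
    {m : (A.pts → Bool) → ((rowWord Y.row).pts → Bool) → ℕ} (h : WMat φ m) :
    HasMat (φ ≫ (rowIso t Y).hom) fun u w => m (u ∘ wordEquiv t A) (w ∘ rowEquiv Y.row) := by
  refine (HasMat.comp h (HasMat.vert _ _)).congr fun u w => ?_
  simp_rw [mul_comm (m _ _)]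
  rw [sum_ind_mul (w ∘ Sum.map (rowBlack t Y.row) (rowWhite t Y.row)) fun v => Iff.rfl]
  congr 1
  funext x
  exact congrArg w (rowBlack_rowWhite t Y.row x)

theorem HasMat.rowIso_comp {X Y : RepGLZero t} {φ : X ⟶ Y}
    {m : (Dots X → Bool) → (Dots Y → Bool) → ℕ} (h : HasMat φ m) : HasMat ((rowIso t X).hom ≫ φ) fun u w =>
      m (u ∘ (wordEquiv t (rowWord X.row)) ∘ (rowEquiv X.row).symm) w := by
  refine ((HasMat.vert _ _).comp h).congr fun u w => ?_
  refine sum_ind_mul _ (fun v => ?_) fun v => m v w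
  rw [← Function.comp_assoc, Equiv.eq_comp_symm]
  have : v ∘ rowEquiv X.row = (v ∘ Sum.map (rowBlack t X.row) (rowWhite t X.row)) ∘
      wordEquiv t (rowWord X.row) := funext fun x =>
    congrArg v (rowBlack_rowWhite t X.row x).symm
  rw [this]
  exact eq_comm.trans (wordEquiv t (rowWord X.row)).surjective.injective_comp_right.eq_iff.symm

/-- The matrix of a net, with the created and annihilated pairs numbered by `C` and `D`. -/
theorem Net.wMat {A B : Word Bool} {C D : Type} [Finite C] [Finite D]
    {f : A.pts ⊕ C × Bool ≃ B.pts ⊕ D × Bool} {φ : A.obj (dotObj t) ⟶ B.obj (dotObj t)}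
    (h : Net (dotObj t) f φ) : WMat φ fun u w => tot fun x : C → Bool => tot fun y : D → Bool =>
      ind (Sum.elim u (fun p => x p.1) = Sum.elim w (fun p => y p.1) ∘ f) := by
  obtain ⟨s, s', e, e', g, ψ, hψ, hf, rfl⟩ := h
  refine (WMat.net hψ).congr fun u w => ?_
  rw [tot_equiv (e.arrowCongr (Equiv.refl Bool))]
  congr 1
  funext x
  rw [tot_equiv (e'.arrowCongr (Equiv.refl Bool))]
  congr 1
  funext y
  refine ind_congr ?_
  have h1 : Sum.elim u (fun p => (e.arrowCongr (Equiv.refl Bool)).symm x (cupsEquiv s p).1) =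
      Sum.elim u (fun p => x p.1) ∘ (Equiv.sumCongr (Equiv.refl A.pts) (dots e)) := by
    funext p
    rcases p with p | p <;> rfl
  have h2 : Sum.elim w (fun p => (e'.arrowCongr (Equiv.refl Bool)).symm y (cupsEquiv s' p).1) ∘ g =
      (Sum.elim w (fun p => y p.1) ∘ f) ∘ (Equiv.sumCongr (Equiv.refl A.pts) (dots e)) := by
    funext p
    have h3 := hf p
    refine Eq.trans ?_ (congrArg (Sum.elim w fun p => y p.1) h3)
    rw [Function.comp_apply]
    generalize g p = q
    rcases q with q | q <;> rfl
  refine Iff.trans (Eq.congr h1 h2) ?_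
  exact (Equiv.sumCongr (Equiv.refl A.pts) (dots e)).surjective.injective_comp_right.eq_iff

/-- A colouring compatible with a diagram, drawn downwards, is determined by the colours of the
dots of the rows. -/
theorem downward_compatible {R S : Row} (σ : Diag R S) (u : Fin R.black ⊕ Fin R.white → Bool)
    (w : Fin S.black ⊕ Fin S.white → Bool) (x : Fin S.white → Bool) (y : Fin R.white → Bool) :
    Sum.elim (u ∘ rowEquiv R) (fun p => x p.1) =
      Sum.elim (w ∘ rowEquiv S) (fun p => y p.1) ∘ downward σ ↔
    x = w ∘ Sum.inr ∧ y = u ∘ Sum.inr ∧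
      Sum.elim (u ∘ Sum.inl) (w ∘ Sum.inr) = Sum.elim (w ∘ Sum.inl) (u ∘ Sum.inr) ∘ σ := by
  have hs : ∀ (S : Row) (n : ℕ) (w : Fin S.black ⊕ Fin S.white → Bool) (y : Fin n → Bool) z,
      Sum.elim (w ∘ rowEquiv S) (fun p => y p.1) ((side S n).symm z) =
        Sum.elim (Sum.elim (w ∘ Sum.inl) y) (Sum.elim (w ∘ Sum.inr) y) z := by
    rintro S n w y ((z | z) | (z | z)) <;>
      simp [side_symm_black, side_symm_white, side_symm_true, side_symm_false]
  have h1 : Sum.elim (u ∘ rowEquiv R) (fun p => x p.1) =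
      Sum.elim (w ∘ rowEquiv S) (fun p => y p.1) ∘ downward σ ↔
      Sum.elim (Sum.elim (u ∘ Sum.inl) x) (Sum.elim (u ∘ Sum.inr) x) =
        Sum.elim (Sum.elim (w ∘ Sum.inl) y ∘ σ) (Sum.elim y (w ∘ Sum.inr)) := by
    rw [← (side R S.white).symm.surjective.injective_comp_right.eq_iff]
    refine Eq.congr (funext fun z => hs _ _ _ _ z) (funext fun z => ?_)
    rw [Function.comp_apply, Function.comp_apply, downward_side, hs]
    rcases z with z | (z | z) <;> rfl
  rw [h1, Sum.elim_eq_iff, Sum.elim_eq_iff]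
  constructor
  · rintro ⟨h, rfl, rfl⟩
    exact ⟨rfl, rfl, h⟩
  · rintro ⟨rfl, rfl, h⟩
    exact ⟨h, rfl, rfl⟩

/-- The diagrams of the words of rows are the given diagrams. -/
theorem diagMor_rowIso {X Y : RepGLZero t} (σ : Diag X.row Y.row) :
    diagMor (dotObj t) σ ≫ (rowIso t Y).hom = (rowIso t X).hom ≫ RepGLZero.basis σ := by
  have h1 := (net_diagMor (c := dotObj t) σ).wMat.comp_rowIso
  have h2 := (HasMat.basis σ).rowIso_comp
  refine (h1.congr fun u w => ?_).unique h2
  obtain ⟨u, rfl⟩ : ∃ v : Fin X.row.black ⊕ Fin X.row.white → Bool,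
      v ∘ (rowEquiv X.row) ∘ (wordEquiv t (rowWord X.row)).symm = u :=
    ⟨u ∘ (wordEquiv t (rowWord X.row)) ∘ (rowEquiv X.row).symm, funext fun x => by simp⟩
  have hu : (u ∘ (rowEquiv X.row) ∘ (wordEquiv t (rowWord X.row)).symm) ∘
      (wordEquiv t (rowWord X.row)) = u ∘ rowEquiv X.row := funext fun x => by simp
  have hu' : (u ∘ (rowEquiv X.row) ∘ (wordEquiv t (rowWord X.row)).symm) ∘
      (wordEquiv t (rowWord X.row)) ∘ (rowEquiv X.row).symm = u := funext fun x => by simp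
  rw [hu, hu']
  simp_rw [downward_compatible σ u w, ← ind_mul, ← mul_tot]
  rw [tot_ind_mul (w ∘ Sum.inr) fun v => Iff.rfl, tot_ind_mul (u ∘ Sum.inr) fun v => Iff.rfl]
  rfl

/-- The isomorphisms `rowIso` are compatible with juxtaposition. -/
theorem rowIso_tensor {X Y : RepGLZero t}
    {φ : ((rowWord X.row).tensor (rowWord Y.row)).obj (dotObj t) ⟶
      (rowWord (X.row.tensor Y.row)).obj (dotObj t)}
    (h : Struct (dotObj t) (rowTensorEquiv X.row Y.row) φ) :
    φ ≫ (rowIso t (X ⊗ Y)).hom = (rowIso t X).hom ⊗ₘ (rowIso t Y).hom := by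
  have h1 := (WMat.of_struct h).comp_rowIso (Y := X ⊗ Y)
  have h2 := HasMat.tensor (HasMat.vert (rowBlack t X.row) (rowWhite t X.row))
    (HasMat.vert (rowBlack t Y.row) (rowWhite t Y.row))
  refine (h1.congr fun u w => ?_).unique h2
  rw [ind_mul]
  refine ind_congr ?_
  have hl : ∀ x, rowEquiv (X.row.tensor Y.row) (rowTensorEquiv X.row Y.row (Sum.inl x)) =
      Sum.map (Fin.castAdd _) (Fin.castAdd _) (rowEquiv X.row x) := fun x => by
    rcases h : rowEquiv X.row x with y | y <;> simp [rowTensorEquiv, h]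
  have hr : ∀ x, rowEquiv (X.row.tensor Y.row) (rowTensorEquiv X.row Y.row (Sum.inr x)) =
      Sum.map (Fin.natAdd _) (Fin.natAdd _) (rowEquiv Y.row x) := fun x => by
    rcases h : rowEquiv Y.row x with y | y <;> simp [rowTensorEquiv, h]
  rw [← (wordEquiv t (rowWord X.row)).surjective.injective_comp_right.eq_iff,
    ← (wordEquiv t (rowWord Y.row)).surjective.injective_comp_right.eq_iff]
  have h1 : ∀ x, (u ∘ wordEquiv t ((rowWord X.row).tensor (rowWord Y.row))) (Sum.inl x) =
      ((u ∘ Sum.map (Fin.castAdd _) (Fin.castAdd _)) ∘ wordEquiv t (rowWord X.row)) x :=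
    fun x => congrArg u (wordEquiv_inl _ _ x)
  have h2 : ∀ x, (u ∘ wordEquiv t ((rowWord X.row).tensor (rowWord Y.row))) (Sum.inr x) =
      ((u ∘ Sum.map (Fin.natAdd _) (Fin.natAdd _)) ∘ wordEquiv t (rowWord Y.row)) x :=
    fun x => congrArg u (wordEquiv_inr _ _ x)
  have h3 : ∀ x, ((w ∘ rowEquiv (X.row.tensor Y.row)) ∘ rowTensorEquiv X.row Y.row) (Sum.inl x) =
      (((w ∘ Sum.map (Fin.castAdd _) (Fin.castAdd _)) ∘
        Sum.map (rowBlack t X.row) (rowWhite t X.row)) ∘ wordEquiv t (rowWord X.row)) x :=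
    fun x => congrArg w ((hl x).trans (congrArg _ (rowBlack_rowWhite t X.row x).symm))
  have h4 : ∀ x, ((w ∘ rowEquiv (X.row.tensor Y.row)) ∘ rowTensorEquiv X.row Y.row) (Sum.inr x) =
      (((w ∘ Sum.map (Fin.natAdd _) (Fin.natAdd _)) ∘
        Sum.map (rowBlack t Y.row) (rowWhite t Y.row)) ∘ wordEquiv t (rowWord Y.row)) x :=
    fun x => congrArg w ((hr x).trans (congrArg _ (rowBlack_rowWhite t Y.row x).symm))
  refine ⟨fun h => ⟨funext fun x => ?_, funext fun x => ?_⟩, fun h => funext fun x => ?_⟩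
  · exact (h1 x).symm.trans ((congrFun h (Sum.inl x)).trans (h3 x))
  · exact (h2 x).symm.trans ((congrFun h (Sum.inr x)).trans (h4 x))
  · rcases x with x | x
    · exact (h1 x).trans ((congrFun h.1 x).trans (h3 x).symm)
    · exact (h2 x).trans ((congrFun h.2 x).trans (h4 x).symm)

theorem rowIso_unit {φ : (Word.unit : Word Bool).obj (dotObj t) ⟶ (rowWord Row.unit).obj (dotObj t)}
    (h : Struct (dotObj t) rowUnitEquiv φ) :
    φ ≫ (rowIso t (𝟙_ _)).hom = 𝟙 (𝟙_ _) := by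
  obtain ⟨e, g, rfl, -⟩ := h.exists_vert
  refine comp_vert'.trans ?_
  exact congrArg RepGLZero.basis (diag_eq_of_le_one (Nat.zero_le _) _ _)

theorem rowIso_std {φ : (rowWord (dotRow true)).obj (dotObj t) ⟶ dotObj t true}
    {f : (rowWord (dotRow true)).pts ≃ (Word.of true : Word Bool).pts}
    (h : Struct (dotObj t) (B := .of true) f φ) : (rowIso t (dotObj t true)).hom = φ := by
  obtain ⟨e, g, rfl, -⟩ := h.exists_vert
  exact congrArg RepGLZero.basis (diag_eq_of_le_one (le_of_eq rfl) _ _)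

end RowDots

/-! ### Transformations on words -/

section WordTransformations

open Functor.LaxMonoidal Functor.OplaxMonoidal

variable {S : Type u₁} [Category.{v₁} S] [MonoidalCategory S] [SymmetricCategory S]
variable {T : Type u} [Category.{v} T] [MonoidalCategory T] [SymmetricCategory T]
variable (F G : S ⥤ T) [F.Braided] [G.Braided]

/-- The tensor product of the morphisms `a k` along a word. -/
def wordTrans {K : Type} {c : K → S} (a : ∀ k, F.obj (c k) ⟶ G.obj (c k)) :
    (A : Word K) → (F.obj (A.obj c) ⟶ G.obj (A.obj c))
  | .unit => η F ≫ ε G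
  | .of k => a k
  | .tensor A B => δ F _ _ ≫ (wordTrans a A ⊗ₘ wordTrans a B) ≫ μ G _ _

variable {F G}

/-- Compatibility of a morphism between words with `wordTrans`. -/
def WordNat {K : Type} {c : K → S} (a : ∀ k, F.obj (c k) ⟶ G.obj (c k)) {A B : Word K}
    (φ : A.obj c ⟶ B.obj c) : Prop :=
  F.map φ ≫ wordTrans F G a B = wordTrans F G a A ≫ G.map φ

namespace WordNat

variable {K : Type} {c : K → S} {a : ∀ k, F.obj (c k) ⟶ G.obj (c k)} {A B C A' B' : Word K}

theorem id (A : Word K) : WordNat a (A := A) (B := A) (𝟙 _) := by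
  simp [WordNat]

theorem comp {φ : A.obj c ⟶ B.obj c} {ψ : B.obj c ⟶ C.obj c} (h : WordNat a φ)
    (h' : WordNat a ψ) : WordNat a (φ ≫ ψ) := by
  unfold WordNat at *
  rw [F.map_comp, G.map_comp, Category.assoc, h', reassoc_of% h]

theorem tensor {φ : A.obj c ⟶ B.obj c} {φ' : A'.obj c ⟶ B'.obj c} (h : WordNat a φ)
    (h' : WordNat a φ') : WordNat a (A := .tensor A A') (B := .tensor B B') (φ ⊗ₘ φ') := by
  unfold WordNat at *
  change F.map (φ ⊗ₘ φ') ≫ δ F _ _ ≫ (_ ⊗ₘ _) ≫ μ G _ _ =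
    (δ F _ _ ≫ (_ ⊗ₘ _) ≫ μ G _ _) ≫ G.map (φ ⊗ₘ φ')
  rw [← δ_natural_assoc, MonoidalCategory.tensorHom_comp_tensorHom_assoc, h, h', Category.assoc,
    Category.assoc, ← μ_natural, MonoidalCategory.tensorHom_comp_tensorHom_assoc]

theorem of_isIso {φ : A.obj c ⟶ B.obj c} {φ' : B.obj c ⟶ A.obj c} (h : WordNat a φ)
    (h1 : φ ≫ φ' = 𝟙 (A.obj c)) (h2 : φ' ≫ φ = 𝟙 (B.obj c)) : WordNat a φ' := by
  unfold WordNat at *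
  rw [← Category.comp_id (F.map φ' ≫ _), ← G.map_id, ← h1, G.map_comp, Category.assoc,
    ← reassoc_of% h, ← F.map_comp_assoc, h2, F.map_id, Category.id_comp]

theorem assoc (A B C : Word K) : WordNat a (A := .tensor (.tensor A B) C)
    (B := .tensor A (.tensor B C)) (α_ (A.obj c) (B.obj c) (C.obj c)).hom := by
  unfold WordNat
  change F.map _ ≫ δ F _ _ ≫ (wordTrans F G a A ⊗ₘ (δ F _ _ ≫ (_ ⊗ₘ _) ≫ μ G _ _)) ≫ μ G _ _ =
    (δ F _ _ ≫ ((δ F _ _ ≫ (_ ⊗ₘ _) ≫ μ G _ _) ⊗ₘ wordTrans F G a C) ≫ μ G _ _) ≫ G.map _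
  rw [show wordTrans F G a A ⊗ₘ (δ F _ _ ≫ (wordTrans F G a B ⊗ₘ wordTrans F G a C) ≫ μ G _ _) =
      _ ◁ δ F _ _ ≫ (wordTrans F G a A ⊗ₘ (wordTrans F G a B ⊗ₘ wordTrans F G a C)) ≫
        _ ◁ μ G _ _ by
      simp only [← MonoidalCategory.id_tensorHom, MonoidalCategory.tensorHom_comp_tensorHom,
        Category.id_comp, Category.comp_id],
    show (δ F _ _ ≫ (wordTrans F G a A ⊗ₘ wordTrans F G a B) ≫ μ G _ _) ⊗ₘ wordTrans F G a C =
      δ F _ _ ▷ _ ≫ ((wordTrans F G a A ⊗ₘ wordTrans F G a B) ⊗ₘ wordTrans F G a C) ≫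
        μ G _ _ ▷ _ by
      simp only [← MonoidalCategory.tensorHom_id, MonoidalCategory.tensorHom_comp_tensorHom,
        Category.id_comp, Category.comp_id]]
  simp only [Category.assoc]
  rw [Functor.LaxMonoidal.associativity, MonoidalCategory.associator_naturality_assoc,
    Functor.OplaxMonoidal.associativity_assoc]

theorem leftU (A : Word K) : WordNat a (A := .tensor .unit A) (B := A) (λ_ (A.obj c)).hom := by
  unfold WordNat
  change F.map _ ≫ _ = (δ F _ _ ≫ ((η F ≫ ε G) ⊗ₘ _) ≫ μ G _ _) ≫ G.map _
  rw [MonoidalCategory.tensorHom_def', Functor.Monoidal.map_leftUnitor,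
    Functor.Monoidal.map_leftUnitor, MonoidalCategory.comp_whiskerRight]
  simp only [Category.assoc, Functor.Monoidal.μ_δ_assoc, Functor.Monoidal.whiskerRight_ε_η_assoc]
  rw [MonoidalCategory.whisker_exchange_assoc, MonoidalCategory.leftUnitor_naturality]

theorem rightU (A : Word K) : WordNat a (A := .tensor A .unit) (B := A) (ρ_ (A.obj c)).hom := by
  unfold WordNat
  change F.map _ ≫ _ = (δ F _ _ ≫ (_ ⊗ₘ (η F ≫ ε G)) ≫ μ G _ _) ≫ G.map _
  rw [MonoidalCategory.tensorHom_def, Functor.Monoidal.map_rightUnitor,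
    Functor.Monoidal.map_rightUnitor, MonoidalCategory.whiskerLeft_comp]
  simp only [Category.assoc, Functor.Monoidal.μ_δ_assoc, Functor.Monoidal.whiskerLeft_ε_η_assoc]
  rw [← MonoidalCategory.whisker_exchange_assoc, MonoidalCategory.rightUnitor_naturality]

theorem braid (A B : Word K) : WordNat a (A := .tensor A B) (B := .tensor B A)
    (β_ (A.obj c) (B.obj c)).hom := by
  unfold WordNat
  change F.map _ ≫ δ F _ _ ≫ (_ ⊗ₘ _) ≫ μ G _ _ = (δ F _ _ ≫ (_ ⊗ₘ _) ≫ μ G _ _) ≫ G.map _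
  rw [Functor.map_braiding, Functor.map_braiding]
  simp only [Category.assoc, Functor.Monoidal.μ_δ_assoc]
  rw [BraidedCategory.braiding_naturality_assoc]

theorem of_struct {f : A.pts ≃ B.pts} {φ : A.obj c ⟶ B.obj c} (h : Struct c f φ) :
    WordNat a φ := by
  induction h with
  | id A => exact .id A
  | comp _ _ ih ih' => exact ih.comp ih'
  | left C _ ih =>
    rw [← MonoidalCategory.id_tensorHom]
    exact (WordNat.id C).tensor ih
  | right C _ ih =>
    rw [← MonoidalCategory.tensorHom_id]
    exact ih.tensor (.id C)
  | assoc A B C => exact .assoc A B C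
  | assoc_inv A B C => exact (WordNat.assoc A B C).of_isIso (Iso.hom_inv_id _) (Iso.inv_hom_id _)
  | leftU A => exact .leftU A
  | leftU_inv A => exact (WordNat.leftU A).of_isIso (Iso.hom_inv_id _) (Iso.inv_hom_id _)
  | rightU A => exact .rightU A
  | rightU_inv A => exact (WordNat.rightU A).of_isIso (Iso.hom_inv_id _) (Iso.inv_hom_id _)
  | braid A B => exact .braid A B

end WordNat

/-! ### Mates of isomorphisms of dual pairs -/

section Mates

variable {T : Type u} [Category.{v} T] [MonoidalCategory T] {X X' Y Y' : T} [ExactPairing X X']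
  [ExactPairing Y Y']

theorem eq_of_coevaluation_comp_left {Z : T} {f g : X' ⟶ Z}
    (h : η_ X X' ≫ X ◁ f = η_ X X' ≫ X ◁ g) : f = g := by
  have h1 := (tensorLeftHomEquiv_symm_coevaluation_comp_whiskerLeft (Y := X) f).symm
  rw [h, tensorLeftHomEquiv_symm_coevaluation_comp_whiskerLeft] at h1
  exact (cancel_epi _).mp h1

theorem eq_of_coevaluation_comp_right {Z : T} {f g : X ⟶ Z}
    (h : η_ X X' ≫ f ▷ X' = η_ X X' ≫ g ▷ X') : f = g := by
  have h1 := (tensorRightHomEquiv_symm_coevaluation_comp_whiskerRight (Y := X) (Y' := X') f).symm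
  rw [h, tensorRightHomEquiv_symm_coevaluation_comp_whiskerRight] at h1
  exact (cancel_epi _).mp h1

theorem eq_of_left_comp_evaluation {Z : T} {f g : Z ⟶ X}
    (h : X' ◁ f ≫ ε_ X X' = X' ◁ g ≫ ε_ X X') : f = g := by
  let _ : HasLeftDual X' := ⟨X⟩
  have h1 := (tensorLeftHomEquiv_whiskerLeft_comp_evaluation (Z := X') f).symm
  rw [show X' ◁ f ≫ ε_ (ᘁX') X' = X' ◁ g ≫ ε_ (ᘁX') X' from h,
    tensorLeftHomEquiv_whiskerLeft_comp_evaluation] at h1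
  exact (cancel_mono _).mp h1

/-- Morphisms `a` and `b` between the factors of two dual pairs that respect the duality. -/
structure IsMate (a : X ⟶ Y) (b : X' ⟶ Y') : Prop where
  coev : η_ X X' ≫ (a ⊗ₘ b) = η_ Y Y'
  ev : (b ⊗ₘ a) ≫ ε_ Y Y' = ε_ X X'

/-- A morphism of dual pairs is an isomorphism, the inverse being the mate of `b`. -/
theorem IsMate.isIso {a : X ⟶ Y} {b : X' ⟶ Y'} (h : IsMate a b) : IsIso a := by
  let _ : HasLeftDual X' := ⟨X⟩
  let _ : HasLeftDual Y' := ⟨Y⟩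
  have h1 : η_ Y Y' ≫ (show Y ⟶ X from (ᘁb)) ▷ Y' = η_ X X' ≫ X ◁ b :=
    coevaluation_comp_leftAdjointMate b
  have h2 : X' ◁ (show Y ⟶ X from (ᘁb)) ≫ ε_ X X' = b ▷ Y ≫ ε_ Y Y' :=
    leftAdjointMate_comp_evaluation b
  refine ⟨(show Y ⟶ X from (ᘁb)), ?_, ?_⟩
  · refine eq_of_left_comp_evaluation (X' := X') ?_
    rw [MonoidalCategory.whiskerLeft_comp, Category.assoc, h2,
      MonoidalCategory.whisker_exchange_assoc, ← MonoidalCategory.tensorHom_def_assoc, h.ev]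
    simp
  · refine eq_of_coevaluation_comp_right (X' := Y') ?_
    rw [MonoidalCategory.comp_whiskerRight, reassoc_of% h1, ← MonoidalCategory.tensorHom_def',
      h.coev]
    simp

/-- The second component is determined by the first one. -/
theorem IsMate.unique {a : X ⟶ Y} {b b' : X' ⟶ Y'} (h : IsMate a b) (h' : IsMate a b') :
    b = b' := by
  have := h.isIso
  refine eq_of_coevaluation_comp_left (X := X) ?_
  rw [← cancel_mono (a ▷ Y'), Category.assoc, Category.assoc, ← MonoidalCategory.tensorHom_def',
    ← MonoidalCategory.tensorHom_def', h.coev, h'.coev]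

theorem exists_isMate (a : X ≅ Y) : ∃ b : X' ⟶ Y', IsMate a.hom b := by
  let _ : HasRightDual X := ⟨X'⟩
  let _ : HasRightDual Y := ⟨Y'⟩
  have h1 : η_ X X' ≫ X ◁ (show X' ⟶ Y' from a.invᘁ) = η_ Y Y' ≫ a.inv ▷ Y' :=
    coevaluation_comp_rightAdjointMate a.inv
  have h2 : (show X' ⟶ Y' from a.invᘁ) ▷ Y ≫ ε_ Y Y' = X' ◁ a.inv ≫ ε_ X X' :=
    rightAdjointMate_comp_evaluation a.inv
  refine ⟨(show X' ⟶ Y' from a.invᘁ), ?_, ?_⟩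
  · rw [MonoidalCategory.tensorHom_def', reassoc_of% h1, ← MonoidalCategory.comp_whiskerRight]
    simp
  · rw [MonoidalCategory.tensorHom_def', Category.assoc, h2,
      ← MonoidalCategory.whiskerLeft_comp_assoc]
    simp

end Mates

end WordTransformations

/-! ### Transformations on nets -/

section NetTransformations

open Functor.LaxMonoidal Functor.OplaxMonoidal

variable {S : Type u₁} [Category.{v₁} S] [MonoidalCategory S] [SymmetricCategory S]
variable {T : Type u} [Category.{v} T] [MonoidalCategory T] [SymmetricCategory T]

/-- A monoidal functor preserves dual pairs. -/
@[reducible] def mapPairing (F : S ⥤ T) [F.Monoidal] (X X' : S) [ExactPairing X X'] :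
    ExactPairing (F.obj X) (F.obj X') where
  coevaluation' := ε F ≫ F.map (η_ X X') ≫ δ F _ _
  evaluation' := μ F _ _ ≫ F.map (ε_ X X') ≫ η F
  coevaluation_evaluation' := by
    rw [Functor.Monoidal.map_associator_inv' F]
    simp only [MonoidalCategory.whiskerLeft_comp, MonoidalCategory.comp_whiskerRight,
      Category.assoc, Functor.Monoidal.whiskerLeft_δ_μ_assoc, μ_natural_right_assoc,
      Functor.Monoidal.whiskerRight_δ_μ_assoc, δ_natural_left_assoc]
    have h := congrArg (fun x => F.map x) (ExactPairing.coevaluation_evaluation X X')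
    simp only [F.map_comp] at h
    rw [reassoc_of% h]
    simp
  evaluation_coevaluation' := by
    rw [Functor.Monoidal.map_associator' F]
    simp only [MonoidalCategory.whiskerLeft_comp, MonoidalCategory.comp_whiskerRight,
      Category.assoc, Functor.Monoidal.whiskerRight_δ_μ_assoc, μ_natural_left_assoc,
      Functor.Monoidal.whiskerLeft_δ_μ_assoc, δ_natural_right_assoc]
    have h := congrArg (fun x => F.map x) (ExactPairing.evaluation_coevaluation X X')
    simp only [F.map_comp] at h
    rw [reassoc_of% h]
    simp

variable (F G : S ⥤ T) [F.Braided] [G.Braided]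

/-- Two morphisms between the images of the factors of a dual pair that respect the duality. -/
def MapMate {X X' : S} [ExactPairing X X'] (a : F.obj X ⟶ G.obj X) (b : F.obj X' ⟶ G.obj X') :
    Prop :=
  letI := mapPairing F X X'
  letI := mapPairing G X X'
  IsMate a b

variable {F G}

theorem MapMate.coev {X X' : S} [ExactPairing X X'] {a : F.obj X ⟶ G.obj X}
    {b : F.obj X' ⟶ G.obj X'} (h : MapMate F G a b) :
    (ε F ≫ F.map (η_ X X') ≫ δ F _ _) ≫ (a ⊗ₘ b) = ε G ≫ G.map (η_ X X') ≫ δ G _ _ :=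
  letI := mapPairing F X X'
  letI := mapPairing G X X'
  IsMate.coev h

theorem MapMate.ev {X X' : S} [ExactPairing X X'] {a : F.obj X ⟶ G.obj X}
    {b : F.obj X' ⟶ G.obj X'} (h : MapMate F G a b) :
    (b ⊗ₘ a) ≫ μ G _ _ ≫ G.map (ε_ X X') ≫ η G = μ F _ _ ≫ F.map (ε_ X X') ≫ η F :=
  letI := mapPairing F X X'
  letI := mapPairing G X X'
  IsMate.ev h

theorem MapMate.isIso {X X' : S} [ExactPairing X X'] {a : F.obj X ⟶ G.obj X}
    {b : F.obj X' ⟶ G.obj X'} (h : MapMate F G a b) : IsIso a :=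
  letI := mapPairing F X X'
  letI := mapPairing G X X'
  IsMate.isIso h

theorem MapMate.unique {X X' : S} [ExactPairing X X'] {a : F.obj X ⟶ G.obj X}
    {b b' : F.obj X' ⟶ G.obj X'} (h : MapMate F G a b) (h' : MapMate F G a b') : b = b' :=
  letI := mapPairing F X X'
  letI := mapPairing G X X'
  IsMate.unique h h'

/-- An isomorphism between the images of an object has a mate. -/
theorem exists_mapMate {X X' : S} [ExactPairing X X'] (a : F.obj X ≅ G.obj X) :
    ∃ b : F.obj X' ⟶ G.obj X', MapMate F G a.hom b :=
  letI := mapPairing F X X'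
  letI := mapPairing G X X'
  exists_isMate a

/-- The components of a monoidal transformation respect duality. -/
theorem mapMate_app (θ : F ⟶ G) [θ.IsMonoidal] (X X' : S) [ExactPairing X X'] :
    MapMate F G (θ.app X) (θ.app X') := by
  let _ := mapPairing F X X'
  let _ := mapPairing G X X'
  refine IsMate.mk ?_ ?_
  · change (ε F ≫ F.map (η_ X X') ≫ δ F _ _) ≫ _ = ε G ≫ G.map (η_ X X') ≫ δ G _ _
    have h : δ F X X' ≫ (θ.app X ⊗ₘ θ.app X') = θ.app (X ⊗ X') ≫ δ G X X' := by
      rw [← cancel_epi (μ F X X'), Functor.Monoidal.μ_δ_assoc, NatTrans.IsMonoidal.tensor_assoc,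
        Functor.Monoidal.μ_δ, Category.comp_id]
    rw [Category.assoc, Category.assoc, h, θ.naturality_assoc,
      ← NatTrans.IsMonoidal.unit (τ := θ), Category.assoc]
  · change (θ.app X' ⊗ₘ θ.app X) ≫ μ G _ _ ≫ G.map (ε_ X X') ≫ η G =
      μ F _ _ ≫ F.map (ε_ X X') ≫ η F
    have h : θ.app (𝟙_ S) ≫ η G = η F := by
      rw [← cancel_epi (ε F), NatTrans.IsMonoidal.unit_assoc]
      simp
    rw [← NatTrans.IsMonoidal.tensor_assoc, ← θ.naturality_assoc, h]

variable {c : Bool → S} [ExactPairing (c true) (c false)] {a : ∀ k, F.obj (c k) ⟶ G.obj (c k)}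

namespace WordNat

theorem coev (h : MapMate F G (a true) (a false)) :
    WordNat a (A := .unit) (B := .tensor (.of true) (.of false)) (η_ (c true) (c false)) := by
  unfold WordNat
  change F.map (η_ (c true) (c false)) ≫ δ F _ _ ≫ (a true ⊗ₘ a false) ≫ μ G _ _ =
    (η F ≫ ε G) ≫ G.map (η_ (c true) (c false))
  have h1 : (ε F ≫ F.map (η_ (c true) (c false)) ≫ δ F _ _) ≫ (a true ⊗ₘ a false) =
    ε G ≫ G.map (η_ (c true) (c false)) ≫ δ G _ _ := h.coev
  rw [← cancel_mono (δ G _ _), ← cancel_epi (ε F)]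
  simpa using h1

theorem ev (h : MapMate F G (a true) (a false)) :
    WordNat a (A := .tensor (.of false) (.of true)) (B := .unit) (ε_ (c true) (c false)) := by
  unfold WordNat
  change F.map (ε_ (c true) (c false)) ≫ η F ≫ ε G =
    (δ F _ _ ≫ (a false ⊗ₘ a true) ≫ μ G _ _) ≫ G.map (ε_ (c true) (c false))
  have h1 : (a false ⊗ₘ a true) ≫ μ G _ _ ≫ G.map (ε_ (c true) (c false)) ≫ η G =
    μ F _ _ ≫ F.map (ε_ (c true) (c false)) ≫ η F := h.ev
  rw [← cancel_mono (η G), ← cancel_epi (μ F _ _)]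
  simpa using h1.symm

theorem coevS (h : MapMate F G (a true) (a false)) :
    (s : Word Unit) → WordNat a (A := .unit) (DeligneGL.coevS c s)
  | .unit => .id .unit
  | .of _ => .coev h
  | .tensor s s' =>
    (of_struct (.leftU_inv .unit)).comp ((coevS h s).tensor (coevS h s'))

theorem evS (h : MapMate F G (a true) (a false)) :
    (s : Word Unit) → WordNat a (B := .unit) (DeligneGL.evS c s)
  | .unit => .id .unit
  | .of _ => (of_struct (.braid (.of true) (.of false))).comp (.ev h)
  | .tensor s s' =>
    ((evS h s).tensor (evS h s')).comp (of_struct (.leftU .unit))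

/-- Transformations of words that respect duality are compatible with nets. -/
theorem of_net (h : MapMate F G (a true) (a false)) {A B : Word Bool} {C D : Type}
    {f : A.pts ⊕ C × Bool ≃ B.pts ⊕ D × Bool} {φ : A.obj c ⟶ B.obj c} (hφ : Net c f φ) :
    WordNat a φ := by
  obtain ⟨s, s', e, e', g, ψ, hψ, -, rfl⟩ := hφ
  have h1 := (WordNat.id (a := a) A).tensor (coevS h s)
  have h2 := (WordNat.id (a := a) B).tensor (evS h s')
  rw [MonoidalCategory.id_tensorHom] at h1 h2
  exact (of_struct (.rightU_inv A)).comp (h1.comp ((of_struct hψ).comp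
    (h2.comp (of_struct (.rightU B)))))

end WordNat

end NetTransformations

/-! ### Transformations on the diagram category -/

section RowTransformations

open Functor.LaxMonoidal Functor.OplaxMonoidal

variable {T : Type u} [Category.{v} T] [Preadditive T] [Linear ℂ T] [MonoidalCategory T]
  [SymmetricCategory T]

theorem wordTrans_app {S : Type u₁} [Category.{v₁} S] [MonoidalCategory S] [SymmetricCategory S]
    {F G : S ⥤ T} [F.Braided] [G.Braided] (θ : F ⟶ G) [θ.IsMonoidal] {K : Type} (c : K → S) :
    (A : Word K) → wordTrans F G (fun k => θ.app (c k)) A = θ.app (A.obj c)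
  | .unit => by
    change η F ≫ ε G = _
    rw [← NatTrans.IsMonoidal.unit (τ := θ), Functor.Monoidal.η_ε_assoc]
  | .of k => rfl
  | .tensor A B => by
    change δ F _ _ ≫ (wordTrans F G _ A ⊗ₘ wordTrans F G _ B) ≫ μ G _ _ = _
    rw [wordTrans_app θ c A, wordTrans_app θ c B, ← NatTrans.IsMonoidal.tensor,
      Functor.Monoidal.δ_μ_assoc]

variable {t : ℂ} {F G : RepGLZero t ⥤ T} [F.Braided] [G.Braided]

/-- A monoidal transformation is determined by its component at `[1, 0]`. -/
theorem natTrans_ext_of_std (θ θ' : F ⟶ G) [θ.IsMonoidal] [θ'.IsMonoidal]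
    (h : θ.app (dotObj t true) = θ'.app (dotObj t true)) : θ = θ' := by
  have h1 := mapMate_app θ (dotObj t true) (dotObj t false)
  have h2 := mapMate_app θ' (dotObj t true) (dotObj t false)
  rw [← h] at h2
  have h3 : ∀ k, θ.app (dotObj t k) = θ'.app (dotObj t k) := by
    rintro (_ | _)
    · exact h1.unique h2
    · exact h
  ext X
  rw [← cancel_epi (F.map (rowIso t X).hom), θ.naturality, θ'.naturality, ← wordTrans_app,
    ← wordTrans_app, funext h3]

variable [F.Additive] [G.Additive] [F.Linear ℂ] [G.Linear ℂ]

/-- The component at `[l, m]` of the transformation with the components `a` at the dots. -/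
def rowTrans (a : ∀ k, F.obj (dotObj t k) ⟶ G.obj (dotObj t k)) (X : RepGLZero t) :
    F.obj X ⟶ G.obj X :=
  F.map (rowIso t X).inv ≫ wordTrans F G a (rowWord X.row) ≫ G.map (rowIso t X).hom

variable {a : ∀ k, F.obj (dotObj t k) ⟶ G.obj (dotObj t k)}

theorem rowTrans_naturality (h : MapMate F G (a true) (a false)) {X Y : RepGLZero t} (f : X ⟶ Y) :
    F.map f ≫ rowTrans a Y = rowTrans a X ≫ G.map f := by
  refine RepGLZero.mor_induction (p := fun f : RepGLZero.Mor X Y =>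
    F.map (show X ⟶ Y from f) ≫ rowTrans a Y = rowTrans a X ≫ G.map (show X ⟶ Y from f)) f
    ?_ ?_ ?_ fun σ => ?_
  · change F.map (0 : X ⟶ Y) ≫ _ = _ ≫ G.map (0 : X ⟶ Y)
    simp
  · intro f g hf hg
    change F.map ((show X ⟶ Y from f) + (show X ⟶ Y from g)) ≫ _ =
      _ ≫ G.map ((show X ⟶ Y from f) + (show X ⟶ Y from g))
    rw [F.map_add, G.map_add, Preadditive.add_comp, Preadditive.comp_add, hf, hg]
  · intro r f hf
    change F.map (r • (show X ⟶ Y from f)) ≫ _ = _ ≫ G.map (r • (show X ⟶ Y from f))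
    rw [F.map_smul, G.map_smul, Linear.smul_comp, Linear.comp_smul, hf]
  · have h1 : F.map (diagMor (dotObj t) σ) ≫ wordTrans F G a (rowWord Y.row) =
        wordTrans F G a (rowWord X.row) ≫ G.map (diagMor (dotObj t) σ) :=
      WordNat.of_net h (net_diagMor (c := dotObj t) σ)
    have h2 : (show X ⟶ Y from RepGLZero.basis σ) =
        (rowIso t X).inv ≫ diagMor (dotObj t) σ ≫ (rowIso t Y).hom := by
      rw [diagMor_rowIso, Iso.inv_hom_id_assoc]
    change F.map (show X ⟶ Y from RepGLZero.basis σ) ≫ _ =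
      _ ≫ G.map (show X ⟶ Y from RepGLZero.basis σ)
    rw [h2]
    simp only [rowTrans, F.map_comp, G.map_comp, Category.assoc, Iso.map_hom_inv_id_assoc]
    rw [reassoc_of% h1]

theorem map_comp_rowTrans {A : Word Bool} {X : RepGLZero t}
    {φ : A.obj (dotObj t) ⟶ (rowWord X.row).obj (dotObj t)} (h : WordNat (F := F) (G := G) a φ) :
    F.map (φ ≫ (rowIso t X).hom) ≫ rowTrans a X =
      wordTrans F G a A ≫ G.map (φ ≫ (rowIso t X).hom) := by
  unfold WordNat at h
  simp only [rowTrans, F.map_comp, G.map_comp, Category.assoc, Iso.map_hom_inv_id_assoc]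
  rw [reassoc_of% h]

theorem rowTrans_unit : ε F ≫ rowTrans a (𝟙_ (RepGLZero t)) = ε G := by
  have hs := struct_permIso (dotObj t) rowUnitEquiv lbl_rowUnitEquiv
  have h1 := map_comp_rowTrans (X := 𝟙_ _) (WordNat.of_struct (F := F) (G := G) (a := a) hs)
  rw [rowIso_unit hs, G.map_id, Category.comp_id] at h1
  have h2 : rowTrans a (𝟙_ (RepGLZero t)) = η F ≫ ε G :=
    (Category.id_comp _).symm.trans ((congrArg (fun x => x ≫ _) (F.map_id _).symm).trans h1)
  rw [h2, Functor.Monoidal.ε_η_assoc]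

theorem rowTrans_tensor (X Y : RepGLZero t) :
    μ F X Y ≫ rowTrans a (X ⊗ Y) = (rowTrans a X ⊗ₘ rowTrans a Y) ≫ μ G X Y := by
  have hs := struct_permIso (dotObj t) (rowTensorEquiv X.row Y.row) (lbl_rowTensorEquiv X.row Y.row)
  have h1 : F.map _ ≫ rowTrans a (X ⊗ Y) =
    (δ F _ _ ≫ (wordTrans F G a (rowWord X.row) ⊗ₘ wordTrans F G a (rowWord Y.row)) ≫ μ G _ _) ≫
      G.map _ :=
    map_comp_rowTrans (X := X ⊗ Y) (WordNat.of_struct (F := F) (G := G) (a := a) hs)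
  rw [rowIso_tensor hs, Functor.Monoidal.map_tensor, Functor.Monoidal.map_tensor] at h1
  simp only [Category.assoc, Functor.Monoidal.μ_δ_assoc, cancel_epi] at h1
  rw [← cancel_epi (F.map (rowIso t X).hom ⊗ₘ F.map (rowIso t Y).hom), h1]
  simp only [rowTrans, MonoidalCategory.tensorHom_comp_tensorHom_assoc, Iso.map_hom_inv_id_assoc]

theorem rowTrans_std : rowTrans a (dotObj t true) = a true := by
  have hs : Struct (dotObj t) (B := .of true) _
    (rowFunctorStd (dotObj t) RepGLZero.loop_dotObj).hom := struct_permIso _ _ _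
  have h1 := WordNat.of_struct (F := F) (G := G) (a := a) hs
  unfold WordNat at h1
  unfold rowTrans
  rw [← cancel_epi (F.map (rowIso t (dotObj t true)).hom), Iso.map_hom_inv_id_assoc, rowIso_std hs]
  exact h1.symm

/-- A transformation is given by an isomorphism between the images of `[1, 0]`. -/
theorem exists_natTrans_std (a : F.obj (dotObj t true) ≅ G.obj (dotObj t true)) :
    ∃ θ : F ⟶ G, θ.IsMonoidal ∧ θ.app (dotObj t true) = a.hom := by
  obtain ⟨b, hb⟩ := exists_mapMate (X' := dotObj t false) a
  let a' : ∀ k, F.obj (dotObj t k) ⟶ G.obj (dotObj t k) := fun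
    | true => a.hom
    | false => b
  exact ⟨⟨rowTrans a', fun X Y f => rowTrans_naturality (a := a') hb f⟩,
    ⟨rowTrans_unit, rowTrans_tensor⟩, rowTrans_std⟩

end RowTransformations

/-! ### Extension along a functor that generates its target -/

section Generation

open Functor.LaxMonoidal Functor.OplaxMonoidal

variable {C : Type u₁} [Category.{v₁} C] {D : Type u₂} [Category.{v₂} D] [Preadditive D]

/-- An expression of `P` as a direct summand of a finite direct sum of objects in the image
of `j`. -/
structure Cover (j : C ⥤ D) (P : D) where
  /-- The index type of the summands. -/
  ι : Type
  [fintype : Fintype ι]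
  /-- The summands. -/
  c : ι → C
  /-- The components of the projection onto `P`. -/
  i : ∀ k, j.obj (c k) ⟶ P
  /-- The components of the inclusion of `P`. -/
  p : ∀ k, P ⟶ j.obj (c k)
  sum_eq : ∑ k, p k ≫ i k = 𝟙 P

attribute [instance] Cover.fintype

variable {j : C ⥤ D} {T : Type u} [Category.{v} T] [Preadditive T]

theorem Cover.map_sum {P : D} (s : Cover j P) (K : D ⥤ T) [K.Additive] :
    ∑ k, K.map (s.p k) ≫ K.map (s.i k) = 𝟙 (K.obj P) := by
  simp_rw [← K.map_comp]
  rw [← K.map_sum, s.sum_eq, K.map_id]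

theorem Cover.hom_ext' {P : D} (s : Cover j P) (K : D ⥤ T) [K.Additive] {Z : T}
    {φ ψ : K.obj P ⟶ Z} (h : ∀ k, K.map (s.i k) ≫ φ = K.map (s.i k) ≫ ψ) : φ = ψ := by
  rw [← Category.id_comp φ, ← Category.id_comp ψ, ← s.map_sum K, Preadditive.sum_comp,
    Preadditive.sum_comp]
  simp_rw [Category.assoc, h]

theorem Cover.hom_ext {P : D} (s : Cover j P) (K : D ⥤ T) [K.Additive] {Z : T}
    {φ ψ : K.obj P ⟶ Z} (h : ∀ (c : C) (x : j.obj c ⟶ P), K.map x ≫ φ = K.map x ≫ ψ) : φ = ψ :=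
  s.hom_ext' K fun k => h _ _

theorem Cover.hom_ext_tensor [MonoidalCategory T] [MonoidalPreadditive T]
    (cov : ∀ P, Cover j P) (K : D ⥤ T) [K.Additive] {P Q : D} {Z : T} {φ ψ : K.obj P ⊗ K.obj Q ⟶ Z}
    (h : ∀ (c d : C) (x : j.obj c ⟶ P) (y : j.obj d ⟶ Q),
      (K.map x ⊗ₘ K.map y) ≫ φ = (K.map x ⊗ₘ K.map y) ≫ ψ) : φ = ψ := by
  refine (cov P).hom_ext (K ⋙ tensorRight (K.obj Q)) fun c x => ?_
  refine (cov Q).hom_ext (K ⋙ tensorLeft (K.obj (j.obj c))) fun d y => ?_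
  simpa [MonoidalCategory.tensorHom_def'] using h c d x y

theorem Cover.hom_ext_tensor₃ [MonoidalCategory T] [MonoidalPreadditive T]
    (cov : ∀ P, Cover j P) (K : D ⥤ T) [K.Additive] {P Q R : D} {Z : T}
    {φ ψ : (K.obj P ⊗ K.obj Q) ⊗ K.obj R ⟶ Z}
    (h : ∀ (c d e : C) (x : j.obj c ⟶ P) (y : j.obj d ⟶ Q) (z : j.obj e ⟶ R),
      ((K.map x ⊗ₘ K.map y) ⊗ₘ K.map z) ≫ φ = ((K.map x ⊗ₘ K.map y) ⊗ₘ K.map z) ≫ ψ) :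
    φ = ψ := by
  refine (cov P).hom_ext (K ⋙ tensorRight (K.obj Q) ⋙ tensorRight (K.obj R)) fun c x => ?_
  refine (cov Q).hom_ext (K ⋙ tensorLeft (K.obj (j.obj c)) ⋙ tensorRight (K.obj R)) fun d y => ?_
  refine (cov R).hom_ext (K ⋙ tensorLeft (K.obj (j.obj c) ⊗ K.obj (j.obj d))) fun e z => ?_
  simpa [MonoidalCategory.tensorHom_def'] using h c d e x y z

section Transformations

variable {F G : D ⥤ T} [F.Additive] [G.Additive]

/-- A transformation is determined by its components at the generating objects. -/
theorem natTrans_ext_of_cover (cov : ∀ P, Cover j P) {θ θ' : F ⟶ G}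
    (h : ∀ c, θ.app (j.obj c) = θ'.app (j.obj c)) : θ = θ' := by
  ext P
  refine (cov P).hom_ext F fun c x => ?_
  rw [θ.naturality, θ'.naturality, h]

variable [j.Full] (cov : ∀ P, Cover j P)

theorem map_comp_extApp (θ : j ⋙ F ⟶ j ⋙ G) {P : D} {c : C} (x : j.obj c ⟶ P) :
    F.map x ≫ (∑ k, F.map ((cov P).p k) ≫ θ.app ((cov P).c k) ≫ G.map ((cov P).i k)) =
      θ.app c ≫ G.map x := by
  have h : ∀ k, F.map x ≫ F.map ((cov P).p k) ≫ θ.app ((cov P).c k) ≫ G.map ((cov P).i k) =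
      θ.app c ≫ G.map x ≫ G.map ((cov P).p k) ≫ G.map ((cov P).i k) := fun k => by
    obtain ⟨u, hu⟩ := j.map_surjective (x ≫ (cov P).p k)
    have h1 : F.map (j.map u) ≫ θ.app _ = θ.app _ ≫ G.map (j.map u) := θ.naturality u
    rw [← F.map_comp_assoc, ← G.map_comp_assoc, ← hu, reassoc_of% h1]
  rw [Preadditive.comp_sum, Finset.sum_congr rfl fun k _ => h k, ← Preadditive.comp_sum,
    ← Preadditive.comp_sum, (cov P).map_sum, Category.comp_id]

/-- The extension of a transformation from the generating objects. -/
def extTrans (θ : j ⋙ F ⟶ j ⋙ G) : F ⟶ G where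
  app P := ∑ k, F.map ((cov P).p k) ≫ θ.app ((cov P).c k) ≫ G.map ((cov P).i k)
  naturality P Q f := (cov P).hom_ext F fun c x => by
    rw [← F.map_comp_assoc, map_comp_extApp, reassoc_of% map_comp_extApp cov θ x, G.map_comp]

theorem map_comp_extTrans (θ : j ⋙ F ⟶ j ⋙ G) {P : D} {c : C} (x : j.obj c ⟶ P) :
    F.map x ≫ (extTrans cov θ).app P = θ.app c ≫ G.map x :=
  map_comp_extApp cov θ x

theorem extTrans_app (θ : j ⋙ F ⟶ j ⋙ G) (c : C) :
    (extTrans cov θ).app (j.obj c) = θ.app c := by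
  have h := map_comp_extTrans cov θ (𝟙 (j.obj c))
  rw [F.map_id, G.map_id, Category.id_comp] at h
  exact h.trans (Category.comp_id _)

variable [MonoidalCategory C] [MonoidalCategory D] [MonoidalCategory T] [MonoidalPreadditive T]
  [j.Monoidal] [F.Monoidal] [G.Monoidal]

theorem extTrans_isMonoidal (θ : j ⋙ F ⟶ j ⋙ G) [hθ : θ.IsMonoidal] :
    (extTrans cov θ).IsMonoidal where
  unit := by
    have h : (ε F ≫ F.map (ε j)) ≫ θ.app (𝟙_ C) = ε G ≫ G.map (ε j) := hθ.unit
    rw [Category.assoc] at h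
    rw [← Category.id_comp ((extTrans cov θ).app _), ← F.map_id, ← Functor.Monoidal.ε_η j,
      F.map_comp, Category.assoc, map_comp_extTrans cov θ (η j), reassoc_of% h,
      Functor.Monoidal.map_ε_η, Category.comp_id]
  tensor P Q := by
    refine Cover.hom_ext_tensor cov F fun c d x y => ?_
    have h : (μ F _ _ ≫ F.map (μ j c d)) ≫ θ.app (c ⊗ d) =
      (θ.app c ⊗ₘ θ.app d) ≫ μ G _ _ ≫ G.map (μ j c d) := hθ.tensor c d
    rw [Category.assoc] at h
    rw [μ_natural_assoc, MonoidalCategory.tensorHom_comp_tensorHom_assoc, map_comp_extTrans,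
      map_comp_extTrans, ← MonoidalCategory.tensorHom_comp_tensorHom_assoc, μ_natural,
      ← Category.id_comp (x ⊗ₘ y), ← Functor.Monoidal.μ_δ j, Category.assoc, F.map_comp,
      Category.assoc, map_comp_extTrans cov θ (δ j c d ≫ (x ⊗ₘ y)),
      reassoc_of% h, ← G.map_comp]

end Transformations

end Generation

/-! ### Extension of monoidal structures -/

section MonoidalExtension

open Functor.LaxMonoidal Functor.OplaxMonoidal

variable {C : Type u₁} [Category.{v₁} C] [MonoidalCategory C] [SymmetricCategory C]
  {D : Type u₂} [Category.{v₂} D] [Preadditive D] [MonoidalCategory D] [SymmetricCategory D]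
  [MonoidalPreadditive D] {j : C ⥤ D} [j.Braided]

/-- The products of the summands are summands of the product. -/
def Cover.tensor {P Q : D} (s : Cover j P) (s' : Cover j Q) : Cover j (P ⊗ Q) where
  ι := s.ι × s'.ι
  c k := s.c k.1 ⊗ s'.c k.2
  i k := δ j _ _ ≫ (s.i k.1 ⊗ₘ s'.i k.2)
  p k := (s.p k.1 ⊗ₘ s'.p k.2) ≫ μ j _ _
  sum_eq := by
    simp_rw [Category.assoc, Functor.Monoidal.μ_δ_assoc,
      MonoidalCategory.tensorHom_comp_tensorHom]
    rw [Fintype.sum_prod_type]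
    simp_rw [← tensor_sum, ← sum_tensor]
    rw [s.sum_eq, s'.sum_eq, MonoidalCategory.id_tensorHom_id]

variable {T : Type u} [Category.{v} T] [Preadditive T] [MonoidalCategory T]
  [SymmetricCategory T] [MonoidalPreadditive T]
  (K : D ⥤ T) [K.Additive] [(j ⋙ K).Braided]

theorem Cover.map_sum_tensor {P Q : D} (s : Cover j P) (s' : Cover j Q) :
    ∑ k : s.ι × s'.ι, K.map ((s.p k.1 ⊗ₘ s'.p k.2) ≫ μ j _ _) ≫
      K.map (δ j _ _ ≫ (s.i k.1 ⊗ₘ s'.i k.2)) = 𝟙 (K.obj (P ⊗ Q)) :=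
  (s.tensor s').map_sum K

theorem Cover.hom_ext_map_tensor {P Q : D} (s : Cover j P) (s' : Cover j Q) {Z : T}
    {φ ψ : K.obj (P ⊗ Q) ⟶ Z} (h : ∀ (c d : C) (x : j.obj c ⟶ P) (y : j.obj d ⟶ Q),
      K.map (δ j c d ≫ (x ⊗ₘ y)) ≫ φ = K.map (δ j c d ≫ (x ⊗ₘ y)) ≫ ψ) : φ = ψ :=
  (s.tensor s').hom_ext' K fun k => h _ _ _ _

variable (j) in
/-- The tensorator of `j ⋙ K`. -/
def compMu (c d : C) : K.obj (j.obj c) ⊗ K.obj (j.obj d) ⟶ K.obj (j.obj (c ⊗ d)) :=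
  μ (j ⋙ K) c d

variable (j) in
/-- The inverse of the tensorator of `j ⋙ K`. -/
def compDelta (c d : C) : K.obj (j.obj (c ⊗ d)) ⟶ K.obj (j.obj c) ⊗ K.obj (j.obj d) :=
  δ (j ⋙ K) c d

variable (j) in
theorem compMu_compDelta (c d : C) : compMu j K c d ≫ compDelta j K c d = 𝟙 _ :=
  Functor.Monoidal.μ_δ (j ⋙ K) c d

variable (j) in
theorem compDelta_compMu (c d : C) : compDelta j K c d ≫ compMu j K c d = 𝟙 _ :=
  Functor.Monoidal.δ_μ (j ⋙ K) c d

theorem compMu_natural {c d c' d' : C} (u : c ⟶ c') (v : d ⟶ d') :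
    (K.map (j.map u) ⊗ₘ K.map (j.map v)) ≫ compMu j K c' d' =
      compMu j K c d ≫ K.map (j.map (u ⊗ₘ v)) :=
  μ_natural (j ⋙ K) u v

theorem compDelta_natural {c d c' d' : C} (u : c ⟶ c') (v : d ⟶ d') :
    compDelta j K c d ≫ (K.map (j.map u) ⊗ₘ K.map (j.map v)) =
      K.map (j.map (u ⊗ₘ v)) ≫ compDelta j K c' d' :=
  δ_natural (j ⋙ K) u v

variable (cov : ∀ P, Cover j P)

/-- The tensorator extended from the generating objects. -/
def extMu (P Q : D) : K.obj P ⊗ K.obj Q ⟶ K.obj (P ⊗ Q) :=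
  ∑ k : (cov P).ι × (cov Q).ι, (K.map ((cov P).p k.1) ⊗ₘ K.map ((cov Q).p k.2)) ≫
    compMu j K _ _ ≫ K.map (δ j _ _ ≫ ((cov P).i k.1 ⊗ₘ (cov Q).i k.2))

/-- The inverse of `extMu`. -/
def extDelta (P Q : D) : K.obj (P ⊗ Q) ⟶ K.obj P ⊗ K.obj Q :=
  ∑ k : (cov P).ι × (cov Q).ι, K.map (((cov P).p k.1 ⊗ₘ (cov Q).p k.2) ≫ μ j _ _) ≫
    compDelta j K _ _ ≫ (K.map ((cov P).i k.1) ⊗ₘ K.map ((cov Q).i k.2))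

variable [j.Full]

theorem map_comp_extMu {P Q : D} {c d : C} (x : j.obj c ⟶ P) (y : j.obj d ⟶ Q) :
    (K.map x ⊗ₘ K.map y) ≫ extMu K cov P Q =
      compMu j K c d ≫ K.map (δ j c d ≫ (x ⊗ₘ y)) := by
  have h : ∀ k : (cov P).ι × (cov Q).ι, (K.map x ⊗ₘ K.map y) ≫
      (K.map ((cov P).p k.1) ⊗ₘ K.map ((cov Q).p k.2)) ≫
        compMu j K _ _ ≫ K.map (δ j _ _ ≫ ((cov P).i k.1 ⊗ₘ (cov Q).i k.2)) =
      compMu j K c d ≫ K.map (δ j c d ≫ (x ⊗ₘ y)) ≫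
        K.map (((cov P).p k.1 ⊗ₘ (cov Q).p k.2) ≫ μ j _ _) ≫
        K.map (δ j _ _ ≫ ((cov P).i k.1 ⊗ₘ (cov Q).i k.2)) := fun k => by
    obtain ⟨u, hu⟩ := j.map_surjective (x ≫ (cov P).p k.1)
    obtain ⟨v, hv⟩ := j.map_surjective (y ≫ (cov Q).p k.2)
    rw [MonoidalCategory.tensorHom_comp_tensorHom_assoc, ← K.map_comp, ← K.map_comp, ← hu, ← hv,
      reassoc_of% compMu_natural, ← K.map_comp_assoc (δ j c d ≫ (x ⊗ₘ y))]
    congr 3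
    rw [Category.assoc, MonoidalCategory.tensorHom_comp_tensorHom_assoc, ← hu, ← hv, μ_natural,
      Functor.Monoidal.δ_μ_assoc]
  unfold extMu
  rw [Preadditive.comp_sum, Finset.sum_congr rfl fun k _ => h k, ← Preadditive.comp_sum,
    ← Preadditive.comp_sum]
  rw [Cover.map_sum_tensor, Category.comp_id]

theorem map_comp_extDelta {P Q : D} {c d : C} (x : j.obj c ⟶ P) (y : j.obj d ⟶ Q) :
    K.map (δ j c d ≫ (x ⊗ₘ y)) ≫ extDelta K cov P Q =
      compDelta j K c d ≫ (K.map x ⊗ₘ K.map y) := by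
  have h : ∀ k : (cov P).ι × (cov Q).ι, K.map (δ j c d ≫ (x ⊗ₘ y)) ≫
      K.map (((cov P).p k.1 ⊗ₘ (cov Q).p k.2) ≫ μ j _ _) ≫
        compDelta j K _ _ ≫ (K.map ((cov P).i k.1) ⊗ₘ K.map ((cov Q).i k.2)) =
      compDelta j K c d ≫ (K.map (x ≫ (cov P).p k.1 ≫ (cov P).i k.1) ⊗ₘ
        K.map (y ≫ (cov Q).p k.2 ≫ (cov Q).i k.2)) := fun k => by
    obtain ⟨u, hu⟩ := j.map_surjective (x ≫ (cov P).p k.1)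
    obtain ⟨v, hv⟩ := j.map_surjective (y ≫ (cov Q).p k.2)
    have h1 : (δ j c d ≫ (x ⊗ₘ y)) ≫ ((cov P).p k.1 ⊗ₘ (cov Q).p k.2) ≫ μ j _ _ =
        j.map (u ⊗ₘ v) := by
      rw [Category.assoc, MonoidalCategory.tensorHom_comp_tensorHom_assoc, ← hu, ← hv, μ_natural,
        Functor.Monoidal.δ_μ_assoc]
    rw [← K.map_comp_assoc, h1, ← reassoc_of% compDelta_natural, hu, hv,
      MonoidalCategory.tensorHom_comp_tensorHom, ← K.map_comp, ← K.map_comp, Category.assoc,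
      Category.assoc]
  unfold extDelta
  rw [Preadditive.comp_sum, Finset.sum_congr rfl fun k _ => h k, ← Preadditive.comp_sum]
  congr 1
  rw [Fintype.sum_prod_type]
  simp_rw [← tensor_sum, ← sum_tensor, ← K.map_sum, ← Preadditive.comp_sum]
  rw [(cov P).sum_eq, (cov Q).sum_eq, Category.comp_id, Category.comp_id]

/-- The tensorator extended from the generating objects, as an isomorphism. -/
def extMuIso (P Q : D) : K.obj P ⊗ K.obj Q ≅ K.obj (P ⊗ Q) where
  hom := extMu K cov P Q
  inv := extDelta K cov P Q
  hom_inv_id := Cover.hom_ext_tensor cov K fun c d x y => by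
    rw [reassoc_of% map_comp_extMu, map_comp_extDelta, ← Category.assoc, compMu_compDelta,
      Category.id_comp, Category.comp_id]
  inv_hom_id := (cov P).hom_ext_map_tensor K (cov Q) fun c d x y => by
    rw [reassoc_of% map_comp_extDelta, map_comp_extMu, ← Category.assoc, compDelta_compMu,
      Category.id_comp, Category.comp_id]

/-- The monoidal structure extended from the generating objects. -/
def extCore : K.CoreMonoidal where
  εIso :=
    { hom := (show 𝟙_ T ⟶ K.obj (j.obj (𝟙_ C)) from ε (j ⋙ K)) ≫ K.map (η j)
      inv := K.map (ε j) ≫ (show K.obj (j.obj (𝟙_ C)) ⟶ 𝟙_ T from η (j ⋙ K))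
      hom_inv_id := by
        rw [Category.assoc, ← K.map_comp_assoc, Functor.Monoidal.η_ε, K.map_id, Category.id_comp]
        exact Functor.Monoidal.ε_η (j ⋙ K)
      inv_hom_id := by
        have h : (show K.obj (j.obj (𝟙_ C)) ⟶ 𝟙_ T from η (j ⋙ K)) ≫
          (show 𝟙_ T ⟶ K.obj (j.obj (𝟙_ C)) from ε (j ⋙ K)) = 𝟙 _ :=
            Functor.Monoidal.η_ε (j ⋙ K)
        rw [Category.assoc, reassoc_of% h, ← K.map_comp, Functor.Monoidal.ε_η, K.map_id] }
  μIso P Q := extMuIso K cov P Q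
  μIso_hom_natural_left {P P'} f Q := by
    change K.map f ▷ _ ≫ extMu K cov _ _ = extMu K cov _ _ ≫ K.map (f ▷ Q)
    refine Cover.hom_ext_tensor cov K fun c d x y => ?_
    rw [reassoc_of% map_comp_extMu, ← K.map_comp, ← MonoidalCategory.tensorHom_id,
      ← MonoidalCategory.tensorHom_id, MonoidalCategory.tensorHom_comp_tensorHom_assoc,
      Category.assoc, MonoidalCategory.tensorHom_comp_tensorHom, ← K.map_comp, Category.comp_id,
      Category.comp_id, map_comp_extMu]
  μIso_hom_natural_right {Q Q'} P f := by
    change _ ◁ K.map f ≫ extMu K cov _ _ = extMu K cov _ _ ≫ K.map (P ◁ f)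
    refine Cover.hom_ext_tensor cov K fun c d x y => ?_
    rw [reassoc_of% map_comp_extMu, ← K.map_comp, ← MonoidalCategory.id_tensorHom,
      ← MonoidalCategory.id_tensorHom, MonoidalCategory.tensorHom_comp_tensorHom_assoc,
      Category.assoc, MonoidalCategory.tensorHom_comp_tensorHom, ← K.map_comp, Category.comp_id,
      Category.comp_id, map_comp_extMu]
  associativity P Q R := by
    change extMu K cov P Q ▷ _ ≫ extMu K cov _ R ≫ K.map (α_ P Q R).hom =
      (α_ _ _ _).hom ≫ _ ◁ extMu K cov Q R ≫ extMu K cov P _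
    refine Cover.hom_ext_tensor₃ cov K fun c d e x y z => ?_
    have h : compMu j K c d ▷ _ ≫ compMu j K (c ⊗ d) e ≫ K.map (j.map (α_ c d e).hom) =
        (α_ _ _ _).hom ≫ _ ◁ compMu j K d e ≫ compMu j K c (d ⊗ e) :=
      Functor.LaxMonoidal.associativity (j ⋙ K) c d e
    have h1 : (δ j (c ⊗ d) e ≫ ((δ j c d ≫ (x ⊗ₘ y)) ⊗ₘ z)) ≫ (α_ P Q R).hom =
        j.map (α_ c d e).hom ≫ δ j c (d ⊗ e) ≫ (x ⊗ₘ (δ j d e ≫ (y ⊗ₘ z))) := by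
      have h2 : (δ j c d ≫ (x ⊗ₘ y)) ⊗ₘ z = δ j c d ▷ _ ≫ ((x ⊗ₘ y) ⊗ₘ z) := by
        simp only [← MonoidalCategory.tensorHom_id, MonoidalCategory.tensorHom_comp_tensorHom,
          Category.id_comp]
      have h3 : x ⊗ₘ (δ j d e ≫ (y ⊗ₘ z)) = _ ◁ δ j d e ≫ (x ⊗ₘ (y ⊗ₘ z)) := by
        simp only [← MonoidalCategory.id_tensorHom, MonoidalCategory.tensorHom_comp_tensorHom,
          Category.id_comp]
      rw [h2, h3, ← Functor.OplaxMonoidal.associativity_assoc, Category.assoc, Category.assoc,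
        MonoidalCategory.associator_naturality]
    have h4 : ((K.map x ⊗ₘ K.map y) ⊗ₘ K.map z) ≫ extMu K cov P Q ▷ _ =
        compMu j K c d ▷ _ ≫ (K.map (δ j c d ≫ (x ⊗ₘ y)) ⊗ₘ K.map z) := by
      rw [← MonoidalCategory.tensorHom_id, ← MonoidalCategory.tensorHom_id,
        MonoidalCategory.tensorHom_comp_tensorHom, MonoidalCategory.tensorHom_comp_tensorHom,
        map_comp_extMu, Category.id_comp, Category.comp_id]
    have h5 : (K.map x ⊗ₘ (K.map y ⊗ₘ K.map z)) ≫ _ ◁ extMu K cov Q R =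
        _ ◁ compMu j K d e ≫ (K.map x ⊗ₘ K.map (δ j d e ≫ (y ⊗ₘ z))) := by
      rw [← MonoidalCategory.id_tensorHom, ← MonoidalCategory.id_tensorHom,
        MonoidalCategory.tensorHom_comp_tensorHom, MonoidalCategory.tensorHom_comp_tensorHom,
        map_comp_extMu, Category.id_comp, Category.comp_id]
    rw [reassoc_of% h4, reassoc_of% map_comp_extMu, ← K.map_comp, h1,
      MonoidalCategory.associator_naturality_assoc, reassoc_of% h5, map_comp_extMu, K.map_comp,
      reassoc_of% h]
  left_unitality P := by
    change _ = ((show 𝟙_ T ⟶ K.obj (j.obj (𝟙_ C)) from ε (j ⋙ K)) ≫ K.map (η j)) ▷ _ ≫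
      extMu K cov _ P ≫ K.map (λ_ P).hom
    refine (cov P).hom_ext (K ⋙ tensorLeft (𝟙_ T)) fun c x => ?_
    have h : (λ_ (K.obj (j.obj c))).hom = (show 𝟙_ T ⟶ K.obj (j.obj (𝟙_ C)) from ε (j ⋙ K)) ▷ _ ≫
        compMu j K (𝟙_ C) c ≫ K.map (j.map (λ_ c).hom) :=
      Functor.LaxMonoidal.left_unitality (j ⋙ K) c
    change 𝟙_ T ◁ K.map x ≫ _ = 𝟙_ T ◁ K.map x ≫ _
    have h1 : (δ j (𝟙_ C) c ≫ (η j ⊗ₘ x)) ≫ (λ_ P).hom = j.map (λ_ c).hom ≫ x := by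
      rw [Functor.Monoidal.map_leftUnitor, MonoidalCategory.tensorHom_def]
      simp
    have h2 : 𝟙_ T ◁ K.map x ≫
        ((show 𝟙_ T ⟶ K.obj (j.obj (𝟙_ C)) from ε (j ⋙ K)) ≫ K.map (η j)) ▷ _ =
        (show 𝟙_ T ⟶ K.obj (j.obj (𝟙_ C)) from ε (j ⋙ K)) ▷ _ ≫ (K.map (η j) ⊗ₘ K.map x) := by
      rw [← MonoidalCategory.tensorHom_def', MonoidalCategory.tensorHom_def,
        MonoidalCategory.tensorHom_def, MonoidalCategory.comp_whiskerRight_assoc]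
    rw [reassoc_of% h2, reassoc_of% map_comp_extMu, ← K.map_comp, h1,
      MonoidalCategory.leftUnitor_naturality, h, K.map_comp, Category.assoc, Category.assoc]
  right_unitality P := by
    change _ = _ ◁ ((show 𝟙_ T ⟶ K.obj (j.obj (𝟙_ C)) from ε (j ⋙ K)) ≫ K.map (η j)) ≫
      extMu K cov P _ ≫ K.map (ρ_ P).hom
    refine (cov P).hom_ext (K ⋙ tensorRight (𝟙_ T)) fun c x => ?_
    have h : (ρ_ (K.obj (j.obj c))).hom = _ ◁ (show 𝟙_ T ⟶ K.obj (j.obj (𝟙_ C)) from ε (j ⋙ K)) ≫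
        compMu j K c (𝟙_ C) ≫ K.map (j.map (ρ_ c).hom) :=
      Functor.LaxMonoidal.right_unitality (j ⋙ K) c
    change K.map x ▷ 𝟙_ T ≫ _ = K.map x ▷ 𝟙_ T ≫ _
    have h1 : (δ j c (𝟙_ C) ≫ (x ⊗ₘ η j)) ≫ (ρ_ P).hom = j.map (ρ_ c).hom ≫ x := by
      rw [Functor.Monoidal.map_rightUnitor, MonoidalCategory.tensorHom_def']
      simp
    have h2 : K.map x ▷ 𝟙_ T ≫
        _ ◁ ((show 𝟙_ T ⟶ K.obj (j.obj (𝟙_ C)) from ε (j ⋙ K)) ≫ K.map (η j)) =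
        _ ◁ (show 𝟙_ T ⟶ K.obj (j.obj (𝟙_ C)) from ε (j ⋙ K)) ≫ (K.map x ⊗ₘ K.map (η j)) := by
      rw [← MonoidalCategory.tensorHom_def, MonoidalCategory.tensorHom_def',
        MonoidalCategory.tensorHom_def', MonoidalCategory.whiskerLeft_comp_assoc]
    rw [reassoc_of% h2, reassoc_of% map_comp_extMu, ← K.map_comp, h1,
      MonoidalCategory.rightUnitor_naturality, h, K.map_comp, Category.assoc, Category.assoc]

/-- A braided structure on `j ⋙ K` extends to `K`. -/
@[reducible] def extBraided : K.Braided where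
  toMonoidal := (extCore K cov).toMonoidal
  braided P Q := by
    change extMu K cov P Q ≫ _ = _ ≫ extMu K cov Q P
    refine Cover.hom_ext_tensor cov K fun c d x y => ?_
    have h : compMu j K c d ≫ K.map (j.map (β_ c d).hom) = (β_ _ _).hom ≫ compMu j K d c :=
      Functor.Braided.braided (F := j ⋙ K) c d
    rw [reassoc_of% map_comp_extMu, BraidedCategory.braiding_naturality_assoc, map_comp_extMu,
      ← reassoc_of% h, ← K.map_comp, ← K.map_comp, Functor.map_braiding]
    simp

end MonoidalExtension

/-! ### The inclusion into the Karoubian envelope of the additive completion -/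

section Inclusion

open Functor.LaxMonoidal Functor.OplaxMonoidal Idempotents

variable {C : Type u} [Category.{v} C]

section Karoubi

variable [MonoidalCategory C]

/-- The image of `f` in the envelope is induced by `f`. -/
theorem IsInduced.toKaroubi_map {X Y : C} (f : X ⟶ Y) :
    IsInduced ((toKaroubi C).map f)
      (show ((toKaroubi C).obj X).X ⟶ ((toKaroubi C).obj Y).X from f) :=
  ⟨(Category.id_comp f).symm, (Category.id_comp f).trans (Category.comp_id f).symm⟩

/-- The objects `(X ⊗ Y, 𝟙 ⊗ 𝟙)` and `(X ⊗ Y, 𝟙)` of the envelope are isomorphic. -/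
def toKaroubiMuIso (X Y : C) :
    (toKaroubi C).obj X ⊗ (toKaroubi C).obj Y ≅ (toKaroubi C).obj (X ⊗ Y) :=
  karoubiIso _ _ (Iso.refl (X ⊗ Y)) (by
    change (𝟙 X ⊗ₘ 𝟙 Y) ≫ 𝟙 (X ⊗ Y) = 𝟙 (X ⊗ Y) ≫ 𝟙 (X ⊗ Y)
    rw [MonoidalCategory.id_tensorHom_id])

theorem toKaroubiMuIso_isInduced (X Y : C) : IsInduced (toKaroubiMuIso X Y).hom (𝟙 (X ⊗ Y)) :=
  .iso _ _

/-- The monoidal structure of the inclusion into the Karoubian envelope. -/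
def toKaroubiCore : (toKaroubi C).CoreMonoidal where
  εIso := Iso.refl _
  μIso := toKaroubiMuIso
  μIso_hom_natural_left f Z := ((IsInduced.toKaroubi_map f).whiskerRight _).comp
      (toKaroubiMuIso_isInduced _ _) |>.ext
    ((toKaroubiMuIso_isInduced _ _).comp (.toKaroubi_map _))
    ((Category.comp_id _).trans (Category.id_comp _).symm)
  μIso_hom_natural_right Z f := ((IsInduced.toKaroubi_map f).whiskerLeft _).comp
      (toKaroubiMuIso_isInduced _ _) |>.ext
    ((toKaroubiMuIso_isInduced _ _).comp (.toKaroubi_map _))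
    ((Category.comp_id _).trans (Category.id_comp _).symm)
  associativity X Y Z := ((toKaroubiMuIso_isInduced _ _).whiskerRight _).comp
      ((toKaroubiMuIso_isInduced _ _).comp (.toKaroubi_map _)) |>.ext
    (.comp (.iso _ _) (((toKaroubiMuIso_isInduced _ _).whiskerLeft _).comp
      (toKaroubiMuIso_isInduced _ _)))
    (by
      change 𝟙 (X ⊗ Y) ▷ Z ≫ 𝟙 ((X ⊗ Y) ⊗ Z) ≫ (α_ X Y Z).hom =
        (α_ X Y Z).hom ≫ X ◁ 𝟙 (Y ⊗ Z) ≫ 𝟙 (X ⊗ Y ⊗ Z)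
      simp)
  left_unitality X := (IsInduced.iso _ _).ext
    (((IsInduced.id (𝟙_ (Karoubi C))).whiskerRight _).comp
      ((toKaroubiMuIso_isInduced _ _).comp (.toKaroubi_map _)))
    (by
      change (λ_ X).hom = 𝟙 (𝟙_ C) ▷ X ≫ 𝟙 (𝟙_ C ⊗ X) ≫ (λ_ X).hom
      simp)
  right_unitality X := (IsInduced.iso _ _).ext
    (((IsInduced.id (𝟙_ (Karoubi C))).whiskerLeft _).comp
      ((toKaroubiMuIso_isInduced _ _).comp (.toKaroubi_map _)))
    (by
      change (ρ_ X).hom = X ◁ 𝟙 (𝟙_ C) ≫ 𝟙 (X ⊗ 𝟙_ C) ≫ (ρ_ X).hom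
      simp)

instance [SymmetricCategory C] : (toKaroubi C).Braided where
  toMonoidal := toKaroubiCore.toMonoidal
  braided X Y := ((toKaroubiMuIso_isInduced _ _).comp (.toKaroubi_map _)).ext
    (.comp (.iso _ _) (toKaroubiMuIso_isInduced _ _))
    (by
      change 𝟙 (X ⊗ Y) ≫ (β_ X Y).hom = (β_ X Y).hom ≫ 𝟙 (Y ⊗ X)
      simp)

end Karoubi

section Mat

variable [Preadditive C]

theorem embedding_map_eq {X Y : C} (f : X ⟶ Y) : (Mat_.embedding C).map f =
    monomialMat (M := (Mat_.embedding C).obj X) (N := (Mat_.embedding C).obj Y) (fun i => i)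
      (fun _ => f) := by
  ext ⟨⟩ ⟨⟩
  exact (monomialMat_self (M := (Mat_.embedding C).obj X) (N := (Mat_.embedding C).obj Y)
    (fun i => i) (fun _ => f) PUnit.unit).symm

variable [MonoidalCategory C] [MonoidalPreadditive C]

/-- The one-entry rows of `X ⊗ Y`, with the index types `PUnit × PUnit` and `PUnit`. -/
def embeddingMuIso (X Y : C) :
    (Mat_.embedding C).obj X ⊗ (Mat_.embedding C).obj Y ≅ (Mat_.embedding C).obj (X ⊗ Y) where
  hom := monomialMat (M := (Mat_.embedding C).obj X ⊗ (Mat_.embedding C).obj Y)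
    (N := (Mat_.embedding C).obj (X ⊗ Y)) (fun _ => PUnit.unit) (fun _ => 𝟙 (X ⊗ Y))
  inv := monomialMat (N := (Mat_.embedding C).obj X ⊗ (Mat_.embedding C).obj Y)
    (M := (Mat_.embedding C).obj (X ⊗ Y)) (fun _ => (PUnit.unit, PUnit.unit)) (fun _ => 𝟙 (X ⊗ Y))
  hom_inv_id := (monomialMat_comp _ _ _ _).trans
    ((monomialMat_congr fun p => Category.id_comp _).trans
      (monomialMat_id ((Mat_.embedding C).obj X ⊗ (Mat_.embedding C).obj Y)))
  inv_hom_id := (monomialMat_comp _ _ _ _).trans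
    ((monomialMat_congr fun p => Category.id_comp _).trans
      (monomialMat_id ((Mat_.embedding C).obj (X ⊗ Y))))

/-- The monoidal structure of the inclusion into the additive completion. -/
def embeddingCore : (Mat_.embedding C).CoreMonoidal where
  εIso := Iso.refl _
  μIso := embeddingMuIso
  μIso_hom_natural_left {X Y} f Z := by
    rw [embedding_map_eq, embedding_map_eq, ← MonoidalCategory.tensorHom_id]
    refine (congrArg (fun x => x ≫ _) (monomialMat_tensor_id _ _)).trans ?_
    refine (monomialMat_comp _ _ _ _).trans (Eq.trans ?_ (monomialMat_comp _ _ _ _).symm)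
    refine monomialMat_congr fun p => ?_
    change (f ⊗ₘ 𝟙 Z) ≫ 𝟙 (Y ⊗ Z) = 𝟙 (X ⊗ Z) ≫ f ▷ Z
    simp
  μIso_hom_natural_right {X Y} Z f := by
    rw [embedding_map_eq, embedding_map_eq, ← MonoidalCategory.id_tensorHom]
    refine (congrArg (fun x => x ≫ _) (id_tensor_monomialMat _ _)).trans ?_
    refine (monomialMat_comp _ _ _ _).trans (Eq.trans ?_ (monomialMat_comp _ _ _ _).symm)
    refine monomialMat_congr fun p => ?_
    change (𝟙 Z ⊗ₘ f) ≫ 𝟙 (Z ⊗ Y) = 𝟙 (Z ⊗ X) ≫ Z ◁ f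
    simp
  associativity X Y Z := by
    rw [embedding_map_eq, ← MonoidalCategory.tensorHom_id, ← MonoidalCategory.id_tensorHom]
    refine (congrArg (fun x => x ≫ _ ≫ _) (monomialMat_tensor_id _ _)).trans ?_
    refine (congrArg (fun x => _ ≫ x) (monomialMat_comp _ _ _ _)).trans ?_
    refine (monomialMat_comp _ _ _ _).trans ?_
    refine Eq.trans ?_ (congrArg (fun x => _ ≫ x ≫ _) (id_tensor_monomialMat _ _)).symm
    refine Eq.trans ?_ (congrArg (fun x => _ ≫ x) (monomialMat_comp _ _ _ _)).symm
    refine Eq.trans ?_ (monomialMat_comp _ _ _ _).symm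
    refine monomialMat_congr fun p => ?_
    change (𝟙 (X ⊗ Y) ⊗ₘ 𝟙 Z) ≫ 𝟙 ((X ⊗ Y) ⊗ Z) ≫ (α_ X Y Z).hom =
      (α_ X Y Z).hom ≫ (𝟙 X ⊗ₘ 𝟙 (Y ⊗ Z)) ≫ 𝟙 (X ⊗ Y ⊗ Z)
    simp
  left_unitality X := by
    rw [embedding_map_eq, ← MonoidalCategory.tensorHom_id]
    refine Eq.trans ?_ (congrArg (fun x => x ≫ _) (MonoidalCategory.id_tensorHom_id _ _)).symm
    refine Eq.trans ?_ (Category.id_comp _).symm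
    refine Eq.trans ?_ (monomialMat_comp _ _ _ _).symm
    refine monomialMat_congr fun p => ?_
    change (λ_ X).hom = 𝟙 (𝟙_ C ⊗ X) ≫ (λ_ X).hom
    simp
  right_unitality X := by
    rw [embedding_map_eq, ← MonoidalCategory.id_tensorHom]
    refine Eq.trans ?_ (congrArg (fun x => x ≫ _) (MonoidalCategory.id_tensorHom_id _ _)).symm
    refine Eq.trans ?_ (Category.id_comp _).symm
    refine Eq.trans ?_ (monomialMat_comp _ _ _ _).symm
    refine monomialMat_congr fun p => ?_
    change (ρ_ X).hom = 𝟙 (X ⊗ 𝟙_ C) ≫ (ρ_ X).hom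
    simp

instance [SymmetricCategory C] : (Mat_.embedding C).Braided where
  toMonoidal := embeddingCore.toMonoidal
  braided X Y := by
    rw [embedding_map_eq]
    refine (monomialMat_comp _ _ _ _).trans (Eq.trans ?_ (monomialMat_comp _ _ _ _).symm)
    refine monomialMat_congr fun p => ?_
    change 𝟙 (X ⊗ Y) ≫ (β_ X Y).hom = (β_ X Y).hom ≫ 𝟙 (Y ⊗ X)
    simp

end Mat

variable (C) [Preadditive C]

/-- The inclusion of `C` into the Karoubian envelope of its additive completion. -/
abbrev incl : C ⥤ Karoubi (Mat_ C) := Mat_.embedding C ⋙ toKaroubi (Mat_ C)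

variable {C}

instance {R : Type*} [Semiring R] [Linear R C] : (incl C).Linear R where
  map_smul f r := rfl

theorem idem_apply (P : Karoubi (Mat_ C)) (k l : P.X.ι) :
    ∑ m, P.p k m ≫ P.p m l = P.p k l := by
  rw [← Mat_.comp_apply]
  exact congrFun (congrFun P.idem k) l

/-- The `k`-th row of the idempotent `P.p`. -/
def rowHom (P : Karoubi (Mat_ C)) (k : P.X.ι) : (Mat_.embedding C).obj (P.X.X k) ⟶ P.X :=
  fun _ l => P.p k l

/-- The `k`-th column of the idempotent `P.p`. -/
def columnHom (P : Karoubi (Mat_ C)) (k : P.X.ι) : P.X ⟶ (Mat_.embedding C).obj (P.X.X k) :=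
  fun l _ => P.p l k

theorem rowHom_comp (P : Karoubi (Mat_ C)) (k : P.X.ι) : rowHom P k ≫ P.p = rowHom P k := by
  ext ⟨⟩ l
  exact (Mat_.comp_apply _ _ _ _).trans (idem_apply P k l)

theorem comp_columnHom (P : Karoubi (Mat_ C)) (k : P.X.ι) :
    P.p ≫ columnHom P k = columnHom P k := by
  ext l ⟨⟩
  exact (Mat_.comp_apply _ _ _ _).trans (idem_apply P l k)

theorem columnHom_comp_rowHom (P : Karoubi (Mat_ C)) (k a b : P.X.ι) :
    (columnHom P k ≫ rowHom P k) a b = P.p a k ≫ P.p k b :=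
  (Mat_.comp_apply _ _ _ _).trans (Fintype.sum_unique (ι := PUnit) _)

/-- Every object of the envelope is a direct summand of a sum of objects of `C`. -/
def inclCover (P : Karoubi (Mat_ C)) : Cover (incl C) P where
  ι := P.X.ι
  fintype := P.X.fintype
  c := P.X.X
  i k := ⟨rowHom P k, (Category.id_comp _).trans (rowHom_comp P k)⟩
  p k := ⟨columnHom P k, (congrArg (P.p ≫ ·) (Category.comp_id _)).trans (comp_columnHom P k)⟩
  sum_eq := by
    ext : 1
    rw [Karoubi.sum_hom]
    ext a b
    refine Eq.trans ?_ (idem_apply P a b)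
    refine (congrFun (Finset.sum_apply a _ _) b).trans ((Finset.sum_apply b _ _).trans ?_)
    exact Finset.sum_congr rfl fun k _ => columnHom_comp_rowHom P k a b

end Inclusion

/-! ### Extension of functors to the envelope -/

section Extension

open Idempotents

variable {C : Type u₁} [Category.{v₁} C] [Preadditive C]
variable {T : Type u} [Category.{v} T] [Preadditive T]

section MatLift

theorem matrix_add [HasFiniteBiproducts T] {J K : Type} [Finite J] [Finite K] {f : J → T}
    {g : K → T} (m m' : ∀ j k, f j ⟶ g k) :
    biproduct.matrix (fun j k => m j k + m' j k) = biproduct.matrix m + biproduct.matrix m' := by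
  ext i j
  simp

theorem matrix_smul [HasFiniteBiproducts T] [Linear ℂ T] {J K : Type} [Finite J] [Finite K]
    {f : J → T} {g : K → T} (r : ℂ) (m : ∀ j k, f j ⟶ g k) :
    biproduct.matrix (fun j k => r • m j k) = r • biproduct.matrix m := by
  ext i j
  simp

theorem matrix_punit [HasFiniteBiproducts T] (X : T) :
    biproduct.desc (f := fun _ : PUnit.{1} => X) (fun _ => 𝟙 X) ≫ biproduct.lift (fun _ => 𝟙 X) =
      𝟙 (⨁ fun _ : PUnit.{1} => X) := by
  ext ⟨⟩ ⟨⟩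
  simp

theorem lift_desc_punit [HasFiniteBiproducts T] (X : T) :
    biproduct.lift (fun _ => 𝟙 X) ≫ biproduct.desc (f := fun _ : PUnit.{1} => X) (fun _ => 𝟙 X) =
      𝟙 X := by
  simp [biproduct.lift_desc]

theorem matrix_desc_punit [HasFiniteBiproducts T] {X Y : T} (f : X ⟶ Y) :
    biproduct.matrix (f := fun _ : PUnit.{1} => X) (g := fun _ : PUnit.{1} => Y) (fun _ _ => f) ≫
      biproduct.desc (fun _ => 𝟙 Y) = biproduct.desc (fun _ => 𝟙 X) ≫ f := by
  ext ⟨⟩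
  simp [biproduct.lift_desc]

variable [HasFiniteBiproducts T] (F : C ⥤ T) [F.Additive]

/-- The extension of an additive functor to formal direct sums and matrices (`Mat_.lift` without
its restriction on universes). -/
def matLift : Mat_ C ⥤ T where
  obj X := ⨁ fun i => F.obj (X.X i)
  map f := biproduct.matrix fun i j => F.map (f i j)
  map_id X := by
    ext i j
    by_cases h : j = i
    · subst h
      simp
    · simp [h]
  map_comp f g := by
    ext i j
    simp [Mat_.comp_apply, biproduct.lift_matrix, Functor.map_sum, biproduct.lift_desc]

instance : (matLift F).Additive where
  map_add {X Y f g} := (congrArg biproduct.matrix (funext fun i => funext fun j =>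
    F.map_add (f := f i j) (g := g i j))).trans (matrix_add _ _)

instance [Linear ℂ C] [Linear ℂ T] [F.Linear ℂ] : (matLift F).Linear ℂ where
  map_smul f r := (congrArg biproduct.matrix (funext fun i => funext fun j =>
    F.map_smul r (f i j))).trans (matrix_smul r _)

/-- The extension to matrices restricts to the given functor. -/
def embeddingMatLiftIso : Mat_.embedding C ⋙ matLift F ≅ F :=
  NatIso.ofComponents (fun X =>
      { hom := biproduct.desc (f := fun _ : PUnit.{1} => F.obj X) fun _ => 𝟙 (F.obj X)
        inv := biproduct.lift (f := fun _ : PUnit.{1} => F.obj X) fun _ => 𝟙 (F.obj X)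
        hom_inv_id := matrix_punit (F.obj X)
        inv_hom_id := lift_desc_punit (F.obj X) })
    (fun {X Y} f => matrix_desc_punit (F.map f))

end MatLift

section Karoubi

variable (K : Karoubi C ⥤ T)

/-- A morphism between formal summands, expressed by a morphism of the original category. -/
theorem karoubi_hom_eq {P Q : Karoubi C} (f : P ⟶ Q) :
    f = P.decompId_i ≫ (toKaroubi C).map f.f ≫ Q.decompId_p := by
  ext
  simp

theorem additive_of_toKaroubi [(toKaroubi C ⋙ K).Additive] : K.Additive where
  map_add {P Q f g} := by
    rw [karoubi_hom_eq f, karoubi_hom_eq g, ← Preadditive.comp_add, ← Preadditive.add_comp]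
    simp only [K.map_comp]
    rw [← Preadditive.comp_add, ← Preadditive.add_comp]
    have h : (toKaroubi C ⋙ K).map (f.f + g.f) = _ := Functor.map_add _
    simp only [Functor.comp_map, Functor.map_add] at h
    rw [h]

theorem linear_of_toKaroubi [Linear ℂ C] [Linear ℂ T] [(toKaroubi C ⋙ K).Linear ℂ] :
    K.Linear ℂ where
  map_smul {P Q} f r := by
    have h : (toKaroubi C ⋙ K).map (r • f.f) = _ := Functor.map_smul _ _ _
    conv_lhs => rw [karoubi_hom_eq f, ← Linear.comp_smul, ← Linear.smul_comp]
    conv_rhs => rw [karoubi_hom_eq f]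
    simp only [K.map_comp]
    rw [← Linear.comp_smul, ← Linear.smul_comp]
    exact congrArg (fun x => _ ≫ x ≫ _) h

end Karoubi

/-- A linear functor extends to the envelope: first to formal sums, then to formal summands. -/
theorem exists_extension [HasFiniteBiproducts T] [IsIdempotentComplete T] [Linear ℂ C] [Linear ℂ T]
    (F : C ⥤ T) [F.Additive] [F.Linear ℂ] :
    ∃ K : Karoubi (Mat_ C) ⥤ T, K.Additive ∧ K.Linear ℂ ∧ Nonempty (incl C ⋙ K ≅ F) := by
  let Φ := (Functor.whiskeringLeft (Mat_ C) (Karoubi (Mat_ C)) T).obj (toKaroubi (Mat_ C))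
  let K := Φ.objPreimage (matLift F)
  have e : toKaroubi (Mat_ C) ⋙ K ≅ matLift F := Φ.objObjPreimageIso (matLift F)
  have hA : (toKaroubi (Mat_ C) ⋙ K).Additive := Functor.additive_of_iso e.symm
  have hL : (toKaroubi (Mat_ C) ⋙ K).Linear ℂ := Functor.linear_of_iso ℂ e.symm
  exact ⟨K, additive_of_toKaroubi K, linear_of_toKaroubi K,
    ⟨Functor.isoWhiskerLeft (Mat_.embedding C) e ≪≫ embeddingMatLiftIso F⟩⟩

section Braided

variable {C : Type u₁} [Category.{v₁} C] [MonoidalCategory C] [SymmetricCategory C]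
variable {T : Type u} [Category.{v} T] [MonoidalCategory T] [SymmetricCategory T]

/-- The braided structure of a functor, transported along an isomorphism of functors. -/
@[reducible] def braidedTransport {F G : C ⥤ T} [F.Braided] (e : F ≅ G) : G.Braided where
  toMonoidal := Functor.Monoidal.transport e
  braided X Y := by
    simp only [Functor.Monoidal.transport_μ, Category.assoc]
    rw [← e.hom.naturality, Functor.LaxBraided.braided_assoc,
      BraidedCategory.braiding_naturality_assoc]

end Braided

end Extension

/-! ### Dimensions -/

section Dimensions

open Functor.LaxMonoidal Functor.OplaxMonoidal

variable {T : Type u} [Category.{v} T] [MonoidalCategory T] [SymmetricCategory T]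

/-- Dual pairs that correspond to each other have the same dimension. -/
theorem IsMate.loop_eq {X X' Y Y' : T} [ExactPairing X X'] [ExactPairing Y Y'] {a : X ⟶ Y}
    {b : X' ⟶ Y'} (h : IsMate a b) :
    η_ X X' ≫ (β_ X X').hom ≫ ε_ X X' = η_ Y Y' ≫ (β_ Y Y').hom ≫ ε_ Y Y' := by
  rw [← h.ev, ← h.coev, Category.assoc, BraidedCategory.braiding_naturality_assoc]

/-- The dimension may be computed with any dual. -/
theorem dim_eq_of_exactPairing (X Y : T) [HasRightDual X] [ExactPairing X Y] :
    dim X = η_ X Y ≫ (β_ X Y).hom ≫ ε_ X Y := by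
  obtain ⟨b, hb⟩ := exists_isMate (X' := Xᘁ) (Y' := Y) (Iso.refl X)
  have h : dim X = η_ X Xᘁ ≫ (β_ X Xᘁ).hom ≫ ε_ X Xᘁ := by simp [dim, trace]
  exact h.trans hb.loop_eq

/-- A symmetric monoidal functor preserves dimensions. -/
theorem dim_map {S : Type u₁} [Category.{v₁} S] [MonoidalCategory S] [SymmetricCategory S]
    (F : S ⥤ T) [F.Braided] (X X' : S) [ExactPairing X X'] [HasRightDual (F.obj X)] :
    dim (F.obj X) = ε F ≫ F.map (η_ X X' ≫ (β_ X X').hom ≫ ε_ X X') ≫ η F := by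
  let _ := mapPairing F X X'
  rw [dim_eq_of_exactPairing (F.obj X) (F.obj X')]
  change (ε F ≫ F.map (η_ X X') ≫ δ F _ _) ≫ (β_ _ _).hom ≫ μ F _ _ ≫ F.map (ε_ X X') ≫ η F = _
  rw [← Functor.LaxBraided.braided_assoc]
  simp

end Dimensions

/-! ### The universal property -/

section UniversalProperty

open Functor.LaxMonoidal Functor.OplaxMonoidal

variable {t : ℂ} {T : Type u} [Category.{v} T] [Preadditive T] [Linear ℂ T] [MonoidalCategory T]
  [SymmetricCategory T]

theorem dim_obj_std [RigidCategory T] (F : LinSymFunctor (RepGL t) T) :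
    dim (F.toFunctor.obj (std t)) = t • 𝟙 (𝟙_ T) := by
  have h := dim_map (incl (RepGLZero t) ⋙ F.toFunctor) (dotObj t true) (dotObj t false)
  refine h.trans ((congrArg (fun x => _ ≫ (incl (RepGLZero t) ⋙ F.toFunctor).map x ≫ _)
    RepGLZero.loop_dotObj).trans ?_)
  have h1 : (incl (RepGLZero t) ⋙ F.toFunctor).map (t • 𝟙 (𝟙_ (RepGLZero t))) = t • 𝟙 _ := by
    rw [Functor.map_smul, CategoryTheory.Functor.map_id]
  rw [h1, Linear.smul_comp, Linear.comp_smul, Category.id_comp, Functor.Monoidal.ε_η]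

/-- The dual of `[1, 0]` makes the components of transformations at `[1, 0]` invertible. -/
theorem isIso_app_std {F G : LinSymFunctor (RepGL t) T} (η : F ⟶ G) :
    IsIso (η.toNatTrans.app (std t)) :=
  have h : (Functor.whiskerLeft (incl (RepGLZero t)) η.toNatTrans).IsMonoidal := inferInstance
  (mapMate_app (Functor.whiskerLeft (incl (RepGLZero t)) η.toNatTrans) (dotObj t true)
    (dotObj t false)).isIso

variable [MonoidalPreadditive T] [MonoidalLinear ℂ T]

/-- Faithfulness of the evaluation at `[1, 0]`. -/
theorem hom_ext_std {F G : LinSymFunctor (RepGL t) T} {η θ : F ⟶ G}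
    (h : η.toNatTrans.app (std t) = θ.toNatTrans.app (std t)) : η = θ := by
  have h1 : Functor.whiskerLeft (incl (RepGLZero t)) η.toNatTrans =
      Functor.whiskerLeft (incl (RepGLZero t)) θ.toNatTrans := natTrans_ext_of_std _ _ h
  have h2 : η.toNatTrans = θ.toNatTrans :=
    natTrans_ext_of_cover (j := incl (RepGLZero t)) inclCover fun c => congr_app h1 c
  obtain ⟨η⟩ := η
  obtain ⟨θ⟩ := θ
  cases h2
  rfl

/-- Fullness of the evaluation at `[1, 0]`. -/
theorem exists_hom_std {F G : LinSymFunctor (RepGL t) T}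
    (a : F.toFunctor.obj (std t) ≅ G.toFunctor.obj (std t)) :
    ∃ η : F ⟶ G, η.toNatTrans.app (std t) = a.hom := by
  obtain ⟨θ, hθ, h⟩ := exists_natTrans_std (F := incl (RepGLZero t) ⋙ F.toFunctor)
    (G := incl (RepGLZero t) ⋙ G.toFunctor) a
  have hm := extTrans_isMonoidal inclCover θ
  exact ⟨⟨extTrans inclCover θ⟩, (extTrans_app inclCover θ (dotObj t true)).trans h⟩

/-- The pair of an object (for `true`) and its dual (for `false`). -/
def dualPair [RigidCategory T] (X : T) : Bool → T
  | true => X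
  | false => Xᘁ

instance [RigidCategory T] (X : T) : ExactPairing (dualPair X true) (dualPair X false) :=
  HasRightDual.exact

/-- Essential surjectivity of the evaluation at `[1, 0]`. -/
theorem exists_functor_std [HasFiniteBiproducts T] [IsIdempotentComplete T] [RigidCategory T]
    (X : T) (hX : dim X = t • 𝟙 (𝟙_ T)) :
    ∃ F : LinSymFunctor (RepGL t) T, Nonempty (F.toFunctor.obj (std t) ≅ X) := by
  have ht : loop (dualPair X) = t • 𝟙 (𝟙_ T) := (dim_eq_of_exactPairing X Xᘁ).symm.trans hX
  obtain ⟨K, _, _, ⟨e⟩⟩ := exists_extension (rowFunctor (dualPair X) ht)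
  let _ : (incl (RepGLZero t) ⋙ K).Braided := braidedTransport e.symm
  let _ : K.Braided := extBraided (j := incl (RepGLZero t)) K inclCover
  exact ⟨⟨K⟩, ⟨e.app (dotObj t true) ≪≫ rowFunctorStd (dualPair X) ht⟩⟩

end UniversalProperty

end DeligneGL

end

open DeligneGL

theorem mainTheorem4 (t : ℂ) (T : Type u) [Category.{v} T] [Preadditive T] [Linear ℂ T]
    [HasFiniteBiproducts T] [IsIdempotentComplete T] [MonoidalCategory T]
    [MonoidalPreadditive T] [MonoidalLinear ℂ T] [SymmetricCategory T] [RigidCategory T] :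
    ∃ (hdim : ∀ F : LinSymFunctor (RepGL t) T,
        dim (F.toFunctor.obj (std t)) = t • 𝟙 (𝟙_ T))
      (hiso : ∀ {F G : LinSymFunctor (RepGL t) T} (η : F ⟶ G),
        IsIso (η.toNatTrans.app (std t))),
      (evalStd t T hdim hiso).IsEquivalence := by
  refine ⟨dim_obj_std, isIso_app_std, ?_, ?_, ?_⟩
  · exact ⟨fun h => hom_ext_std (congrArg Iso.hom h)⟩
  · exact ⟨fun a => (exists_hom_std a).imp fun _ h => Iso.ext h⟩
  · refine ⟨fun X => (exists_functor_std X.obj X.dim_eq).imp fun F h => h.map fun e => ?_⟩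
    exact { hom := e, inv := e.symm, hom_inv_id := e.self_symm_id, inv_hom_id := e.symm_self_id }
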